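/- **Theorem (Punctured Hybrid).** For $\omega\in\{1,\dots,n\}$, a matrix $H\in\mathbb F_2^{(n-k)\times n}$ of rank $n-k$ and a syndrome $s\in\mathbb F_2^{n-k}$, the problem $\mathrm{SD}(n,k,\omega)$ asks for $e\in\mathbb F_2^n$ of Hamming weight $\omega$ with $He=s$. Let $k=Rn$ with $R\in[0,1]$, let $\delta\in[0,1]$ (the qubit reduction factor), put $\beta=(1-\delta)(1-R)$, let $\beta n$ be an integer, and let $0\le p\le\min(\omega,\beta n)$ with $\omega-p\le(1-\beta-R)n$. Write $$S=\binom{(1-\beta)n}{\omega-p}2^{-(1-\beta-R)n}.$$ *Algorithm Punctured-Hybrid* repeats the following round until a vector is returned. 1. Draw a uniformly random permutation matrix $P$, and bring $HP$ by row operations into systematic form $$\tilde H=\begin{pmatrix}I_{(1-\beta-R)n}&0&H_1\\0&I_{\beta n}&H_2\end{pmatrix},$$ with syndrome $\tilde s=(s',s'')$. The $\beta n$ columns of the middle block form the window. (If the first $n-k$ columns of $HP$ are linearly dependent, eliminate the window columns first, keep $(1-\beta-R)n$ rows that vanish on the window, and bring these into systematic form by permuting the columns outside the window.) 2. At most $n^{a}\lceil\max(1,S)\rceil$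 times, for a fixed exponent $a$: drop the last $\beta n$ rows, call a quantum circuit for the punctured instance $(I\mid H_1)(e_1,e_3)=s'$ with target weight $\omega-p$, obtain a candidate $(e_1,e_3)$, and set $e_2=s''+H_2e_3$. (Window coordinates whose column has no pivot, which exist only if the window columns are dependent, are instead drawn uniformly at random.) If $\mathrm{wt}(e_2)=p$ and $e=P(e_1,e_2,e_3)$ has weight $\omega$ and satisfies $He=s$, return $e$. The circuits consist of one-qubit gates with any number of controls; a gate with $c$ controls counts as $c+1$ steps. In each call one circuit of a finite list is drawn uniformly at random; the list depends only on $(1-\beta-R)n$, $k$ and $\omega-p$, and $H_1$ and $s'$ enter only as the initial basis state. All qubits are measured at the end. Time is the total number of quantum gates, qubit initializations, bits of the random choice of circuit, and classical steps (row operations of the elimination, schoolbook matrix-vector products). Then there are an exponent $a$, constants $C,d$, and such a family of quantum circuits, none of them depending on $n,k,\omega,R,\delta,p$, such that for all parameters as above and every $e\in\mathbb F_2^n$ of weight $\omega$: * For every $H$ of rank $n-k$, Punctured-Hybrid on $(H,He,\omega)$ returns only solutions of the instance and returns one with probability $1$. * If $H$ is uniformly random among the matrices of rank $n-k$, the expected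 time of Punctured-Hybrid on $(H,He,\omega)$, over $H$, the coins and the measurements, is at most $C\,n^{d}\,T$, where $$T=\frac{\binom{n}{\omega}}{\sqrt{\binom{(1-\beta)n}{\omega-p}\binom{(1-\beta-R)n}{\omega-p}}\binom{\beta n}{p}}\cdot\max\left(1,\sqrt{\binom{(1-\beta)n}{\omega-p}\cdot 2^{-(1-\beta-R)n}}\right).$$ * The circuits use exactly $\delta(1-R)Rn^2$ qubits for the representation of the matrix, and at most $\delta(1-R)Rn^2+Cn$ qubits in total. -/

import Mathlib

open scoped ENNReal

/-! ## Quantum circuits -/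

/-- The pure states of a register whose qubits are labelled by `Q`: amplitudes on the
computational basis `Q → ZMod 2`. -/
abbrev QState (Q : Type) : Type := (Q → ZMod 2) → ℂ

/-- A multi-controlled one-qubit gate: the unitary `op` is applied to the qubit `target` exactly
when every control qubit `q` has the value `pattern q`. With no control this is an arbitrary
one-qubit gate (in particular a rotation), with `op` the bit flip it is a NOT, CNOT, Toffoli or
multi-controlled NOT gate. -/
structure QGate (Q : Type) where
  target : Q
  controls : Finset Q
  pattern : Q → ZMod 2
  target_notMem : target ∉ controls
  op : Matrix.unitaryGroup (ZMod 2) ℂ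

/-- A gate with `c` controls counts as `c + 1` elementary gates. -/
def QGate.cost {Q : Type} (g : QGate Q) : ℕ := g.controls.card + 1

/-- Action of a gate on a state. -/
noncomputable def QGate.apply {Q : Type} [DecidableEq Q] (g : QGate Q) (ψ : QState Q) :
    QState Q := fun y =>
  if ∀ q ∈ g.controls, y q = g.pattern q then
    ∑ a : ZMod 2, (g.op : Matrix (ZMod 2) (ZMod 2) ℂ) (y g.target) a *
      ψ (Function.update y g.target a)
  else ψ y

/-- A circuit is a list of gates, applied from left to right. -/
abbrev QCircuit (Q : Type) : Type := List (QGate Q)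

/-- The number of elementary gates of a circuit, which bounds its depth. -/
def QCircuit.cost {Q : Type} (c : QCircuit Q) : ℕ := (c.map QGate.cost).sum

/-- The state that a circuit produces. -/
noncomputable def QCircuit.apply {Q : Type} [DecidableEq Q] (c : QCircuit Q) (ψ : QState Q) :
    QState Q := c.foldl (fun φ g => g.apply φ) ψ

/-- The computational basis state `|x⟩`. -/
noncomputable def basisState {Q : Type} [Fintype Q] [DecidableEq Q] (x : Q → ZMod 2) : QState Q :=
  fun y => if y = x then 1 else 0

theorem sum_norm_sq_unitary (U : Matrix.unitaryGroup (ZMod 2) ℂ) (v : ZMod 2 → ℂ) :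
    ∑ a, ‖∑ b, (U : Matrix (ZMod 2) (ZMod 2) ℂ) a b * v b‖ ^ 2 = ∑ b, ‖v b‖ ^ 2 := by
  have key : ∀ w : ZMod 2 → ℂ, ((∑ a, ‖w a‖ ^ 2 : ℝ) : ℂ) = star w ⬝ᵥ w := by
    intro w
    simp only [dotProduct, Complex.ofReal_sum, Pi.star_apply]
    refine Finset.sum_congr rfl fun a _ => ?_
    have := Complex.conj_mul' (w a)
    simpa using this.symm
  have h : star ((U : Matrix (ZMod 2) (ZMod 2) ℂ).mulVec v) ⬝ᵥ
      ((U : Matrix (ZMod 2) (ZMod 2) ℂ).mulVec v) = star v ⬝ᵥ v := by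
    rw [Matrix.star_mulVec, Matrix.dotProduct_mulVec, Matrix.vecMul_vecMul]
    have hU := Matrix.mem_unitaryGroup_iff'.mp U.2
    rw [Matrix.star_eq_conjTranspose] at hU
    rw [hU, Matrix.vecMul_one]
  rw [← key, ← key] at h
  exact_mod_cast h

theorem QGate.sum_norm_sq_apply {Q : Type} [Fintype Q] [DecidableEq Q] (g : QGate Q)
    (ψ : QState Q) : ∑ y, ‖g.apply ψ y‖ ^ 2 = ∑ y, ‖ψ y‖ ^ 2 := by
  have split : ∀ φ : QState Q, ∑ y, ‖φ y‖ ^ 2 =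
      ∑ z : {j // j ≠ g.target} → ZMod 2, ∑ a : ZMod 2,
        ‖φ ((Equiv.funSplitAt g.target (ZMod 2)).symm (a, z))‖ ^ 2 := by
    intro φ
    rw [← (Equiv.funSplitAt g.target (ZMod 2)).symm.sum_comp, Fintype.sum_prod_type_right]
  rw [split, split]
  refine Finset.sum_congr rfl fun z _ => ?_
  have hupd : ∀ a b : ZMod 2,
      Function.update ((Equiv.funSplitAt g.target (ZMod 2)).symm (a, z)) g.target b =
        (Equiv.funSplitAt g.target (ZMod 2)).symm (b, z) := by
    intro a b
    funext q
    by_cases hq : q = g.target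
    · subst hq; simp [Equiv.funSplitAt, Equiv.piSplitAt]
    · simp [Function.update, hq, Equiv.funSplitAt, Equiv.piSplitAt]
  have hval : ∀ a : ZMod 2, (Equiv.funSplitAt g.target (ZMod 2)).symm (a, z) g.target = a := by
    intro a; simp [Equiv.funSplitAt, Equiv.piSplitAt]
  have hctl : ∀ a : ZMod 2,
      (∀ q ∈ g.controls, (Equiv.funSplitAt g.target (ZMod 2)).symm (a, z) q = g.pattern q) ↔
      (∀ q ∈ g.controls, (Equiv.funSplitAt g.target (ZMod 2)).symm (0, z) q = g.pattern q) := by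
    intro a
    refine forall₂_congr fun q hq => ?_
    have hne : q ≠ g.target := fun h => g.target_notMem (h ▸ hq)
    simp [Equiv.funSplitAt, Equiv.piSplitAt, hne]
  by_cases hc :
      ∀ q ∈ g.controls, (Equiv.funSplitAt g.target (ZMod 2)).symm (0, z) q = g.pattern q
  · have := sum_norm_sq_unitary g.op
      (fun b => ψ ((Equiv.funSplitAt g.target (ZMod 2)).symm (b, z)))
    rw [← this]
    refine Finset.sum_congr rfl fun a _ => ?_
    rw [QGate.apply, if_pos ((hctl a).2 hc)]
    simp only [hupd, hval]
  · refine Finset.sum_congr rfl fun a _ => ?_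
    rw [QGate.apply, if_neg (fun h => hc ((hctl a).1 h))]

theorem QCircuit.sum_norm_sq_apply {Q : Type} [Fintype Q] [DecidableEq Q] (c : QCircuit Q)
    (ψ : QState Q) : ∑ y, ‖QCircuit.apply c ψ y‖ ^ 2 = ∑ y, ‖ψ y‖ ^ 2 := by
  induction c generalizing ψ with
  | nil => rfl
  | cons g c ih =>
    have h : QCircuit.apply (g :: c) ψ = QCircuit.apply c (g.apply ψ) := rfl
    rw [h, ih, g.sum_norm_sq_apply]

/-- Run a circuit on the basis state `|x⟩` and measure all qubits in the computational basis
(Born rule). -/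
noncomputable def QCircuit.measure {Q : Type} [Fintype Q] [DecidableEq Q] (c : QCircuit Q)
    (x : Q → ZMod 2) : PMF (Q → ZMod 2) :=
  PMF.ofFintype (fun y => ENNReal.ofReal (‖QCircuit.apply c (basisState x) y‖ ^ 2)) (by
    rw [← ENNReal.ofReal_sum_of_nonneg (fun _ _ => by positivity), QCircuit.sum_norm_sq_apply]
    simp [basisState, apply_ite])

/-! ## Randomized computations with a step count -/

/-- A randomized computation: the joint law of its result and of the number of steps spent. -/
def Timed (α : Type) : Type := PMF (α × ℕ)

noncomputable instance : Monad Timed where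
  pure a := PMF.pure (a, 0)
  bind x f := PMF.bind x fun u => PMF.map (fun v => (v.1, u.2 + v.2)) (f u.1)

/-- Spend `c` steps. -/
noncomputable def Timed.tick (c : ℕ) : Timed Unit := PMF.pure ((), c)

/-- Draw from a law; the steps for this are charged separately. -/
noncomputable def Timed.sample {α : Type} (μ : PMF α) : Timed α := PMF.map (fun a => (a, 0)) μ

/-- The law of the result. -/
noncomputable def Timed.result {α : Type} (x : Timed α) : PMF α := PMF.map Prod.fst x

/-- The expected number of steps. -/
noncomputable def Timed.expectedTime {α : Type} (x : Timed α) : ℝ≥0∞ :=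
  ∑' u : α × ℕ, (show PMF (α × ℕ) from x) u * (u.2 : ℝ≥0∞)

/-- `repeat x until it returns a value`, cut off after `N` rounds. -/
noncomputable def Timed.repeatUpTo {α : Type} (x : Timed (Option α)) : ℕ → Timed (Option α)
  | 0 => pure none
  | N + 1 => do
    match ← x with
    | some a => pure (some a)
    | none => Timed.repeatUpTo x N

/-- Expected number of steps of `repeat x until it returns a value` (without a cut-off). -/
noncomputable def Timed.repeatExpectedTime {α : Type} (x : Timed (Option α)) : ℝ≥0∞ :=
  ⨆ N : ℕ, (x.repeatUpTo N).expectedTime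

/-! ## The quantum subroutine -/

/-- The qubits of a circuit for a systematic parity-check matrix `(I_r ∣ A)`, where `A` is
`r × k`: the matrix register that holds `A`, the register of the syndrome, and `a` further
qubits. -/
abbrev QReg (r k a : ℕ) : Type := (Fin r × Fin k) ⊕ (Fin r ⊕ Fin a)

/-- The initial basis state: the matrix and the syndrome are loaded, all other qubits are `0`. -/
def loadInstance {r k : ℕ} (a : ℕ) (A : Matrix (Fin r) (Fin k) (ZMod 2)) (s : Fin r → ZMod 2) :
    QReg r k a → ZMod 2 :=
  Sum.elim (fun ij => A ij.1 ij.2) (Sum.elim s (fun _ => 0))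

/-- A quantum procedure for syndrome decoding of `(I_r ∣ A) x = s`. One of `seeds + 1` circuits is
drawn uniformly at random (in a quantum search with an unknown number of solutions the seed is the
number of amplification rounds), it is run on the loaded instance, and all qubits are measured; the
vector returned is read off the qubits `out`. The circuits do not depend on `A` and `s`. -/
structure QDecoder (r k : ℕ) where
  ancillas : ℕ
  seeds : ℕ
  circuit : Fin (seeds + 1) → QCircuit (QReg r k ancillas)
  out : Fin r ⊕ Fin k → QReg r k ancillas

/-- One call of the procedure. The steps are the bits of the random seed, the initialization of the
qubits, and the gates of the circuit. -/
noncomputable def QDecoder.call {r k : ℕ} (D : QDecoder r k) (A : Matrix (Fin r) (Fin k) (ZMod 2))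
    (s : Fin r → ZMod 2) : Timed (Fin r ⊕ Fin k → ZMod 2) := do
  let j ← Timed.sample (PMF.uniformOfFintype (Fin (D.seeds + 1)))
  let y ← Timed.sample ((D.circuit j).measure (loadInstance D.ancillas A s))
  Timed.tick (Nat.size D.seeds + Fintype.card (QReg r k D.ancillas) +
    QCircuit.cost (D.circuit j))
  pure (fun i => y (D.out i))

/-! ## Classical Gaussian elimination -/

/-- State of an elimination on `A x = s` with `q` rows and `n` columns: the current matrix and
right-hand side, the pivot column of each row that has one, and the number of steps spent. -/
structure Elim (q n : ℕ) where
  A : Matrix (Fin q) (Fin n) (ZMod 2)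
  s : Fin q → ZMod 2
  piv : Fin q → Option (Fin n)
  time : ℕ

/-- Add row `i` to row `j`. -/
def Elim.addRow {q n : ℕ} (i j : Fin q) (st : Elim q n) : Elim q n where
  A := st.A.updateRow j (st.A j + st.A i)
  s := Function.update st.s j (st.s j + st.s i)
  piv := st.piv
  time := st.time + (n + 1)

/-- Look for the first row in `rows` without a pivot and with a `1` in column `c`; if there is one,
make it the pivot row of `c` and clear column `c` in all other rows. -/
def Elim.pivotOn {q n : ℕ} (rows : List (Fin q)) (st : Elim q n) (c : Fin n) : Elim q n :=
  match rows.find? (fun i => decide (st.piv i = none ∧ st.A i c = 1)) with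
  | none => { st with time := st.time + q }
  | some i =>
    let st' := (List.finRange q).foldl
      (fun t j => if j ≠ i ∧ t.A j c = 1 then t.addRow i j else t) st
    { st' with piv := Function.update st'.piv i (some c), time := st'.time + 2 * q }

/-! ## The algorithm -/

/-- Hamming weight over `𝔽₂`. -/
def hwt {n : ℕ} (x : Fin n → ZMod 2) : ℕ := (Finset.univ.filter fun i => x i ≠ 0).card

/-- `x` solves the syndrome decoding instance `(H, s, ω)`. -/
def IsSDSolution {q n : ℕ} (H : Matrix (Fin q) (Fin n) (ZMod 2)) (s : Fin q → ZMod 2) (ω : ℕ)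
    (x : Fin n → ZMod 2) : Prop := H.mulVec x = s ∧ hwt x = ω

instance {q n : ℕ} (H : Matrix (Fin q) (Fin n) (ZMod 2)) (s : Fin q → ZMod 2) (ω : ℕ)
    (x : Fin n → ZMod 2) : Decidable (IsSDSolution H s ω x) :=
  inferInstanceAs (Decidable (_ ∧ _))

/-- The columns that the permutation `σ` moves to the positions `[r, q)` (counted from `0`). -/
def windowCols {n : ℕ} (r q : ℕ) (σ : Equiv.Perm (Fin n)) : List (Fin n) :=
  ((List.finRange n).filter fun t => decide (r ≤ t.val ∧ t.val < q)).map σ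

/-- All other columns, in their permuted order. -/
def otherCols {n : ℕ} (r q : ℕ) (σ : Equiv.Perm (Fin n)) : List (Fin n) :=
  ((List.finRange n).filter fun t => decide (¬ (r ≤ t.val ∧ t.val < q))).map σ

/-- The punctured instance and what is needed to lift its solutions. `el` is the final elimination
state, `rows` are the rows that are kept, `free` are the non-pivot columns outside the window. -/
structure Punctured (q n : ℕ) where
  el : Elim q n
  rows : List (Fin q)
  free : List (Fin n)

/-- Bring `H` with permuted columns into systematic form, with `r` rows to be kept. First the
window columns are eliminated; `r` rows that vanish on the window are kept, and these are then
brought into systematic form on the other columns, taking pivots as early as possible. If the first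
`q` permuted columns of `H` are linearly independent, the result is, up to the order of the rows,
`(I 0 H₁; 0 I H₂)` in the permuted column order. -/
def puncture {q n : ℕ} (r : ℕ) (H : Matrix (Fin q) (Fin n) (ZMod 2)) (s : Fin q → ZMod 2)
    (σ : Equiv.Perm (Fin n)) : Punctured q n :=
  let st₁ := (windowCols r q σ).foldl (Elim.pivotOn (List.finRange q)) ⟨H, s, fun _ => none, 0⟩
  let rows := ((List.finRange q).filter fun i => decide (st₁.piv i = none)).take r
  let st₂ := (otherCols r q σ).foldl (Elim.pivotOn rows) st₁
  { el := st₂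
    rows := rows
    free := (otherCols r q σ).filter fun c => decide (∀ i, st₂.piv i ≠ some c) }

/-- The matrix `H₁` of the punctured instance `(I_r ∣ H₁) x = s'`. -/
def Punctured.matrix {q n : ℕ} (P : Punctured q n) (r k : ℕ) : Matrix (Fin r) (Fin k) (ZMod 2) :=
  fun t j =>
    match P.rows[t.val]?, P.free[j.val]? with
    | some i, some c => P.el.A i c
    | _, _ => 0

/-- The syndrome `s'` of the punctured instance `(I_r ∣ H₁) x = s'`. -/
def Punctured.syndrome {q n : ℕ} (P : Punctured q n) (r : ℕ) : Fin r → ZMod 2 :=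
  fun t =>
    match P.rows[t.val]? with
    | some i => P.el.s i
    | none => 0

/-- Lift a vector `y` for the punctured instance to length `n`. Outside the window the coordinates
are those of `y`. On the window, the coordinate of the pivot column of a row is determined by that
row of the system; window columns without a pivot (which occur only if the window columns are
linearly dependent) take their values from the coins `z`. -/
def Punctured.lift {q n r k : ℕ} (P : Punctured q n) (window : List (Fin n))
    (y : Fin r ⊕ Fin k → ZMod 2) (z : Fin n → ZMod 2) : Fin n → ZMod 2 :=
  let x₀ : Fin n → ZMod 2 := fun c =>
    if c ∈ window then
      if ∃ i, P.el.piv i = some c then 0 else z c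
    else
      (∑ t : Fin r, if (P.rows[t.val]?).bind P.el.piv = some c then y (Sum.inl t) else 0) +
      ∑ j : Fin k, if P.free[j.val]? = some c then y (Sum.inr j) else 0
  fun c =>
    x₀ c + ∑ i : Fin q,
      if c ∈ window ∧ P.el.piv i = some c then P.el.s i + ∑ c', P.el.A i c' * x₀ c' else 0

/-- The inner loop: at most `L` calls of the quantum procedure on the punctured instance. Each
vector returned is lifted, and it is accepted if its weight on the window is `p` and it solves the
full instance. The steps charged are those of schoolbook matrix-vector products. -/
noncomputable def innerLoop {q n r k : ℕ} (D : QDecoder r k) (p ω : ℕ)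
    (H : Matrix (Fin q) (Fin n) (ZMod 2)) (s : Fin q → ZMod 2) (σ : Equiv.Perm (Fin n))
    (P : Punctured q n) : ℕ → Timed (Option (Fin n → ZMod 2))
  | 0 => pure none
  | L + 1 => do
    let y ← D.call (P.matrix r k) (P.syndrome r)
    let z ← Timed.sample (PMF.uniformOfFintype (Fin n → ZMod 2))
    Timed.tick (2 * (q * (n + 1)) + 4 * n)
    let x := P.lift (windowCols r q σ) y z
    if ((windowCols r q σ).filter fun c => decide (x c ≠ 0)).length = p ∧ IsSDSolution H s ω x then
      pure (some x)
    else
      innerLoop D p ω H s σ P L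

/-- One round of the outer loop. -/
noncomputable def puncturedHybridRound {q n r k : ℕ} (D : QDecoder r k) (p ω L : ℕ)
    (H : Matrix (Fin q) (Fin n) (ZMod 2)) (s : Fin q → ZMod 2) :
    Timed (Option (Fin n → ZMod 2)) := do
  let σ ← Timed.sample (PMF.uniformOfFintype (Equiv.Perm (Fin n)))
  Timed.tick (n * n)
  let P := puncture r H s σ
  Timed.tick P.el.time
  innerLoop D p ω H s σ P L

/-- The expected number `S` of solutions of weight `w` of a random instance with `r` equations in
`m` unknowns. -/
noncomputable def expectedSolutions (m r w : ℕ) : ℝ := (m.choose w : ℝ) * (2 : ℝ) ^ (-(r : ℤ))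

/-- The number of calls of the inner loop: a polynomial in `n`, here `n ^ a`, times `S`, and at
least `n ^ a`. -/
noncomputable def callCount (a n m r w : ℕ) : ℕ := n ^ a * ⌈max 1 (expectedSolutions m r w)⌉₊

/-- One round of Punctured-Hybrid on a code of length `n` and dimension `k`, where `b` rows are
dropped and the weight on the `b` window columns is guessed to be `p`; `D r k w` is the quantum
procedure used for `r` equations, `r + k` unknowns and weight `w`. The algorithm repeats this
round until it returns a vector. -/
noncomputable def puncturedHybrid (a : ℕ) (D : (r k : ℕ) → ℕ → QDecoder r k) (n k ω b p : ℕ)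
    (H : Matrix (Fin (n - k)) (Fin n) (ZMod 2)) (s : Fin (n - k) → ZMod 2) :
    Timed (Option (Fin n → ZMod 2)) :=
  puncturedHybridRound (D (n - k - b) k (ω - p)) p ω
    (callCount a n (n - b) (n - k - b) (ω - p)) H s

/-- The parity-check matrices of binary linear `[n, k]` codes. -/
noncomputable def parityCheckMatrices (n k : ℕ) :
    Finset (Matrix (Fin (n - k)) (Fin n) (ZMod 2)) :=
  Finset.univ.filter fun H => H.rank = n - k

/-- The time bound, without the suppressed polynomial factor. -/
noncomputable def puncturedHybridTime (n k ω b p : ℕ) : ℝ :=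
  (n.choose ω : ℝ) /
      (√(((n - b).choose (ω - p) : ℝ) * ((n - k - b).choose (ω - p) : ℝ)) * (b.choose p : ℝ)) *
    max 1 (√(((n - b).choose (ω - p) : ℝ) * (2 : ℝ) ^ (-((n - k - b : ℕ) : ℤ))))

/-! The quantum subroutine is information-set decoding under amplitude amplification, arranged so
that the matrix register is the only register of quadratic size. A set of unknowns is prepared by
choosing every label independently with probability `r / (r + k)`; it has size `r` with probability
at least `1 / (r + k + 1)` (`modeProb_bounds`), so one-qubit rotations replace a uniform
superposition over `r`-sets. A reversible elimination, carried out in the matrix register itself,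
solves the system for vectors supported in the set, with coins for the free coordinates
(`solveProg_complete`). Pivot columns are left untouched by later row additions and serve as the
record from which everything is undone, so linearly many further qubits suffice (`card_anc_le`). One
extra fair bit keeps the marked probability at most 1/2, and a uniformly random number of rounds
makes knowledge of the number of solutions unnecessary (`sum_groverAmp_sq_ge`).

Fix the error vector `e`. A set `K` of size `r` that contains its support yields `e` with
probability at least the inverse of the number of solutions inside `K`. Cauchy-Schwarz turns the sum
of these inverses into the inverse of a sum, and `decoder_call_ge` bounds the inverse success
probability by a product of two counts: solutions inside the sets `K`, and solutions of the right
weight. Such a product can be averaged over codes by a second-moment computation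
(`sum_callCost_le`). It is exact because the row operations that clear the window depend only on the
window columns, so the other columns of the kept rows are still uniform
(`sum_windowKernel_keptZero`), and over `ZMod 2` two distinct nonzero vectors are orthogonal to a
random row with probability 1/4. A dependent window is paid for by coins; their price is at most the
number of kernel vectors on the window, whose mean is at most 2 (`two_pow_looseCols_le`,
`sum_windowKernel_le`). Conditioning on full rank costs a factor 4 (`card_le_four_mul_card_rank`).

A random permutation puts `p` errors into the window with probability at least `C(b,p) C(n-b,ω-p) /
C(n,ω)` (`goodPerms_ge`). If a call succeeds with probability `θ`, then `L` calls succeed with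
probability at least `Lθ / (1 + Lθ)`. The inverse `1 + 1/(Lθ)` is affine in `1/θ`, so the average
over codes passes through, and `L` of the order of `max(1, S)` is enough (`sum_inv_roundBound_le`).
The expected time is the cost of a round divided by its success probability; the product of the
number of calls and the number of amplification rounds collapses to the stated `T`
(`mul_sqrt_div_eq`, `round_time_le`). -/

set_option linter.unusedSectionVars false

/-! ### Laws, worst-case time and expected time of randomized computations. -/

namespace Timed

variable {α β : Type}

/-- The joint law of result and number of steps. -/
def law (x : Timed α) : PMF (α × ℕ) := x

theorem law_pure (a : α) : (pure a : Timed α).law = PMF.pure (a, 0) := rfl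

theorem law_tick (c : ℕ) : (Timed.tick c).law = PMF.pure ((), c) := rfl

theorem law_sample (μ : PMF α) : (Timed.sample μ).law = μ.map fun a => (a, 0) := rfl

theorem law_bind (x : Timed α) (f : α → Timed β) :
    (x >>= f).law = x.law.bind fun u => (f u.1).law.map fun v => (v.1, u.2 + v.2) := rfl

theorem result_eq (x : Timed α) : x.result = x.law.map Prod.fst := rfl

theorem expectedTime_eq (x : Timed α) : x.expectedTime = ∑' u, x.law u * (u.2 : ℝ≥0∞) := rfl

@[simp] theorem result_pure (a : α) : (pure a : Timed α).result = PMF.pure a := by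
  rw [result_eq, law_pure, PMF.pure_map]

@[simp] theorem result_tick (c : ℕ) : (Timed.tick c).result = PMF.pure () := by
  rw [result_eq, law_tick, PMF.pure_map]

@[simp] theorem result_sample (μ : PMF α) : (Timed.sample μ).result = μ := by
  rw [result_eq, law_sample, PMF.map_comp]
  exact PMF.map_id μ

@[simp] theorem result_bind (x : Timed α) (f : α → Timed β) :
    (x >>= f).result = x.result.bind fun a => (f a).result := by
  simp only [result_eq]
  rw [law_bind, PMF.map_bind, PMF.bind_map]
  congr 1
  funext u
  rw [PMF.map_comp]
  rfl

/-- Every run of `x` takes at most `t` steps. -/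
def TimeLE (x : Timed α) (t : ℕ) : Prop := ∀ u ∈ x.law.support, u.2 ≤ t

theorem TimeLE.mono {x : Timed α} {s t : ℕ} (h : TimeLE x s) (hst : s ≤ t) : TimeLE x t :=
  fun u hu => (h u hu).trans hst

theorem timeLE_pure (a : α) : TimeLE (pure a : Timed α) 0 := by
  intro u hu
  rw [law_pure, PMF.mem_support_pure_iff] at hu
  simp [hu]

theorem timeLE_tick (c : ℕ) : TimeLE (Timed.tick c) c := by
  intro u hu
  rw [law_tick, PMF.mem_support_pure_iff] at hu
  simp [hu]

theorem timeLE_sample (μ : PMF α) : TimeLE (Timed.sample μ) 0 := by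
  intro u hu
  rw [law_sample, PMF.mem_support_map_iff] at hu
  obtain ⟨a, -, rfl⟩ := hu
  simp

theorem TimeLE.bind {x : Timed α} {f : α → Timed β} {s t : ℕ} (hx : TimeLE x s)
    (hf : ∀ a, TimeLE (f a) t) : TimeLE (x >>= f) (s + t) := by
  intro u hu
  rw [law_bind, PMF.mem_support_bind_iff] at hu
  obtain ⟨v, hv, hu⟩ := hu
  rw [PMF.mem_support_map_iff] at hu
  obtain ⟨z, hz, rfl⟩ := hu
  exact add_le_add (hx v hv) (hf _ z hz)

theorem tsum_map_mul {γ δ : Type} (p : PMF γ) (h : γ → δ) (φ : δ → ℝ≥0∞) :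
    ∑' v, (p.map h) v * φ v = ∑' w, p w * φ (h w) := by
  classical
  simp only [PMF.map_apply, ← ENNReal.tsum_mul_right]
  rw [ENNReal.tsum_comm]
  refine tsum_congr fun w => ?_
  rw [tsum_eq_single (h w)]
  · simp
  · intro v hv
    simp [hv]

theorem expectedTime_bind (x : Timed α) (f : α → Timed β) :
    (x >>= f).expectedTime =
      ∑' u : α × ℕ, x.law u * (u.2 + (f u.1).expectedTime) := by
  rw [expectedTime_eq, law_bind]
  simp only [PMF.bind_apply, ← ENNReal.tsum_mul_right]
  rw [ENNReal.tsum_comm]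
  refine tsum_congr fun u => ?_
  simp only [mul_assoc]
  rw [ENNReal.tsum_mul_left]
  congr 1
  rw [tsum_map_mul (f u.1).law (fun v => (v.1, u.2 + v.2)) fun v => (v.2 : ℝ≥0∞)]
  simp only [Nat.cast_add, mul_add]
  rw [ENNReal.tsum_add, ENNReal.tsum_mul_right, PMF.tsum_coe, one_mul]
  rfl

theorem repeatUpTo_succ (x : Timed (Option α)) (N : ℕ) :
    x.repeatUpTo (N + 1) = x >>= fun o => match o with
      | some a => pure (some a)
      | none => x.repeatUpTo N := rfl

theorem result_repeatUpTo_none (x : Timed (Option α)) (N : ℕ) :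
    (x.repeatUpTo N).result none = (x.result none) ^ N := by
  induction N with
  | zero => simp [Timed.repeatUpTo]
  | succ N ih =>
    rw [repeatUpTo_succ, result_bind, PMF.bind_apply, tsum_eq_single none]
    · simp only [ih]
      rw [pow_succ']
    · rintro (_ | a) h
      · exact absurd rfl h
      · simp

theorem mem_support_repeatUpTo (x : Timed (Option α)) (N : ℕ) (a : α)
    (h : some a ∈ (x.repeatUpTo N).result.support) : some a ∈ x.result.support := by
  induction N with
  | zero => simp [Timed.repeatUpTo] at h
  | succ N ih =>
    rw [repeatUpTo_succ, result_bind, PMF.mem_support_bind_iff] at h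
    obtain ⟨o, ho, h⟩ := h
    cases o with
    | none => exact ih h
    | some b =>
      simp only [result_pure, PMF.mem_support_pure_iff, Option.some.injEq] at h
      rwa [h]

/-- The geometric waiting time without a series: if a round fails with probability `f`, then the
expected times satisfy `E (N + 1) ≤ t + f * E N`, and `E N * p ≤ t` is preserved because `p + f ≤
1`. A lower bound `p` for the success probability is enough, and no subtraction in `ℝ≥0∞` occurs. -/
theorem expectedTime_repeatUpTo_mul_le (x : Timed (Option α)) {t : ℕ} (ht : TimeLE x t)
    {p : ℝ≥0∞} (hp : p + x.result none ≤ 1) (N : ℕ) :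
    (x.repeatUpTo N).expectedTime * p ≤ t := by
  have hpt : p ≠ ⊤ := ne_top_of_le_ne_top ENNReal.one_ne_top (le_self_add.trans hp)
  induction N with
  | zero =>
    have : (x.repeatUpTo 0).expectedTime = 0 := by
      have h1 : (x.repeatUpTo 0).expectedTime =
        ∑' u : Option α × ℕ, PMF.pure (none, 0) u * (u.2 : ℝ≥0∞) := rfl
      rw [h1, ENNReal.tsum_eq_zero]
      intro u
      by_cases hu : u = (none, 0)
      · simp [hu]
      · simp [PMF.pure_apply, hu]
    simp [this]
  | succ N ih =>
    -- The first round costs at most `t`; the remaining ones are run only if it fails.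
    have key : (x.repeatUpTo (N + 1)).expectedTime ≤
        t + x.result none * (x.repeatUpTo N).expectedTime := by
      rw [repeatUpTo_succ, expectedTime_bind]
      simp only [mul_add]
      rw [ENNReal.tsum_add]
      refine add_le_add ?_ ?_
      · calc ∑' u : Option α × ℕ, x.law u * (u.2 : ℝ≥0∞)
            ≤ ∑' u : Option α × ℕ, x.law u * (t : ℝ≥0∞) := by
              refine ENNReal.tsum_le_tsum fun u => ?_
              by_cases hu : x.law u = 0
              · simp [hu]
              · exact mul_le_mul_right (Nat.cast_le.2 (ht u hu)) _
          _ = t := by rw [ENNReal.tsum_mul_right, PMF.tsum_coe, one_mul]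
      · have h2 : x.result none * (x.repeatUpTo N).expectedTime =
            ∑' o, x.result o * (if o = none then (x.repeatUpTo N).expectedTime else 0) := by
          rw [tsum_eq_single none]
          · simp
          · intro o ho
            simp [ho]
        rw [h2]
        rw [result_eq, tsum_map_mul]
        refine ENNReal.tsum_le_tsum fun u => ?_
        refine mul_le_mul_right ?_ _
        obtain ⟨(_ | a), s⟩ := u
        · simp
        · have h1 : (pure (some a) : Timed (Option α)).expectedTime =
            ∑' u : Option α × ℕ, PMF.pure (some a, 0) u * (u.2 : ℝ≥0∞) := rfl
          simp only [reduceCtorEq, if_false, nonpos_iff_eq_zero]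
          rw [h1, ENNReal.tsum_eq_zero]
          intro u
          by_cases hu : u = (some a, 0)
          · simp [hu]
          · simp [PMF.pure_apply, hu]
    calc _ ≤ (t + x.result none * (x.repeatUpTo N).expectedTime) * p := mul_le_mul_left key _
      _ = t * p + x.result none * ((x.repeatUpTo N).expectedTime * p) := by ring
      _ ≤ t * p + x.result none * t := by gcongr
      _ = t * (p + x.result none) := by ring
      _ ≤ t * 1 := by gcongr
      _ = t := mul_one _

theorem repeatExpectedTime_le (x : Timed (Option α)) {t : ℕ} (ht : TimeLE x t)
    {p : ℝ≥0∞} (hp : p + x.result none ≤ 1) (hp0 : p ≠ 0) :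
    x.repeatExpectedTime ≤ t / p := by
  have hpt : p ≠ ⊤ := ne_top_of_le_ne_top ENNReal.one_ne_top (le_self_add.trans hp)
  refine iSup_le fun N => ?_
  rw [ENNReal.le_div_iff_mul_le (Or.inl hp0) (Or.inl hpt)]
  exact expectedTime_repeatUpTo_mul_le x ht hp N

end Timed

/-! ## Reflection gates -/

section Circuits

variable {Q : Type} [DecidableEq Q]

theorem QGate.apply_add (g : QGate Q) (φ ψ : QState Q) :
    g.apply (φ + ψ) = g.apply φ + g.apply ψ := by
  funext y
  by_cases h : ∀ q ∈ g.controls, y q = g.pattern q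
  · simp only [QGate.apply, Pi.add_apply, if_pos h, mul_add, Finset.sum_add_distrib]
  · simp only [QGate.apply, Pi.add_apply, if_neg h]

theorem QGate.apply_smul (g : QGate Q) (a : ℂ) (ψ : QState Q) :
    g.apply (a • ψ) = a • g.apply ψ := by
  funext y
  by_cases h : ∀ q ∈ g.controls, y q = g.pattern q
  · simp only [QGate.apply, Pi.smul_apply, smul_eq_mul, if_pos h, Finset.mul_sum]
    exact Finset.sum_congr rfl fun _ _ => by ring
  · simp only [QGate.apply, Pi.smul_apply, if_neg h]

@[simp] theorem QCircuit.apply_nil (ψ : QState Q) : QCircuit.apply [] ψ = ψ := rfl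

theorem QCircuit.apply_cons (g : QGate Q) (c : QCircuit Q) (ψ : QState Q) :
    QCircuit.apply (g :: c) ψ = QCircuit.apply c (g.apply ψ) := rfl

theorem QCircuit.apply_append (c d : QCircuit Q) (ψ : QState Q) :
    QCircuit.apply (c ++ d) ψ = QCircuit.apply d (QCircuit.apply c ψ) := by
  simp [QCircuit.apply]

theorem QCircuit.apply_add (c : QCircuit Q) (φ ψ : QState Q) :
    QCircuit.apply c (φ + ψ) = QCircuit.apply c φ + QCircuit.apply c ψ := by
  induction c generalizing φ ψ with
  | nil => rfl
  | cons g c ih => rw [QCircuit.apply_cons, g.apply_add, ih]; rfl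

theorem QCircuit.apply_smul (c : QCircuit Q) (a : ℂ) (ψ : QState Q) :
    QCircuit.apply c (a • ψ) = a • QCircuit.apply c ψ := by
  induction c generalizing ψ with
  | nil => rfl
  | cons g c ih => rw [QCircuit.apply_cons, g.apply_smul, ih]; rfl

/-- A gate whose one-qubit unitary is symmetric and an involution. -/
structure QGate.IsReflection (g : QGate Q) : Prop where
  symm : ∀ a b, (g.op : Matrix (ZMod 2) (ZMod 2) ℂ) a b = (g.op : Matrix (ZMod 2) (ZMod 2) ℂ) b a
  mul_self : (g.op : Matrix (ZMod 2) (ZMod 2) ℂ) * (g.op : Matrix (ZMod 2) (ZMod 2) ℂ) = 1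

theorem QGate.IsReflection.apply_apply {g : QGate Q} (hg : g.IsReflection) (ψ : QState Q) :
    g.apply (g.apply ψ) = ψ := by
  funext y
  by_cases h : ∀ q ∈ g.controls, y q = g.pattern q
  · have hu : ∀ a, ∀ q ∈ g.controls, Function.update y g.target a q = g.pattern q := by
      intro a q hq
      rw [Function.update_of_ne (by rintro rfl; exact g.target_notMem hq), h q hq]
    simp only [QGate.apply, if_pos h, if_pos (hu _), Function.update_self, Function.update_idem,
      Finset.mul_sum]
    rw [Finset.sum_comm]
    simp only [← mul_assoc, ← Finset.sum_mul]
    have := fun b => congrFun (congrFun hg.mul_self (y g.target)) b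
    simp only [Matrix.mul_apply] at this
    simp only [this, Matrix.one_apply, ite_mul, one_mul, zero_mul, Finset.sum_ite_eq,
      Finset.mem_univ, if_true, Function.update_eq_self]
  · simp only [QGate.apply, if_neg h]

/-- The bilinear pairing of two states. -/
noncomputable def QState.pair [Fintype Q] (φ ψ : QState Q) : ℂ := ∑ y, φ y * ψ y

theorem ZMod.two_sum (c : ZMod 2) (f : ZMod 2 → ℂ) : ∑ a, f a = f c + f (c + 1) := by
  fin_cases c
  · exact Fin.sum_univ_two f
  · rw [add_comm]; exact Fin.sum_univ_two f

theorem QGate.IsReflection.pair_apply [Fintype Q] {g : QGate Q} (hg : g.IsReflection) (φ ψ : QState Q) :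
    QState.pair (g.apply φ) ψ = QState.pair φ (g.apply ψ) := by
  have h2 : ∀ a : ZMod 2, a + 1 + 1 = a := by decide
  -- The flip of the target qubit pairs up the basis states. Reindexing by it exchanges the two
  -- off-diagonal entries of the gate, which agree by symmetry.
  let fl : (Q → ZMod 2) ≃ (Q → ZMod 2) :=
    { toFun := fun y => Function.update y g.target (y g.target + 1)
      invFun := fun y => Function.update y g.target (y g.target + 1)
      left_inv := fun y => by simp [h2]
      right_inv := fun y => by simp [h2] }
  have hfl : ∀ y, fl y = Function.update y g.target (y g.target + 1) := fun _ => rfl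
  have hc : ∀ y, (∀ q ∈ g.controls, fl y q = g.pattern q) ↔
      ∀ q ∈ g.controls, y q = g.pattern q := by
    intro y
    refine forall₂_congr fun q hq => ?_
    rw [hfl, Function.update_of_ne (by rintro rfl; exact g.target_notMem hq)]
  have expand : ∀ χ : QState Q, ∀ y, g.apply χ y =
      if ∀ q ∈ g.controls, y q = g.pattern q then
        (g.op : Matrix (ZMod 2) (ZMod 2) ℂ) (y g.target) (y g.target) * χ y +
        (g.op : Matrix (ZMod 2) (ZMod 2) ℂ) (y g.target) (y g.target + 1) * χ (fl y)
      else χ y := by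
    intro χ y
    rw [QGate.apply, ZMod.two_sum (y g.target), Function.update_eq_self, hfl]
    split_ifs <;> rfl
  have key : ∀ χ ξ : QState Q, QState.pair χ (g.apply ξ) =
      (∑ y, if ∀ q ∈ g.controls, y q = g.pattern q then
        (g.op : Matrix (ZMod 2) (ZMod 2) ℂ) (y g.target) (y g.target) * χ y * ξ y else χ y * ξ y) +
      ∑ y, if ∀ q ∈ g.controls, y q = g.pattern q then
        (g.op : Matrix (ZMod 2) (ZMod 2) ℂ) (y g.target) (y g.target + 1) * χ y * ξ (fl y)
        else 0 := by
    intro χ ξ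
    rw [← Finset.sum_add_distrib]
    refine Finset.sum_congr rfl fun y _ => ?_
    rw [expand]
    split_ifs
    · ring
    · ring
  have comm : ∀ χ ξ : QState Q, QState.pair χ ξ = QState.pair ξ χ :=
    fun χ ξ => Finset.sum_congr rfl fun _ _ => mul_comm _ _
  rw [comm, key, key]
  congr 1
  · refine Finset.sum_congr rfl fun y _ => ?_
    split_ifs <;> ring
  · rw [← fl.sum_comp]
    refine Finset.sum_congr rfl fun y _ => ?_
    simp only [hc]
    have e1 : fl (fl y) = y := fl.left_inv y
    have e2 : fl y g.target = y g.target + 1 := by rw [hfl, Function.update_self]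
    rw [e1, e2, h2, hg.symm]
    split_ifs <;> ring

/-- Every gate is its own transpose, so reversing the circuit transposes it. The pairing has no
conjugation; it is used only with the prepared state, whose amplitudes are real. -/
theorem QCircuit.pair_apply [Fintype Q] {c : QCircuit Q} (hc : ∀ g ∈ c, g.IsReflection) (φ ψ : QState Q) :
    QState.pair (QCircuit.apply c φ) ψ = QState.pair φ (QCircuit.apply c.reverse ψ) := by
  induction c generalizing φ ψ with
  | nil => rfl
  | cons g c ih =>
    rw [QCircuit.apply_cons, ih (fun g hg => hc g (List.mem_cons_of_mem _ hg)),
      (hc g List.mem_cons_self).pair_apply, List.reverse_cons, QCircuit.apply_append]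
    rfl

theorem QCircuit.apply_reverse_apply {c : QCircuit Q} (hc : ∀ g ∈ c, g.IsReflection)
    (ψ : QState Q) : QCircuit.apply c.reverse (QCircuit.apply c ψ) = ψ := by
  induction c generalizing ψ with
  | nil => rfl
  | cons g c ih =>
    rw [QCircuit.apply_cons, List.reverse_cons, QCircuit.apply_append,
      ih (fun g hg => hc g (List.mem_cons_of_mem _ hg))]
    exact (hc g List.mem_cons_self).apply_apply ψ

theorem QCircuit.apply_apply_reverse {c : QCircuit Q} (hc : ∀ g ∈ c, g.IsReflection)
    (ψ : QState Q) : QCircuit.apply c (QCircuit.apply c.reverse ψ) = ψ := by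
  have := QCircuit.apply_reverse_apply (c := c.reverse) (fun g hg => hc g (by simpa using hg)) ψ
  rwa [List.reverse_reverse] at this

/-! ## Classical reversible programs -/

/-- A bit flip of `target`, controlled by the values of the wires in `ctl` (a control on the
target itself is ignored). -/
structure Toggle (Q : Type) where
  target : Q
  ctl : List (Q × ZMod 2)

/-- The condition under which the bit is flipped. -/
def Toggle.Fires (g : Toggle Q) (y : Q → ZMod 2) : Prop :=
  ∀ p ∈ g.ctl, p.1 ≠ g.target → y p.1 = p.2

instance (g : Toggle Q) (y : Q → ZMod 2) : Decidable (g.Fires y) :=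
  inferInstanceAs (Decidable (∀ p ∈ g.ctl, p.1 ≠ g.target → y p.1 = p.2))

/-- The action on basis states. -/
def Toggle.step (g : Toggle Q) (y : Q → ZMod 2) : Q → ZMod 2 :=
  if g.Fires y then Function.update y g.target (y g.target + 1) else y

/-- The action of a list of toggles, from left to right. -/
def Toggle.run (l : List (Toggle Q)) (y : Q → ZMod 2) : Q → ZMod 2 :=
  l.foldl (fun y g => g.step y) y

theorem Toggle.fires_step (g : Toggle Q) (y : Q → ZMod 2) : g.Fires (g.step y) ↔ g.Fires y := by
  unfold Toggle.Fires
  refine forall₂_congr fun p _ => forall_congr' fun hp => ?_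
  unfold Toggle.step
  split_ifs
  · rw [Function.update_of_ne hp]
  · rfl

theorem Toggle.step_step (g : Toggle Q) (y : Q → ZMod 2) : g.step (g.step y) = y := by
  have h2 : ∀ a : ZMod 2, a + 1 + 1 = a := by decide
  rw [Toggle.step]
  simp only [Toggle.fires_step]
  unfold Toggle.step
  split_ifs
  · simp [h2]
  · rfl

@[simp] theorem Toggle.run_nil (y : Q → ZMod 2) : Toggle.run [] y = y := rfl

theorem Toggle.run_cons (g : Toggle Q) (l : List (Toggle Q)) (y : Q → ZMod 2) :
    Toggle.run (g :: l) y = Toggle.run l (g.step y) := rfl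

theorem Toggle.run_append (l l' : List (Toggle Q)) (y : Q → ZMod 2) :
    Toggle.run (l ++ l') y = Toggle.run l' (Toggle.run l y) := by
  simp [Toggle.run]

theorem Toggle.run_reverse_run (l : List (Toggle Q)) (y : Q → ZMod 2) :
    Toggle.run l.reverse (Toggle.run l y) = y := by
  induction l generalizing y with
  | nil => rfl
  | cons g l ih =>
    rw [Toggle.run_cons, List.reverse_cons, Toggle.run_append, ih]
    exact g.step_step y

theorem Toggle.run_injective (l : List (Toggle Q)) : Function.Injective (Toggle.run l) :=
  Function.LeftInverse.injective (Toggle.run_reverse_run l)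

/-- The bit flip as a unitary matrix. -/
noncomputable def bitFlip : Matrix.unitaryGroup (ZMod 2) ℂ :=
  ⟨Matrix.of fun a b => if b = a + 1 then 1 else 0, by
    rw [Matrix.mem_unitaryGroup_iff]
    ext a b
    have hs : ∀ f : ZMod 2 → ℂ, ∑ a, f a = f 0 + f 1 := fun f => Fin.sum_univ_two f
    have hz : ∀ a : ZMod 2, a = 0 ∨ a = 1 := by decide
    have h11 : (1 : ZMod 2) + 1 = 0 := by decide
    rcases hz a with rfl | rfl <;> rcases hz b with rfl | rfl <;>
      simp [Matrix.mul_apply, Matrix.star_apply, hs, h11]⟩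

/-- The gate of a toggle. -/
noncomputable def Toggle.gate (g : Toggle Q) : QGate Q where
  target := g.target
  controls := (g.ctl.map Prod.fst).toFinset.erase g.target
  pattern q := if (q, 1) ∈ g.ctl then 1 else 0
  target_notMem := Finset.notMem_erase _ _
  op := bitFlip

/-- The circuit of a toggle; it is empty if the controls contradict each other. -/
noncomputable def Toggle.toCircuit (g : Toggle Q) : QCircuit Q :=
  if ∀ p ∈ g.ctl, ∀ p' ∈ g.ctl, p.1 ≠ g.target → p.1 = p'.1 → p.2 = p'.2 then [g.gate] else []

/-- The circuit of a classical reversible program. -/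
noncomputable def Toggle.compile (l : List (Toggle Q)) : QCircuit Q := l.flatMap Toggle.toCircuit

theorem Toggle.apply_toCircuit (g : Toggle Q) (ψ : QState Q) :
    QCircuit.apply g.toCircuit ψ = fun y => ψ (g.step y) := by
  funext y
  unfold Toggle.toCircuit
  split_ifs with h
  · have hz : ∀ a : ZMod 2, a = 0 ∨ a = 1 := by decide
    have hf : (∀ q ∈ g.gate.controls, y q = g.gate.pattern q) ↔ g.Fires y := by
      simp only [Toggle.gate, Finset.mem_erase, List.mem_toFinset, List.mem_map, Toggle.Fires]
      -- The pattern of the gate reads 1 exactly on wires listed with value 1; consistency of the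
      -- list makes this the prescribed value on every control.
      have hpat : ∀ p ∈ g.ctl, p.1 ≠ g.target → (if (p.1, 1) ∈ g.ctl then (1 : ZMod 2) else 0) = p.2 := by
        intro p hp hpt
        split_ifs with h1
        · exact h _ h1 _ hp hpt rfl
        · rcases hz p.2 with h0 | h0
          · exact h0.symm
          · exact absurd (by rw [← h0]; exact hp) h1
      constructor
      · intro H p hp hpt
        rw [H p.1 ⟨hpt, p, hp, rfl⟩, hpat p hp hpt]
      · rintro H q ⟨hq, p, hp, rfl⟩
        rw [H p hp hq, hpat p hp hq]
    change g.gate.apply ψ y = _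
    unfold QGate.apply
    unfold Toggle.step
    by_cases hy : g.Fires y
    · rw [if_pos (hf.2 hy), if_pos hy]
      simp [Toggle.gate, bitFlip]
    · rw [if_neg (fun e => hy (hf.1 e)), if_neg hy]
  · have : ¬ g.Fires y := by
      intro H
      apply h
      intro p hp p' hp' hpt e
      rw [← H p hp hpt, ← H p' hp' (e ▸ hpt), e]
    unfold Toggle.step
    rw [if_neg this]
    rfl

/-- Amplitudes are pulled back along the inverse permutation of basis states, hence the reversed
program. -/
theorem Toggle.apply_compile (l : List (Toggle Q)) (ψ : QState Q) :
    QCircuit.apply (Toggle.compile l) ψ = fun y => ψ (Toggle.run l.reverse y) := by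
  induction l generalizing ψ with
  | nil => rfl
  | cons g l ih =>
    have : Toggle.compile (g :: l) = g.toCircuit ++ Toggle.compile l := rfl
    rw [this, QCircuit.apply_append, ih, Toggle.apply_toCircuit, List.reverse_cons]
    funext y
    rw [Toggle.run_append]
    rfl

/-- Target and controls are distinct qubits. It therefore suffices to bound circuit lengths;
multiplying by the number of qubits bounds the cost. -/
theorem QGate.cost_le [Fintype Q] (g : QGate Q) : g.cost ≤ Fintype.card Q := by
  have h : g.controls.card < Fintype.card Q :=
    Finset.card_lt_univ_of_notMem g.target_notMem
  exact h

theorem QCircuit.cost_le [Fintype Q] (c : QCircuit Q) : QCircuit.cost c ≤ c.length * Fintype.card Q := by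
  have := List.sum_le_card_nsmul (c.map QGate.cost) (Fintype.card Q) (by
    intro x hx
    obtain ⟨g, -, rfl⟩ := List.mem_map.1 hx
    exact g.cost_le)
  simpa [QCircuit.cost] using this

theorem Toggle.length_compile_le (l : List (Toggle Q)) :
    (Toggle.compile l).length ≤ l.length := by
  induction l with
  | nil => simp [Toggle.compile]
  | cons g l ih =>
    have : Toggle.compile (g :: l) = g.toCircuit ++ Toggle.compile l := rfl
    rw [this, List.length_append, List.length_cons, add_comm]
    refine add_le_add ih ?_
    unfold Toggle.toCircuit
    split_ifs <;> simp

/-! ## Phase gates and preparation gates -/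

/-- The diagonal unitary with sign `-1` at `v`. -/
noncomputable def signAt (v : ZMod 2) : Matrix.unitaryGroup (ZMod 2) ℂ :=
  ⟨Matrix.diagonal fun a => if a = v then -1 else 1, by
    rw [Matrix.mem_unitaryGroup_iff, Matrix.star_eq_conjTranspose, Matrix.diagonal_conjTranspose,
      Matrix.diagonal_mul_diagonal, ← Matrix.diagonal_one]
    congr 1
    funext a
    by_cases h : a = v <;> simp [h]⟩

/-- The gate that changes the sign of the basis states with value `pat q` at all `q ∈ C` and at
`t`. -/
noncomputable def phaseGate (t : Q) (C : Finset Q) (pat : Q → ZMod 2) : QGate Q where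
  target := t
  controls := C.erase t
  pattern := pat
  target_notMem := Finset.notMem_erase _ _
  op := signAt (pat t)

theorem phaseGate_apply (t : Q) (C : Finset Q) (pat : Q → ZMod 2) (ψ : QState Q)
    (y : Q → ZMod 2) : (phaseGate t C pat).apply ψ y =
      if y t = pat t ∧ ∀ q ∈ C, y q = pat q then -ψ y else ψ y := by
  unfold QGate.apply phaseGate
  simp only [signAt, Matrix.diagonal_apply, ite_mul, zero_mul,
    Finset.sum_ite_eq, Finset.mem_univ, if_true, Function.update_eq_self]
  by_cases ht : y t = pat t
  · have : (∀ q ∈ C.erase t, y q = pat q) ↔ ∀ q ∈ C, y q = pat q := by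
      simp only [Finset.mem_erase]
      constructor
      · intro h q hq
        by_cases e : q = t
        · rw [e, ht]
        · exact h q ⟨e, hq⟩
      · exact fun h q hq => h q hq.2
    simp only [this, ht, true_and, if_true]
    split_ifs <;> ring
  · simp only [ht, false_and, if_false, one_mul, ite_self]

/-- The reflection that maps `|0⟩` to `√(1-p)|0⟩ + √p|1⟩`. -/
noncomputable def biasOp (p : ℝ) (h0 : 0 ≤ p) (h1 : p ≤ 1) : Matrix.unitaryGroup (ZMod 2) ℂ :=
  ⟨Matrix.of fun a b => if a = b then (if a = 0 then (√(1 - p) : ℂ) else -(√(1 - p) : ℂ)) else (√p : ℂ), by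
    have e1 : (√(1 - p) : ℂ) * (√(1 - p) : ℂ) = 1 - p := by
      rw [← Complex.ofReal_mul, Real.mul_self_sqrt (by linarith)]; simp
    have e2 : (√p : ℂ) * (√p : ℂ) = p := by
      rw [← Complex.ofReal_mul, Real.mul_self_sqrt h0]
    rw [Matrix.mem_unitaryGroup_iff]
    ext a b
    have hs : ∀ f : ZMod 2 → ℂ, ∑ a, f a = f 0 + f 1 := fun f => Fin.sum_univ_two f
    have hz : ∀ a : ZMod 2, a = 0 ∨ a = 1 := by decide
    rcases hz a with rfl | rfl <;> rcases hz b with rfl | rfl <;>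
      simp [Matrix.mul_apply, Matrix.star_apply, hs, e1, e2] <;> ring⟩

/-- The uncontrolled gate with unitary `biasOp`. -/
noncomputable def biasGate (q : Q) (p : ℝ) (h0 : 0 ≤ p) (h1 : p ≤ 1) : QGate Q where
  target := q
  controls := ∅
  pattern := 0
  target_notMem := Finset.notMem_empty _
  op := biasOp p h0 h1

/-- A real symmetric matrix equals its adjoint, so unitarity says that it squares to the identity.
-/
theorem biasGate_isReflection (q : Q) (p : ℝ) (h0 : 0 ≤ p) (h1 : p ≤ 1) :
    (biasGate q p h0 h1).IsReflection where
  symm a b := by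
    change (if a = b then _ else _) = (if b = a then _ else _)
    by_cases h : a = b
    · subst h; rfl
    · rw [if_neg h, if_neg (Ne.symm h)]
  mul_self := by
    have h := Matrix.mem_unitaryGroup_iff.1 (biasOp p h0 h1).2
    have hstar : star ((biasOp p h0 h1 : Matrix (ZMod 2) (ZMod 2) ℂ)) = biasOp p h0 h1 := by
      ext a b
      have hz : ∀ a : ZMod 2, a = 0 ∨ a = 1 := by decide
      rcases hz a with rfl | rfl <;> rcases hz b with rfl | rfl <;>
        simp [Matrix.star_apply, biasOp, Complex.conj_ofReal]
    rw [hstar] at h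
    exact h

end Circuits

/-! ## Amplitude amplification -/

/-- The amplitudes, relative to those of the initial state, of the marked and of the other basis
states after `j` rounds of amplitude amplification, if the marked states have total weight `f`. -/
noncomputable def groverAmp (f : ℝ) : ℕ → ℝ × ℝ
  | 0 => (1, 1)
  | j + 1 =>
    let u := groverAmp f j
    (-u.1 - 2 * (-u.1 * f + u.2 * (1 - f)), u.2 - 2 * (-u.1 * f + u.2 * (1 - f)))

/-- With `f = sin² θ`, a round rotates the plane of the marked and the unmarked part by `2θ`. The
sign `(-1) ^ j` appears because the diffusion is the negative of the usual reflection about the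
prepared state; the denominators normalize by the initial amplitudes. -/
theorem groverAmp_eq {θ : ℝ} (hs : Real.sin θ ≠ 0) (hc : Real.cos θ ≠ 0) (j : ℕ) :
    groverAmp (Real.sin θ ^ 2) j =
      ((-1) ^ j * (Real.sin ((2 * j + 1) * θ) / Real.sin θ),
        (-1) ^ j * (Real.cos ((2 * j + 1) * θ) / Real.cos θ)) := by
  induction j with
  | zero => simp [groverAmp, hs, hc]
  | succ j ih =>
    have e : (2 * ((j + 1 : ℕ) : ℝ) + 1) * θ = (2 * j + 1) * θ + 2 * θ := by push_cast; ring
    have e2 : 1 - Real.sin θ ^ 2 = Real.cos θ ^ 2 := by rw [← Real.cos_sq']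
    rw [groverAmp, ih, e, Real.sin_add, Real.cos_add, Real.sin_two_mul, Real.cos_two_mul, e2]
    have h1 : Real.cos θ ^ 2 = 1 - Real.sin θ ^ 2 := Real.cos_sq' θ
    ext
    · simp only
      field_simp
      rw [pow_succ]
      generalize Real.sin ((2 * j + 1) * θ) = s
      generalize Real.cos ((2 * j + 1) * θ) = c
      linear_combination (2 * (-1) ^ j * s) * h1
    · simp only
      field_simp
      rw [pow_succ]
      generalize Real.sin ((2 * j + 1) * θ) = s
      generalize Real.cos ((2 * j + 1) * θ) = c
      ring

/-- Telescoping: `4 sin² x = 2 - 2 cos 2x` and `2 sin 2θ cos 2x = sin (2x + 2θ) - sin (2x - 2θ)`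
with `x = (2j + 1)θ`. -/
theorem sum_sin_sq_odd_mul (θ : ℝ) (J : ℕ) :
    4 * Real.sin (2 * θ) * ∑ j ∈ Finset.range J, Real.sin ((2 * j + 1) * θ) ^ 2 =
      2 * J * Real.sin (2 * θ) - Real.sin (4 * J * θ) := by
  induction J with
  | zero => simp
  | succ J ih =>
    rw [Finset.sum_range_succ, mul_add, ih]
    have e1 : 4 * ((J + 1 : ℕ) : ℝ) * θ = 2 * ((2 * J + 1) * θ) + 2 * θ := by push_cast; ring
    have e2 : 4 * (J : ℝ) * θ = 2 * ((2 * J + 1) * θ) - 2 * θ := by ring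
    rw [e1, e2, Real.sin_add, Real.sin_sub]
    generalize (2 * (J : ℝ) + 1) * θ = x
    rw [Real.cos_two_mul x, Real.cos_sq' x]
    push_cast
    ring

theorem sum_odd_sq (J : ℕ) :
    3 * ∑ j ∈ Finset.range J, (2 * (j : ℝ) + 1) ^ 2 = (J : ℝ) * (4 * (J : ℝ) ^ 2 - 1) := by
  induction J with
  | zero => simp
  | succ J ih =>
    rw [Finset.sum_range_succ, mul_add, ih]
    push_cast
    ring

/-- Amplitude amplification with a uniformly random number of rounds below `J`. -/
theorem sum_groverAmp_sq_ge {f : ℝ} (h0 : 0 < f) (h1 : f ≤ 1 / 2) {J : ℕ} (hJ : 1 ≤ J) :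
    (J : ℝ) / 4 * min ((J : ℝ) ^ 2) (1 / f) ≤ ∑ j ∈ Finset.range J, (groverAmp f j).1 ^ 2 := by
  obtain ⟨θ, hθ⟩ : ∃ θ, θ = Real.arcsin (√f) := ⟨_, rfl⟩
  have hf1 : √f ≤ 1 := Real.sqrt_le_one.2 (by linarith)
  have hsin : Real.sin θ = √f := by
    rw [hθ, Real.sin_arcsin (by linarith [Real.sqrt_nonneg f]) hf1]
  have hsq : Real.sin θ ^ 2 = f := by rw [hsin, Real.sq_sqrt h0.le]
  have hpos : 0 < θ := by rw [hθ]; exact Real.arcsin_pos.2 (Real.sqrt_pos.2 h0)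
  -- The assumption `f ≤ 1/2` enters here; it puts `2θ` into `[0, π/2]`, where the sine lies above
  -- its chord.
  have hle : θ ≤ Real.pi / 4 := by
    rw [hθ]
    rw [Real.arcsin_le_iff_le_sin' ⟨by linarith [Real.pi_pos], by linarith [Real.pi_pos]⟩,
      Real.sin_pi_div_four]
    rw [Real.sqrt_le_left (by positivity)]
    have : (√2 / 2) ^ 2 = (1 : ℝ) / 2 := by
      rw [div_pow, Real.sq_sqrt (by norm_num)]; norm_num
    linarith
  have hpi := Real.pi_pos
  have hs : 0 < Real.sin θ := by rw [hsin]; exact Real.sqrt_pos.2 h0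
  have hc : 0 < Real.cos θ := Real.cos_pos_of_mem_Ioo ⟨by linarith, by linarith⟩
  have hsum : ∀ j, (groverAmp f j).1 ^ 2 = Real.sin ((2 * j + 1) * θ) ^ 2 / f := by
    intro j
    rw [← hsq, groverAmp_eq hs.ne' hc.ne']
    simp only [mul_pow, div_pow]
    rw [← pow_mul, mul_comm j 2, pow_mul]
    norm_num
  simp only [hsum]
  have hJ' : (1 : ℝ) ≤ J := by exact_mod_cast hJ
  have hs2 : 0 < Real.sin (2 * θ) := Real.sin_pos_of_pos_of_lt_pi (by linarith) (by linarith)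
  -- With this many rounds the oscillating term is harmless and the mean of `sin²` is at least 1/4
  -- whatever `f` is. Otherwise all angles `(2j + 1)θ` stay below `π/2`, each sine is at least `2/π`
  -- times its angle, and the gain is quadratic in `J`.
  by_cases hcase : 1 ≤ J * Real.sin (2 * θ)
  · have hb := sum_sin_sq_odd_mul θ J
    have hb1 : (J : ℝ) / 4 ≤ ∑ j ∈ Finset.range J, Real.sin ((2 * j + 1) * θ) ^ 2 := by
      have := Real.sin_le_one (4 * J * θ)
      have h3 : 4 * Real.sin (2 * θ) * (J / 4) ≤ 4 * Real.sin (2 * θ) *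
          ∑ j ∈ Finset.range J, Real.sin ((2 * j + 1) * θ) ^ 2 := by
        rw [hb]; linarith
      exact le_of_mul_le_mul_left h3 (by positivity)
    rw [← Finset.sum_div]
    calc (J : ℝ) / 4 * min ((J : ℝ) ^ 2) (1 / f) ≤ J / 4 * (1 / f) := by
          gcongr; exact min_le_right _ _
      _ = J / 4 / f := by ring
      _ ≤ _ := by gcongr
  · push Not at hcase
    have hlow : 2 / Real.pi * (2 * θ) ≤ Real.sin (2 * θ) :=
      Real.mul_le_sin (by linarith) (by linarith)
    have hJθ : 2 * J * θ ≤ Real.pi / 2 := by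
      have : J * (2 / Real.pi * (2 * θ)) < 1 := lt_of_le_of_lt (by gcongr) hcase
      have h4 : J * (2 / Real.pi * (2 * θ)) = 4 * J * θ / Real.pi := by ring
      rw [h4, div_lt_one hpi] at this
      linarith
    have hterm : ∀ j ∈ Finset.range J, 4 / Real.pi ^ 2 * (2 * (j : ℝ) + 1) ^ 2 ≤
        Real.sin ((2 * j + 1) * θ) ^ 2 / f := by
      intro j hj
      have hj : (j : ℝ) + 1 ≤ J := by exact_mod_cast Finset.mem_range.1 hj
      have hb : (2 * (j : ℝ) + 1) * θ ≤ Real.pi / 2 := by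
        refine le_trans ?_ hJθ
        gcongr
        linarith
      have hb0 : 0 ≤ (2 * (j : ℝ) + 1) * θ := by positivity
      have h5 := Real.mul_le_sin hb0 hb
      have h6 : Real.sin θ ≤ θ := Real.sin_le hpos.le
      rw [le_div_iff₀ h0, ← hsq]
      have h7 : 2 / Real.pi * ((2 * (j : ℝ) + 1) * Real.sin θ) ≤ Real.sin ((2 * j + 1) * θ) := by
        refine le_trans ?_ h5
        gcongr
      calc 4 / Real.pi ^ 2 * (2 * (j : ℝ) + 1) ^ 2 * Real.sin θ ^ 2
          = (2 / Real.pi * ((2 * (j : ℝ) + 1) * Real.sin θ)) ^ 2 := by ring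
        _ ≤ _ := by gcongr
    refine le_trans ?_ (Finset.sum_le_sum hterm)
    rw [← Finset.mul_sum]
    have hS := sum_odd_sq J
    have hS2 : (J : ℝ) ^ 3 ≤ ∑ j ∈ Finset.range J, (2 * (j : ℝ) + 1) ^ 2 := by nlinarith
    -- The crude bound `π ≤ 4` gives the same constant 1/4 as in the other case.
    have hpi2 : (1 : ℝ) / 4 ≤ 4 / Real.pi ^ 2 := by
      rw [div_le_div_iff₀ (by norm_num) (by positivity)]
      nlinarith [Real.pi_le_four]
    calc (J : ℝ) / 4 * min ((J : ℝ) ^ 2) (1 / f) ≤ J / 4 * J ^ 2 := by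
          gcongr; exact min_le_left _ _
      _ = 1 / 4 * (J : ℝ) ^ 3 := by ring
      _ ≤ _ := by gcongr

/-! ### Preparation, diffusion and oracle circuits, and the law of the measured outcome. -/

section Amplify

variable {Q : Type} [Fintype Q] [DecidableEq Q]

/-- The gates that prepare the wires of `X` in a product state in which the wire `q` is `1` with
probability `p q`. -/
noncomputable def prepare (p : Q → ℝ) (hp : ∀ q, p q ∈ Set.Icc (0 : ℝ) 1) (X : List Q) :
    QCircuit Q := X.map fun q => biasGate q (p q) (hp q).1 (hp q).2

/-- The amplitudes of the product state. -/
noncomputable def prepAmp (p : Q → ℝ) (X : List Q) (x₀ y : Q → ZMod 2) : ℝ :=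
  if ∀ q, q ∉ X → y q = x₀ q then (X.map fun q => if y q = 0 then √(1 - p q) else √(p q)).prod
  else 0

variable {p : Q → ℝ} {hp : ∀ q, p q ∈ Set.Icc (0 : ℝ) 1} {X : List Q} {x₀ : Q → ZMod 2}

theorem prepare_isReflection : ∀ g ∈ prepare p hp X, g.IsReflection := by
  intro g hg
  obtain ⟨q, -, rfl⟩ := List.mem_map.1 hg
  exact biasGate_isReflection _ _ _ _

theorem biasGate_apply (q : Q) (t : ℝ) (h0 : 0 ≤ t) (h1 : t ≤ 1) (ψ : QState Q)
    (y : Q → ZMod 2) : (biasGate q t h0 h1).apply ψ y =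
      (if y q = 0 then (√(1 - t) : ℂ) else √t) * ψ (Function.update y q 0) +
      (if y q = 0 then (√t : ℂ) else -√(1 - t)) * ψ (Function.update y q 1) := by
  have hs : ∀ f : ZMod 2 → ℂ, ∑ a, f a = f 0 + f 1 := fun f => Fin.sum_univ_two f
  have hz : ∀ a : ZMod 2, a = 0 ∨ a = 1 := by decide
  unfold QGate.apply
  rw [if_pos (by intro q hq; exact absurd hq (Finset.notMem_empty _)), hs]
  simp only [biasGate, biasOp, Matrix.of_apply]
  rcases hz (y q) with h | h <;> simp [h]

/-- The gates act on distinct wires that start in `0`, so the amplitude is a product over the wires.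
-/
theorem apply_prepare (hX : X.Nodup) (h0 : ∀ q ∈ X, x₀ q = 0) (y : Q → ZMod 2) :
    QCircuit.apply (prepare p hp X) (basisState x₀) y = (prepAmp p X x₀ y : ℂ) := by
  induction X using List.reverseRecOn generalizing y with
  | nil =>
    simp only [prepare, List.map_nil, QCircuit.apply_nil, basisState, prepAmp, List.not_mem_nil,
      not_false_eq_true, forall_const, List.prod_nil, funext_iff]
    split_ifs <;> simp
  | append_singleton X q ih =>
    have hq : q ∉ X := by
      intro h
      have := (List.nodup_append.1 hX).2.2 q h q (by simp)
      exact this rfl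
    have hX' : X.Nodup := (List.nodup_append.1 hX).1
    have ih := ih hX' fun q hq => h0 q (by simp [hq])
    have hq0 : x₀ q = 0 := h0 q (by simp)
    have e : prepare p hp (X ++ [q]) = prepare p hp X ++ [biasGate q (p q) (hp q).1 (hp q).2] := by
      simp [prepare]
    rw [e, QCircuit.apply_append, QCircuit.apply_cons, QCircuit.apply_nil, biasGate_apply, ih, ih]
    -- Before its own gate the wire `q` is still `0`, so the branch with value `1` is empty.
    have h1 : prepAmp p X x₀ (Function.update y q 1) = 0 := by
      unfold prepAmp
      rw [if_neg]
      intro h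
      have := h q hq
      rw [Function.update_self, hq0] at this
      exact absurd this (by decide)
    have h2 : prepAmp p (X ++ [q]) x₀ y = (if y q = 0 then √(1 - p q) else √(p q)) *
        prepAmp p X x₀ (Function.update y q 0) := by
      unfold prepAmp
      have hiff : (∀ q', q' ∉ X ++ [q] → y q' = x₀ q') ↔
          ∀ q', q' ∉ X → Function.update y q 0 q' = x₀ q' := by
        refine forall_congr' fun q' => ?_
        by_cases e : q' = q
        · subst e; simp [hq0]
        · simp [e]
      simp only [hiff]
      by_cases hh : ∀ q', q' ∉ X → Function.update y q 0 q' = x₀ q'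
      · rw [if_pos hh, if_pos hh, List.map_append, List.prod_append, mul_comm]
        congr 1
        · simp
        · congr 1
          refine List.map_congr_left fun q' hq' => ?_
          rw [Function.update_of_ne (by rintro rfl; exact hq hq')]
      · rw [if_neg hh, if_neg hh, mul_zero]
    rw [h1, h2]
    split_ifs <;> simp

/-- The states that agree with `x₀` outside `X`. -/
def SupportedOn (X : List Q) (x₀ : Q → ZMod 2) (φ : QState Q) : Prop :=
  ∀ y, (¬ ∀ q, q ∉ X → y q = x₀ q) → φ y = 0

theorem SupportedOn.apply {c : QCircuit Q} {φ : QState Q} (h : SupportedOn X x₀ φ)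
    (hc : ∀ g ∈ c, g.target ∈ X ∧ g.controls = ∅) :
    SupportedOn X x₀ (QCircuit.apply c φ) := by
  induction c generalizing φ with
  | nil => exact h
  | cons g c ih =>
    rw [QCircuit.apply_cons]
    refine ih ?_ fun g hg => hc g (List.mem_cons_of_mem _ hg)
    intro y hy
    obtain ⟨hg, hg'⟩ := hc g List.mem_cons_self
    unfold QGate.apply
    rw [if_pos (by simp [hg'])]
    refine Finset.sum_eq_zero fun a _ => ?_
    rw [h, mul_zero]
    intro H
    apply hy
    intro q hq
    rw [← H q hq, Function.update_of_ne (by rintro rfl; exact hq hg)]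

/-- The reflection about the prepared state, up to a global sign. -/
noncomputable def diffusion (p : Q → ℝ) (hp : ∀ q, p q ∈ Set.Icc (0 : ℝ) 1) (X : List Q) (t : Q) :
    QCircuit Q :=
  (prepare p hp X).reverse ++ phaseGate t X.toFinset 0 :: prepare p hp X

/-- Among the basis states that agree with `x₀` outside `X`, the phase gate changes the sign of `x₀`
only. Conjugation by the preparation turns this reflection into the one about the prepared state.
The support condition is essential, since the wires outside `X` are not among the controls of the
phase gate. -/
theorem apply_diffusion (hX : X.Nodup) (h0 : ∀ q ∈ X, x₀ q = 0) {t : Q} (ht : t ∈ X)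
    {φ : QState Q} (hφ : SupportedOn X x₀ φ) (y : Q → ZMod 2) :
    QCircuit.apply (diffusion p hp X t) φ y =
      φ y - 2 * QState.pair (fun z => (prepAmp p X x₀ z : ℂ)) φ * prepAmp p X x₀ y := by
  set φ' := QCircuit.apply (prepare p hp X).reverse φ with hφ'
  have hsupp : SupportedOn X x₀ φ' := by
    refine hφ.apply fun g hg => ?_
    obtain ⟨q, hq, rfl⟩ := List.mem_map.1 (List.mem_reverse.1 hg)
    exact ⟨hq, rfl⟩
  have hphase : (phaseGate t X.toFinset 0).apply φ' =
      φ' + (-(2 * φ' x₀)) • basisState x₀ := by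
    funext z
    rw [phaseGate_apply]
    simp only [Pi.zero_apply, List.mem_toFinset, Pi.add_apply, Pi.smul_apply, basisState,
      smul_eq_mul, mul_ite, mul_one, mul_zero]
    by_cases hz : z = x₀
    · subst hz
      rw [if_pos ⟨h0 t ht, h0⟩, if_pos rfl]
      ring
    · rw [if_neg hz, add_zero]
      split_ifs with h
      · rw [hsupp z, neg_zero]
        intro H
        apply hz
        funext q
        by_cases hq : q ∈ X
        · rw [h.2 q hq, h0 q hq]
        · exact H q hq
      · rfl
  have hpair : φ' x₀ = QState.pair (fun z => (prepAmp p X x₀ z : ℂ)) φ := by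
    have e : (fun z => (prepAmp p X x₀ z : ℂ)) =
        QCircuit.apply (prepare p hp X) (basisState x₀) :=
      funext fun z => (apply_prepare hX h0 z).symm
    rw [e, QCircuit.pair_apply prepare_isReflection, ← hφ']
    simp [QState.pair, basisState]
  rw [diffusion, QCircuit.apply_append, QCircuit.apply_cons, ← hφ', hphase, QCircuit.apply_add,
    QCircuit.apply_smul, hφ', QCircuit.apply_apply_reverse prepare_isReflection, ← hφ']
  simp only [Pi.add_apply, Pi.smul_apply, smul_eq_mul]
  rw [apply_prepare hX h0, hpair]
  ring

theorem sum_prepAmp_sq (hp : ∀ q, p q ∈ Set.Icc (0 : ℝ) 1) (hX : X.Nodup)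
    (h0 : ∀ q ∈ X, x₀ q = 0) : ∑ y, prepAmp p X x₀ y ^ 2 = 1 := by
  have h := QCircuit.sum_norm_sq_apply (prepare p hp X) (basisState x₀)
  simp only [apply_prepare hX h0] at h
  simpa [basisState, apply_ite] using h

/-- The circuit that changes the sign of the basis states on which the classical program `V`
produces the values `pat` on `C` and `t`. -/
noncomputable def phaseOracle (V : List (Toggle Q)) (t : Q) (C : Finset Q) (pat : Q → ZMod 2) :
    QCircuit Q :=
  Toggle.compile V ++ phaseGate t C pat :: Toggle.compile V.reverse

theorem apply_phaseOracle (V : List (Toggle Q)) (t : Q) (C : Finset Q) (pat : Q → ZMod 2)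
    (φ : QState Q) (y : Q → ZMod 2) : QCircuit.apply (phaseOracle V t C pat) φ y =
      if Toggle.run V y t = pat t ∧ ∀ q ∈ C, Toggle.run V y q = pat q then -φ y else φ y := by
  rw [phaseOracle, QCircuit.apply_append, QCircuit.apply_cons, Toggle.apply_compile,
    Toggle.apply_compile, List.reverse_reverse]
  simp only [phaseGate_apply, Toggle.run_reverse_run]

/-- Amplitude amplification with `j` rounds, followed by the classical program. -/
noncomputable def amplify (p : Q → ℝ) (hp : ∀ q, p q ∈ Set.Icc (0 : ℝ) 1) (X : List Q) (t₀ : Q)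
    (V : List (Toggle Q)) (t : Q) (C : Finset Q) (pat : Q → ZMod 2) (j : ℕ) : QCircuit Q :=
  prepare p hp X ++ (List.replicate j (phaseOracle V t C pat ++ diffusion p hp X t₀)).flatten ++
    Toggle.compile V

/-- Oracle and diffusion preserve the span of the marked and the unmarked part of the prepared
state, so only the pair `groverAmp` evolves. -/
theorem apply_amplify_rounds (hX : X.Nodup) (h0 : ∀ q ∈ X, x₀ q = 0) {t₀ : Q} (ht₀ : t₀ ∈ X)
    (V : List (Toggle Q)) (t : Q) (C : Finset Q) (pat : Q → ZMod 2)
    {f : ℝ} (hf : f = ∑ y, if Toggle.run V y t = pat t ∧ ∀ q ∈ C, Toggle.run V y q = pat q then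
      prepAmp p X x₀ y ^ 2 else 0) (j : ℕ) (y : Q → ZMod 2) :
    QCircuit.apply (prepare p hp X ++
      (List.replicate j (phaseOracle V t C pat ++ diffusion p hp X t₀)).flatten) (basisState x₀) y =
      ((prepAmp p X x₀ y * if Toggle.run V y t = pat t ∧ ∀ q ∈ C, Toggle.run V y q = pat q then
        (groverAmp f j).1 else (groverAmp f j).2 : ℝ) : ℂ) := by
  induction j generalizing y with
  | zero =>
    simp only [List.replicate_zero, List.flatten_nil, List.append_nil, groverAmp]
    rw [apply_prepare hX h0, ite_self, mul_one]
  | succ j ih =>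
    set M : (Q → ZMod 2) → Prop :=
      fun y => Toggle.run V y t = pat t ∧ ∀ q ∈ C, Toggle.run V y q = pat q with hM
    change ∀ y, _ = ((prepAmp p X x₀ y * if M y then _ else _ : ℝ) : ℂ) at ih
    change _ = ((prepAmp p X x₀ y * if M y then _ else _ : ℝ) : ℂ)
    change f = ∑ y, if M y then _ else _ at hf
    rw [List.replicate_succ', List.flatten_append, List.flatten_singleton, ← List.append_assoc,
      QCircuit.apply_append, QCircuit.apply_append]
    have e1 : QCircuit.apply (phaseOracle V t C pat) (QCircuit.apply (prepare p hp X ++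
        (List.replicate j (phaseOracle V t C pat ++ diffusion p hp X t₀)).flatten)
        (basisState x₀)) = fun y => ((prepAmp p X x₀ y *
          if M y then -(groverAmp f j).1 else (groverAmp f j).2 : ℝ) : ℂ) := by
      funext z
      rw [apply_phaseOracle, ih]
      change (if M z then _ else _) = _
      split_ifs <;> simp
    rw [e1, apply_diffusion hX h0 ht₀]
    · have e2 : QState.pair (fun z => (prepAmp p X x₀ z : ℂ)) (fun y => ((prepAmp p X x₀ y *
          if M y then -(groverAmp f j).1 else (groverAmp f j).2 : ℝ) : ℂ)) =
          ((-(groverAmp f j).1 * f + (groverAmp f j).2 * (1 - f) : ℝ) : ℂ) := by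
        have hcompl : 1 - f = ∑ y, if M y then 0 else prepAmp p X x₀ y ^ 2 := by
          rw [← sum_prepAmp_sq hp hX h0, hf, ← Finset.sum_sub_distrib]
          refine Finset.sum_congr rfl fun z _ => ?_
          split_ifs <;> simp
        rw [hcompl, hf, QState.pair, Finset.mul_sum, Finset.mul_sum, ← Finset.sum_add_distrib,
          Complex.ofReal_sum]
        refine Finset.sum_congr rfl fun z _ => ?_
        rw [← Complex.ofReal_mul]
        congr 1
        split_ifs <;> ring
      rw [e2]
      norm_cast
      rw [groverAmp]
      split_ifs <;> ring
    · intro z hz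
      simp only [prepAmp]
      rw [if_neg hz]
      simp

/-- The circuit ends with one uninverted run of `V`, so the measured outcome carries the results of
`V`. As `V` permutes the basis states, the probability is that of `y` before this run. -/
theorem measure_amplify (hX : X.Nodup) (h0 : ∀ q ∈ X, x₀ q = 0) {t₀ : Q} (ht₀ : t₀ ∈ X)
    (V : List (Toggle Q)) (t : Q) (C : Finset Q) (pat : Q → ZMod 2)
    {f : ℝ} (hf : f = ∑ y, if Toggle.run V y t = pat t ∧ ∀ q ∈ C, Toggle.run V y q = pat q then
      prepAmp p X x₀ y ^ 2 else 0) (j : ℕ) {y : Q → ZMod 2}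
    (hy : Toggle.run V y t = pat t ∧ ∀ q ∈ C, Toggle.run V y q = pat q) :
    QCircuit.measure (amplify p hp X t₀ V t C pat j) x₀ (Toggle.run V y) =
      ENNReal.ofReal (prepAmp p X x₀ y ^ 2 * (groverAmp f j).1 ^ 2) := by
  unfold QCircuit.measure
  rw [PMF.ofFintype_apply, amplify, QCircuit.apply_append, Toggle.apply_compile]
  simp only [Toggle.run_reverse_run]
  rw [apply_amplify_rounds hX h0 ht₀ V t C pat hf, if_pos hy, Complex.norm_real,
    Real.norm_eq_abs, sq_abs, mul_pow]

theorem length_amplify_le (V : List (Toggle Q)) (t₀ t : Q) (C : Finset Q) (pat : Q → ZMod 2)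
    (j : ℕ) : (amplify p hp X t₀ V t C pat j).length ≤
      (j + 1) * (2 * V.length + 2 * X.length + 2) := by
  have h1 := Toggle.length_compile_le V
  have h2 := Toggle.length_compile_le V.reverse
  rw [List.length_reverse] at h2
  simp only [amplify, phaseOracle, diffusion, prepare, List.length_append, List.length_map,
    List.length_flatten, List.map_replicate, List.sum_replicate, List.length_cons,
    List.length_reverse, smul_eq_mul]
  have : j * ((Toggle.compile V).length + ((Toggle.compile V.reverse).length + 1) +
      (X.length + (X.length + 1))) ≤ j * (2 * V.length + 2 * X.length + 2) := by
    refine Nat.mul_le_mul_left _ ?_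
    omega
  rw [add_mul]
  omega

end Amplify

/-! ### Rules for computing the effect of reversible programs. -/

section ToggleRules

variable {Q : Type} [DecidableEq Q]

theorem ZMod.ite_eq_one_eq (a : ZMod 2) : (if a = 1 then (1 : ZMod 2) else 0) = a := by
  revert a; decide

theorem ZMod.two_cases (a : ZMod 2) : a = 0 ∨ a = 1 := by
  revert a; decide

theorem ZMod.two_add_self (a : ZMod 2) : a + a = 0 := by
  revert a; decide

theorem Toggle.run_of_target_ne {l : List (Toggle Q)} {q : Q} (h : ∀ g ∈ l, g.target ≠ q)
    (y : Q → ZMod 2) : Toggle.run l y q = y q := by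
  induction l generalizing y with
  | nil => rfl
  | cons g l ih =>
    rw [Toggle.run_cons, ih fun g hg => h g (List.mem_cons_of_mem _ hg)]
    unfold Toggle.step
    split_ifs
    · rw [Function.update_of_ne (h g List.mem_cons_self).symm]
    · rfl

/-- A program whose targets are not used as controls acts on all wires simultaneously. -/
theorem Toggle.run_parallel {l : List (Toggle Q)}
    (h : ∀ g ∈ l, ∀ g' ∈ l, ∀ p ∈ g'.ctl, p.1 ≠ g.target) (y : Q → ZMod 2) (q : Q) :
    Toggle.run l y q =
      y q + (l.map fun g => if g.target = q ∧ ∀ p ∈ g.ctl, y p.1 = p.2 then 1 else 0).sum := by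
  induction l generalizing y with
  | nil => simp
  | cons g l ih =>
    have hstep : ∀ q', q' ≠ g.target → g.step y q' = y q' := by
      intro q' hq'
      unfold Toggle.step
      split_ifs
      · rw [Function.update_of_ne hq']
      · rfl
    have hfire : g.Fires y ↔ ∀ p ∈ g.ctl, y p.1 = p.2 := by
      refine forall₂_congr fun p hp => ?_
      have := h g List.mem_cons_self g List.mem_cons_self p hp
      simp [this]
    rw [Toggle.run_cons, ih fun g' hg' g'' hg'' => h g' (List.mem_cons_of_mem _ hg') g''
      (List.mem_cons_of_mem _ hg''), List.map_cons, List.sum_cons, ← add_assoc]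
    congr 1
    · unfold Toggle.step
      simp only [hfire]
      by_cases hq : g.target = q
      · subst hq
        split_ifs with h1 h2 h2
        · simp
        · exact absurd ⟨rfl, h1⟩ h2
        · exact absurd h2.2 h1
        · simp
      · split_ifs with h1 h2 h2
        · exact absurd h2.1 hq
        · rw [Function.update_of_ne (Ne.symm hq), add_zero]
        · exact absurd h2.1 hq
        · simp
    · congr 1
      refine List.map_congr_left fun g' hg' => ?_
      have : (∀ p ∈ g'.ctl, g.step y p.1 = p.2) ↔ ∀ p ∈ g'.ctl, y p.1 = p.2 := by
        refine forall₂_congr fun p hp => ?_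
        rw [hstep p.1 (h g List.mem_cons_self g' (List.mem_cons_of_mem _ hg') p hp)]
      simp only [this]

theorem List.sum_map_ite_unique {ι : Type} {l : List ι} (hl : l.Nodup) {a : ι} (ha : a ∈ l)
    {P : ι → Prop} [DecidablePred P] (hP : ∀ b ∈ l, P b → b = a) :
    (l.map fun b => if P b then (1 : ZMod 2) else 0).sum = if P a then 1 else 0 := by
  classical
  rw [← List.sum_toFinset _ hl]
  refine Finset.sum_eq_single a ?_ ?_
  · intro b hb hba
    rw [if_neg fun h => hba (hP b (List.mem_toFinset.1 hb) h)]
  · intro h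
    exact absurd (List.mem_toFinset.2 ha) h

theorem Toggle.run_parallel_map {ι : Type} {l : List ι} (hl : l.Nodup) {g : ι → Toggle Q}
    (h : ∀ a ∈ l, ∀ a' ∈ l, ∀ p ∈ (g a').ctl, p.1 ≠ (g a).target)
    (hinj : ∀ a ∈ l, ∀ a' ∈ l, (g a).target = (g a').target → a = a') (y : Q → ZMod 2) {a : ι}
    (ha : a ∈ l) : Toggle.run (l.map g) y (g a).target =
      y (g a).target + if ∀ p ∈ (g a).ctl, y p.1 = p.2 then 1 else 0 := by
  rw [Toggle.run_parallel (by simpa using h), List.map_map]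
  congr 1
  have := List.sum_map_ite_unique hl ha
    (P := fun b => (g b).target = (g a).target ∧ ∀ p ∈ (g b).ctl, y p.1 = p.2)
    (fun b hb hP => hinj b hb a ha hP.1)
  simp only [true_and] at this
  exact this

/-- No gate sees a translation that vanishes on all controls. This is used for the coins, and for
the computed vector during uncomputation. -/
theorem Toggle.run_add {l : List (Toggle Q)} {d : Q → ZMod 2}
    (h : ∀ g ∈ l, ∀ p ∈ g.ctl, d p.1 = 0) (y : Q → ZMod 2) :
    Toggle.run l (y + d) = Toggle.run l y + d := by
  induction l generalizing y with
  | nil => rfl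
  | cons g l ih =>
    rw [Toggle.run_cons, Toggle.run_cons, ← ih fun g hg => h g (List.mem_cons_of_mem _ hg)]
    congr 1
    have hf : g.Fires (y + d) ↔ g.Fires y := by
      refine forall₂_congr fun p hp => ?_
      rw [Pi.add_apply, h g List.mem_cons_self p hp, add_zero]
    unfold Toggle.step
    simp only [hf]
    split_ifs
    · funext q
      by_cases hq : q = g.target
      · subst hq; simp; ring
      · simp [Function.update_of_ne hq]
    · rfl

/-- Compute, modify, uncompute: undoing `W` is not disturbed by a modification that `W` does not
read. -/
theorem Toggle.run_conj {W M : List (Toggle Q)} {y d : Q → ZMod 2}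
    (hM : Toggle.run M (Toggle.run W y) = Toggle.run W y + d)
    (hW : ∀ g ∈ W, ∀ p ∈ g.ctl, d p.1 = 0) : Toggle.run (W ++ M ++ W.reverse) y = y + d := by
  rw [Toggle.run_append, Toggle.run_append, hM,
    Toggle.run_add (fun g hg => hW g (List.mem_reverse.1 hg)), Toggle.run_reverse_run]

/-- The controls that single out `t` as the first wire of the family `α` with value `0`. -/
def firstZero {s : ℕ} (α : Fin s → Q) (t : Fin s) : List (Q × ZMod 2) :=
  (α t, 0) :: ((List.finRange s).filter (· < t)).map fun i => (α i, 1)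

/-- The controls that single out `t` as the last wire of the family `υ` with value `1`. -/
def lastOne {s : ℕ} (υ : Fin s → Q) (t : Fin s) : List (Q × ZMod 2) :=
  (υ t, 1) :: ((List.finRange s).filter (t < ·)).map fun i => (υ i, 0)

/-- The controls that single out `t` as the first wire of the family `υ` with value `1`. -/
def firstOne {s : ℕ} (υ : Fin s → Q) (t : Fin s) : List (Q × ZMod 2) :=
  (υ t, 1) :: ((List.finRange s).filter (· < t)).map fun i => (υ i, 0)

/-- Whether all controls of a list have the prescribed values. -/
def Holds (c : List (Q × ZMod 2)) (y : Q → ZMod 2) : Prop := ∀ p ∈ c, y p.1 = p.2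

instance (c : List (Q × ZMod 2)) (y : Q → ZMod 2) : Decidable (Holds c y) :=
  inferInstanceAs (Decidable (∀ p ∈ c, y p.1 = p.2))

@[simp] theorem holds_nil (y : Q → ZMod 2) : Holds [] y := by simp [Holds]

@[simp] theorem holds_cons (p : Q × ZMod 2) (c : List (Q × ZMod 2)) (y : Q → ZMod 2) :
    Holds (p :: c) y ↔ y p.1 = p.2 ∧ Holds c y := by simp [Holds]

@[simp] theorem holds_append (c c' : List (Q × ZMod 2)) (y : Q → ZMod 2) :
    Holds (c ++ c') y ↔ Holds c y ∧ Holds c' y := by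
  simp only [Holds, List.mem_append, or_imp, forall_and]

@[simp] theorem holds_firstZero {s : ℕ} (α : Fin s → Q) (t : Fin s) (y : Q → ZMod 2) :
    Holds (firstZero α t) y ↔ y (α t) = 0 ∧ ∀ i < t, y (α i) = 1 := by
  rw [firstZero, holds_cons]
  simp [Holds]

@[simp] theorem holds_lastOne {s : ℕ} (υ : Fin s → Q) (t : Fin s) (y : Q → ZMod 2) :
    Holds (lastOne υ t) y ↔ y (υ t) = 1 ∧ ∀ i, t < i → y (υ i) = 0 := by
  rw [lastOne, holds_cons]
  simp [Holds]

@[simp] theorem holds_firstOne {s : ℕ} (υ : Fin s → Q) (t : Fin s) (y : Q → ZMod 2) :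
    Holds (firstOne υ t) y ↔ y (υ t) = 1 ∧ ∀ i < t, y (υ i) = 0 := by
  rw [firstOne, holds_cons]
  simp [Holds]

/-- If `b` holds, the first wire of `α` with value `0` is set, and so is the corresponding wire
of `υ`. The wires of `υ` record which wires of `α` were set in this way. -/
def takeFirst {s : ℕ} (b : Q) (α υ : Fin s → Q) : List (Toggle Q) :=
  (List.finRange s).map (fun t => ⟨υ t, (b, 1) :: firstZero α t⟩) ++
    (List.finRange s).map fun t => ⟨α t, (b, 1) :: lastOne υ t⟩

theorem mem_firstZero {s : ℕ} {α : Fin s → Q} {t : Fin s} {p : Q × ZMod 2}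
    (h : p ∈ firstZero α t) : ∃ i, p.1 = α i := by
  simp only [firstZero, List.mem_cons, List.mem_map] at h
  rcases h with rfl | ⟨i, -, rfl⟩
  · exact ⟨t, rfl⟩
  · exact ⟨i, rfl⟩

theorem mem_lastOne {s : ℕ} {α : Fin s → Q} {t : Fin s} {p : Q × ZMod 2}
    (h : p ∈ lastOne α t) : ∃ i, p.1 = α i := by
  simp only [lastOne, List.mem_cons, List.mem_map] at h
  rcases h with rfl | ⟨i, -, rfl⟩
  · exact ⟨t, rfl⟩
  · exact ⟨i, rfl⟩

theorem mem_firstOne {s : ℕ} {α : Fin s → Q} {t : Fin s} {p : Q × ZMod 2}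
    (h : p ∈ firstOne α t) : ∃ i, p.1 = α i := by
  simp only [firstOne, List.mem_cons, List.mem_map] at h
  rcases h with rfl | ⟨i, -, rfl⟩
  · exact ⟨t, rfl⟩
  · exact ⟨i, rfl⟩

theorem mem_takeFirst {s : ℕ} {b : Q} {α υ : Fin s → Q} {g : Toggle Q}
    (h : g ∈ takeFirst b α υ) : (∃ i, g.target = α i ∨ g.target = υ i) ∧
      ∀ p ∈ g.ctl, p.1 = b ∨ ∃ i, p.1 = α i ∨ p.1 = υ i := by
  simp only [takeFirst, List.mem_append, List.mem_map, List.mem_finRange, true_and] at h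
  rcases h with ⟨t, rfl⟩ | ⟨t, rfl⟩
  · refine ⟨⟨t, Or.inr rfl⟩, ?_⟩
    intro p hp
    rcases List.mem_cons.1 hp with rfl | hp
    · exact Or.inl rfl
    · obtain ⟨i, hi⟩ := mem_firstZero hp
      exact Or.inr ⟨i, Or.inl hi⟩
  · refine ⟨⟨t, Or.inl rfl⟩, ?_⟩
    intro p hp
    rcases List.mem_cons.1 hp with rfl | hp
    · exact Or.inl rfl
    · obtain ⟨i, hi⟩ := mem_lastOne hp
      exact Or.inr ⟨i, Or.inr hi⟩

theorem run_takeFirst_of_zero {s : ℕ} {b : Q} {α υ : Fin s → Q}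
    (hbα : ∀ i, b ≠ α i) (hbυ : ∀ i, b ≠ υ i) {y : Q → ZMod 2} (hb : y b = 0) :
    Toggle.run (takeFirst b α υ) y = y := by
  have key : ∀ l : List (Toggle Q), (∀ g ∈ l, (b, 1) ∈ g.ctl ∧ b ≠ g.target) →
      Toggle.run l y = y := by
    intro l
    induction l with
    | nil => intro _; rfl
    | cons g l ih =>
      intro h
      have hg := h g List.mem_cons_self
      have : g.step y = y := by
        unfold Toggle.step
        rw [if_neg]
        intro H
        have := H _ hg.1 hg.2
        simp only at this
        rw [hb] at this
        exact absurd this (by decide)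
      rw [Toggle.run_cons, this]
      exact ih fun g hg => h g (List.mem_cons_of_mem _ hg)
  refine key _ fun g hg => ?_
  simp only [takeFirst, List.mem_append, List.mem_map, List.mem_finRange, true_and] at hg
  rcases hg with ⟨t, rfl⟩ | ⟨t, rfl⟩
  · exact ⟨by simp, hbυ t⟩
  · exact ⟨by simp, hbα t⟩

/-- A wire cannot be toggled under the condition that it is itself the first zero, since a toggle
must not read its target. Hence the log `υ`: the first free position is logged, and then the wire of
`α` at the last logged position is set. By `inv` all earlier log entries precede every free
position, so the last entry is the new one. -/
theorem run_takeFirst {s : ℕ} {b : Q} {α υ : Fin s → Q} (hα : Function.Injective α)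
    (hυ : Function.Injective υ) (hαυ : ∀ i i', α i ≠ υ i') (hbα : ∀ i, b ≠ α i)
    (hbυ : ∀ i, b ≠ υ i) {y : Q → ZMod 2}
    (inv : ∀ i i', y (υ i) = 1 → y (α i') = 0 → i < i') (hb : y b = 1) {t : Fin s}
    (ht : y (α t) = 0) (ht' : ∀ i < t, y (α i) = 1) :
    Toggle.run (takeFirst b α υ) y = Function.update (Function.update y (υ t) 1) (α t) 1 := by
  have h01 : (0 : ZMod 2) ≠ 1 := by decide
  have hυt : y (υ t) = 0 := by
    rcases ZMod.two_cases (y (υ t)) with h | h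
    · exact h
    · exact absurd (inv t t h ht) (lt_irrefl _)
  have hfirst : ∀ i, Holds ((b, 1) :: firstZero α i) y ↔ i = t := by
    intro i
    simp only [holds_cons, holds_firstZero, hb, true_and]
    constructor
    · rintro ⟨h1, h2⟩
      rcases lt_trichotomy i t with h | h | h
      · rw [ht' i h] at h1; exact absurd h1.symm h01
      · exact h
      · have := h2 t h
        rw [ht] at this; exact absurd this h01
    · rintro rfl
      exact ⟨ht, ht'⟩
  have e1 : Toggle.run ((List.finRange s).map fun t => ⟨υ t, (b, 1) :: firstZero α t⟩) y =
      Function.update y (υ t) 1 := by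
    funext q
    by_cases hq : ∃ i, q = υ i
    · obtain ⟨i, rfl⟩ := hq
      have := Toggle.run_parallel_map (List.nodup_finRange s)
        (g := fun t => (⟨υ t, (b, 1) :: firstZero α t⟩ : Toggle Q)) (by
          intro a _ a' _ p hp
          rcases List.mem_cons.1 hp with rfl | hp
          · exact hbυ a
          · obtain ⟨i, hi⟩ := mem_firstZero hp
            rw [hi]; exact hαυ i a) (fun a _ a' _ e => hυ e) y (List.mem_finRange i)
      simp only at this
      rw [this]
      change _ + (if Holds _ y then _ else _) = _
      simp only [hfirst]
      by_cases h : i = t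
      · subst h; simp [hυt]
      · rw [Function.update_of_ne fun e => h (hυ e)]
        simp [h]
    · rw [Toggle.run_of_target_ne, Function.update_of_ne fun e => hq ⟨t, e⟩]
      intro g hg
      obtain ⟨i, -, rfl⟩ := List.mem_map.1 hg
      exact fun e => hq ⟨i, e.symm⟩
  rw [takeFirst, Toggle.run_append, e1]
  set y1 := Function.update y (υ t) 1 with hy1
  have hy1υ : ∀ i, y1 (υ i) = if i = t then 1 else y (υ i) := by
    intro i
    by_cases h : i = t
    · subst h; simp [hy1]
    · rw [hy1, Function.update_of_ne fun e => h (hυ e), if_neg h]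
  have hlast : ∀ i, Holds ((b, 1) :: lastOne υ i) y1 ↔ i = t := by
    intro i
    have hb1 : y1 b = 1 := by rw [hy1, Function.update_of_ne (hbυ t), hb]
    simp only [holds_cons, holds_lastOne, hb1, true_and, hy1υ]
    constructor
    · rintro ⟨h1, h2⟩
      by_contra hne
      rw [if_neg hne] at h1
      have hlt := inv i t h1 ht
      have := h2 t hlt
      rw [if_pos rfl] at this
      exact h01 this.symm
    · rintro rfl
      refine ⟨by simp, fun i' hi' => ?_⟩
      rw [if_neg hi'.ne']
      rcases ZMod.two_cases (y (υ i')) with h | h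
      · exact h
      · exact absurd (inv i' i h ht) (lt_asymm hi')
  funext q
  by_cases hq : ∃ i, q = α i
  · obtain ⟨i, rfl⟩ := hq
    have := Toggle.run_parallel_map (List.nodup_finRange s)
      (g := fun t => (⟨α t, (b, 1) :: lastOne υ t⟩ : Toggle Q)) (by
        intro a _ a' _ p hp
        rcases List.mem_cons.1 hp with rfl | hp
        · exact hbα a
        · obtain ⟨i, hi⟩ := mem_lastOne hp
          rw [hi]; exact (hαυ a i).symm) (fun a _ a' _ e => hα e) y1 (List.mem_finRange i)
    simp only at this
    rw [this]
    change _ + (if Holds _ y1 then _ else _) = _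
    simp only [hlast]
    by_cases h : i = t
    · subst h
      have : y1 (α i) = 0 := by rw [hy1, Function.update_of_ne (hαυ _ _), ht]
      simp [this]
    · rw [Function.update_of_ne fun e => h (hα e)]
      simp [h]
  · rw [Toggle.run_of_target_ne, Function.update_of_ne fun e => hq ⟨t, e⟩]
    intro g hg
    obtain ⟨i, -, rfl⟩ := List.mem_map.1 hg
    exact fun e => hq ⟨i, e.symm⟩

end ToggleRules

/-! ### Wires of the decoder and controlled row operations. -/

/-- The working qubits of the decoder for `r` equations in `r + k` unknowns. -/
inductive Anc (r k : ℕ)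
  -- The keys encode the candidate support. A row label with key 0 forces its identity coordinate to
  -- vanish, so its equation constrains the other unknowns: these are the available rows. A column
  -- label with key 1 is an unknown to be solved for.
  | key (x : Fin r ⊕ Fin k)
  | coin (j : Fin k)
  -- A fair bit that takes part in the acceptance test only to keep the marked probability at most
  -- 1/2.
  | dum
  | used (i : Fin r)
  | piv (i : Fin r)
  | succ (j : Fin k)
  | err (x : Fin r ⊕ Fin k)
  | bad (x : Fin r ⊕ Fin k)
  | cnt (b : Bool) (i : Fin (r + k))
  | cntUsed (b : Bool) (i : Fin (r + k))
  deriving DecidableEq, Fintype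

/-- The qubits of the decoder. -/
inductive Wire (r k : ℕ)
  | mat (i : Fin r) (j : Fin k)
  | syn (i : Fin r)
  | anc (a : Anc r k)
  deriving DecidableEq, Fintype

section RowOperations

variable {r k : ℕ}

open Wire Anc

/-- Add row `src` to row `dst` in the columns of `js` and in the syndrome. -/
def rowAdd (c : List (Wire r k × ZMod 2)) (src dst : Fin r) (js : List (Fin k)) :
    List (Toggle (Wire r k)) :=
  (none :: js.map some).map fun o => match o with
    | none => ⟨syn dst, (syn src, 1) :: c⟩
    | some l => ⟨mat dst l, (mat src l, 1) :: c⟩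

/-- The effect of a row addition. -/
def rowAddFun (src dst : Fin r) (js : List (Fin k)) (y : Wire r k → ZMod 2) : Wire r k → ZMod 2
  | syn i => y (syn i) + if i = dst then y (syn src) else 0
  | mat i l => y (mat i l) + if i = dst ∧ l ∈ js then y (mat src l) else 0
  | anc a => y (anc a)

theorem run_rowAdd {c : List (Wire r k × ZMod 2)} {src dst : Fin r} {js : List (Fin k)}
    (hne : src ≠ dst) (hjs : js.Nodup) (hc : ∀ p ∈ c, ∃ a, p.1 = anc a)
    (y : Wire r k → ZMod 2) :
    Toggle.run (rowAdd c src dst js) y = if Holds c y then rowAddFun src dst js y else y := by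
  have hnd : (none :: js.map some).Nodup := by
    rw [List.nodup_cons]
    exact ⟨by simp, hjs.map (Option.some_injective _)⟩
  have hpar := fun {a} (ha : a ∈ none :: js.map some) =>
    Toggle.run_parallel_map (Q := Wire r k) hnd (g := fun o => match o with
    | none => ⟨syn dst, (syn src, 1) :: c⟩
    | some l => ⟨mat dst l, (mat src l, 1) :: c⟩) (by
      intro a _ a' _ p hp e
      have hp' : p.1 = syn src ∨ (∃ l, p.1 = mat src l) ∨ ∃ a, p.1 = anc a := by
        cases a' with
        | none =>
          rcases List.mem_cons.1 hp with rfl | hp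
          · exact Or.inl rfl
          · exact Or.inr (Or.inr (hc p hp))
        | some l =>
          rcases List.mem_cons.1 hp with rfl | hp
          · exact Or.inr (Or.inl ⟨l, rfl⟩)
          · exact Or.inr (Or.inr (hc p hp))
      cases a <;> rcases hp' with h | ⟨l, h⟩ | ⟨a, h⟩ <;> rw [h] at e <;> simp at e
      · exact hne e
      · exact hne e.1) (by
      intro a _ a' _ e
      cases a <;> cases a' <;> simp at e ⊢
      exact e) y ha
  have hsplit : ∀ q : Wire r k, (∀ p ∈ (q, (1 : ZMod 2)) :: c, y p.1 = p.2) ↔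
      y q = 1 ∧ Holds c y := fun q => holds_cons _ _ _
  have hframe : ∀ q, q ≠ syn dst → (∀ l ∈ js, q ≠ mat dst l) →
      Toggle.run (rowAdd c src dst js) y q = y q := by
    intro q h1 h2
    refine Toggle.run_of_target_ne (fun g hg => ?_) y
    obtain ⟨o, ho, rfl⟩ := List.mem_map.1 hg
    cases o with
    | none => exact h1.symm
    | some l => exact (h2 l (by simpa using ho)).symm
  funext q
  cases q with
  | syn i =>
    by_cases hi : i = dst
    · subst hi
      have := hpar (a := none) (by simp)
      simp only [hsplit] at this
      rw [rowAdd, this]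
      by_cases h : Holds c y
      · simp [h, rowAddFun, ZMod.ite_eq_one_eq]
      · simp [h]
    · rw [hframe _ (by simpa using hi) (by simp)]
      split_ifs
      · simp [rowAddFun, hi]
      · rfl
  | mat i l =>
    by_cases hi : i = dst ∧ l ∈ js
    · obtain ⟨rfl, hl⟩ := hi
      have := hpar (a := some l) (by simpa using hl)
      simp only [hsplit] at this
      rw [rowAdd, this]
      by_cases h : Holds c y
      · simp [h, rowAddFun, ZMod.ite_eq_one_eq, hl]
      · simp [h]
    · rw [hframe _ (by simp) (by
        intro l' hl' e
        simp only [mat.injEq] at e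
        exact hi ⟨e.1, e.2 ▸ hl'⟩)]
      split_ifs
      · simp [rowAddFun, hi]
      · rfl
  | anc a =>
    rw [hframe _ (by simp) (by simp)]
    split_ifs <;> rfl

/-- The synResidual of the equations for the values `z` of the free unknowns. -/
def synResidual (y : Wire r k → ZMod 2) (z : Fin k → ZMod 2) (i : Fin r) : ZMod 2 :=
  y (syn i) + ∑ l, y (mat i l) * z l

/-- Add entry `src` to entry `dst`. -/
def entryAdd (src dst : Fin r) (v : Fin r → ZMod 2) : Fin r → ZMod 2 :=
  fun i => v i + if i = dst then v src else 0

/-- Columns outside `js` are multiplied by zero entries of `z`. This is why the row additions may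
leave the columns already processed alone. -/
theorem synResidual_rowAddFun (src dst : Fin r) {js : List (Fin k)} (y : Wire r k → ZMod 2)
    {z : Fin k → ZMod 2} (hz : ∀ l, l ∉ js → z l = 0) :
    synResidual (rowAddFun src dst js y) z = entryAdd src dst (synResidual y z) := by
  funext i
  by_cases hi : i = dst
  · subst hi
    simp only [synResidual, rowAddFun, entryAdd, if_true, true_and, add_mul, Finset.sum_add_distrib]
    have : ∑ l, (if l ∈ js then y (mat src l) else 0) * z l = ∑ l, y (mat src l) * z l := by
      refine Finset.sum_congr rfl fun l _ => ?_
      by_cases hl : l ∈ js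
      · rw [if_pos hl]
      · rw [hz l hl, mul_zero, mul_zero]
    rw [this]
    ring
  · simp [synResidual, rowAddFun, entryAdd, hi]

/-- A list of controlled row additions: the controls, the source and the destination. -/
def rowAdds (ops : List (List (Wire r k × ZMod 2) × Fin r × Fin r)) (js : List (Fin k)) :
    List (Toggle (Wire r k)) :=
  ops.flatMap fun o => rowAdd o.1 o.2.1 o.2.2 js

/-- The controls are ancillas and the targets are matrix and syndrome wires, so all conditions can
be evaluated on one state `y₀` with the same ancillas. -/
theorem run_rowAdds {ops : List (List (Wire r k × ZMod 2) × Fin r × Fin r)} {js : List (Fin k)}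
    (hjs : js.Nodup) (hne : ∀ o ∈ ops, o.2.1 ≠ o.2.2) (hc : ∀ o ∈ ops, ∀ p ∈ o.1, ∃ a, p.1 = anc a)
    (y₀ y : Wire r k → ZMod 2) (hy : ∀ a, y (anc a) = y₀ (anc a)) :
    Toggle.run (rowAdds ops js) y = ops.foldl
      (fun y o => if Holds o.1 y₀ then rowAddFun o.2.1 o.2.2 js y else y) y := by
  induction ops generalizing y with
  | nil => rfl
  | cons o ops ih =>
    have e : rowAdds (o :: ops) js = rowAdd o.1 o.2.1 o.2.2 js ++ rowAdds ops js := rfl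
    have hh : Holds o.1 y ↔ Holds o.1 y₀ := by
      refine forall₂_congr fun p hp => ?_
      obtain ⟨a, ha⟩ := hc o List.mem_cons_self p hp
      rw [ha, hy]
    rw [e, Toggle.run_append, run_rowAdd (hne o List.mem_cons_self) hjs (hc o List.mem_cons_self),
      ih (fun o ho => hne o (List.mem_cons_of_mem _ ho))
        (fun o ho => hc o (List.mem_cons_of_mem _ ho)), List.foldl_cons]
    · simp only [hh]
    · intro a
      split_ifs
      · exact hy a
      · exact hy a

theorem foldl_rowAddFun (ops : List (List (Wire r k × ZMod 2) × Fin r × Fin r))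
    (js : List (Fin k)) (y₀ y : Wire r k → ZMod 2) :
    let y' := ops.foldl (fun y o => if Holds o.1 y₀ then rowAddFun o.2.1 o.2.2 js y else y) y
    (∀ a, y' (anc a) = y (anc a)) ∧ (∀ i l, l ∉ js → y' (mat i l) = y (mat i l)) ∧
    (∀ z : Fin k → ZMod 2, (∀ l, l ∉ js → z l = 0) → synResidual y' z = ops.foldl
      (fun v o => if Holds o.1 y₀ then entryAdd o.2.1 o.2.2 v else v) (synResidual y z)) := by
  induction ops generalizing y with
  | nil => simp
  | cons o ops ih =>
    obtain ⟨h1, h2, h3⟩ :=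
      ih (if Holds o.1 y₀ then rowAddFun o.2.1 o.2.2 js y else y)
    refine ⟨fun a => ?_, fun i l hl => ?_, fun z hz => ?_⟩
    · rw [List.foldl_cons, h1]
      split_ifs <;> rfl
    · rw [List.foldl_cons, h2 i l hl]
      split_ifs
      · simp [rowAddFun, hl]
      · rfl
    · rw [List.foldl_cons, List.foldl_cons, h3 z hz]
      congr 1
      split_ifs
      · exact synResidual_rowAddFun _ _ _ hz
      · rfl

theorem foldl_entryAdd_unique {ι : Type} [DecidableEq ι] {l : List ι} (hl : l.Nodup) {P : ι → Prop}
    [DecidablePred P] {a : ι} (hP : ∀ b ∈ l, P b ↔ b = a) (src dst : ι → Fin r)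
    (v : Fin r → ZMod 2) :
    l.foldl (fun v b => if P b then entryAdd (src b) (dst b) v else v) v =
      if a ∈ l then entryAdd (src a) (dst a) v else v := by
  induction l generalizing v with
  | nil => simp
  | cons b l ih =>
    rw [List.foldl_cons, ih (List.nodup_cons.1 hl).2 fun b hb => hP b (List.mem_cons_of_mem _ hb)]
    by_cases hb : b = a
    · subst hb
      rw [if_pos ((hP b List.mem_cons_self).2 rfl), if_neg (List.nodup_cons.1 hl).1,
        if_pos List.mem_cons_self]
    · rw [if_neg fun h => hb ((hP b List.mem_cons_self).1 h)]
      simp [Ne.symm hb]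

/-- All selected additions have the source `t`, which is never their destination, so they take
effect simultaneously. -/
theorem foldl_entryAdd_source {l : List (Fin r × Fin r)} (hl : l.Nodup)
    {P : Fin r × Fin r → Prop} [DecidablePred P] {t : Fin r} (hP : ∀ b ∈ l, P b → b.1 = t)
    (hne : ∀ b ∈ l, b.1 ≠ b.2) (v : Fin r → ZMod 2) :
    l.foldl (fun v b => if P b then entryAdd b.1 b.2 v else v) v =
      fun i => v i + if (t, i) ∈ l ∧ P (t, i) then v t else 0 := by
  induction l generalizing v with
  | nil => simp
  | cons b l ih =>
    rw [List.foldl_cons, ih (List.nodup_cons.1 hl).2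
      (fun b hb => hP b (List.mem_cons_of_mem _ hb)) fun b hb => hne b (List.mem_cons_of_mem _ hb)]
    by_cases hb : P b
    · obtain ⟨b1, b2⟩ := b
      obtain rfl : b1 = t := hP _ List.mem_cons_self hb
      have hn := hne _ List.mem_cons_self
      have hnl := (List.nodup_cons.1 hl).1
      simp only at hn
      funext i
      rw [if_pos hb]
      by_cases hi : i = b2
      · subst hi
        simp [entryAdd, hb, hnl]
      · simp [entryAdd, hi, hn]
    · funext i
      rw [if_neg hb]
      have : (t, i) ∈ b :: l ∧ P (t, i) ↔ (t, i) ∈ l ∧ P (t, i) := by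
        constructor
        · rintro ⟨h1, h2⟩
          rcases List.mem_cons.1 h1 with rfl | h1
          · exact absurd h2 hb
          · exact ⟨h1, h2⟩
        · rintro ⟨h1, h2⟩
          exact ⟨List.mem_cons_of_mem _ h1, h2⟩
      simp only [this]

/-- The wire of the row label `i`: `1` if the row is not available as a pivot row. -/
abbrev rowKey (i : Fin r) : Wire r k := anc (key (Sum.inl i))

/-- The wire of the column label `j`. -/
abbrev colKey (j : Fin k) : Wire r k := anc (key (Sum.inr j))

/-- Make the entry of the first available row nonzero in the pivot column. -/
def fetchOps (r k : ℕ) : List (List (Wire r k × ZMod 2) × Fin r × Fin r) :=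
  ((List.finRange r ×ˢ List.finRange r).filter fun p => p.1 < p.2).map fun p =>
    (firstZero rowKey p.1 ++ firstOne (fun i => anc (piv i)) p.2, p.2, p.1)

/-- Clear the pivot column in all other available rows. -/
def clearOps (r k : ℕ) : List (List (Wire r k × ZMod 2) × Fin r × Fin r) :=
  ((List.finRange r ×ˢ List.finRange r).filter fun p => p.1 ≠ p.2).map fun p =>
    (firstZero rowKey p.1 ++ [(anc (piv p.2), 1)], p.1, p.2)

theorem nodup_pairs (P : Fin r × Fin r → Bool) :
    ((List.finRange r ×ˢ List.finRange r).filter P).Nodup :=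
  ((List.nodup_finRange r).product (List.nodup_finRange r)).filter _

theorem foldl_fetchOps {y : Wire r k → ZMod 2} {t s : Fin r} (ht : y (rowKey t) = 0)
    (ht' : ∀ i < t, y (rowKey i) = 1) (hs : y (anc (piv s)) = 1)
    (hs' : ∀ i < s, y (anc (piv i)) = 0) (v : Fin r → ZMod 2) :
    (fetchOps r k).foldl (fun v o => if Holds o.1 y then entryAdd o.2.1 o.2.2 v else v) v =
      if t < s then entryAdd s t v else v := by
  rw [fetchOps, List.foldl_map]
  have := foldl_entryAdd_unique (nodup_pairs fun p => decide (p.1 < p.2))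
    (P := fun p => Holds (firstZero (rowKey (k := k)) p.1 ++ firstOne (fun i => anc (piv i)) p.2) y)
    (a := (t, s)) (by
      rintro ⟨a, b⟩ -
      simp only [holds_append, holds_firstZero, holds_firstOne, Prod.mk.injEq]
      have h01 : (0 : ZMod 2) ≠ 1 := by decide
      constructor
      · rintro ⟨⟨h1, h2⟩, h3, h4⟩
        constructor
        · rcases lt_trichotomy a t with h | h | h
          · rw [ht' a h] at h1; exact absurd h1.symm h01
          · exact h
          · rw [h2 t h] at ht; exact absurd ht.symm h01
        · rcases lt_trichotomy b s with h | h | h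
          · rw [hs' b h] at h3; exact absurd h3 h01
          · exact h
          · rw [h4 s h] at hs; exact absurd hs h01
      · rintro ⟨rfl, rfl⟩
        exact ⟨⟨ht, ht'⟩, hs, hs'⟩) (fun p => p.2) (fun p => p.1) v
  simp only at this ⊢
  rw [this]
  simp [List.mem_filter]

theorem foldl_clearOps {y : Wire r k → ZMod 2} {t : Fin r} (ht : y (rowKey t) = 0)
    (ht' : ∀ i < t, y (rowKey i) = 1) (v : Fin r → ZMod 2) :
    (clearOps r k).foldl (fun v o => if Holds o.1 y then entryAdd o.2.1 o.2.2 v else v) v =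
      fun i => v i + if i ≠ t ∧ y (anc (piv i)) = 1 then v t else 0 := by
  rw [clearOps, List.foldl_map]
  have hcond : ∀ a b : Fin r, Holds (firstZero (rowKey (k := k)) a ++ [(anc (piv b), 1)]) y ↔
      a = t ∧ y (anc (piv b)) = 1 := by
    intro a b
    simp only [holds_append, holds_firstZero, holds_cons, holds_nil, and_true]
    have h01 : (0 : ZMod 2) ≠ 1 := by decide
    refine and_congr_left fun _ => ?_
    constructor
    · rintro ⟨h1, h2⟩
      rcases lt_trichotomy a t with h | h | h
      · rw [ht' a h] at h1; exact absurd h1.symm h01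
      · exact h
      · rw [h2 t h] at ht; exact absurd ht.symm h01
    · rintro rfl
      exact ⟨ht, ht'⟩
  have := foldl_entryAdd_source (nodup_pairs fun p => decide (p.1 ≠ p.2))
    (P := fun p => Holds (firstZero (rowKey (k := k)) p.1 ++ [(anc (piv p.2), 1)]) y) (t := t)
    (fun b _ hb => ((hcond _ _).1 hb).1) (by simp [List.mem_filter]) v
  simp only at this ⊢
  rw [this]
  funext i
  have hmem : (t, i) ∈ ((List.finRange r ×ˢ List.finRange r).filter fun p => decide (p.1 ≠ p.2)) ↔
      i ≠ t := by
    rw [List.mem_filter]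
    simp
    exact ne_comm
  simp only [hmem, hcond, true_and]

/-- Mark the rows that can serve as pivot rows of column `j`. -/
def markPivots (j : Fin k) : List (Toggle (Wire r k)) :=
  (List.finRange r).map fun i =>
    ⟨anc (piv i), [(colKey j, 1), (rowKey i, 0), (mat i j, 1)]⟩

/-- Record whether column `j` has a pivot. -/
def recordSuccess (j : Fin k) : List (Toggle (Wire r k)) :=
  [⟨anc (succ j), []⟩, ⟨anc (succ j), (List.finRange r).map fun i => (anc (piv i), 0)⟩]

/-- One elimination step. -/
def eliminate (j : Fin k) (js : List (Fin k)) : List (Toggle (Wire r k)) :=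
  markPivots j ++ recordSuccess j ++ (rowAdds (fetchOps r k) js ++ rowAdds (clearOps r k) js) ++
    markPivots j

theorem run_markPivots (j : Fin k) (y : Wire r k → ZMod 2) :
    (∀ i, Toggle.run (markPivots j) y (anc (piv i)) = y (anc (piv i)) +
      if y (colKey j) = 1 ∧ y (rowKey i) = 0 ∧ y (mat i j) = 1 then 1 else 0) ∧
    ∀ q, (∀ i, q ≠ anc (piv i)) → Toggle.run (markPivots j) y q = y q := by
  constructor
  · intro i
    have := Toggle.run_parallel_map (List.nodup_finRange r) (g := fun i =>
      (⟨anc (piv i), [(colKey j, 1), (rowKey i, 0), (mat i j, 1)]⟩ : Toggle (Wire r k)))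
      (by intro a _ a' _ p hp; simp at hp; rcases hp with rfl | rfl | rfl <;> simp)
      (by intro a _ a' _ e; simpa using e) y (List.mem_finRange i)
    simpa [markPivots] using this
  · intro q hq
    refine Toggle.run_of_target_ne (fun g hg => ?_) y
    obtain ⟨i, -, rfl⟩ := List.mem_map.1 hg
    exact (hq i).symm

/-- The two toggles compute a disjunction: the bit is set unconditionally and reset if no row is
marked. -/
theorem run_recordSuccess (j : Fin k) (y : Wire r k → ZMod 2) (hs : y (anc (succ j)) = 0) :
    Toggle.run (recordSuccess j) y = Function.update y (anc (succ j))
      (if ∀ i : Fin r, y (anc (piv i)) = 0 then 0 else 1) := by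
  have h1 : (⟨anc (succ j), []⟩ : Toggle (Wire r k)).step y =
      Function.update y (anc (succ j)) 1 := by
    unfold Toggle.step
    rw [if_pos (by simp [Toggle.Fires]), hs, zero_add]
  rw [recordSuccess, Toggle.run_cons, Toggle.run_cons, Toggle.run_nil, h1]
  unfold Toggle.step
  have h2 : (⟨anc (succ j), (List.finRange r).map fun i => (anc (piv i), 0)⟩ :
      Toggle (Wire r k)).Fires (Function.update y (anc (succ j)) 1) ↔
      ∀ i : Fin r, y (anc (piv i)) = 0 := by
    simp [Toggle.Fires]
  simp only [h2]
  split_ifs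
  · simp [ZMod.two_add_self]
  · rfl

theorem rowOps_controls {o : List (Wire r k × ZMod 2) × Fin r × Fin r}
    (ho : o ∈ fetchOps r k ++ clearOps r k) : o.2.1 ≠ o.2.2 ∧ ∀ p ∈ o.1, ∃ a, p.1 = anc a ∧
      ((∃ i, a = key (Sum.inl i)) ∨ ∃ i, a = piv i) := by
  rcases List.mem_append.1 ho with ho | ho
  · obtain ⟨⟨a, b⟩, hab, rfl⟩ := List.mem_map.1 ho
    refine ⟨?_, fun p hp => ?_⟩
    · have : a < b := by simpa using (List.mem_filter.1 hab).2
      exact this.ne'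
    · rcases List.mem_append.1 hp with hp | hp
      · obtain ⟨i, hi⟩ := mem_firstZero hp
        exact ⟨_, hi, Or.inl ⟨i, rfl⟩⟩
      · obtain ⟨i, hi⟩ := mem_firstOne hp
        exact ⟨_, hi, Or.inr ⟨i, rfl⟩⟩
  · obtain ⟨⟨a, b⟩, hab, rfl⟩ := List.mem_map.1 ho
    refine ⟨by simpa using (List.mem_filter.1 hab).2, fun p hp => ?_⟩
    rcases List.mem_append.1 hp with hp | hp
    · obtain ⟨i, hi⟩ := mem_firstZero hp
      exact ⟨_, hi, Or.inl ⟨i, rfl⟩⟩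
    · rw [List.mem_singleton] at hp
      subst hp
      exact ⟨_, rfl, Or.inr ⟨b, rfl⟩⟩

theorem run_rowOps {js : List (Fin k)} (hjs : js.Nodup) (y : Wire r k → ZMod 2) :
    Toggle.run (rowAdds (fetchOps r k) js ++ rowAdds (clearOps r k) js) y =
      (fetchOps r k ++ clearOps r k).foldl
        (fun y' o => if Holds o.1 y then rowAddFun o.2.1 o.2.2 js y' else y') y := by
  have e : rowAdds (fetchOps r k) js ++ rowAdds (clearOps r k) js =
      rowAdds (fetchOps r k ++ clearOps r k) js := by
    simp [rowAdds]
  rw [e]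
  refine run_rowAdds hjs (fun o ho => (rowOps_controls ho).1) (fun o ho p hp => ?_) y y fun _ => rfl
  obtain ⟨a, ha, -⟩ := (rowOps_controls ho).2 p hp
  exact ⟨a, ha⟩

/-- Row `i` can serve as a pivot row of column `j`. -/
def IsPivot (y : Wire r k → ZMod 2) (j : Fin k) (i : Fin r) : Prop :=
  y (colKey j) = 1 ∧ y (rowKey i) = 0 ∧ y (mat i j) = 1

instance (y : Wire r k → ZMod 2) (j : Fin k) (i : Fin r) : Decidable (IsPivot y j i) :=
  inferInstanceAs (Decidable (_ ∧ _))

theorem run_eliminate_of_no_pivot {j : Fin k} {js : List (Fin k)} (hjs : js.Nodup)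
    {y : Wire r k → ZMod 2} (hp : ∀ i, y (anc (piv i)) = 0) (hs : y (anc (succ j)) = 0)
    (hno : ∀ i : Fin r, ¬ IsPivot y j i) : Toggle.run (eliminate j js) y = y := by
  have hm : Toggle.run (markPivots j) y = y := by
    funext q
    by_cases hq : ∃ i, q = anc (piv i)
    · obtain ⟨i, rfl⟩ := hq
      rw [(run_markPivots j y).1]
      have := hno i
      unfold IsPivot at this
      rw [if_neg this, add_zero]
    · exact (run_markPivots j y).2 q fun i hi => hq ⟨i, hi⟩
  have hr : Toggle.run (recordSuccess j) y = y := by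
    rw [run_recordSuccess j y hs, if_pos hp, ← hs, Function.update_eq_self]
  have hf : Toggle.run (rowAdds (fetchOps r k) js ++ rowAdds (clearOps r k) js) y = y := by
    rw [run_rowOps hjs]
    have : ∀ l : List (List (Wire r k × ZMod 2) × Fin r × Fin r), (∀ o ∈ l, ¬ Holds o.1 y) →
        l.foldl (fun y' o => if Holds o.1 y then rowAddFun o.2.1 o.2.2 js y' else y') y = y := by
      intro l hl
      induction l with
      | nil => rfl
      | cons o l ih =>
        rw [List.foldl_cons, if_neg (hl o List.mem_cons_self)]
        exact ih fun o ho => hl o (List.mem_cons_of_mem _ ho)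
    refine this _ fun o ho => ?_
    have h01 : (0 : ZMod 2) ≠ 1 := by decide
    rcases List.mem_append.1 ho with ho | ho
    · obtain ⟨⟨a, b⟩, -, rfl⟩ := List.mem_map.1 ho
      simp [hp]
    · obtain ⟨⟨a, b⟩, -, rfl⟩ := List.mem_map.1 ho
      simp [hp]
  rw [eliminate, Toggle.run_append, Toggle.run_append (markPivots j ++ recordSuccess j),
    Toggle.run_append (markPivots j), hm, hr, hf, hm]

/-- Row additions touch only the columns of `js`, so column `j` keeps its entries. They record the
multipliers: a second run of `markPivots` clears the marks, and the step can be undone later without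
workspace of matrix size. On the level of equations, row `t` becomes the pivot equation with value
`c`, and the other available rows no longer involve the unknown `j`. -/
theorem run_eliminate_of_pivot {j : Fin k} {js : List (Fin k)} (hjs : js.Nodup) (hj : j ∉ js)
    {y : Wire r k → ZMod 2} (hp : ∀ i, y (anc (piv i)) = 0) (hs : y (anc (succ j)) = 0)
    (hex : ∃ i : Fin r, IsPivot y j i) :
    ∃ t : Fin r, y (rowKey t) = 0 ∧ (∀ i < t, y (rowKey i) = 1) ∧
      (∀ a, Toggle.run (eliminate j js) y (anc a) = if a = succ j then 1 else y (anc a)) ∧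
      (∀ i l, l ∉ js → Toggle.run (eliminate j js) y (mat i l) = y (mat i l)) ∧
      ∀ (z : Fin k → ZMod 2) (c : ZMod 2), (∀ l, l ∉ js → z l = 0) →
        ((∀ i, y (rowKey i) = 0 → synResidual y z i + y (mat i j) * c = 0) ↔
          synResidual (Toggle.run (eliminate j js) y) z t = c ∧
          ∀ i, i ≠ t → y (rowKey i) = 0 → synResidual (Toggle.run (eliminate j js) y) z i = 0) := by
  classical
  -- Here `s` is the first available row with a one in column `j`, and `t` below is the first
  -- available row. Then `t ≤ s`, and row `s` has to be added to row `t` exactly when `t < s`.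
  obtain ⟨s, hs1, hs2⟩ : ∃ s : Fin r, IsPivot y j s ∧ ∀ i < s, ¬ IsPivot y j i := by
    obtain ⟨s, hs, hmin⟩ := (Set.toFinite {i : Fin r | IsPivot y j i}).exists_minimal hex
    exact ⟨s, hs, fun i hi h => not_lt_of_ge (hmin h hi.le) hi⟩
  obtain ⟨t, ht1, ht2⟩ : ∃ t : Fin r, y (rowKey t) = 0 ∧ ∀ i < t, y (rowKey i) = 1 := by
    obtain ⟨t, ht, hmin⟩ := (Set.toFinite {i : Fin r | y (rowKey i) = 0}).exists_minimal
      ⟨s, hs1.2.1⟩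
    refine ⟨t, ht, fun i hi => ?_⟩
    rcases ZMod.two_cases (y (rowKey i)) with h | h
    · exact absurd hi (not_lt_of_ge (hmin h hi.le))
    · exact h
  have hts : t ≤ s := by
    by_contra h
    have := ht2 s (not_le.1 h)
    rw [hs1.2.1] at this
    exact absurd this (by decide)
  set y1 := Toggle.run (markPivots j) y with hy1
  have hy1p : ∀ i, y1 (anc (piv i)) = if IsPivot y j i then 1 else 0 := by
    intro i
    rw [hy1, (run_markPivots j y).1, hp, zero_add]
    rfl
  have hy1q : ∀ q, (∀ i, q ≠ anc (piv i)) → y1 q = y q := (run_markPivots j y).2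
  set y2 := Toggle.run (recordSuccess j) y1 with hy2
  have hy2' : y2 = Function.update y1 (anc (succ j)) 1 := by
    rw [hy2, run_recordSuccess j y1 (by rw [hy1q _ (by simp), hs]), if_neg]
    intro h
    have := h s
    rw [hy1p, if_pos hs1] at this
    exact absurd this (by decide)
  have hy2a : ∀ a, y2 (anc a) = if a = succ j then 1 else y1 (anc a) := by
    intro a
    rw [hy2']
    by_cases h : a = succ j
    · subst h; simp
    · rw [Function.update_of_ne (by simpa using h), if_neg h]
  have hy2q : ∀ q, (∀ a, q ≠ anc a) → y2 q = y q := by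
    intro q hq
    rw [hy2', Function.update_of_ne (hq _), hy1q _ fun i => hq _]
  have hrow : ∀ i, y2 (rowKey i) = y (rowKey i) := by
    intro i
    rw [hy2a, if_neg (by simp), hy1q _ (by simp)]
  have hpiv : ∀ i, y2 (anc (piv i)) = if IsPivot y j i then 1 else 0 := by
    intro i
    rw [hy2a, if_neg (by simp), hy1p]
  set y3 := Toggle.run (rowAdds (fetchOps r k) js ++ rowAdds (clearOps r k) js) y2 with hy3
  rw [run_rowOps hjs] at hy3
  obtain ⟨h3a, h3m, h3r⟩ := foldl_rowAddFun (fetchOps r k ++ clearOps r k) js y2 y2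
  rw [← hy3] at h3a h3m h3r
  have hrun : Toggle.run (eliminate j js) y = Toggle.run (markPivots j) y3 := by
    rw [eliminate, Toggle.run_append, Toggle.run_append (markPivots j ++ recordSuccess j),
    Toggle.run_append (markPivots j), ← hy1, ← hy2]
  have hmat : ∀ i l, l ∉ js → y3 (mat i l) = y (mat i l) := by
    intro i l hl
    rw [h3m i l hl, hy2q _ (by simp)]
  have hfin : ∀ q, (∀ i, q ≠ anc (piv i)) → Toggle.run (eliminate j js) y q = y3 q := by
    intro q hq
    rw [hrun, (run_markPivots j y3).2 q hq]
  have hfp : ∀ i, Toggle.run (eliminate j js) y (anc (piv i)) = 0 := by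
    intro i
    rw [hrun, (run_markPivots j y3).1, h3a, hpiv]
    -- The second marking evaluates the same condition as the first because keys and column `j` are
    -- unchanged, so the marks cancel.
    have : (y3 (colKey j) = 1 ∧ y3 (rowKey i) = 0 ∧ y3 (mat i j) = 1) ↔ IsPivot y j i := by
      rw [h3a, h3a, hrow, hmat i j hj, hy2a, if_neg (by simp), hy1q _ (by simp)]
      rfl
    simp only [this]
    split_ifs <;> decide
  refine ⟨t, ht1, ht2, ?_, ?_, ?_⟩
  · intro a
    by_cases ha : ∃ i, a = piv i
    · obtain ⟨i, rfl⟩ := ha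
      rw [hfp, if_neg (by simp), hp]
    · rw [hfin _ (fun i h => ha ⟨i, by simpa using h⟩), h3a, hy2a]
      split_ifs
      · rfl
      · rw [hy1q _ (fun i h => ha ⟨i, by simpa using h⟩)]
  · intro i l hl
    rw [hfin _ (by simp), hmat i l hl]
  · intro z c hz
    have hres : synResidual (Toggle.run (eliminate j js) y) z = synResidual y3 z := by
      funext i
      simp only [synResidual]
      rw [hfin _ (by simp)]
      congr 1
      refine Finset.sum_congr rfl fun l _ => ?_
      rw [hfin _ (by simp)]
    have hres2 : synResidual y2 z = synResidual y z := by
      funext i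
      simp only [synResidual]
      rw [hy2q _ (by simp)]
      congr 1
      refine Finset.sum_congr rfl fun l _ => ?_
      rw [hy2q _ (by simp)]
    rw [hres, h3r z hz, List.foldl_append, foldl_fetchOps (s := s) (by rw [hrow, ht1])
      (fun i hi => by rw [hrow, ht2 i hi]) (by rw [hpiv, if_pos hs1])
      (fun i hi => by rw [hpiv, if_neg (hs2 i hi)]),
      foldl_clearOps (by rw [hrow, ht1]) (fun i hi => by rw [hrow, ht2 i hi]), hres2]
    set v := synResidual y z with hv
    -- In the available rows, the marks are exactly the entries of column `j`.
    have hav : ∀ i, y (rowKey i) = 0 → y (mat i j) = if IsPivot y j i then 1 else 0 := by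
      intro i hi
      split_ifs with h
      · exact h.2.2
      · rcases ZMod.two_cases (y (mat i j)) with h' | h'
        · exact h'
        · exact absurd ⟨hs1.1, hi, h'⟩ h
    have hpiv1 : ∀ i, y2 (anc (piv i)) = 1 ↔ IsPivot y j i := by
      intro i
      rw [hpiv]
      split_ifs with h <;> simp [h]
    set w := (if t < s then entryAdd s t v else v) with hw
    have hwi : ∀ i, i ≠ t → w i = v i := by
      intro i hi
      rw [hw]
      split_ifs
      · simp [entryAdd, hi]
      · rfl
    simp only [hpiv1]
    have hadd : ∀ a b : ZMod 2, a + b = 0 ↔ a = b := by decide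
    have hz2 : ∀ a : ZMod 2, a + a = 0 := by decide
    have hwt : w t = if t < s then v t + v s else v t := by
      rw [hw]
      split_ifs <;> simp [entryAdd]
    constructor
    · intro H
      have H' : ∀ i, y (rowKey i) = 0 → v i = if IsPivot y j i then c else 0 := by
        intro i hi
        have := H i hi
        rw [hav i hi, hadd] at this
        rw [this]
        split_ifs <;> simp
      have hvs : v s = c := by rw [H' s hs1.2.1, if_pos hs1]
      have hwc : w t = c := by
        rw [hwt]
        split_ifs with h
        · rw [H' t ht1, if_neg (hs2 t h), hvs, zero_add]
        · obtain rfl : t = s := le_antisymm hts (not_lt.1 h)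
          exact hvs
      refine ⟨by simp [hwc], fun i hi hi0 => ?_⟩
      simp only [hi, ne_eq, not_false_eq_true, true_and]
      rw [hwi i hi, H' i hi0, hwc]
      split_ifs
      · exact hz2 c
      · simp
    · rintro ⟨h1, h2⟩
      simp only [ne_eq, not_true_eq_false, false_and, if_false, add_zero] at h1
      have H' : ∀ i, i ≠ t → y (rowKey i) = 0 → v i = if IsPivot y j i then c else 0 := by
        intro i hi hi0
        have := h2 i hi hi0
        simp only [hi, ne_eq, not_false_eq_true, true_and] at this
        rw [hwi i hi, h1, hadd] at this
        exact this
      have Ht : v t = if IsPivot y j t then c else 0 := by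
        rw [hwt] at h1
        split_ifs at h1 with h
        · rw [if_neg (hs2 t h)]
          rw [H' s h.ne' hs1.2.1, if_pos hs1] at h1
          have : ∀ a b : ZMod 2, a + b = b → a = 0 := by decide
          exact this _ _ h1
        · obtain rfl : t = s := le_antisymm hts (not_lt.1 h)
          rw [if_pos hs1]; exact h1
      intro i hi
      rw [hav i hi]
      by_cases hit : i = t
      · subst hit
        rw [Ht]
        split_ifs
        · rw [one_mul, hz2]
        · simp
      · rw [H' i hit hi]
        split_ifs
        · rw [one_mul, hz2]
        · simp

end RowOperations

/-! ### The reversible linear solver. -/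

section Solve

variable {r k : ℕ}

open Wire Anc

/-- The wires of the computed vector. -/
abbrev freeErr (j : Fin k) : Wire r k := anc (err (Sum.inr j))

/-- Mark the first available row as used if column `j` has a pivot. -/
def consume (r : ℕ) (j : Fin k) : List (Toggle (Wire r k)) :=
  takeFirst (anc (succ j)) rowKey fun i => anc (used i)

/-- Compute coordinate `j` of the solution: a coin if column `j` has no pivot, and otherwise from
the equation of the pivot row. -/
def substitute (r : ℕ) (j : Fin k) (js : List (Fin k)) : List (Toggle (Wire r k)) :=
  ⟨freeErr j, [(anc (succ j), 0), (colKey j, 1), (anc (coin j), 1)]⟩ ::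
    (List.finRange r).flatMap fun t =>
      ⟨freeErr j, (anc (succ j), 1) :: (syn t, 1) :: firstZero rowKey t⟩ ::
        js.map fun l =>
          ⟨freeErr j, (anc (succ j), 1) :: (mat t l, 1) :: (freeErr l, 1) :: firstZero rowKey t⟩

/-- Solve the equations of the available rows for the columns of `js`; all wires except those of
the computed vector are restored. -/
def solveProg (r : ℕ) : List (Fin k) → List (Toggle (Wire r k))
  | [] => []
  | j :: js => eliminate j js ++ (consume r j ++ solveProg r js ++ (consume r j).reverse ++
      substitute r j js) ++ (eliminate j js).reverse

theorem mem_eliminate {j : Fin k} {js : List (Fin k)} {g : Toggle (Wire r k)}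
    (hg : g ∈ eliminate j js) : ∀ p ∈ g.ctl, (∀ x, p.1 ≠ anc (err x)) ∧ ∀ x, p.1 ≠ anc (coin x) := by
  simp only [eliminate, List.mem_append] at hg
  have hmark : ∀ g ∈ markPivots (r := r) j, ∀ p ∈ g.ctl, (∀ x, p.1 ≠ anc (err x)) ∧
      ∀ x, p.1 ≠ anc (coin x) := by
    intro g hg p hp
    obtain ⟨i, -, rfl⟩ := List.mem_map.1 hg
    simp at hp
    rcases hp with rfl | rfl | rfl <;> simp
  have hadds : ∀ ops : List (List (Wire r k × ZMod 2) × Fin r × Fin r),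
      (∀ o ∈ ops, o ∈ fetchOps r k ++ clearOps r k) → ∀ g ∈ rowAdds ops js, ∀ p ∈ g.ctl,
      (∀ x, p.1 ≠ anc (err x)) ∧ ∀ x, p.1 ≠ anc (coin x) := by
    intro ops hops g hg p hp
    obtain ⟨o, ho, hg⟩ := List.mem_flatMap.1 hg
    have hctl := (rowOps_controls (hops o ho)).2
    have hc : ∀ p ∈ o.1, (∀ x, p.1 ≠ anc (err x)) ∧ ∀ x, p.1 ≠ anc (coin x) := by
      intro p hp
      obtain ⟨a, ha, ⟨i, rfl⟩ | ⟨i, rfl⟩⟩ := hctl p hp <;> simp [ha]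
    obtain ⟨b, -, rfl⟩ := List.mem_map.1 hg
    cases b <;> rcases List.mem_cons.1 hp with rfl | hp
    · simp
    · exact hc p hp
    · simp
    · exact hc p hp
  rcases hg with ((hg | hg) | hg | hg) | hg
  · exact hmark g hg
  · simp only [recordSuccess, List.mem_cons, List.not_mem_nil, or_false] at hg
    rcases hg with rfl | rfl
    · simp
    · intro p hp
      obtain ⟨i, -, rfl⟩ := List.mem_map.1 hp
      simp
  · exact hadds _ (fun o ho => List.mem_append_left _ ho) g hg
  · exact hadds _ (fun o ho => List.mem_append_right _ ho) g hg
  · exact hmark g hg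

theorem mem_consume {j : Fin k} {g : Toggle (Wire r k)} (hg : g ∈ consume r j) :
    ((∀ x, g.target ≠ anc (err x)) ∧ (∀ x, g.target ≠ anc (coin x))) ∧
      ∀ p ∈ g.ctl, (∀ x, p.1 ≠ anc (err x)) ∧ ∀ x, p.1 ≠ anc (coin x) := by
  obtain ⟨⟨i, hi⟩, h⟩ := mem_takeFirst hg
  refine ⟨?_, fun p hp => ?_⟩
  · rcases hi with hi | hi <;> simp [hi]
  · rcases h p hp with h | ⟨i, h | h⟩ <;> simp [h]

theorem mem_substitute {j : Fin k} {js : List (Fin k)} (hj : j ∉ js) {g : Toggle (Wire r k)}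
    (hg : g ∈ substitute r j js) : g.target = freeErr j ∧ ∀ p ∈ g.ctl, p.1 ≠ freeErr j := by
  rcases List.mem_cons.1 hg with rfl | hg
  · refine ⟨rfl, fun p hp => ?_⟩
    simp at hp
    rcases hp with rfl | rfl | rfl <;> simp
  · obtain ⟨t, -, hg⟩ := List.mem_flatMap.1 hg
    rcases List.mem_cons.1 hg with rfl | hg
    · refine ⟨rfl, fun p hp => ?_⟩
      rcases List.mem_cons.1 hp with rfl | hp
      · simp
      rcases List.mem_cons.1 hp with rfl | hp
      · simp
      obtain ⟨i, hi⟩ := mem_firstZero hp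
      simp [hi]
    · obtain ⟨l, hl, rfl⟩ := List.mem_map.1 hg
      refine ⟨rfl, fun p hp => ?_⟩
      rcases List.mem_cons.1 hp with rfl | hp
      · simp
      rcases List.mem_cons.1 hp with rfl | hp
      · simp
      rcases List.mem_cons.1 hp with rfl | hp
      · simp only [ne_eq, anc.injEq, err.injEq, Sum.inr.injEq]
        rintro rfl
        exact hj hl
      obtain ⟨i, hi⟩ := mem_firstZero hp
      simp [hi]

/-- A modification of the computed vector in the coordinates of `js`. -/
def ErrOn (js : List (Fin k)) (d : Wire r k → ZMod 2) : Prop :=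
  ∀ q, (∀ l ∈ js, q ≠ freeErr l) → d q = 0

theorem run_substitute {j : Fin k} {js : List (Fin k)} (hj : j ∉ js) (y : Wire r k → ZMod 2) :
    ∃ d, ErrOn [j] d ∧ Toggle.run (substitute r j js) y = y + d := by
  refine ⟨Toggle.run (substitute r j js) y - y, fun q hq => ?_, by abel⟩
  rw [Pi.sub_apply, Toggle.run_of_target_ne, sub_self]
  intro g hg
  rw [(mem_substitute hj hg).1]
  exact (hq j (by simp)).symm

/-- Two nested applications of `Toggle.run_conj`, one for `consume` and one for `eliminate`. The
recursive call and the substitution change only `err` wires, which neither of these programs reads.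
-/
theorem run_solveProg_cons {j : Fin k} {js : List (Fin k)} {d₁ : Wire r k → ZMod 2}
    (y : Wire r k → ZMod 2) (hj : j ∉ js) (h1 : ErrOn js d₁)
    (hd : Toggle.run (solveProg r js) (Toggle.run (consume r j) (Toggle.run (eliminate j js) y)) =
      Toggle.run (consume r j) (Toggle.run (eliminate j js) y) + d₁) :
    ∃ d₂, ErrOn [j] d₂ ∧ Toggle.run (substitute r j js) (Toggle.run (eliminate j js) y + d₁) =
      Toggle.run (eliminate j js) y + d₁ + d₂ ∧
      Toggle.run (solveProg r (j :: js)) y = y + (d₁ + d₂) := by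
  obtain ⟨d₂, h2, hd2⟩ := run_substitute (r := r) hj (Toggle.run (eliminate j js) y + d₁)
  refine ⟨d₂, h2, hd2, ?_⟩
  rw [solveProg]
  have hzero : ∀ {js' : List (Fin k)} {d : Wire r k → ZMod 2}, ErrOn js' d → ∀ q,
      (∀ x, q ≠ anc (err x)) → d q = 0 := fun hd q hq => hd q fun l _ => hq _
  refine Toggle.run_conj ?_ ?_
  · rw [Toggle.run_append, Toggle.run_conj hd, hd2, add_assoc]
    intro g hg p hp
    exact hzero h1 _ ((mem_consume hg).2 p hp).1
  · intro g hg p hp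
    rw [Pi.add_apply, hzero h1 _ (mem_eliminate hg p hp).1, hzero h2 _ (mem_eliminate hg p hp).1,
      add_zero]

theorem ErrOn.add {js js' : List (Fin k)} {d d' : Wire r k → ZMod 2} (h : ErrOn js d)
    (h' : ErrOn js' d') : ErrOn (js' ++ js) (d + d') := by
  intro q hq
  rw [Pi.add_apply, h q fun l hl => hq l (by simp [hl]), h' q fun l hl => hq l (by simp [hl]),
    add_zero]

theorem run_solveProg {js : List (Fin k)} (hjs : js.Nodup) (y : Wire r k → ZMod 2) :
    ∃ d, ErrOn js d ∧ Toggle.run (solveProg r js) y = y + d := by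
  induction js generalizing y with
  | nil => exact ⟨0, fun _ _ => rfl, by simp [solveProg]⟩
  | cons j js ih =>
    obtain ⟨hj, hjs⟩ := List.nodup_cons.1 hjs
    obtain ⟨d₁, h1, hd1⟩ := ih hjs (Toggle.run (consume r j) (Toggle.run (eliminate j js) y))
    obtain ⟨d₂, h2, -, h3⟩ := run_solveProg_cons y hj h1 hd1
    exact ⟨d₁ + d₂, h1.add h2, h3⟩

/-- The invariants of the elimination on the columns of `js`. -/
structure SolveReady (js : List (Fin k)) (y : Wire r k → ZMod 2) : Prop where
  piv : ∀ i, y (anc (piv i)) = 0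
  order : ∀ i i', y (anc (used i)) = 1 → y (rowKey i') = 0 → i < i'
  succ : ∀ l ∈ js, y (anc (succ l)) = 0
  err : ∀ l ∈ js, y (freeErr l) = 0

/-- The values of the unknowns of the columns of `js` that satisfy the equations of the available
rows and vanish outside the selected columns. -/
def solutions (js : List (Fin k)) (y : Wire r k → ZMod 2) : Finset (Fin k → ZMod 2) :=
  Finset.univ.filter fun z => (∀ l, l ∉ js → z l = 0) ∧ (∀ l, y (colKey l) = 0 → z l = 0) ∧
    ∀ i : Fin r, y (rowKey i) = 0 → synResidual y z i = 0

theorem mem_solutions {js : List (Fin k)} {y : Wire r k → ZMod 2} {z : Fin k → ZMod 2} :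
    z ∈ solutions js y ↔ (∀ l, l ∉ js → z l = 0) ∧ (∀ l, y (colKey l) = 0 → z l = 0) ∧
    ∀ i : Fin r, y (rowKey i) = 0 → synResidual y z i = 0 := by
  simp [solutions]

theorem synResidual_update (y : Wire r k → ZMod 2) (z : Fin k → ZMod 2) (j : Fin k) (i : Fin r)
    (hz : z j = 0) (c : ZMod 2) :
    synResidual y (Function.update z j c) i = synResidual y z i + y (mat i j) * c := by
  have : Function.update z j c = z + Pi.single j c := by
    funext l
    by_cases h : l = j
    · subst h; simp [hz]
    · simp [h]
  rw [this, synResidual, synResidual]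
  simp only [Pi.add_apply, mul_add, Finset.sum_add_distrib, Pi.single_apply, mul_ite, mul_zero,
    Finset.sum_ite_eq', Finset.mem_univ, if_true]
  ring

/-- The value computed by the substitution step. -/
theorem run_substitute_self {j : Fin k} {js : List (Fin k)} (hj : j ∉ js) (hjs : js.Nodup)
    (y : Wire r k → ZMod 2) :
    (y (anc (succ j)) = 0 → Toggle.run (substitute r j js) y (freeErr j) =
      y (freeErr j) + if y (colKey j) = 1 ∧ y (anc (coin j)) = 1 then 1 else 0) ∧
    (y (anc (succ j)) = 1 → ∀ t : Fin r, y (rowKey t) = 0 → (∀ i < t, y (rowKey i) = 1) →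
      Toggle.run (substitute r j js) y (freeErr j) = y (freeErr j) +
        (y (syn t) + ∑ l ∈ js.toFinset, y (mat t l) * y (freeErr l))) := by
  have h01 : (0 : ZMod 2) ≠ 1 := by decide
  have hrun := Toggle.run_parallel (l := substitute r j js) (fun g hg g' hg' p hp => by
    rw [(mem_substitute hj hg).1]
    exact (mem_substitute hj hg').2 p hp) y (freeErr j)
  have hP : ∀ c : List (Wire r k × ZMod 2), (∀ p ∈ c, y p.1 = p.2) ↔ Holds c y := fun _ => Iff.rfl
  constructor
  · intro h0
    rw [hrun]
    congr 1
    rw [substitute, List.map_cons, List.sum_cons, List.sum_eq_zero, add_zero]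
    · simp only [true_and, hP, holds_cons, holds_nil, h0, and_true]
    · intro a ha
      obtain ⟨g, hg, rfl⟩ := List.mem_map.1 ha
      rw [if_neg]
      rintro ⟨-, h⟩
      obtain ⟨t, -, hg⟩ := List.mem_flatMap.1 hg
      have : (anc (succ j), 1) ∈ g.ctl := by
        rcases List.mem_cons.1 hg with rfl | hg
        · simp
        · obtain ⟨l, -, rfl⟩ := List.mem_map.1 hg
          simp
      have := h _ this
      simp only [h0] at this
      exact h01 this
  · intro h1 t ht ht'
    rw [hrun]
    congr 1
    have hfirst : ∀ i : Fin r, (y (rowKey i) = 0 ∧ ∀ i' < i, y (rowKey i') = 1) ↔ i = t := by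
      intro i
      constructor
      · rintro ⟨h1, h2⟩
        rcases lt_trichotomy i t with h | h | h
        · rw [ht' i h] at h1; exact absurd h1.symm h01
        · exact h
        · have := h2 t h
          rw [ht] at this; exact absurd this h01
      · rintro rfl
        exact ⟨ht, ht'⟩
    rw [substitute, List.map_cons, List.sum_cons]
    simp only [true_and, hP, holds_cons, holds_nil, h1, and_true, List.map_flatMap, List.map_cons,
      List.map_map, Function.comp_def, holds_firstZero, hfirst, h01.symm, false_and, if_false,
      zero_add]
    have hmul : ∀ a b : ZMod 2, (if a = 1 ∧ b = 1 then (1 : ZMod 2) else 0) = a * b := by decide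
    rw [List.flatMap, List.sum_flatten, List.map_map, ← List.ofFn_eq_map, List.sum_ofFn,
      Finset.sum_eq_single t]
    · simp only [Function.comp_apply, List.sum_cons, and_true, ZMod.ite_eq_one_eq, hmul]
      rw [List.sum_toFinset _ hjs]
    · intro i _ hi
      simp [hi]
    · simp

end Solve

/-! ### Completeness of the solver: one coin for each free column. -/

section Solve

variable {r k : ℕ}

open Wire Anc

/-- A modification of the coins. -/
def CoinOn (d : Wire r k → ZMod 2) : Prop := ∀ q, (∀ l, q ≠ anc (coin l)) → d q = 0

/-- The program computes a prescribed solution if the coins are right on an exceptional set `F`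
of coordinates, and `2 ^ |F|` is at most the number of solutions. -/
theorem solveProg_complete {js : List (Fin k)} (hjs : js.Nodup) {y : Wire r k → ZMod 2}
    (hy : SolveReady js y) {z : Fin k → ZMod 2} (hz : z ∈ solutions js y) :
    ∃ F : Finset (Fin k), 2 ^ F.card ≤ (solutions js y).card ∧ (∀ l ∈ F, l ∈ js) ∧
      ∀ d : Wire r k → ZMod 2, CoinOn d → (∀ l ∈ F, (y + d) (anc (coin l)) = z l) →
        ∀ l ∈ js, Toggle.run (solveProg r js) (y + d) (freeErr l) = z l := by
  induction js generalizing y z with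
  | nil =>
    refine ⟨∅, ?_, by simp, by simp⟩
    simpa using Finset.card_pos.2 ⟨z, hz⟩
  | cons j js ih =>
    obtain ⟨hj, hjs⟩ := List.nodup_cons.1 hjs
    have hz' := mem_solutions.1 hz
    set E := Toggle.run (eliminate j js) y with hE
    set y' := Toggle.run (consume r j) E with hy'
    have hEd : ∀ d, CoinOn d → Toggle.run (eliminate j js) (y + d) = E + d := fun d hd =>
      Toggle.run_add (fun g hg p hp => hd _ fun l => (mem_eliminate hg p hp).2 l) y
    have hyd : ∀ d, CoinOn d → Toggle.run (consume r j) (E + d) = y' + d := fun d hd =>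
      Toggle.run_add (fun g hg p hp => hd _ fun l => ((mem_consume hg).2 p hp).2 l) E
    -- The recursive call sees the solution with coordinate `j` removed; the substitution step
    -- restores that coordinate.
    set z' := Function.update z j 0 with hz'def
    have hz'j : z' j = 0 := by simp [hz'def]
    have hz'l : ∀ l, l ≠ j → z' l = z l := fun l hl => by simp [hz'def, hl]
    have hz'js : ∀ l, l ∉ js → z' l = 0 := by
      intro l hl
      by_cases h : l = j
      · rw [h, hz'j]
      · rw [hz'l l h]
        exact hz'.1 l (by simp [h, hl])
    have hzz' : Function.update z' j (z j) = z := by simp [hz'def]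
    have hres : ∀ i, synResidual y z i = synResidual y z' i + y (mat i j) * z j := by
      intro i
      rw [← synResidual_update y z' j i hz'j, hzz']
    have hcoin0 : ∀ d : Wire r k → ZMod 2, CoinOn d → ∀ a, (∀ l, a ≠ coin l) → d (anc a) = 0 := by
      intro d hd a ha
      exact hd _ fun l => by simpa using ha l
    -- the value of the coordinates, from the value on `js` and the substitution step
    have final : ∀ d, CoinOn d → (∀ l ∈ js, y' (freeErr l) = 0) →
        (∀ l ∈ js, Toggle.run (solveProg r js) (y' + d) (freeErr l) = z' l) →
        (∀ Y : Wire r k → ZMod 2, (∀ q, (∀ l, q ≠ freeErr l) → Y q = (E + d) q) →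
          (∀ l ∈ js, Y (freeErr l) = E (freeErr l) + z' l) →
          Toggle.run (substitute r j js) Y (freeErr j) = Y (freeErr j) + z j) →
        ∀ l ∈ j :: js, Toggle.run (solveProg r (j :: js)) (y + d) (freeErr l) = z l := by
      intro d hd h0 hIH hsub
      obtain ⟨d₁, h1, hd1⟩ := run_solveProg (r := r) hjs (y' + d)
      have hd1' := hd1
      rw [← hyd d hd, ← hEd d hd] at hd1
      obtain ⟨d₂, h2, hs2, hrun⟩ := run_solveProg_cons (y + d) hj h1 hd1
      rw [hEd d hd] at hs2
      have hd1l : ∀ l ∈ js, d₁ (freeErr l) = z' l := by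
        intro l hl
        have := hIH l hl
        rwa [hd1', Pi.add_apply, Pi.add_apply, h0 l hl, hcoin0 d hd _ (by simp), zero_add,
          zero_add] at this
      have hd1q : ∀ q, (∀ l, q ≠ freeErr l) → d₁ q = 0 := fun q hq => h1 q fun l _ => hq l
      have hd2 : d₂ (freeErr j) = z j := by
        have := hsub (E + d + d₁) (fun q hq => by rw [Pi.add_apply, hd1q q hq, add_zero])
          (fun l hl => by
            rw [Pi.add_apply, hd1l l hl, Pi.add_apply, hcoin0 d hd _ (by simp), add_zero])
        rw [hs2, Pi.add_apply] at this
        exact add_left_cancel this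
      intro l hl
      rw [hrun, Pi.add_apply, Pi.add_apply, Pi.add_apply, hy.err l hl, hcoin0 d hd _ (by simp),
        zero_add, zero_add]
      by_cases hlj : l = j
      · subst hlj
        rw [h1 _ (by
          intro l' hl' e
          simp only [anc.injEq, err.injEq, Sum.inr.injEq] at e
          exact hj (e ▸ hl')), hd2, zero_add]
      · have hl' : l ∈ js := by simpa [hlj] using hl
        rw [hd1l l hl', h2 _ (by simpa using hlj), add_zero, hz'l l hlj]
    -- With a pivot, coordinate `j` is determined by the other coordinates, so the exceptional set
    -- is inherited. Without a pivot, either the column is not selected and the coordinate is 0, or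
    -- it is free: then its coin is needed and the number of solutions doubles.
    by_cases hex : ∃ i : Fin r, IsPivot y j i
    · obtain ⟨t, ht, ht', ha, hm, hequiv⟩ :=
        run_eliminate_of_pivot hjs hj hy.piv (hy.succ j (by simp)) hex
      rw [← hE] at ha hm hequiv
      have hcol : y (colKey j) = 1 := hex.choose_spec.1
      have hy'eq : y' = Function.update (Function.update E (anc (used t)) 1) (rowKey t) 1 := by
        refine run_takeFirst ?_ ?_ ?_ ?_ ?_ ?_ ?_ ?_ ?_
        · intro a b h; simpa using h
        · intro a b h; simpa using h
        · simp
        · simp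
        · simp
        · intro i i'
          rw [ha, ha, if_neg (by simp), if_neg (by simp)]
          exact hy.order i i'
        · rw [ha, if_pos rfl]
        · rw [ha, if_neg (by simp), ht]
        · intro i hi
          rw [ha, if_neg (by simp), ht' i hi]
      have hyrow : ∀ i, y' (rowKey i) = if i = t then 1 else y (rowKey i) := by
        intro i
        rw [hy'eq]
        by_cases h : i = t
        · subst h; simp
        · rw [Function.update_of_ne (by simpa using h), Function.update_of_ne (by simp), ha,
            if_neg (by simp), if_neg h]
      have hyused : ∀ i, y' (anc (used i)) = if i = t then 1 else y (anc (used i)) := by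
        intro i
        rw [hy'eq, Function.update_of_ne (by simp)]
        by_cases h : i = t
        · subst h; simp
        · rw [Function.update_of_ne (by simpa using h), ha, if_neg (by simp), if_neg h]
      have hyother : ∀ q, (∀ i, q ≠ rowKey i) → (∀ i, q ≠ anc (used i)) → y' q = E q := by
        intro q h1 h2
        rw [hy'eq, Function.update_of_ne (h1 t), Function.update_of_ne (h2 t)]
      have hyres : ∀ u, synResidual y' u = synResidual E u := by
        intro u
        funext i
        simp only [synResidual]
        rw [hyother _ (by simp) (by simp)]
        congr 1
        refine Finset.sum_congr rfl fun l _ => ?_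
        rw [hyother _ (by simp) (by simp)]
      have h01 : (1 : ZMod 2) ≠ 0 := by decide
      have hready : SolveReady js y' := by
        refine ⟨fun i => ?_, fun i i' h1 h2 => ?_, fun l hl => ?_, fun l hl => ?_⟩
        · rw [hyother _ (by simp) (by simp), ha, if_neg (by simp), hy.piv]
        · rw [hyrow] at h2
          have hi' : i' ≠ t := by
            rintro rfl
            rw [if_pos rfl] at h2
            exact h01 h2
          rw [if_neg hi'] at h2
          rw [hyused] at h1
          split_ifs at h1 with h
          · subst h
            rcases lt_trichotomy i' i with h3 | h3 | h3
            · rw [ht' i' h3] at h2; exact absurd h2 h01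
            · exact absurd h3 hi'
            · exact h3
          · exact hy.order i i' h1 h2
        · rw [hyother _ (by simp) (by simp), ha, if_neg, hy.succ l (by simp [hl])]
          simp only [succ.injEq]
          rintro rfl
          exact hj hl
        · rw [hyother _ (by simp) (by simp), ha, if_neg (by simp), hy.err l (by simp [hl])]
      have hcol' : ∀ l, y' (colKey l) = y (colKey l) := by
        intro l
        rw [hyother _ (by simp) (by simp), ha, if_neg (by simp)]
      obtain ⟨hzt, hzi⟩ := (hequiv z' (z j) hz'js).1 fun i hi => by
        rw [← hres, hz'.2.2 i hi]
      have hz'mem : z' ∈ solutions js y' := by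
        refine mem_solutions.2 ⟨hz'js, fun l hl => ?_, fun i hi => ?_⟩
        · rw [hcol'] at hl
          by_cases h : l = j
          · rw [h, hz'j]
          · rw [hz'l l h, hz'.2.1 l hl]
        · rw [hyrow] at hi
          have hit : i ≠ t := by
            rintro rfl
            rw [if_pos rfl] at hi
            exact h01 hi
          rw [if_neg hit] at hi
          rw [hyres, hzi i hit hi]
      obtain ⟨F, hF1, hF2, hF3⟩ := ih hjs hready hz'mem
      refine ⟨F, hF1.trans ?_, fun l hl => by simp [hF2 l hl], fun d hd hF => ?_⟩
      -- Solutions of the reduced system extend by the value at `j` that the pivot equation `t`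
      -- forces.
      · refine Finset.card_le_card_of_injOn (fun u => Function.update u j (synResidual E u t)) ?_ ?_
        · intro u hu
          obtain ⟨hu1, hu2, hu3⟩ := mem_solutions.1 (Finset.mem_coe.1 hu)
          refine Finset.mem_coe.2 (mem_solutions.2 ⟨fun l hl => ?_, fun l hl => ?_, fun i hi => ?_⟩)
          · have hlj : l ≠ j := by rintro rfl; simp at hl
            simp only [Function.update_of_ne hlj]
            exact hu1 l fun h => hl (by simp [h])
          · have hlj : l ≠ j := by
              rintro rfl
              rw [hcol] at hl
              exact h01 hl
            simp only [Function.update_of_ne hlj]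
            exact hu2 l (by rw [hcol', hl])
          · simp only
            rw [synResidual_update y u j i (hu1 j hj)]
            refine (hequiv u _ hu1).2 ⟨rfl, fun i hi hi0 => ?_⟩ i hi
            rw [← hyres]
            exact hu3 i (by rw [hyrow, if_neg hi, hi0])
        · intro u hu u' hu' e
          have hu1 := (mem_solutions.1 (Finset.mem_coe.1 hu)).1 j hj
          have hu1' := (mem_solutions.1 (Finset.mem_coe.1 hu')).1 j hj
          funext l
          by_cases hlj : l = j
          · rw [hlj, hu1, hu1']
          · have := congrFun e l
            simpa [Function.update_of_ne hlj] using this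
      · refine final d hd hready.err ?_ ?_
        · refine hF3 d hd fun l hl => ?_
          have hlj : l ≠ j := fun h => hj (h ▸ hF2 l hl)
          rw [Pi.add_apply, hyother _ (by simp) (by simp), ha, if_neg (by simp), hz'l l hlj]
          exact hF l hl
        · intro Y hY1 hY2
          have hYa : ∀ a, (∀ l, a ≠ coin l) → (∀ x, a ≠ err x) → Y (anc a) = E (anc a) := by
            intro a h1 h2
            rw [hY1 _ (by intro l; simpa using h2 _), Pi.add_apply, hcoin0 d hd a h1, add_zero]
          rw [(run_substitute_self hj hjs Y).2 (by rw [hYa _ (by simp) (by simp), ha, if_pos rfl]) t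
            (by rw [hYa _ (by simp) (by simp), ha, if_neg (by simp), ht])
            (fun i hi => by rw [hYa _ (by simp) (by simp), ha, if_neg (by simp), ht' i hi])]
          congr 1
          rw [← hzt, synResidual, hY1 _ (by simp), Pi.add_apply, hd _ (by simp), add_zero]
          congr 1
          rw [← Finset.sum_subset (Finset.subset_univ js.toFinset)]
          · refine Finset.sum_congr rfl fun l hl => ?_
            have hl : l ∈ js := List.mem_toFinset.1 hl
            rw [hY1 _ (by simp), Pi.add_apply, hd _ (by simp), add_zero, hY2 l hl, ha,
              if_neg (by simp), hy.err l (by simp [hl]), zero_add]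
          · intro l _ hl
            rw [hz'js l (by simpa using hl), mul_zero]
    · have hno : ∀ i : Fin r, ¬ IsPivot y j i := fun i hi => hex ⟨i, hi⟩
      have hEy : E = y := run_eliminate_of_no_pivot hjs hy.piv (hy.succ j (by simp)) hno
      have hyy : y' = y := by
        rw [hy', hEy]
        exact run_takeFirst_of_zero (by simp) (by simp) (hy.succ j (by simp))
      have hready : SolveReady js y :=
        ⟨hy.piv, hy.order, fun l hl => hy.succ l (by simp [hl]), fun l hl => hy.err l (by simp [hl])⟩
      have hmul : ∀ c : ZMod 2, (y (colKey j) = 0 → c = 0) → ∀ i, y (rowKey i) = 0 →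
          y (mat i j) * c = 0 := by
        intro c hc i hi
        rcases ZMod.two_cases (y (colKey j)) with h | h
        · rw [hc h, mul_zero]
        · rcases ZMod.two_cases (y (mat i j)) with h' | h'
          · rw [h', zero_mul]
          · exact absurd ⟨h, hi, h'⟩ (hno i)
      have hz'mem : z' ∈ solutions js y := by
        refine mem_solutions.2 ⟨hz'js, fun l hl => ?_, fun i hi => ?_⟩
        · by_cases h : l = j
          · rw [h, hz'j]
          · rw [hz'l l h, hz'.2.1 l hl]
        · have := hz'.2.2 i hi
          rwa [hres, hmul _ (hz'.2.1 j) i hi, add_zero] at this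
      obtain ⟨F, hF1, hF2, hF3⟩ := ih hjs hready hz'mem
      have hupd : ∀ c : ZMod 2, (y (colKey j) = 0 → c = 0) → ∀ u ∈ solutions js y,
          Function.update u j c ∈ solutions (j :: js) y := by
        intro c hc u hu
        obtain ⟨hu1, hu2, hu3⟩ := mem_solutions.1 hu
        refine mem_solutions.2 ⟨fun l hl => ?_, fun l hl => ?_, fun i hi => ?_⟩
        · have hlj : l ≠ j := by rintro rfl; simp at hl
          rw [Function.update_of_ne hlj]
          exact hu1 l fun h => hl (by simp [h])
        · by_cases hlj : l = j
          · subst hlj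
            rw [Function.update_self, hc hl]
          · rw [Function.update_of_ne hlj, hu2 l hl]
        · rw [synResidual_update y u j i (hu1 j hj), hu3 i hi, hmul c hc i hi, add_zero]
      have hinj : ∀ u ∈ solutions js y, ∀ u' ∈ solutions js y, ∀ c c' : ZMod 2,
          Function.update u j c = Function.update u' j c' → c = c' ∧ u = u' := by
        intro u hu u' hu' c c' e
        refine ⟨by simpa using congrFun e j, ?_⟩
        funext l
        by_cases hlj : l = j
        · rw [hlj, (mem_solutions.1 hu).1 j hj, (mem_solutions.1 hu').1 j hj]
        · simpa [Function.update_of_ne hlj] using congrFun e l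
      have hIH : ∀ d, CoinOn d → (∀ l ∈ F, (y + d) (anc (coin l)) = z l) →
          ∀ l ∈ js, Toggle.run (solveProg r js) (y' + d) (freeErr l) = z' l := by
        intro d hd hF
        rw [hyy]
        refine hF3 d hd fun l hl => ?_
        rw [hz'l l fun h => hj (h ▸ hF2 l hl)]
        exact hF l hl
      have hsub : ∀ d : Wire r k → ZMod 2, CoinOn d →
          (if y (colKey j) = 1 ∧ (y + d) (anc (coin j)) = 1 then 1 else 0) = z j →
          ∀ Y : Wire r k → ZMod 2, (∀ q, (∀ l, q ≠ freeErr l) → Y q = (E + d) q) →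
            (∀ l ∈ js, Y (freeErr l) = E (freeErr l) + z' l) →
            Toggle.run (substitute r j js) Y (freeErr j) = Y (freeErr j) + z j := by
        intro d hd hval Y hY1 _
        rw [hEy] at hY1
        rw [(run_substitute_self hj hjs Y).1 (by
          rw [hY1 _ (by simp), Pi.add_apply, hcoin0 d hd _ (by simp), add_zero,
            hy.succ j (by simp)]), hY1 (colKey j) (by simp), hY1 (anc (coin j)) (by simp),
            Pi.add_apply y d (colKey j), hcoin0 d hd _ (by simp), add_zero, hval]
      rcases ZMod.two_cases (y (colKey j)) with hcol | hcol
      · refine ⟨F, hF1.trans ?_, fun l hl => by simp [hF2 l hl], fun d hd hF => ?_⟩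
        · refine Finset.card_le_card_of_injOn (fun u => Function.update u j 0) ?_ ?_
          · intro u hu
            exact Finset.mem_coe.2 (hupd 0 (fun _ => rfl) u (Finset.mem_coe.1 hu))
          · intro u hu u' hu' e
            exact (hinj u (Finset.mem_coe.1 hu) u' (Finset.mem_coe.1 hu') _ _ e).2
        · refine final d hd (hyy ▸ hready.err) (hIH d hd hF) (hsub d hd ?_)
          rw [hz'.2.1 j hcol, if_neg]
          rw [hcol]
          rintro ⟨h, -⟩
          exact absurd h (by decide)
      -- Both values at `j` extend every solution on `js`, which pays for the additional coin.
      · refine ⟨insert j F, ?_, ?_, fun d hd hF => ?_⟩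
        · rw [Finset.card_insert_of_notMem fun h => hj (hF2 j h), pow_succ]
          calc 2 ^ F.card * 2 ≤ (solutions js y).card * 2 := Nat.mul_le_mul_right _ hF1
            _ = (solutions js y ×ˢ (Finset.univ : Finset (ZMod 2))).card := by
                rw [Finset.card_product, Finset.card_univ, ZMod.card]
            _ ≤ _ := by
                refine Finset.card_le_card_of_injOn (fun u => Function.update u.1 j u.2) ?_ ?_
                · intro u hu
                  have := (Finset.mem_product.1 (Finset.mem_coe.1 hu)).1
                  exact Finset.mem_coe.2 (hupd u.2 (fun h => by
                    rw [hcol] at h; exact absurd h (by decide)) u.1 this)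
                · intro u hu u' hu' e
                  have h1 := (Finset.mem_product.1 (Finset.mem_coe.1 hu)).1
                  have h2 := (Finset.mem_product.1 (Finset.mem_coe.1 hu')).1
                  obtain ⟨h3, h4⟩ := hinj _ h1 _ h2 _ _ e
                  exact Prod.ext h4 h3
        · intro l hl
          rcases Finset.mem_insert.1 hl with rfl | hl
          · simp
          · simp [hF2 l hl]
        · refine final d hd (hyy ▸ hready.err)
            (hIH d hd fun l hl => hF l (Finset.mem_insert_of_mem hl)) (hsub d hd ?_)
          rw [hF j (Finset.mem_insert_self _ _), hcol]
          simp only [true_and]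
          exact ZMod.ite_eq_one_eq _

end Solve

/-! ### The complete classical program and its acceptance test. -/

section Decode

variable {r k : ℕ}

open Wire Anc

/-- All labels of unknowns. -/
def labels (r k : ℕ) : List (Fin r ⊕ Fin k) :=
  (List.finRange r).map Sum.inl ++ (List.finRange k).map Sum.inr

theorem mem_labels (x : Fin r ⊕ Fin k) : x ∈ labels r k := by
  cases x <;> simp [labels]

theorem nodup_labels : (labels r k).Nodup := by
  refine List.nodup_append.2 ⟨(List.nodup_finRange r).map Sum.inl_injective,
    (List.nodup_finRange k).map Sum.inr_injective, ?_⟩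
  intro a ha b hb
  obtain ⟨i, -, rfl⟩ := List.mem_map.1 ha
  obtain ⟨j, -, rfl⟩ := List.mem_map.1 hb
  simp

theorem length_labels : (labels r k).length = r + k := by simp [labels]

theorem toFinset_labels : (labels r k).toFinset = Finset.univ :=
  Finset.eq_univ_iff_forall.2 fun x => List.mem_toFinset.2 (mem_labels x)

/-- Compute the coordinates of the solution that belong to the identity block. -/
def completeErr (r k : ℕ) : List (Toggle (Wire r k)) :=
  (List.finRange r).flatMap fun i =>
    ⟨anc (err (Sum.inl i)), [(syn i, 1)]⟩ :: (List.finRange k).map fun l =>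
      ⟨anc (err (Sum.inl i)), [(mat i l, 1), (freeErr l, 1)]⟩

/-- Record the coordinates of the solution that do not belong to the selected set. -/
def markBad (r k : ℕ) : List (Toggle (Wire r k)) :=
  (labels r k).map fun x => ⟨anc (bad x), [(anc (err x), 1), (anc (key x), 0)]⟩

/-- Count the ones among the wires `src x`. -/
def countOnes (b : Bool) (src : Fin r ⊕ Fin k → Wire r k) (l : List (Fin r ⊕ Fin k)) :
    List (Toggle (Wire r k)) :=
  l.flatMap fun x => takeFirst (src x) (fun i => anc (cnt b i)) fun i => anc (cntUsed b i)

/-- The classical program of the decoder. -/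
def decodeProg (r k : ℕ) : List (Toggle (Wire r k)) :=
  solveProg r (List.finRange k) ++ completeErr r k ++ markBad r k ++
    countOnes false (fun x => anc (err x)) (labels r k) ++
    countOnes true (fun x => anc (key x)) (labels r k)

theorem run_completeErr (y : Wire r k → ZMod 2) :
    (∀ i, Toggle.run (completeErr r k) y (anc (err (Sum.inl i))) =
      y (anc (err (Sum.inl i))) + (y (syn i) + ∑ l, y (mat i l) * y (freeErr l))) ∧
    ∀ q, (∀ i, q ≠ anc (err (Sum.inl i))) → Toggle.run (completeErr r k) y q = y q := by
  constructor
  · intro i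
    rw [Toggle.run_parallel]
    · congr 1
      have hmul : ∀ a b : ZMod 2, (if a = 1 ∧ b = 1 then (1 : ZMod 2) else 0) = a * b := by decide
      rw [completeErr, List.map_flatMap, List.flatMap, List.sum_flatten, List.map_map,
        ← List.ofFn_eq_map, List.sum_ofFn, Finset.sum_eq_single i]
      · simp only [Function.comp_apply, List.map_cons, List.map_map, List.sum_cons]
        congr 1
        · simp [ZMod.ite_eq_one_eq]
        · rw [← List.ofFn_eq_map, List.sum_ofFn]
          refine Finset.sum_congr rfl fun l _ => ?_
          simp only [Function.comp_apply]
          rw [← hmul]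
          refine if_congr ⟨fun h => ⟨h.2 (_, _) (by simp), h.2 (_, _) (by simp)⟩, ?_⟩ rfl rfl
          rintro ⟨h1, h2⟩
          refine ⟨trivial, fun p hp => ?_⟩
          simp only [List.mem_cons, List.not_mem_nil, or_false] at hp
          rcases hp with rfl | rfl <;> assumption
      · intro i' _ hi'
        simp only [Function.comp_apply, List.map_cons, List.map_map, List.sum_cons]
        rw [if_neg (by simp [hi']), zero_add]
        refine List.sum_eq_zero fun a ha => ?_
        obtain ⟨l, -, rfl⟩ := List.mem_map.1 ha
        simp [hi']
      · simp
    · intro g hg g' hg' p hp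
      have h1 : ∃ i, g.target = anc (err (Sum.inl i)) := by
        obtain ⟨i, -, hg⟩ := List.mem_flatMap.1 hg
        rcases List.mem_cons.1 hg with rfl | hg
        · exact ⟨i, rfl⟩
        · obtain ⟨l, -, rfl⟩ := List.mem_map.1 hg
          exact ⟨i, rfl⟩
      obtain ⟨i, hi⟩ := h1
      rw [hi]
      obtain ⟨i', -, hg'⟩ := List.mem_flatMap.1 hg'
      rcases List.mem_cons.1 hg' with rfl | hg'
      · simp at hp; simp [hp]
      · obtain ⟨l, -, rfl⟩ := List.mem_map.1 hg'
        simp at hp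
        rcases hp with rfl | rfl <;> simp
  · intro q hq
    refine Toggle.run_of_target_ne (fun g hg => ?_) y
    obtain ⟨i, -, hg⟩ := List.mem_flatMap.1 hg
    rcases List.mem_cons.1 hg with rfl | hg
    · exact (hq i).symm
    · obtain ⟨l, -, rfl⟩ := List.mem_map.1 hg
      exact (hq i).symm

theorem run_markBad (y : Wire r k → ZMod 2) :
    (∀ x, Toggle.run (markBad r k) y (anc (bad x)) =
      y (anc (bad x)) + if y (anc (err x)) = 1 ∧ y (anc (key x)) = 0 then 1 else 0) ∧
    ∀ q, (∀ x, q ≠ anc (bad x)) → Toggle.run (markBad r k) y q = y q := by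
  constructor
  · intro x
    have := Toggle.run_parallel_map nodup_labels (g := fun x =>
      (⟨anc (bad x), [(anc (err x), 1), (anc (key x), 0)]⟩ : Toggle (Wire r k)))
      (by intro a _ a' _ p hp; simp at hp; rcases hp with rfl | rfl <;> simp)
      (by intro a _ a' _ e; simpa using e) y (mem_labels x)
    simpa [markBad] using this
  · intro q hq
    refine Toggle.run_of_target_ne (fun g hg => ?_) y
    obtain ⟨x, -, rfl⟩ := List.mem_map.1 hg
    exact (hq x).symm

/-- Every one among the sources takes the first free wire of the counter, so the counter is unary:
after `c` ones exactly its first `c` wires are set. A comparison with a fixed number is then a test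
against a fixed pattern. The starting value `c` serves the induction. -/
theorem run_countOnes (b : Bool) (src : Fin r ⊕ Fin k → Wire r k)
    (h1 : ∀ x i, src x ≠ anc (cnt b i)) (h2 : ∀ x i, src x ≠ anc (cntUsed b i))
    (l : List (Fin r ⊕ Fin k)) (c : ℕ) (hc : c + l.length ≤ r + k) (y : Wire r k → ZMod 2)
    (hy1 : ∀ i, y (anc (cnt b i)) = if i.val < c then 1 else 0)
    (hy2 : ∀ i, y (anc (cntUsed b i)) = if i.val < c then 1 else 0) :
    (∀ i, Toggle.run (countOnes b src l) y (anc (cntUsed b i)) =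
      if i.val < c + (l.filter fun x => y (src x) = 1).length then 1 else 0) ∧
    ∀ q, (∀ i, q ≠ anc (cnt b i)) → (∀ i, q ≠ anc (cntUsed b i)) →
      Toggle.run (countOnes b src l) y q = y q := by
  have h10 : (1 : ZMod 2) ≠ 0 := by decide
  induction l generalizing c y with
  | nil => exact ⟨by simpa [countOnes] using hy2, fun _ _ _ => rfl⟩
  | cons x l ih =>
    have e : countOnes b src (x :: l) = takeFirst (src x) (fun i => anc (cnt b i))
      (fun i => anc (cntUsed b i)) ++ countOnes b src l := rfl
    rw [List.length_cons] at hc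
    rcases ZMod.two_cases (y (src x)) with hx | hx
    · have hrun := run_takeFirst_of_zero (h1 x) (h2 x) hx
      rw [e, Toggle.run_append, hrun]
      have := ih c (by omega) y hy1 hy2
      rwa [List.filter_cons_of_neg (by simp [hx])]
    · have hcm : c < r + k := by omega
      have hrun : Toggle.run (takeFirst (src x) (fun i => anc (cnt b i))
          (fun i => anc (cntUsed b i))) y = Function.update (Function.update y
            (anc (cntUsed b ⟨c, hcm⟩)) 1) (anc (cnt b ⟨c, hcm⟩)) 1 := by
        refine run_takeFirst ?_ ?_ ?_ (h1 x) (h2 x) ?_ hx ?_ ?_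
        · intro i i' h; simpa using h
        · intro i i' h; simpa using h
        · simp
        · intro i i' hi hi'
          simp only [hy1, hy2] at hi hi'
          split_ifs at hi with h3
          split_ifs at hi' with h4
          · exact absurd hi' h10
          · exact Fin.lt_def.2 (by omega)
          · exact absurd hi.symm h10
        · rw [hy1, if_neg (lt_irrefl _)]
        · intro i hi
          rw [hy1, if_pos (Fin.lt_def.1 hi)]
      rw [e, Toggle.run_append, hrun]
      set y' := Function.update (Function.update y (anc (cntUsed b ⟨c, hcm⟩)) 1)
        (anc (cnt b ⟨c, hcm⟩)) 1 with hy'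
      have hother : ∀ q, (∀ i, q ≠ anc (cnt b i)) → (∀ i, q ≠ anc (cntUsed b i)) → y' q = y q := by
        intro q hq1 hq2
        rw [hy', Function.update_of_ne (hq1 _), Function.update_of_ne (hq2 _)]
      obtain ⟨ih1, ih2⟩ := ih (c + 1) (by omega) y' (by
        intro i
        by_cases hi : i = ⟨c, hcm⟩
        · subst hi; simp [hy']
        · have : i.val ≠ c := fun h => hi (Fin.ext h)
          rw [hy', Function.update_of_ne (by simpa using hi), Function.update_of_ne (by simp), hy1]
          refine if_congr ?_ rfl rfl
          omega) (by
        intro i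
        by_cases hi : i = ⟨c, hcm⟩
        · subst hi; simp [hy']
        · have : i.val ≠ c := fun h => hi (Fin.ext h)
          rw [hy', Function.update_of_ne (by simp), Function.update_of_ne (by simpa using hi), hy2]
          refine if_congr ?_ rfl rfl
          omega)
      refine ⟨fun i => ?_, fun q hq1 hq2 => by rw [ih2 q hq1 hq2, hother q hq1 hq2]⟩
      rw [ih1, List.filter_cons_of_pos (by simp [hx]), List.length_cons]
      have : (l.filter fun x => y' (src x) = 1) = l.filter fun x => y (src x) = 1 := by
        refine List.filter_congr fun x' _ => ?_
        rw [hother _ (h1 x') (h2 x')]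
      rw [this]
      refine if_congr ?_ rfl rfl
      omega

theorem length_filter_labels (P : Fin r ⊕ Fin k → Prop) [DecidablePred P] :
    ((labels r k).filter fun x => P x).length = (Finset.univ.filter P).card := by
  rw [← List.toFinset_card_of_nodup (nodup_labels.filter _)]
  congr 1
  ext x
  simp [mem_labels]

/-- The basis state with a given instance and given values of the search register. -/
def loadWires (A : Matrix (Fin r) (Fin k) (ZMod 2)) (s : Fin r → ZMod 2)
    (κ : Fin r ⊕ Fin k → ZMod 2) (Y : Fin k → ZMod 2) (dm : ZMod 2) : Wire r k → ZMod 2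
  | mat i j => A i j
  | syn i => s i
  | anc (key x) => κ x
  | anc (coin j) => Y j
  | anc dum => dm
  | anc _ => 0

/-- The vector that the program computes. -/
def outVec (y : Wire r k → ZMod 2) (x : Fin r ⊕ Fin k) : ZMod 2 :=
  Toggle.run (decodeProg r k) y (anc (err x))

/-- The values that the measured control wires must have in an accepted run for the weight `w`. -/
def acceptPattern (r k w : ℕ) : Wire r k → ZMod 2
  | anc dum => 1
  | anc (cntUsed false i) => if i.val < w then 1 else 0
  | anc (cntUsed true i) => if i.val < r then 1 else 0
  | _ => 0

/-- The control wires, apart from `dum`. -/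
def acceptWires (r k : ℕ) : Finset (Wire r k) :=
  (Finset.univ.image fun x => anc (bad x)) ∪
    Finset.univ.image fun p : Bool × Fin (r + k) => anc (cntUsed p.1 p.2)

/-- The final state is accepted. -/
def Accepted (w : ℕ) (y : Wire r k → ZMod 2) : Prop :=
  Toggle.run (decodeProg r k) y (anc dum) = acceptPattern r k w (anc dum) ∧
    ∀ q ∈ acceptWires r k, Toggle.run (decodeProg r k) y q = acceptPattern r k w q

instance (w : ℕ) (y : Wire r k → ZMod 2) : Decidable (Accepted w y) :=
  inferInstanceAs (Decidable (_ ∧ _))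

/-- `x` solves the systematic system `(I ∣ A) x = s`. -/
def SysSol (A : Matrix (Fin r) (Fin k) (ZMod 2)) (s : Fin r → ZMod 2)
    (x : Fin r ⊕ Fin k → ZMod 2) : Prop :=
  ∀ i, x (Sum.inl i) + ∑ j, A i j * x (Sum.inr j) = s i

instance (A : Matrix (Fin r) (Fin k) (ZMod 2)) (s : Fin r → ZMod 2)
    (x : Fin r ⊕ Fin k → ZMod 2) : Decidable (SysSol A s x) :=
  inferInstanceAs (Decidable (∀ _, _))

theorem ite_lt_eq_iff {m c w : ℕ} (hc : c ≤ m) (hw : w ≤ m) :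
    (∀ i : Fin m, (if i.val < c then (1 : ZMod 2) else 0) = if i.val < w then 1 else 0) ↔ c = w := by
  have h10 : (1 : ZMod 2) ≠ 0 := by decide
  constructor
  · intro h
    by_contra hne
    rcases lt_or_gt_of_ne hne with h1 | h1
    · have := h ⟨c, by omega⟩
      simp only [lt_irrefl, if_false] at this
      rw [if_pos h1] at this
      exact h10 this.symm
    · have := h ⟨w, by omega⟩
      simp only [lt_irrefl, if_false] at this
      rw [if_pos h1] at this
      exact h10 this
  · rintro rfl
    exact fun _ => rfl

/-- Each stage writes only wires that the earlier stages have left at zero. The identity coordinates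
are computed from the equations, so the output solves the system in any case; the test has to check
only the support, the weight and the size of the set. -/
theorem run_decodeProg {y : Wire r k → ZMod 2} (hbad : ∀ x, y (anc (bad x)) = 0)
    (hcnt : ∀ b i, y (anc (cnt b i)) = 0) (hused : ∀ b i, y (anc (cntUsed b i)) = 0)
    (herr : ∀ x, y (anc (err x)) = 0) :
    (∀ j, outVec y (Sum.inr j) = Toggle.run (solveProg r (List.finRange k)) y (freeErr j)) ∧
    (∀ i, outVec y (Sum.inl i) = y (syn i) + ∑ l, y (mat i l) * outVec y (Sum.inr l)) ∧
    (∀ w ≤ r + k, Accepted w y ↔ y (anc dum) = 1 ∧ (∀ x, outVec y x = 1 → y (anc (key x)) = 1) ∧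
      (Finset.univ.filter fun x => outVec y x = 1).card = w ∧
      (Finset.univ.filter fun x => y (anc (key x)) = 1).card = r) := by
  obtain ⟨d, hd, hrun⟩ := run_solveProg (r := r) (List.nodup_finRange k) y
  set y1 := Toggle.run (solveProg r (List.finRange k)) y with hy1
  have h1 : ∀ q, (∀ j, q ≠ freeErr j) → y1 q = y q := by
    intro q hq
    rw [hrun, Pi.add_apply, hd q fun l _ => hq l, add_zero]
  set y2 := Toggle.run (completeErr r k) y1 with hy2
  obtain ⟨h2i, h2q⟩ := run_completeErr y1
  set y3 := Toggle.run (markBad r k) y2 with hy3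
  obtain ⟨h3i, h3q⟩ := run_markBad y2
  have h2 : ∀ q, (∀ x, q ≠ anc (err x)) → y2 q = y q := fun q hq => by
    rw [hy2, h2q q fun i => hq _, h1 q fun j => hq _]
  have h3 : ∀ q, (∀ x, q ≠ anc (err x)) → (∀ x, q ≠ anc (bad x)) → y3 q = y q := fun q hq hq' => by
    rw [hy3, h3q q hq', h2 q hq]
  obtain ⟨h4i, h4q⟩ := run_countOnes false (fun x => anc (err x)) (by simp) (by simp)
    (labels r k) 0 (by rw [length_labels, zero_add]) y3
    (fun i => by rw [h3 _ (by simp) (by simp), hcnt]; simp)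
    (fun i => by rw [h3 _ (by simp) (by simp), hused]; simp)
  set y4 := Toggle.run (countOnes false (fun x => anc (err x)) (labels r k)) y3 with hy4
  obtain ⟨h5i, h5q⟩ := run_countOnes true (fun x => anc (key x)) (by simp) (by simp)
    (labels r k) 0 (by rw [length_labels, zero_add]) y4
    (fun i => by rw [h4q _ (by simp) (by simp), h3 _ (by simp) (by simp), hcnt]; simp)
    (fun i => by rw [h4q _ (by simp) (by simp), h3 _ (by simp) (by simp), hused]; simp)
  have hall : Toggle.run (decodeProg r k) y =
      Toggle.run (countOnes true (fun x => anc (key x)) (labels r k)) y4 := by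
    rw [decodeProg, Toggle.run_append, Toggle.run_append _ (countOnes false _ _),
      Toggle.run_append _ (markBad r k), Toggle.run_append _ (completeErr r k)]
  have hout : ∀ x, outVec y x = y2 (anc (err x)) := by
    intro x
    rw [outVec, hall, h5q _ (by simp) (by simp), h4q _ (by simp) (by simp), hy3, h3q _ (by simp)]
  have houtr : ∀ j, outVec y (Sum.inr j) = y1 (freeErr j) := by
    intro j
    rw [hout, hy2, h2q _ (by simp)]
  refine ⟨houtr, fun i => ?_, fun w hw => ?_⟩
  · rw [hout, hy2, h2i, h1 _ (by simp), herr, zero_add, h1 _ (by simp)]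
    congr 1
    refine Finset.sum_congr rfl fun l _ => ?_
    rw [h1 _ (by simp), houtr]
  · have hdum : Toggle.run (decodeProg r k) y (anc dum) = y (anc dum) := by
      rw [hall, h5q _ (by simp) (by simp), h4q _ (by simp) (by simp), h3 _ (by simp) (by simp)]
    have hkey : ∀ x, y2 (anc (key x)) = y (anc (key x)) := fun x => h2 _ (by simp)
    have hb : ∀ x, Toggle.run (decodeProg r k) y (anc (bad x)) =
        if outVec y x = 1 ∧ y (anc (key x)) = 0 then 1 else 0 := by
      intro x
      rw [hall, h5q _ (by simp) (by simp), h4q _ (by simp) (by simp), hy3, h3i, h2 _ (by simp),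
        hbad, zero_add, hkey, hout]
    have hf : ∀ i, Toggle.run (decodeProg r k) y (anc (cntUsed false i)) =
        if i.val < (Finset.univ.filter fun x => outVec y x = 1).card then 1 else 0 := by
      intro i
      rw [hall, h5q _ (by simp) (by simp), h4i, zero_add, length_filter_labels]
      have : ∀ x, y3 (anc (err x)) = outVec y x := fun x => by
        rw [hy3, h3q _ (by simp), hout]
      simp only [this]
    have ht : ∀ i, Toggle.run (decodeProg r k) y (anc (cntUsed true i)) =
        if i.val < (Finset.univ.filter fun x => y (anc (key x)) = 1).card then 1 else 0 := by
      intro i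
      rw [hall, h5i, zero_add, length_filter_labels]
      have : ∀ x, y4 (anc (key x)) = y (anc (key x)) := fun x => by
        rw [h4q _ (by simp) (by simp), h3 _ (by simp) (by simp)]
      simp only [this]
    have hcard : ∀ P : Fin r ⊕ Fin k → Prop, ∀ [DecidablePred P],
        (Finset.univ.filter P).card ≤ r + k := by
      intro P _
      refine (Finset.card_le_univ _).trans ?_
      simp
    unfold Accepted
    rw [hdum]
    refine and_congr Iff.rfl ?_
    have hsplit : (∀ q ∈ acceptWires r k, Toggle.run (decodeProg r k) y q = acceptPattern r k w q) ↔
        (∀ x, Toggle.run (decodeProg r k) y (anc (bad x)) = 0) ∧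
        (∀ i, Toggle.run (decodeProg r k) y (anc (cntUsed false i)) = if i.val < w then 1 else 0) ∧
        (∀ i, Toggle.run (decodeProg r k) y (anc (cntUsed true i)) = if i.val < r then 1 else 0) := by
      simp only [acceptWires, Finset.mem_union, Finset.mem_image, Finset.mem_univ, true_and]
      constructor
      · intro h
        exact ⟨fun x => h _ (Or.inl ⟨x, rfl⟩), fun i => h _ (Or.inr ⟨(false, i), rfl⟩),
          fun i => h _ (Or.inr ⟨(true, i), rfl⟩)⟩
      · rintro ⟨ha, hb, hc⟩ q (⟨x, rfl⟩ | ⟨⟨b, i⟩, rfl⟩)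
        · exact ha x
        · cases b
          · exact hb i
          · exact hc i
    rw [hsplit]
    simp only [hb, hf, ht]
    rw [ite_lt_eq_iff (hcard _) hw, ite_lt_eq_iff (hcard _) (by omega)]
    refine and_congr ?_ Iff.rfl
    refine forall_congr' fun x => ?_
    rcases ZMod.two_cases (y (anc (key x))) with h | h <;> simp [h]

end Decode

/-! ### Relabelling of qubits. -/

section Transport

variable {Q Q' : Type} [Fintype Q] [DecidableEq Q] [Fintype Q'] [DecidableEq Q']

/-- Relabel the qubits of a gate. -/
def QGate.relabel (e : Q ≃ Q') (g : QGate Q) : QGate Q' where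
  target := e g.target
  controls := g.controls.map e.toEmbedding
  pattern := fun q => g.pattern (e.symm q)
  target_notMem := by simpa using g.target_notMem
  op := g.op

theorem QGate.relabel_apply (e : Q ≃ Q') (g : QGate Q) (ψ : QState Q) :
    (g.relabel e).apply (fun y => ψ (y ∘ e)) = fun y => g.apply ψ (y ∘ e) := by
  funext y
  have h : ∀ a, (Function.update y (e g.target) a) ∘ e = Function.update (y ∘ e) g.target a := by
    intro a
    funext q
    by_cases hq : q = g.target
    · subst hq; simp
    · rw [Function.update_of_ne hq, Function.comp_apply, Function.update_of_ne (by simpa using hq),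
        Function.comp_apply]
  have hc : (∀ q : Q', e.symm q ∈ g.controls → y q = g.pattern (e.symm q)) ↔
      ∀ q ∈ g.controls, y (e q) = g.pattern q :=
    ⟨fun h q hq => by simpa using h (e q) (by simpa using hq),
      fun h q hq => by simpa using h (e.symm q) hq⟩
  simp [QGate.apply, QGate.relabel, h, hc]

/-- Relabel the qubits of a circuit. -/
def QCircuit.relabel (e : Q ≃ Q') (c : QCircuit Q) : QCircuit Q' := c.map (QGate.relabel e)

theorem QCircuit.relabel_apply (e : Q ≃ Q') (c : QCircuit Q) (ψ : QState Q) :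
    QCircuit.apply (c.relabel e) (fun y => ψ (y ∘ e)) = fun y => QCircuit.apply c ψ (y ∘ e) := by
  induction c generalizing ψ with
  | nil => rfl
  | cons g c ih =>
    rw [QCircuit.apply_cons, ← ih, QCircuit.relabel, List.map_cons, QCircuit.apply_cons,
      QGate.relabel_apply]
    rfl

theorem QCircuit.relabel_measure (e : Q ≃ Q') (c : QCircuit Q) (x y : Q → ZMod 2) :
    QCircuit.measure (c.relabel e) (x ∘ e.symm) (y ∘ e.symm) = QCircuit.measure c x y := by
  have h : basisState (x ∘ e.symm) = fun y : Q' → ZMod 2 => basisState x (y ∘ e) := by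
    funext z
    have : z = x ∘ e.symm ↔ z ∘ e = x := by
      constructor
      · rintro rfl; funext q; simp
      · rintro rfl; funext q; simp
    simp [basisState, this]
  unfold QCircuit.measure
  rw [PMF.ofFintype_apply, PMF.ofFintype_apply, h, QCircuit.relabel_apply]
  have : (y ∘ e.symm) ∘ e = y := by funext q; simp
  simp only [this]

theorem QCircuit.length_relabel (e : Q ≃ Q') (c : QCircuit Q) :
    (c.relabel e).length = c.length := List.length_map _

end Transport

/-! ### Length of the programs and number of qubits. -/

section Size

variable {r k : ℕ}

open Wire Anc

theorem length_rowAdds (ops : List (List (Wire r k × ZMod 2) × Fin r × Fin r))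
    (js : List (Fin k)) : (rowAdds ops js).length = ops.length * (js.length + 1) := by
  rw [rowAdds, List.length_flatMap, List.map_congr_left (g := fun _ => js.length + 1)
    (fun o _ => by simp [rowAdd])]
  simp

theorem length_fetchOps_le : (fetchOps r k).length ≤ r * r := by
  rw [fetchOps, List.length_map]
  exact (List.length_filter_le _ _).trans ((List.length_product _ _).le.trans (by simp))

theorem length_clearOps_le : (clearOps r k).length ≤ r * r := by
  rw [clearOps, List.length_map]
  exact (List.length_filter_le _ _).trans ((List.length_product _ _).le.trans (by simp))

theorem length_takeFirst {Q : Type} {s : ℕ} (b : Q) (α υ : Fin s → Q) :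
    (takeFirst b α υ).length = 2 * s := by
  simp [takeFirst, two_mul]

/-- A column costs two eliminations, each with two families of at most `r²` row additions, two runs
of `consume`, and a substitution. The constant 22 is crude and absorbs the lower-order terms. -/
theorem length_solveProg_le (js : List (Fin k)) :
    (solveProg r js).length ≤ js.length * (22 * (r + js.length + 1) ^ 3) := by
  induction js with
  | nil => simp [solveProg]
  | cons j js ih =>
    have h1 : (eliminate (r := r) j js).length ≤ 2 * r + 2 + 2 * (r * r * (js.length + 1)) := by
      have ha := Nat.mul_le_mul_right (js.length + 1) (length_fetchOps_le (r := r) (k := k))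
      have hb := Nat.mul_le_mul_right (js.length + 1) (length_clearOps_le (r := r) (k := k))
      simp only [eliminate, List.length_append, markPivots, recordSuccess, List.length_map,
        List.length_finRange, length_rowAdds, List.length_cons, List.length_nil]
      omega
    have h2 : (consume r j).length = 2 * r := length_takeFirst _ _ _
    have h3 : (substitute r j js).length = 1 + r * (js.length + 1) := by
      rw [substitute, List.length_cons, List.length_flatMap, List.map_congr_left
        (g := fun _ => js.length + 1) (fun o _ => by simp)]
      simp
      ring
    simp only [solveProg, List.length_append, List.length_reverse, List.length_cons]
    have hM : ∀ c : ℕ, js.length = c → (solveProg r js).length + (8 * r + 5 + 4 * (r * r * (c + 1)) +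
        r * (c + 1)) ≤ (c + 1) * (22 * (r + (c + 1) + 1) ^ 3) := by
      rintro c rfl
      have h4 : (r + js.length + 1) ^ 3 ≤ (r + (js.length + 1) + 1) ^ 3 :=
        Nat.pow_le_pow_left (by omega) 3
      have h5 : js.length * (22 * (r + js.length + 1) ^ 3) ≤
          js.length * (22 * (r + (js.length + 1) + 1) ^ 3) :=
        Nat.mul_le_mul_left _ (Nat.mul_le_mul_left _ h4)
      have h6 : 8 * r + 5 + 4 * (r * r * (js.length + 1)) + r * (js.length + 1) ≤
          22 * (r + (js.length + 1) + 1) ^ 3 := by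
        generalize hc : js.length + 1 = c
        have e : 22 * (r + c + 1) ^ 3 = 8 * r + 5 + 4 * (r * r * c) + r * c + (22 * r ^ 3 +
            22 * c ^ 3 + 17 + 62 * (r * r * c) + 66 * (r * c * c) + 131 * (r * c) + 66 * r ^ 2 +
            66 * c ^ 2 + 58 * r + 66 * c) := by ring
        omega
      rw [add_mul, one_mul]
      omega
    have := hM _ rfl
    omega

theorem length_decodeProg_le : (decodeProg r k).length ≤ 28 * (r + k + 1) ^ 4 := by
  have h1 := length_solveProg_le (r := r) (List.finRange k)
  rw [List.length_finRange] at h1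
  have h2 : (completeErr r k).length = r * (k + 1) := by
    rw [completeErr, List.length_flatMap, List.map_congr_left (g := fun _ => k + 1)
      (fun o _ => by simp)]
    simp
  have h3 : ∀ (b : Bool) (src : Fin r ⊕ Fin k → Wire r k),
      (countOnes b src (labels r k)).length = (r + k) * (2 * (r + k)) := by
    intro b src
    rw [countOnes, List.length_flatMap, List.map_congr_left (g := fun _ => 2 * (r + k))
      (fun o _ => length_takeFirst _ _ _)]
    simp [length_labels]
  simp only [decodeProg, List.length_append, h2, h3, markBad, List.length_map, length_labels]
  have h5 : k * (22 * (r + k + 1) ^ 3) ≤ 22 * (r + k + 1) ^ 4 := by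
    rw [pow_succ (r + k + 1) 3]
    nlinarith [Nat.mul_le_mul_left (22 * (r + k + 1) ^ 3) (show k ≤ r + k + 1 by omega)]
  have h6 : r * (k + 1) + (r + k) + (r + k) * (2 * (r + k)) + (r + k) * (2 * (r + k)) ≤
      6 * (r + k + 1) ^ 2 := by
    have e : 6 * (r + k + 1) ^ 2 = r * (k + 1) + (r + k) + (r + k) * (2 * (r + k)) +
      (r + k) * (2 * (r + k)) + (2 * r ^ 2 + 2 * k ^ 2 + 3 * (r * k) + 10 * r + 11 * k + 6) := by ring
    omega
  have h7 : (r + k + 1) ^ 2 ≤ (r + k + 1) ^ 4 := Nat.pow_le_pow_right (by omega) (by omega)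
  omega

/-- The ancillas as a sum type. -/
def ancCode : Anc r k → (Fin r ⊕ Fin k) × Fin 3 ⊕ (Fin k × Fin 2 ⊕ (Unit ⊕ (Fin r × Fin 2 ⊕
    Bool × Fin (r + k) × Fin 2)))
  | key x => Sum.inl (x, 0)
  | err x => Sum.inl (x, 1)
  | bad x => Sum.inl (x, 2)
  | coin j => Sum.inr (Sum.inl (j, 0))
  | succ j => Sum.inr (Sum.inl (j, 1))
  | dum => Sum.inr (Sum.inr (Sum.inl ()))
  | used i => Sum.inr (Sum.inr (Sum.inr (Sum.inl (i, 0))))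
  | piv i => Sum.inr (Sum.inr (Sum.inr (Sum.inl (i, 1))))
  | cnt b i => Sum.inr (Sum.inr (Sum.inr (Sum.inr (b, i, 0))))
  | cntUsed b i => Sum.inr (Sum.inr (Sum.inr (Sum.inr (b, i, 1))))

/-- Linear, because the elimination takes place in the matrix register. Keys, errors, bad marks and
the two counters with their logs give `7(r + k)`; the wires attached to columns and to rows give
`2k` and `2r`. -/
theorem card_anc_le : Fintype.card (Anc r k) ≤ 9 * (r + k) + 1 := by
  refine (Fintype.card_le_of_injective ancCode ?_).trans ?_
  · intro a b h
    cases a <;> cases b <;> simp_all [ancCode]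
  · simp
    omega

/-- The wires are the qubits of a register. -/
noncomputable def wireEquiv (r k : ℕ) : Wire r k ≃ QReg r k (Fintype.card (Anc r k)) where
  toFun
    | mat i j => Sum.inl (i, j)
    | syn i => Sum.inr (Sum.inl i)
    | anc a => Sum.inr (Sum.inr (Fintype.equivFin _ a))
  invFun
    | Sum.inl p => mat p.1 p.2
    | Sum.inr (Sum.inl i) => syn i
    | Sum.inr (Sum.inr a) => anc ((Fintype.equivFin _).symm a)
  left_inv := by rintro (_ | _ | _) <;> simp
  right_inv := by rintro (_ | _ | _) <;> simp

theorem loadInstance_eq (A : Matrix (Fin r) (Fin k) (ZMod 2)) (s : Fin r → ZMod 2) :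
    loadInstance _ A s = loadWires A s 0 0 0 ∘ (wireEquiv r k).symm := by
  funext q
  rcases q with p | i | a
  · rfl
  · rfl
  · simp only [loadInstance, Sum.elim_inr, Function.comp_apply, wireEquiv, Equiv.coe_fn_symm_mk]
    cases (Fintype.equivFin (Anc r k)).symm a <;> rfl

theorem card_qreg_le : Fintype.card (QReg r k (Fintype.card (Anc r k))) ≤
    11 * (r + k + 1) ^ 2 := by
  have := card_anc_le (r := r) (k := k)
  simp only [Fintype.card_sum, Fintype.card_prod, Fintype.card_fin]
  have e : 11 * (r + k + 1) ^ 2 = r * k + (r + (9 * (r + k) + 1)) + (11 * r ^ 2 + 11 * k ^ 2 +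
    21 * (r * k) + 12 * r + 13 * k + 10) := by ring
  omega

end Size

/-! ### The quantum decoder and its worst-case time. -/

section Decoder

variable {r k : ℕ}

open Wire Anc

/-- The wires of the search register. -/
def searchWires (r k : ℕ) : List (Wire r k) :=
  (labels r k).map (fun x => anc (key x)) ++ ((List.finRange k).map (fun j => anc (coin j)) ++
    [anc dum])

/-- The probabilities with which the wires of the search register are set. -/
noncomputable def searchProb (r k : ℕ) : Wire r k → ℝ
  | anc (key _) => (r : ℝ) / (r + k : ℕ)
  | _ => 1 / 2

theorem searchProb_mem (q : Wire r k) : searchProb r k q ∈ Set.Icc (0 : ℝ) 1 := by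
  have h : (r : ℝ) / (r + k : ℕ) ∈ Set.Icc (0 : ℝ) 1 :=
    ⟨by positivity, div_le_one_of_le₀ (by exact_mod_cast Nat.le_add_right r k) (by positivity)⟩
  have h' : (1 / 2 : ℝ) ∈ Set.Icc (0 : ℝ) 1 := by norm_num
  rcases q with _ | _ | a
  · exact h'
  · exact h'
  · cases a
    · exact h
    all_goals exact h'

theorem nodup_searchWires : (searchWires r k).Nodup := by
  refine List.nodup_append.2 ⟨nodup_labels.map fun a b h => by simpa using h,
    List.nodup_append.2 ⟨(List.nodup_finRange k).map fun a b h => by simpa using h,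
      List.nodup_singleton _, ?_⟩, ?_⟩
  · intro a ha b hb
    obtain ⟨x, -, rfl⟩ := List.mem_map.1 ha
    rw [List.mem_singleton.1 hb]
    simp
  · intro a ha b hb
    obtain ⟨x, -, rfl⟩ := List.mem_map.1 ha
    rcases List.mem_append.1 hb with hb | hb
    · obtain ⟨x, -, rfl⟩ := List.mem_map.1 hb
      simp
    · rw [List.mem_singleton.1 hb]
      simp

/-- The number of seeds of the decoder. -/
noncomputable def searchRounds (r k w : ℕ) : ℕ :=
  -- The quotient of the binomial coefficients is the inverse probability that a random `r`-set
  -- contains a given support of size `w`; the factor `max 1 S` accounts for the expected number of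
  -- solutions. The square root is the quantum speed-up.
  max 1 ⌈√(((r + k).choose w : ℝ) / ((r.choose w : ℝ) * max 1 (expectedSolutions (r + k) r w)))⌉₊

theorem one_le_searchRounds (w : ℕ) : 1 ≤ searchRounds r k w := le_max_left _ _

/-- The quantum decoder. -/
noncomputable def decoder (r k w : ℕ) : QDecoder r k where
  ancillas := Fintype.card (Anc r k)
  seeds := searchRounds r k w - 1
  circuit := fun j => (amplify (searchProb r k) searchProb_mem (searchWires r k) (anc dum)
    (decodeProg r k) (anc dum) (acceptWires r k) (acceptPattern r k w) j).relabel (wireEquiv r k)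
  out := fun x => wireEquiv r k (anc (err x))

theorem decoder_ancillas_le (w : ℕ) : (decoder r k w).ancillas ≤ 9 * (r + k) + 1 := card_anc_le

/-- With `m = r + k + 1` and `J` seeds, a circuit has at most `62 J m⁴` gates on at most `11 m²`
qubits, and `62 · 11 = 682`. The slack up to 700 covers the seed bits and the initialization. -/
theorem timeLE_decoder_call (w : ℕ) (A : Matrix (Fin r) (Fin k) (ZMod 2)) (s : Fin r → ZMod 2) :
    Timed.TimeLE ((decoder r k w).call A s) (700 * (r + k + 1) ^ 6 * searchRounds r k w) := by
  have key : ∀ j : Fin ((decoder r k w).seeds + 1),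
      Nat.size (decoder r k w).seeds + Fintype.card (QReg r k (decoder r k w).ancillas) +
      QCircuit.cost ((decoder r k w).circuit j) ≤ 700 * (r + k + 1) ^ 6 * searchRounds r k w := by
    intro j
    have hJ := one_le_searchRounds (r := r) (k := k) w
    have hs : (decoder r k w).seeds = searchRounds r k w - 1 := rfl
    have hj : j.val + 1 ≤ searchRounds r k w := by have := j.2; omega
    have h1 : Nat.size (decoder r k w).seeds ≤ searchRounds r k w := by
      rw [Nat.size_le, hs]
      exact lt_of_le_of_lt (Nat.sub_le _ _) Nat.lt_two_pow_self
    have h2 : Fintype.card (QReg r k (decoder r k w).ancillas) ≤ 11 * (r + k + 1) ^ 2 :=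
      card_qreg_le
    have h3 : ((decoder r k w).circuit j).length ≤ (j.val + 1) * (62 * (r + k + 1) ^ 4) := by
      change (QCircuit.relabel _ _).length ≤ _
      rw [QCircuit.length_relabel]
      refine (length_amplify_le _ _ _ _ _ _).trans (Nat.mul_le_mul_left _ ?_)
      have h4 := length_decodeProg_le (r := r) (k := k)
      have h5 : (searchWires r k).length = r + k + (k + 1) := by
        simp [searchWires, length_labels]
      rw [h5]
      have h6 : r + k + 1 ≤ (r + k + 1) ^ 4 := Nat.le_self_pow (by norm_num) _
      omega
    have h4 : QCircuit.cost ((decoder r k w).circuit j) ≤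
        (searchRounds r k w * (62 * (r + k + 1) ^ 4)) * (11 * (r + k + 1) ^ 2) :=
      (QCircuit.cost_le _).trans (Nat.mul_le_mul
        (h3.trans (Nat.mul_le_mul_right _ hj)) h2)
    have h5 : (searchRounds r k w * (62 * (r + k + 1) ^ 4)) * (11 * (r + k + 1) ^ 2) =
        682 * (r + k + 1) ^ 6 * searchRounds r k w := by ring
    have h6 : (r + k + 1) ^ 2 ≤ (r + k + 1) ^ 6 * searchRounds r k w :=
      (Nat.pow_le_pow_right (by omega) (by omega)).trans (Nat.le_mul_of_pos_right _ hJ)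
    have h7 : searchRounds r k w ≤ (r + k + 1) ^ 6 * searchRounds r k w :=
      Nat.le_mul_of_pos_left _ (by positivity)
    rw [h5] at h4
    rw [mul_assoc] at h4 ⊢
    omega
  unfold QDecoder.call
  rw [← zero_add (700 * (r + k + 1) ^ 6 * searchRounds r k w)]
  refine (Timed.timeLE_sample _).bind fun j => ?_
  rw [← zero_add (700 * (r + k + 1) ^ 6 * searchRounds r k w)]
  refine (Timed.timeLE_sample _).bind fun y => ?_
  rw [← add_zero (700 * (r + k + 1) ^ 6 * searchRounds r k w)]
  exact ((Timed.timeLE_tick _).mono (key j)).bind fun _ => Timed.timeLE_pure _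

end Decoder

/-! ### The mode of the binomial distribution. -/

section Binomial

/-- The weights of the binomial distribution with parameter `r / (r + k)` are largest at `r`. -/
theorem choose_mul_pow_le (r k i : ℕ) (hi : i ≤ r + k) :
    (r + k).choose i * r ^ i * k ^ (r + k - i) ≤ (r + k).choose r * r ^ r * k ^ k := by
  set t : ℕ → ℕ := fun i => (r + k).choose i * r ^ i * k ^ (r + k - i) with ht
  -- The ratio of consecutive weights: they increase up to `i = r` and do not increase afterwards.
  have hrec : ∀ i < r + k, (i + 1) * k * t (i + 1) = (r + k - i) * r * t i := by
    intro i hi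
    have h1 := Nat.choose_succ_right_eq (r + k) i
    have h2 : r + k - i = (r + k - (i + 1)) + 1 := by omega
    calc (i + 1) * k * t (i + 1)
        = ((r + k).choose (i + 1) * (i + 1)) * r ^ (i + 1) * k ^ (r + k - (i + 1) + 1) := by
          simp only [ht]; ring
      _ = (r + k - i) * r * t i := by rw [h1, ← h2]; simp only [ht]; ring
  have hup : ∀ j ≤ r, t (r - j) ≤ t r := by
    intro j
    induction j with
    | zero => simp
    | succ j ih =>
      intro hj
      refine le_trans ?_ (ih (by omega))
      have e : r - j = r - (j + 1) + 1 := by omega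
      rw [e]
      generalize hi' : r - (j + 1) = i
      have hir : i < r := by omega
      rcases Nat.eq_zero_or_pos k with rfl | hk
      · have : t i = 0 := by
          simp only [ht]
          rw [zero_pow (by omega), mul_zero]
        omega
      · have h3 : (i + 1) * k ≤ (r + k - i) * r := by
          obtain ⟨c, rfl⟩ := Nat.exists_eq_add_of_lt hir
          rw [show i + c + 1 + k - i = c + 1 + k by omega]
          nlinarith
        have h4 : (i + 1) * k * t i ≤ (i + 1) * k * t (i + 1) := by
          rw [hrec i (by omega)]
          exact Nat.mul_le_mul_right _ h3
        exact Nat.le_of_mul_le_mul_left h4 (by positivity)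
  have hdown : ∀ j ≤ k, t (r + j) ≤ t r := by
    intro j
    induction j with
    | zero => simp
    | succ j ih =>
      intro hj
      refine le_trans ?_ (ih (by omega))
      have h3 : (r + k - (r + j)) * r ≤ (r + j + 1) * k := by
        rw [Nat.add_sub_add_left]
        calc (k - j) * r ≤ k * (r + j + 1) := Nat.mul_le_mul (Nat.sub_le _ _) (by omega)
          _ = _ := mul_comm _ _
      have h4 : (r + j + 1) * k * t (r + j + 1) ≤ (r + j + 1) * k * t (r + j) := by
        rw [hrec (r + j) (by omega)]
        exact Nat.mul_le_mul_right _ h3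
      exact Nat.le_of_mul_le_mul_left h4 (by have : 0 < k := by omega
                                             positivity)
  have hr : t r = (r + k).choose r * r ^ r * k ^ k := by
    simp only [ht]
    rw [Nat.add_sub_cancel_left]
  rw [← hr]
  rcases le_total i r with h | h
  · have := hup (r - i) (by omega)
    rwa [show r - (r - i) = i by omega] at this
  · have := hdown (i - r) (by omega)
    rwa [show r + (i - r) = i by omega] at this

/-- The probability that a random set in which every element is put with probability
`r / (r + k)` is a given set of size `r`. -/
noncomputable def modeProb (r k : ℕ) : ℝ :=
  ((r : ℝ) / (r + k : ℕ)) ^ r * (1 - (r : ℝ) / (r + k : ℕ)) ^ k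

/-- The `r + k + 1` binomial weights sum to 1 and the one at `r` is the largest. Independent choices
thus imitate a uniformly random `r`-set at the cost of a linear factor. -/
theorem modeProb_bounds (r k : ℕ) : 1 ≤ ((r + k : ℕ) + 1) * (((r + k).choose r : ℝ) * modeProb r k) ∧
    ((r + k).choose r : ℝ) * modeProb r k ≤ 1 ∧ 0 ≤ modeProb r k := by
  set ρ : ℝ := (r : ℝ) / (r + k : ℕ) with hρ
  have hρ0 : 0 ≤ ρ := by positivity
  have hρ1 : 0 ≤ 1 - ρ := sub_nonneg.2
    (div_le_one_of_le₀ (by exact_mod_cast Nat.le_add_right r k) (by positivity))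
  have hsum : ∑ i ∈ Finset.range (r + k + 1),
      ρ ^ i * (1 - ρ) ^ (r + k - i) * ((r + k).choose i : ℝ) = 1 := by
    rw [← add_pow, add_sub_cancel, one_pow]
  have hmode : ((r + k).choose r : ℝ) * modeProb r k =
      ρ ^ r * (1 - ρ) ^ (r + k - r) * ((r + k).choose r : ℝ) := by
    rw [modeProb, Nat.add_sub_cancel_left, ← hρ]
    ring
  refine ⟨?_, ?_, mul_nonneg (pow_nonneg hρ0 _) (pow_nonneg hρ1 _)⟩
  · refine hsum.ge.trans ?_
    refine (Finset.sum_le_card_nsmul _ _ (((r + k).choose r : ℝ) * modeProb r k) ?_).trans_eq ?_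
    · intro i hi
      have hi : i ≤ r + k := by simpa [Nat.lt_succ_iff] using hi
      rcases Nat.eq_zero_or_pos (r + k) with h0 | h0
      · have hr0 : r = 0 := by omega
        have hi0 : i = 0 := by omega
        rw [hmode, hi0, hr0]
      · have hm : (0 : ℝ) < (r + k : ℕ) := by exact_mod_cast h0
        have hρ' : 1 - ρ = k / (r + k : ℕ) := by
          rw [hρ]; field_simp; push_cast; ring
        have h := choose_mul_pow_le r k i hi
        have h' : ((r + k).choose i * r ^ i * k ^ (r + k - i) : ℝ) ≤
          (r + k).choose r * r ^ r * k ^ k := by exact_mod_cast h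
        have e : ∀ j ≤ r + k, ρ ^ j * (1 - ρ) ^ (r + k - j) * ((r + k).choose j : ℝ) =
            ((r + k).choose j * r ^ j * k ^ (r + k - j) : ℝ) / (r + k : ℕ) ^ (r + k) := by
          intro j hj
          rw [hρ', hρ, div_pow, div_pow, div_mul_div_comm, ← pow_add, Nat.add_sub_cancel' hj]
          ring
        rw [hmode, e i hi, e r (Nat.le_add_right _ _), Nat.add_sub_cancel_left]
        gcongr
    · simp
  · rw [hmode]
    refine le_trans ?_ hsum.le
    exact Finset.single_le_sum (f := fun i => ρ ^ i * (1 - ρ) ^ (r + k - i) * ((r + k).choose i : ℝ))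
      (fun i _ => by positivity) (by simp)

end Binomial

/-! ### The search register as a random set with coins. -/

section Decoder

variable {r k : ℕ}

open Wire Anc

/-- The indicator of a set. -/
def indicator (K : Finset (Fin r ⊕ Fin k)) (x : Fin r ⊕ Fin k) : ZMod 2 := if x ∈ K then 1 else 0

/-- The state loaded with a set, coins and a dummy bit. -/
def loadSet (A : Matrix (Fin r) (Fin k) (ZMod 2)) (s : Fin r → ZMod 2)
    (t : Finset (Fin r ⊕ Fin k) × (Fin k → ZMod 2) × ZMod 2) : Wire r k → ZMod 2 :=
  loadWires A s (indicator t.1) t.2.1 t.2.2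

/-- The amplitudes of the search register. -/
noncomputable def searchAmp (A : Matrix (Fin r) (Fin k) (ZMod 2)) (s : Fin r → ZMod 2)
    (y : Wire r k → ZMod 2) : ℝ :=
  prepAmp (searchProb r k) (searchWires r k) (loadWires A s 0 0 0) y

/-- The probability of a set. -/
noncomputable def setProb (K : Finset (Fin r ⊕ Fin k)) : ℝ :=
  ((r : ℝ) / (r + k : ℕ)) ^ K.card * (1 - (r : ℝ) / (r + k : ℕ)) ^ (r + k - K.card)

theorem setProb_nonneg (K : Finset (Fin r ⊕ Fin k)) : 0 ≤ setProb K := by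
  have hρ1 : 0 ≤ 1 - (r : ℝ) / (r + k : ℕ) := sub_nonneg.2
    (div_le_one_of_le₀ (by exact_mod_cast Nat.le_add_right r k) (by positivity))
  unfold setProb
  positivity

theorem setProb_eq {K : Finset (Fin r ⊕ Fin k)} (h : K.card = r) : setProb K = modeProb r k := by
  rw [setProb, modeProb, h, Nat.add_sub_cancel_left]

theorem sum_setProb : ∑ K : Finset (Fin r ⊕ Fin k), setProb K = 1 := by
  have h := Finset.sum_pow_mul_eq_add_pow ((r : ℝ) / (r + k : ℕ)) (1 - (r : ℝ) / (r + k : ℕ))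
    (Finset.univ : Finset (Fin r ⊕ Fin k))
  rw [add_sub_cancel, one_pow, Finset.powerset_univ] at h
  simpa [setProb] using h

theorem searchAmp_loadSet (A : Matrix (Fin r) (Fin k) (ZMod 2)) (s : Fin r → ZMod 2)
    (t : Finset (Fin r ⊕ Fin k) × (Fin k → ZMod 2) × ZMod 2) :
    searchAmp A s (loadSet A s t) ^ 2 = setProb t.1 * ((1 / 2) ^ k * (1 / 2)) := by
  have hcond : ∀ q, q ∉ searchWires r k → loadSet A s t q = loadWires A s 0 0 0 q := by
    intro q hq
    rcases q with _ | _ | a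
    · rfl
    · rfl
    · cases a <;> first | rfl | (exfalso; apply hq; simp [searchWires, mem_labels])
  have hlist : ∀ l : List (Wire r k), ∀ f : Wire r k → ℝ, (l.map f).prod ^ 2 =
      (l.map fun q => f q ^ 2).prod := by
    intro l f
    induction l with
    | nil => simp
    | cons a l ih => simp [mul_pow, ih]
  have hsq : ∀ q, (if loadSet A s t q = 0 then √(1 - searchProb r k q) else √(searchProb r k q)) ^ 2
      = if loadSet A s t q = 0 then 1 - searchProb r k q else searchProb r k q := by
    intro q
    have := searchProb_mem q
    split_ifs
    · exact Real.sq_sqrt (sub_nonneg.2 this.2)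
    · exact Real.sq_sqrt this.1
  rw [searchAmp, prepAmp, if_pos hcond, hlist]
  simp only [hsq]
  rw [searchWires, List.map_append, List.map_append, List.prod_append, List.prod_append,
    List.map_map, List.map_map, List.map_singleton, List.prod_singleton]
  congr 1
  · rw [← List.prod_toFinset _ nodup_labels, toFinset_labels]
    have : ∀ x, ((fun q => if loadSet A s t q = 0 then 1 - searchProb r k q else
        searchProb r k q) ∘ fun x => anc (key x)) x =
        if x ∈ t.1 then (r : ℝ) / (r + k : ℕ) else 1 - (r : ℝ) / (r + k : ℕ) := by
      intro x
      by_cases hx : x ∈ t.1 <;> simp [loadSet, loadWires, indicator, searchProb, hx]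
    rw [Finset.prod_congr rfl fun x _ => this x, Finset.prod_ite, Finset.prod_const,
      Finset.prod_const, setProb]
    congr 2
    · simp
    · rw [Finset.filter_not, Finset.card_sdiff]
      simp
  · congr 1
    · rw [List.prod_eq_pow_card _ (1 / 2)]
      · simp
      · intro x hx
        obtain ⟨j, -, rfl⟩ := List.mem_map.1 hx
        simp only [Function.comp_apply, searchProb]
        norm_num
    · simp only [searchProb]
      norm_num

/-- States that are not of the form `loadSet` have amplitude zero, so sums over basis states become
sums over sets, coins and the extra bit. -/
theorem sum_searchAmp (A : Matrix (Fin r) (Fin k) (ZMod 2)) (s : Fin r → ZMod 2)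
    (P : (Wire r k → ZMod 2) → Prop) [DecidablePred P] :
    (∑ y, if P y then searchAmp A s y ^ 2 else 0) =
      ∑ t : Finset (Fin r ⊕ Fin k) × (Fin k → ZMod 2) × ZMod 2,
        if P (loadSet A s t) then setProb t.1 * ((1 / 2) ^ k * (1 / 2)) else 0 := by
  symm
  refine Fintype.sum_of_injective (loadSet A s) ?_ _ _ ?_ ?_
  · rintro ⟨K, Y, dm⟩ ⟨K', Y', dm'⟩ h
    have h1 : K = K' := by
      ext x
      have := congrFun h (anc (key x))
      simp only [loadSet, loadWires, indicator] at this
      by_cases h1 : x ∈ K <;> by_cases h2 : x ∈ K' <;> simp_all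
    have h2 : Y = Y' := funext fun j => congrFun h (anc (coin j))
    have h3 : dm = dm' := congrFun h (anc dum)
    rw [h1, h2, h3]
  · intro y hy
    have hne : ¬ ∀ q, q ∉ searchWires r k → y q = loadWires A s 0 0 0 q := by
      intro h
      apply hy
      refine ⟨(Finset.univ.filter fun x => y (anc (key x)) = 1, fun j => y (anc (coin j)),
        y (anc dum)), ?_⟩
      funext q
      by_cases hq : q ∈ searchWires r k
      · simp only [searchWires, List.mem_append, List.mem_map, List.mem_singleton] at hq
        rcases hq with ⟨x, -, rfl⟩ | ⟨j, -, rfl⟩ | rfl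
        · rcases ZMod.two_cases (y (anc (key x))) with hx | hx <;>
            simp [loadSet, loadWires, indicator, hx]
        · rfl
        · rfl
      · rw [h q hq]
        rcases q with _ | _ | a
        · rfl
        · rfl
        · cases a <;> first | rfl | (exfalso; apply hq; simp [searchWires, mem_labels])
    simp [searchAmp, prepAmp, hne]
  · intro t
    rw [searchAmp_loadSet]

/-- The program is injective on basis states, so the marked states that compute `e` are distinct
outcomes, each with its prepared weight times the amplification factor. The uniform seed averages
this factor over the number of rounds. -/
theorem decoder_call_result_ge (w : ℕ) (A : Matrix (Fin r) (Fin k) (ZMod 2)) (s : Fin r → ZMod 2)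
    (e : Fin r ⊕ Fin k → ZMod 2) {f g : ℝ}
    (hf : f = ∑ y, if Accepted w y then searchAmp A s y ^ 2 else 0)
    (hg : g = ∑ y, if Accepted w y ∧ outVec y = e then searchAmp A s y ^ 2 else 0) :
    ENNReal.ofReal (g * ((∑ j ∈ Finset.range (searchRounds r k w), (groverAmp f j).1 ^ 2) /
      searchRounds r k w)) ≤ ((decoder r k w).call A s).result e := by
  have hJ := one_le_searchRounds (r := r) (k := k) w
  have hs : (decoder r k w).seeds + 1 = searchRounds r k w := by
    change searchRounds r k w - 1 + 1 = _
    omega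
  have hX0 : ∀ q ∈ searchWires r k, loadWires A s 0 0 0 q = 0 := by
    intro q hq
    simp only [searchWires, List.mem_append, List.mem_map, List.mem_singleton] at hq
    rcases hq with ⟨x, -, rfl⟩ | ⟨j, -, rfl⟩ | rfl <;> rfl
  have hdum : anc dum ∈ searchWires r k := by simp [searchWires]
  have hj : ∀ j : Fin ((decoder r k w).seeds + 1),
      ENNReal.ofReal (g * (groverAmp f j).1 ^ 2) ≤
      (((decoder r k w).circuit j).measure (loadInstance (decoder r k w).ancillas A s)).bind
        (fun y => (PMF.pure fun i => y ((decoder r k w).out i))) e := by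
    intro j
    set T := Finset.univ.filter fun y : Wire r k → ZMod 2 => Accepted w y ∧ outVec y = e with hT
    set φ : (Wire r k → ZMod 2) → (QReg r k (decoder r k w).ancillas → ZMod 2) :=
      fun y => Toggle.run (decodeProg r k) y ∘ (wireEquiv r k).symm with hφ
    have hinj : Function.Injective φ := by
      intro y y' h
      apply Toggle.run_injective (decodeProg r k)
      funext q
      have := congrFun h (wireEquiv r k q)
      change Toggle.run (decodeProg r k) y ((wireEquiv r k).symm (wireEquiv r k q)) =
        Toggle.run (decodeProg r k) y' ((wireEquiv r k).symm (wireEquiv r k q)) at this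
      rwa [Equiv.symm_apply_apply] at this
    have hval : ∀ y ∈ T, ENNReal.ofReal (searchAmp A s y ^ 2 * (groverAmp f j).1 ^ 2) =
        ((decoder r k w).circuit j).measure (loadInstance (decoder r k w).ancillas A s) (φ y) := by
      intro y hy
      have hacc : Accepted w y := (Finset.mem_filter.1 hy).2.1
      refine (measure_amplify (p := searchProb r k) (hp := searchProb_mem) nodup_searchWires hX0
        hdum (decodeProg r k) (anc dum) (acceptWires r k) (acceptPattern r k w) hf j hacc).symm.trans
          ?_
      rw [← QCircuit.relabel_measure (wireEquiv r k), ← loadInstance_eq]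
      rfl
    rw [PMF.bind_apply, tsum_fintype]
    calc ENNReal.ofReal (g * (groverAmp f j).1 ^ 2)
        = ∑ y ∈ T, ENNReal.ofReal (searchAmp A s y ^ 2 * (groverAmp f j).1 ^ 2) := by
          rw [← ENNReal.ofReal_sum_of_nonneg (fun _ _ => by positivity), ← Finset.sum_mul, hg,
            ← Finset.sum_filter]
      _ = ∑ y ∈ T, ((decoder r k w).circuit j).measure
            (loadInstance (decoder r k w).ancillas A s) (φ y) *
            (PMF.pure fun i => φ y ((decoder r k w).out i)) e := by
          refine Finset.sum_congr rfl fun y hy => ?_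
          rw [hval y hy]
          have : (fun i => φ y ((decoder r k w).out i)) = e := by
            rw [← (Finset.mem_filter.1 hy).2.2]
            funext i
            simp only [hφ]
            change Toggle.run (decodeProg r k) y ((wireEquiv r k).symm (wireEquiv r k _)) = _
            rw [Equiv.symm_apply_apply]
            rfl
          rw [this, PMF.pure_apply_self, mul_one]
      _ = ∑ y ∈ T.image φ, ((decoder r k w).circuit j).measure
            (loadInstance (decoder r k w).ancillas A s) y *
            (PMF.pure fun i => y ((decoder r k w).out i)) e :=
          (Finset.sum_image (f := fun y => ((decoder r k w).circuit j).measure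
            (loadInstance (decoder r k w).ancillas A s) y *
            (PMF.pure fun i => y ((decoder r k w).out i)) e) hinj.injOn).symm
      _ ≤ _ := Finset.sum_le_sum_of_subset (Finset.subset_univ _)
  have hres : ((decoder r k w).call A s).result e =
      ∑ j : Fin ((decoder r k w).seeds + 1), (searchRounds r k w : ℝ≥0∞)⁻¹ *
      (((decoder r k w).circuit j).measure (loadInstance (decoder r k w).ancillas A s)).bind
        (fun y => (PMF.pure fun i => y ((decoder r k w).out i))) e := by
    unfold QDecoder.call
    simp only [Timed.result_bind, Timed.result_sample, Timed.result_tick, Timed.result_pure,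
      PMF.pure_bind]
    rw [PMF.bind_apply, tsum_fintype]
    refine Finset.sum_congr rfl fun j _ => ?_
    rw [PMF.uniformOfFintype_apply, Fintype.card_fin, hs]
  rw [hres, ← Finset.mul_sum]
  have hpos : (0 : ℝ) < searchRounds r k w := by exact_mod_cast hJ
  have hg0 : 0 ≤ g := by
    rw [hg]
    exact Finset.sum_nonneg fun y _ => by split_ifs <;> positivity
  calc ENNReal.ofReal (g * ((∑ j ∈ Finset.range (searchRounds r k w), (groverAmp f j).1 ^ 2) /
        searchRounds r k w))
      = (searchRounds r k w : ℝ≥0∞)⁻¹ *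
        ∑ j : Fin ((decoder r k w).seeds + 1), ENNReal.ofReal (g * (groverAmp f j).1 ^ 2) := by
        rw [← ENNReal.ofReal_sum_of_nonneg (fun _ _ => by positivity), ← Finset.mul_sum,
          ← ENNReal.ofReal_natCast, ← ENNReal.ofReal_inv_of_pos hpos,
          ← ENNReal.ofReal_mul (by positivity),
          Fin.sum_univ_eq_sum_range (fun j => (groverAmp f j).1 ^ 2), hs]
        congr 1
        field_simp
    _ ≤ _ := by
        gcongr with j _
        exact hj j

end Decoder

/-! ### Sets of a given size that contain a given support. -/

section Supersets

variable {ι : Type} [Fintype ι] [DecidableEq ι]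

/-- The support of a vector. -/
def vsupp {ι : Type} [Fintype ι] (x : ι → ZMod 2) : Finset ι := Finset.univ.filter fun i => x i ≠ 0

theorem mem_vsupp {x : ι → ZMod 2} {i : ι} : i ∈ vsupp x ↔ x i ≠ 0 := by simp [vsupp]

/-- The sets of size `r` that contain `T`. -/
def supersets (r : ℕ) (T : Finset ι) : Finset (Finset ι) :=
  Finset.univ.filter fun K => K.card = r ∧ T ⊆ K

theorem mem_supersets {r : ℕ} {T K : Finset ι} : K ∈ supersets r T ↔ K.card = r ∧ T ⊆ K := by
  simp [supersets]

theorem card_supersets {r : ℕ} {T : Finset ι} (h : T.card ≤ r) :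
    (supersets r T).card = (Fintype.card ι - T.card).choose (r - T.card) := by
  rw [← Finset.card_compl, ← Finset.card_powersetCard]
  refine Finset.card_nbij' (fun K => K \ T) (fun K => K ∪ T) ?_ ?_ ?_ ?_
  · intro K hK
    obtain ⟨h1, h2⟩ := mem_supersets.1 hK
    refine Finset.mem_coe.2 (Finset.mem_powersetCard.2 ⟨?_, ?_⟩)
    · intro i hi
      simpa using (Finset.mem_sdiff.1 hi).2
    · rw [Finset.card_sdiff_of_subset h2, h1]
  · intro K hK
    obtain ⟨h1, h2⟩ := Finset.mem_powersetCard.1 hK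
    refine Finset.mem_coe.2 (mem_supersets.2 ⟨?_, Finset.subset_union_right⟩)
    rw [Finset.card_union_of_disjoint, h2, Nat.sub_add_cancel h]
    exact (disjoint_compl_left (a := T)).mono_left h1
  · intro K hK
    exact Finset.sdiff_union_of_subset (mem_supersets.1 hK).2
  · intro K hK
    have h1 := (Finset.mem_powersetCard.1 hK).1
    exact Finset.union_sdiff_cancel_right ((disjoint_compl_left (a := T)).mono_left h1)

end Supersets

/-! ### Prepared weight of the accepted states. -/

section Decoder

variable {r k : ℕ}

open Wire Anc

/-- The number of solutions of a systematic system with support in `K`. -/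
def solCount (A : Matrix (Fin r) (Fin k) (ZMod 2)) (s : Fin r → ZMod 2)
    (K : Finset (Fin r ⊕ Fin k)) : ℕ :=
  (Finset.univ.filter fun x => vsupp x ⊆ K ∧ SysSol A s x).card

/-- The solutions of weight `w` of a systematic system. -/
def weightSols (A : Matrix (Fin r) (Fin k) (ZMod 2)) (s : Fin r → ZMod 2) (w : ℕ) :
    Finset (Fin r ⊕ Fin k → ZMod 2) :=
  Finset.univ.filter fun x => (vsupp x).card = w ∧ SysSol A s x

theorem vsupp_eq (x : Fin r ⊕ Fin k → ZMod 2) : vsupp x = Finset.univ.filter fun i => x i = 1 := by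
  ext i
  rcases ZMod.two_cases (x i) with h | h <;> simp [vsupp, h]

variable (A : Matrix (Fin r) (Fin k) (ZMod 2)) (s : Fin r → ZMod 2)

theorem accepted_loadSet {w : ℕ} (hw : w ≤ r + k)
    (t : Finset (Fin r ⊕ Fin k) × (Fin k → ZMod 2) × ZMod 2) :
    Accepted w (loadSet A s t) ↔ t.2.2 = 1 ∧ t.1 ∈ supersets r (vsupp (outVec (loadSet A s t))) ∧
      (vsupp (outVec (loadSet A s t))).card = w := by
  have h := (run_decodeProg (y := loadSet A s t) (fun _ => rfl) (fun _ _ => rfl) (fun _ _ => rfl)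
    (fun _ => rfl)).2.2 w hw
  have hkey : ∀ x, loadSet A s t (anc (key x)) = 1 ↔ x ∈ t.1 := by
    intro x
    by_cases hx : x ∈ t.1 <;> simp [loadSet, loadWires, indicator, hx]
  rw [h, mem_supersets, vsupp_eq]
  simp only [hkey, Finset.filter_univ_mem]
  have h2 : (Finset.univ.filter fun x => outVec (loadSet A s t) x = 1) ⊆ t.1 ↔
      ∀ x, outVec (loadSet A s t) x = 1 → x ∈ t.1 := by
    simp [Finset.subset_iff]
  rw [h2]
  change (t.2.2 = 1 ∧ _) ↔ _
  tauto

theorem sysSol_outVec (t : Finset (Fin r ⊕ Fin k) × (Fin k → ZMod 2) × ZMod 2) :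
    SysSol A s (outVec (loadSet A s t)) := by
  intro i
  rw [(run_decodeProg (y := loadSet A s t) (fun _ => rfl) (fun _ _ => rfl) (fun _ _ => rfl)
    (fun _ => rfl)).2.1 i, add_assoc]
  change s i + (∑ l, A i l * _ + ∑ l, A i l * _) = s i
  rw [ZMod.two_add_self, add_zero]

/-- The coins are summed out, and the factor 1/2 is the probability of `dum = 1`. -/
theorem sum_loadSet_le {P : Finset (Fin r ⊕ Fin k) × (Fin k → ZMod 2) × ZMod 2 → Prop}
    [DecidablePred P] (S : Finset (Finset (Fin r ⊕ Fin k)))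
    (h : ∀ t, P t → t.2.2 = 1 ∧ t.1 ∈ S) :
    (∑ t, if P t then setProb t.1 * ((1 / 2) ^ k * (1 / 2)) else 0) ≤
      1 / 2 * ∑ K ∈ S, setProb K := by
  calc (∑ t, if P t then setProb t.1 * ((1 / 2) ^ k * (1 / 2)) else 0)
      ≤ ∑ t : Finset (Fin r ⊕ Fin k) × (Fin k → ZMod 2) × ZMod 2,
          if t.2.2 = 1 then (if t.1 ∈ S then setProb t.1 * ((1 / 2) ^ k * (1 / 2)) else 0)
            else 0 := by
        refine Finset.sum_le_sum fun t _ => ?_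
        have := setProb_nonneg t.1
        by_cases hP : P t
        · rw [if_pos hP, if_pos (h t hP).1, if_pos (h t hP).2]
        · rw [if_neg hP]
          split_ifs <;> positivity
    _ = 1 / 2 * ∑ K ∈ S, setProb K := by
        simp only [Fintype.sum_prod_type]
        have hS : ∑ K ∈ S, 1 / 2 * setProb K = ∑ K, if K ∈ S then 1 / 2 * setProb K else 0 := by
          simp [Finset.sum_ite_mem]
        rw [Finset.mul_sum, hS]
        refine Finset.sum_congr rfl fun K _ => ?_
        simp only [Finset.sum_ite_eq', Finset.mem_univ, if_true]
        rw [Finset.sum_const, Finset.card_univ]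
        by_cases hK : K ∈ S
        · simp [hK]
          ring_nf
          simp
        · simp [hK]

theorem card_supersets_vsupp {x : Fin r ⊕ Fin k → ZMod 2} {w : ℕ} (hx : (vsupp x).card = w)
    (hw : w ≤ r) : (supersets r (vsupp x)).card = (r + k - w).choose (r - w) := by
  rw [card_supersets (by omega), hx]
  simp

/-- The bound 1/2 comes from `dum` alone and is what the amplification lemma requires. The other
bound is a union bound over the solutions of weight `w` and the `r`-sets containing their supports.
-/
theorem accepted_mass_le {w : ℕ} (hw : w ≤ r) :
    (∑ y, if Accepted w y then searchAmp A s y ^ 2 else 0) ≤ 1 / 2 ∧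
    (∑ y, if Accepted w y then searchAmp A s y ^ 2 else 0) ≤
      1 / 2 * ((weightSols A s w).card * ((r + k - w).choose (r - w) : ℝ) * modeProb r k) := by
  rw [sum_searchAmp]
  constructor
  · refine (sum_loadSet_le Finset.univ fun t ht => ?_).trans_eq ?_
    · exact ⟨((accepted_loadSet A s (by omega) t).1 ht).1, Finset.mem_univ _⟩
    · rw [sum_setProb, mul_one]
  · refine (sum_loadSet_le ((weightSols A s w).biUnion fun x => supersets r (vsupp x))
      fun t ht => ?_).trans ?_
    · obtain ⟨h1, h2, h3⟩ := (accepted_loadSet A s (by omega) t).1 ht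
      exact ⟨h1, Finset.mem_biUnion.2 ⟨_, by simp [weightSols, h3, sysSol_outVec], h2⟩⟩
    · have hmode := (modeProb_bounds r k).2.2
      gcongr
      rw [Finset.sum_congr rfl (g := fun _ => modeProb r k), Finset.sum_const, nsmul_eq_mul]
      · gcongr
        have : ((weightSols A s w).biUnion fun x => supersets r (vsupp x)).card ≤
            (weightSols A s w).card * (r + k - w).choose (r - w) :=
          Finset.card_biUnion_le_card_mul _ _ _ fun x hx =>
            (card_supersets_vsupp (Finset.mem_filter.1 hx).2.1 hw).le
        exact_mod_cast this
      · intro K hK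
        obtain ⟨x, -, hx⟩ := Finset.mem_biUnion.1 hK
        exact setProb_eq (mem_supersets.1 hx).1

theorem card_agree (F : Finset (Fin k)) (z : Fin k → ZMod 2) :
    (Finset.univ.filter fun Y : Fin k → ZMod 2 => ∀ l ∈ F, Y l = z l).card * 2 ^ F.card = 2 ^ k := by
  have h1 : (Finset.univ.filter fun Y : Fin k → ZMod 2 => ∀ l ∈ F, Y l = z l) =
      Fintype.piFinset fun l => if l ∈ F then {z l} else Finset.univ := by
    ext Y
    simp only [Finset.mem_filter, Finset.mem_univ, true_and, Fintype.mem_piFinset]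
    refine forall_congr' fun l => ?_
    by_cases hl : l ∈ F <;> simp [hl]
  have h2 : (2 : ℕ) ^ F.card = ∏ l : Fin k, if l ∈ F then 2 else 1 := by
    rw [Finset.prod_ite_mem]
    simp
  rw [h1, Fintype.card_piFinset, h2, ← Finset.prod_mul_distrib, Finset.prod_congr rfl (g := fun _ => 2)]
  · simp
  · intro l _
    by_cases hl : l ∈ F <;> simp [hl]

/-- The coins as a modification of a state. -/
def coinShift (Y : Fin k → ZMod 2) : Wire r k → ZMod 2
  | anc (coin l) => Y l
  | _ => 0

theorem loadSet_eq_add (K : Finset (Fin r ⊕ Fin k)) (Y : Fin k → ZMod 2) (dm : ZMod 2) :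
    loadSet A s (K, Y, dm) = loadSet A s (K, 0, dm) + coinShift Y := by
  funext q
  rcases q with _ | _ | a
  · simp [loadSet, loadWires, coinShift]
  · simp [loadSet, loadWires, coinShift]
  · cases a <;> simp [loadSet, loadWires, coinShift]

/-- From `solveProg_complete`: each solution of the available equations extends through the identity
block to a solution of the whole system with support in `K`, so the power of 2 is bounded by
`solCount`. -/
theorem exists_coins {e : Fin r ⊕ Fin k → ZMod 2} (hs : SysSol A s e)
    {K : Finset (Fin r ⊕ Fin k)} (hK : vsupp e ⊆ K) (dm : ZMod 2) :
    ∃ F : Finset (Fin k), 2 ^ F.card ≤ solCount A s K ∧ ∀ Y : Fin k → ZMod 2,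
      (∀ l ∈ F, Y l = e (Sum.inr l)) → outVec (loadSet A s (K, Y, dm)) = e := by
  have hkey : ∀ x, loadSet A s (K, 0, dm) (anc (key x)) = if x ∈ K then 1 else 0 := fun x => rfl
  have hres : ∀ z i, synResidual (loadSet A s (K, 0, dm)) z i = s i + ∑ l, A i l * z l :=
    fun _ _ => rfl
  have hready : SolveReady (List.finRange k) (loadSet A s (K, 0, dm)) := by
    refine ⟨fun _ => rfl, fun i i' h => ?_, fun _ _ => rfl, fun _ _ => rfl⟩
    exact absurd h (by change (0 : ZMod 2) ≠ 1; decide)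
  have hadd : ∀ a b c : ZMod 2, a + b = c → c + b = a := by decide
  have hz : (fun l => e (Sum.inr l)) ∈ solutions (List.finRange k) (loadSet A s (K, 0, dm)) := by
    refine mem_solutions.2 ⟨fun l hl => absurd (List.mem_finRange l) hl, fun l hl => ?_,
      fun i hi => ?_⟩
    · by_contra hne
      have := hK (mem_vsupp.2 hne)
      rw [hkey, if_pos this] at hl
      exact absurd hl (by decide)
    · rw [hres, hadd _ _ _ (hs i)]
      by_contra hne
      have := hK (mem_vsupp.2 hne)
      rw [rowKey, hkey, if_pos this] at hi
      exact absurd hi (by decide)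
  obtain ⟨F, h1, -, h3⟩ := solveProg_complete (List.nodup_finRange k) hready hz
  refine ⟨F, h1.trans ?_, fun Y hY => ?_⟩
  · refine Finset.card_le_card_of_injOn
      (fun z => Sum.elim (fun i => s i + ∑ l, A i l * z l) z) ?_ ?_
    · intro z hz
      obtain ⟨-, h5, h6⟩ := mem_solutions.1 hz
      refine Finset.mem_coe.2 (Finset.mem_filter.2 ⟨Finset.mem_univ _, ?_, ?_⟩)
      · intro x hx
        have hx := mem_vsupp.1 hx
        by_contra hxK
        apply hx
        rcases x with i | l
        · have := h6 i (by rw [rowKey, hkey, if_neg hxK])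
          rwa [hres] at this
        · exact h5 l (by rw [colKey, hkey, if_neg hxK])
      · intro i
        simp only [Sum.elim_inl, Sum.elim_inr]
        rw [add_assoc, ZMod.two_add_self, add_zero]
    · intro z _ z' _ h
      funext l
      exact congrFun h (Sum.inr l)
  · have hrun := run_decodeProg (y := loadSet A s (K, Y, dm)) (fun _ => rfl) (fun _ _ => rfl)
      (fun _ _ => rfl) (fun _ => rfl)
    have hr : ∀ l, outVec (loadSet A s (K, Y, dm)) (Sum.inr l) = e (Sum.inr l) := by
      intro l
      rw [hrun.1, loadSet_eq_add]
      refine h3 (coinShift Y) ?_ ?_ l (List.mem_finRange l)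
      · intro q hq
        rcases q with _ | _ | a
        · rfl
        · rfl
        · cases a <;> first | rfl | exact absurd rfl (hq _)
      · intro l hl
        rw [← hY l hl]
        change 0 + Y l = Y l
        rw [zero_add]
    funext x
    rcases x with i | l
    · rw [hrun.2.1 i]
      simp only [hr]
      exact hadd _ _ _ (hs i)
    · exact hr l

/-- For every `r`-set around the support of `e`, the coins are right on the exceptional set with
probability at least `1 / solCount`; the factor 1/2 is again `dum`. -/
theorem accepted_mass_ge {w : ℕ} (hw : w ≤ r) {e : Fin r ⊕ Fin k → ZMod 2} (hs : SysSol A s e)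
    (he : (vsupp e).card = w) :
    1 / 2 * (modeProb r k * ∑ K ∈ supersets r (vsupp e), (1 / (solCount A s K : ℝ))) ≤
      ∑ y, if Accepted w y ∧ outVec y = e then searchAmp A s y ^ 2 else 0 := by
  rw [sum_searchAmp]
  simp only [Fintype.sum_prod_type]
  rw [Finset.mul_sum, Finset.mul_sum]
  have hmode := (modeProb_bounds r k).2.2
  refine le_trans (Finset.sum_le_sum fun K hK => ?_)
    (Finset.sum_le_sum_of_subset_of_nonneg (Finset.subset_univ (supersets r (vsupp e)))
      fun K _ _ => Finset.sum_nonneg fun Y _ => Finset.sum_nonneg fun dm _ => by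
        have := setProb_nonneg K
        split_ifs <;> positivity)
  obtain ⟨F, h1, h2⟩ := exists_coins A s hs (mem_supersets.1 hK).2 1
  have hone : ∀ Y : Fin k → ZMod 2, (if ∀ l ∈ F, Y l = e (Sum.inr l) then
      modeProb r k * ((1 / 2) ^ k * (1 / 2)) else 0) ≤ ∑ dm : ZMod 2,
        if Accepted w (loadSet A s (K, Y, dm)) ∧ outVec (loadSet A s (K, Y, dm)) = e then
          setProb K * ((1 / 2) ^ k * (1 / 2)) else 0 := by
    intro Y
    have hnn : ∀ dm : ZMod 2, 0 ≤ if Accepted w (loadSet A s (K, Y, dm)) ∧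
        outVec (loadSet A s (K, Y, dm)) = e then setProb K * ((1 / 2) ^ k * (1 / 2)) else 0 := by
      intro dm
      have := setProb_nonneg K
      split_ifs <;> positivity
    split_ifs with hY
    · refine le_trans (le_of_eq ?_) (Finset.single_le_sum (fun dm _ => hnn dm)
        (Finset.mem_univ (1 : ZMod 2)))
      have ho := h2 Y hY
      rw [if_pos, setProb_eq (mem_supersets.1 hK).1]
      refine ⟨(accepted_loadSet A s (by omega) _).2 ?_, ho⟩
      rw [ho]
      exact ⟨rfl, hK, he⟩
    · exact Finset.sum_nonneg fun dm _ => hnn dm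
  refine le_trans ?_ (Finset.sum_le_sum fun Y _ => hone Y)
  rw [← Finset.sum_filter, Finset.sum_const, nsmul_eq_mul]
  have hcard := card_agree F fun l => e (Sum.inr l)
  set c := (Finset.univ.filter fun Y : Fin k → ZMod 2 => ∀ l ∈ F, Y l = e (Sum.inr l)).card
  have hc : (c : ℝ) = 2 ^ k / 2 ^ F.card := by
    rw [eq_div_iff (by positivity)]
    exact_mod_cast hcard
  have hsol : (1 : ℝ) / solCount A s K ≤ 1 / 2 ^ F.card :=
    one_div_le_one_div_of_le (by positivity) (by exact_mod_cast h1)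
  have e1 : (c : ℝ) * (modeProb r k * ((1 / 2) ^ k * (1 / 2))) =
      1 / 2 * (modeProb r k * (1 / 2 ^ F.card)) := by
    rw [hc, one_div_pow]
    field_simp
  rw [e1]
  gcongr

end Decoder

/-! ### Success probability of one call. -/

section Decoder

variable {r k : ℕ}

/-- Cauchy-Schwarz, or the inequality of harmonic and arithmetic mean. It moves counts out of
denominators, where they could not be averaged. -/
theorem sq_card_le_sum_mul_sum_inv {ι : Type} (s : Finset ι) (f : ι → ℝ) (hf : ∀ i ∈ s, 0 < f i) :
    (s.card : ℝ) ^ 2 ≤ (∑ i ∈ s, f i) * ∑ i ∈ s, 1 / f i := by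
  have h := Finset.sum_sq_le_sum_mul_sum_of_sq_le_mul s (r := fun _ => (1 : ℝ)) (f := f)
    (g := fun i => 1 / f i) (fun i hi => (hf i hi).le) (fun i hi => (one_div_pos.2 (hf i hi)).le)
    (fun i hi => by rw [mul_one_div_cancel (hf i hi).ne', one_pow])
  simpa using h

theorem sq_searchRounds_ge (r k w : ℕ) :
    ((r + k).choose w : ℝ) / ((r.choose w : ℝ) * max 1 (expectedSolutions (r + k) r w)) ≤
      (searchRounds r k w : ℝ) ^ 2 := by
  have h : √(((r + k).choose w : ℝ) / ((r.choose w : ℝ) *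
      max 1 (expectedSolutions (r + k) r w))) ≤ searchRounds r k w :=
    (Nat.le_ceil _).trans (by exact_mod_cast le_max_right _ _)
  exact (Real.sqrt_le_left (by positivity)).1 h

/-- Here `c` is the number of `r`-sets around the support, `N`, `B` and `Cr` are the binomial
coefficients of `(r+k, w)`, `(r, w)` and `(r+k, r)`, `Pr` is the weight of one `r`-set, `M` counts
the solutions of weight `w`, and `σ` and `ι` sum the solution counts and their inverses. The
amplification gains at least `N / (4B(mx + M))`, the weight to be amplified is at least `Pr c² /
(2σ)`, and `c N = B Cr` turns the product into `c (Cr Pr) / (8σ(mx + M))`. -/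
theorem amplified_prob_ge {c N B Cr Pr mx M σ ι f g J a m : ℝ} (hc : 0 < c) (hN : 0 < N)
    (hB : 0 < B) (hPr : 0 < Pr) (hmx : 1 ≤ mx) (hM : 0 < M) (hσ : 0 < σ)
    (hf : 0 < f) (hg : 0 < g) (hJ : 0 < J) (hm : 0 < m) (hq1 : 1 ≤ m * (Cr * Pr))
    (hq2 : Cr * Pr ≤ 1) (hchoose : c * N = B * Cr) (hamhm : c ^ 2 ≤ σ * ι)
    (hf2 : f ≤ 1 / 2 * (M * c * Pr)) (hg1 : 1 / 2 * (Pr * ι) ≤ g)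
    (hgr : J / 4 * min (J ^ 2) (1 / f) ≤ a) (hJ2 : N / (B * mx) ≤ J ^ 2) :
    c / (8 * m * σ * (mx + M)) ≤ g * (a / J) := by
  have hmin : N / B / (mx + M) ≤ min (J ^ 2) (1 / f) := by
    refine le_min (le_trans ?_ hJ2) ?_
    · rw [div_div]
      gcongr
      linarith
    · rw [div_div, div_le_div_iff₀ (by positivity) hf]
      have h1 : c * Pr * N ≤ B := by
        calc c * Pr * N = c * N * Pr := by ring
          _ = B * (Cr * Pr) := by rw [hchoose]; ring
          _ ≤ B * 1 := by gcongr
          _ = B := mul_one B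
      calc N * f ≤ N * (1 / 2 * (M * c * Pr)) := by gcongr
        _ = 1 / 2 * M * (c * Pr * N) := by ring
        _ ≤ 1 / 2 * M * B := by gcongr
        _ ≤ 1 * (B * (mx + M)) := by
          have := mul_pos hM hB
          have := mul_pos hB (lt_of_lt_of_le one_pos hmx)
          linarith
  have hgr' : 1 / 4 * (N / B / (mx + M)) ≤ a / J := by
    rw [le_div_iff₀ hJ]
    calc 1 / 4 * (N / B / (mx + M)) * J ≤ 1 / 4 * min (J ^ 2) (1 / f) * J := by gcongr
      _ = J / 4 * min (J ^ 2) (1 / f) := by ring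
      _ ≤ a := hgr
  have hglow : 1 / 2 * (Pr * (c ^ 2 / σ)) ≤ g := by
    refine le_trans ?_ hg1
    gcongr
    rwa [div_le_iff₀ hσ, mul_comm]
  have hmxM : 0 < mx + M := by linarith
  refine le_trans ?_ (mul_le_mul hglow hgr' (by positivity) hg.le)
  have e1 : 1 / 2 * (Pr * (c ^ 2 / σ)) * (1 / 4 * (N / B / (mx + M))) =
      c * (Cr * Pr) / (8 * σ * (mx + M)) := by
    have : c ^ 2 * N = c * (B * Cr) := by rw [← hchoose]; ring
    have h2 : c * (Cr * Pr) / (8 * σ * (mx + M)) = (c * (B * Cr)) * Pr / (B * (8 * σ * (mx + M))) := by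
      field_simp
    rw [h2, ← this]
    field_simp
    norm_num
  rw [e1, div_le_div_iff₀ (by positivity) (by positivity)]
  calc c * (8 * σ * (mx + M)) = c * (8 * σ * (mx + M)) * 1 := (mul_one _).symm
    _ ≤ c * (8 * σ * (mx + M)) * (m * (Cr * Pr)) := by gcongr
    _ = _ := by ring

/-- The probability that the decoder finds a given solution. -/
theorem decoder_call_ge (A : Matrix (Fin r) (Fin k) (ZMod 2)) (s : Fin r → ZMod 2) {w : ℕ}
    (hw : w ≤ r) {e : Fin r ⊕ Fin k → ZMod 2} (hs : SysSol A s e) (he : (vsupp e).card = w) :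
    ENNReal.ofReal ((supersets r (vsupp e)).card / (8 * ((r + k : ℕ) + 1) *
      (∑ K ∈ supersets r (vsupp e), (solCount A s K : ℝ)) *
      (max 1 (expectedSolutions (r + k) r w) + (weightSols A s w).card))) ≤
      ((decoder r k w).call A s).result e := by
  refine le_trans (ENNReal.ofReal_le_ofReal ?_) (decoder_call_result_ge w A s e rfl rfl)
  obtain ⟨hf1, hf2⟩ := accepted_mass_le A s hw
  have hg1 := accepted_mass_ge A s hw hs he
  have hgf : (∑ y, if Accepted w y ∧ outVec y = e then searchAmp A s y ^ 2 else 0) ≤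
      ∑ y, if Accepted w y then searchAmp A s y ^ 2 else 0 := by
    refine Finset.sum_le_sum fun y _ => ?_
    by_cases h1 : Accepted w y
    · rw [if_pos h1]
      split_ifs
      · exact le_rfl
      · positivity
    · rw [if_neg (fun h => h1 h.1), if_neg h1]
  have hc := card_supersets_vsupp he hw
  rw [← hc] at hf2
  have hc0 : 0 < (supersets r (vsupp e)).card := by rw [hc]; exact Nat.choose_pos (by omega)
  obtain ⟨hq1, hq2, hm0⟩ := modeProb_bounds r k
  have hchoose : ((supersets r (vsupp e)).card : ℝ) * (r + k).choose w =
      r.choose w * (r + k).choose r := by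
    have h := Nat.choose_mul (n := r + k) hw
    rw [hc]
    have h' : (r + k - w).choose (r - w) * (r + k).choose w = r.choose w * (r + k).choose r := by
      rw [mul_comm, ← h, mul_comm]
    exact_mod_cast h'
  have hPr0 : 0 < modeProb r k := by
    rcases hm0.lt_or_eq with h | h
    · exact h
    · rw [← h] at hq1
      norm_num at hq1
  have hsol : ∀ K ∈ supersets r (vsupp e), (0 : ℝ) < solCount A s K := by
    intro K hK
    exact_mod_cast Finset.card_pos.2 ⟨e, by simp [(mem_supersets.1 hK).2, hs]⟩
  have hne : (supersets r (vsupp e)).Nonempty := Finset.card_pos.1 hc0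
  have hι0 : 0 < ∑ K ∈ supersets r (vsupp e), (1 / (solCount A s K : ℝ)) :=
    Finset.sum_pos (fun K hK => one_div_pos.2 (hsol K hK)) hne
  have hg0 := lt_of_lt_of_le (mul_pos one_half_pos (mul_pos hPr0 hι0)) hg1
  have hf0 := lt_of_lt_of_le hg0 hgf
  have hJ := one_le_searchRounds (r := r) (k := k) w
  exact amplified_prob_ge (by exact_mod_cast hc0)
    (by exact_mod_cast Nat.choose_pos (by omega : w ≤ r + k))
    (by exact_mod_cast Nat.choose_pos hw) hPr0 (le_max_left _ _)
    (by exact_mod_cast Finset.card_pos.2 ⟨e, by simp [weightSols, he, hs]⟩)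
    (Finset.sum_pos hsol hne) hf0 hg0 (by exact_mod_cast hJ) (by positivity) hq1 hq2 hchoose
    (sq_card_le_sum_mul_sum_inv _ _ hsol) hf2 hg1 (sum_groverAmp_sq_ge hf0 hf1 hJ)
    (sq_searchRounds_ge r k w)

end Decoder

/-! ### Classical Gaussian elimination as a linear automorphism applied to all columns. -/

namespace Elim

variable {q n : ℕ}

/-- Add multiples of entry `i` to all other entries. -/
def clearFun (i : Fin q) (a v : Fin q → ZMod 2) : Fin q → ZMod 2 :=
  fun j => v j + if j = i then 0 else a j * v i

/-- Adding multiples of entry `i` to all other entries is a linear automorphism. -/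
def clearEquiv (i : Fin q) (a : Fin q → ZMod 2) : (Fin q → ZMod 2) ≃ₗ[ZMod 2] (Fin q → ZMod 2) :=
  LinearEquiv.ofInvolutive
    { toFun := clearFun i a
      map_add' := fun v w => by
        funext j
        simp only [clearFun, Pi.add_apply]
        split_ifs <;> ring
      map_smul' := fun c v => by
        funext j
        simp only [clearFun, Pi.smul_apply, smul_eq_mul, RingHom.id_apply]
        split_ifs <;> ring }
    (fun v => by
      funext j
      change clearFun i a (clearFun i a v) j = v j
      simp only [clearFun, if_true, add_zero]
      rw [add_assoc, ZMod.two_add_self, add_zero])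

theorem clearEquiv_apply (i : Fin q) (a v : Fin q → ZMod 2) : clearEquiv i a v = clearFun i a v :=
  rfl

/-- Row `i` is never changed and every other row is visited at most once, so all tests read original
entries. -/
theorem foldl_addRow (i : Fin q) (c : Fin n) (l : List (Fin q)) (hl : l.Nodup) (st : Elim q n) :
    let st' := l.foldl (fun t j => if j ≠ i ∧ t.A j c = 1 then t.addRow i j else t) st
    (∀ j c', st'.A j c' = st.A j c' + if j ∈ l ∧ j ≠ i then st.A j c * st.A i c' else 0) ∧
    (∀ j, st'.s j = st.s j + if j ∈ l ∧ j ≠ i then st.A j c * st.s i else 0) ∧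
    st'.piv = st.piv ∧ st'.time ≤ st.time + l.length * (n + 1) := by
  induction l generalizing st with
  | nil => simp
  | cons j l ih =>
    obtain ⟨hj, hl⟩ := List.nodup_cons.1 hl
    simp only [List.foldl_cons]
    obtain ⟨h1, h2, h3, h4⟩ := ih hl (if j ≠ i ∧ st.A j c = 1 then st.addRow i j else st)
    rw [List.length_cons, add_mul, one_mul]
    by_cases hji : j ≠ i ∧ st.A j c = 1
    · rw [if_pos hji] at h1 h2 h3 h4 ⊢
      have hA : ∀ j' c', (st.addRow i j).A j' c' =
          st.A j' c' + if j' = j then st.A i c' else 0 := by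
        intro j' c'
        by_cases hj' : j' = j
        · subst hj'; simp [addRow]
        · simp [addRow, hj']
      have hs : ∀ j', (st.addRow i j).s j' = st.s j' + if j' = j then st.s i else 0 := by
        intro j'
        by_cases hj' : j' = j
        · subst hj'; simp [addRow]
        · simp [addRow, hj']
      refine ⟨fun j' c' => ?_, fun j' => ?_, h3, ?_⟩
      · rw [h1, hA, hA, hA, if_neg hji.1.symm, add_zero]
        by_cases hj' : j' = j
        · subst hj'
          simp [hj, hji.1, hji.2]
        · simp [hj']
      · rw [h2, hs, hs, hA, if_neg hji.1.symm, add_zero]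
        by_cases hj' : j' = j
        · subst hj'
          simp [hj, hji.1, hji.2]
        · simp [hj']
      · refine h4.trans ?_
        change st.time + (n + 1) + _ ≤ _
        omega
    · rw [if_neg hji] at h1 h2 h3 h4 ⊢
      have hz : ∀ v : ZMod 2, j ≠ i → st.A j c * v = 0 := by
        intro v h
        rcases ZMod.two_cases (st.A j c) with h0 | h0
        · rw [h0, zero_mul]
        · exact absurd ⟨h, h0⟩ hji
      refine ⟨fun j' c' => ?_, fun j' => ?_, h3, by omega⟩
      · rw [h1]
        by_cases hj' : j' = j
        · subst hj'
          by_cases h : j' = i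
          · simp [h]
          · simp [hj, hz _ h, h]
        · simp [hj']
      · rw [h2]
        by_cases hj' : j' = j
        · subst hj'
          by_cases h : j' = i
          · simp [h]
          · simp [hj, hz _ h, h]
        · simp [hj']

/-- The row that is used as pivot row for column `c`. -/
def pivotRow (rows : List (Fin q)) (st : Elim q n) (c : Fin n) : Option (Fin q) :=
  rows.find? fun i => decide (st.piv i = none ∧ st.A i c = 1)

/-- `st'` arises from `st` by applying `G` to all columns. -/
structure Acts (G : (Fin q → ZMod 2) ≃ₗ[ZMod 2] (Fin q → ZMod 2)) (st st' : Elim q n) : Prop where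
  col : ∀ c, (fun i => st'.A i c) = G fun i => st.A i c
  rhs : st'.s = G st.s

theorem Acts.mulVec {G : (Fin q → ZMod 2) ≃ₗ[ZMod 2] (Fin q → ZMod 2)} {st st' : Elim q n}
    (h : Acts G st st') (x : Fin n → ZMod 2) : st'.A.mulVec x = G (st.A.mulVec x) := by
  have e : ∀ B : Matrix (Fin q) (Fin n) (ZMod 2), B.mulVec x = ∑ c, x c • fun i => B i c := by
    intro B
    funext i
    simp [Matrix.mulVec, dotProduct, mul_comm]
  rw [e, e, map_sum]
  refine Finset.sum_congr rfl fun c _ => ?_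
  rw [map_smul, h.col]

theorem Acts.trans {G G' : (Fin q → ZMod 2) ≃ₗ[ZMod 2] (Fin q → ZMod 2)} {st st' st'' : Elim q n}
    (h : Acts G st st') (h' : Acts G' st' st'') : Acts (G.trans G') st st'' :=
  ⟨fun c => by rw [h'.col, h.col]; rfl, by rw [h'.rhs, h.rhs]; rfl⟩

theorem acts_refl (st : Elim q n) : Acts (LinearEquiv.refl _ _) st st := ⟨fun _ => rfl, rfl⟩

theorem pivotOn_of_none {rows : List (Fin q)} {st : Elim q n} {c : Fin n}
    (h : pivotRow rows st c = none) : (st.pivotOn rows c).A = st.A ∧ (st.pivotOn rows c).s = st.s ∧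
      (st.pivotOn rows c).piv = st.piv ∧ (st.pivotOn rows c).time = st.time + q := by
  unfold pivotOn
  rw [pivotRow] at h
  rw [h]
  exact ⟨rfl, rfl, rfl, rfl⟩

theorem pivotOn_of_some {rows : List (Fin q)} {st : Elim q n} {c : Fin n} {i : Fin q}
    (h : pivotRow rows st c = some i) :
    (∀ j c', (st.pivotOn rows c).A j c' = st.A j c' + if j = i then 0 else st.A j c * st.A i c') ∧
    (∀ j, (st.pivotOn rows c).s j = st.s j + if j = i then 0 else st.A j c * st.s i) ∧
    (st.pivotOn rows c).piv = Function.update st.piv i (some c) ∧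
    (st.pivotOn rows c).time ≤ st.time + q * (n + 1) + 2 * q := by
  obtain ⟨h1, h2, h3, h4⟩ := foldl_addRow i c (List.finRange q) (List.nodup_finRange q) st
  unfold pivotOn
  rw [pivotRow] at h
  rw [h]
  simp only [List.mem_finRange, true_and, List.length_finRange] at h1 h2 h3 h4 ⊢
  refine ⟨fun j c' => ?_, fun j => ?_, ?_, ?_⟩
  · rw [h1]
    by_cases hj : j = i <;> simp [hj]
  · rw [h2]
    by_cases hj : j = i <;> simp [hj]
  · rw [h3]
  · omega

theorem acts_pivotOn_of_some {rows : List (Fin q)} {st : Elim q n} {c : Fin n} {i : Fin q}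
    (h : pivotRow rows st c = some i) :
    Acts (clearEquiv i fun j => st.A j c) st (st.pivotOn rows c) := by
  obtain ⟨h1, h2, -⟩ := pivotOn_of_some h
  refine ⟨fun c' => ?_, ?_⟩
  · funext j
    rw [h1, clearEquiv_apply, clearFun]
  · funext j
    rw [h2, clearEquiv_apply, clearFun]

/-- The row operations of an elimination depend only on the processed columns. -/
theorem exists_acts_foldl (rows : List (Fin q)) (cs : List (Fin n)) (st : Elim q n) :
    ∃ G, ∀ st₂ : Elim q n, st₂.piv = st.piv → (∀ c ∈ cs, ∀ i, st₂.A i c = st.A i c) →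
      Acts G st₂ (cs.foldl (pivotOn rows) st₂) ∧
      (cs.foldl (pivotOn rows) st₂).piv = (cs.foldl (pivotOn rows) st).piv := by
  induction cs generalizing st with
  | nil => exact ⟨LinearEquiv.refl _ _, fun st₂ h _ => ⟨acts_refl _, h⟩⟩
  | cons c cs ih =>
    obtain ⟨G, hG⟩ := ih (st.pivotOn rows c)
    have hrow : ∀ st₂ : Elim q n, st₂.piv = st.piv → (∀ c' ∈ c :: cs, ∀ i, st₂.A i c' = st.A i c') →
        pivotRow rows st₂ c = pivotRow rows st c := by
      intro st₂ h1 h2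
      simp only [pivotRow, h1, h2 c List.mem_cons_self]
    rcases hp : pivotRow rows st c with _ | i
    · refine ⟨G, fun st₂ h1 h2 => ?_⟩
      obtain ⟨ha, hs, hpv, -⟩ := pivotOn_of_none hp
      obtain ⟨ha2, hs2, hpv2, -⟩ := pivotOn_of_none ((hrow st₂ h1 h2).trans hp)
      obtain ⟨h3, h4⟩ := hG (st₂.pivotOn rows c) (by rw [hpv, hpv2, h1]) (by
        intro c' hc' i
        rw [ha, ha2, h2 c' (List.mem_cons_of_mem _ hc')])
      refine ⟨⟨fun c' => ?_, ?_⟩, h4⟩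
      · rw [List.foldl_cons, h3.col, ha2]
      · rw [List.foldl_cons, h3.rhs, hs2]
    · refine ⟨(clearEquiv i fun j => st.A j c).trans G, fun st₂ h1 h2 => ?_⟩
      have hp2 := (hrow st₂ h1 h2).trans hp
      have hact := acts_pivotOn_of_some hp2
      obtain ⟨ha, -, hpv, -⟩ := pivotOn_of_some hp
      obtain ⟨ha2, -, hpv2, -⟩ := pivotOn_of_some hp2
      obtain ⟨h3, h4⟩ := hG (st₂.pivotOn rows c) (by rw [hpv, hpv2, h1]) (by
        intro c' hc' j
        rw [ha, ha2, h2 c' (List.mem_cons_of_mem _ hc'), h2 c' (List.mem_cons_of_mem _ hc'),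
          h2 c List.mem_cons_self])
      refine ⟨?_, h4⟩
      have e : (fun j => st₂.A j c) = fun j => st.A j c :=
        funext fun j => h2 c List.mem_cons_self j
      rw [e] at hact
      exact hact.trans h3

theorem time_foldl_pivotOn (rows : List (Fin q)) (cs : List (Fin n)) (st : Elim q n) :
    (cs.foldl (pivotOn rows) st).time ≤ st.time + cs.length * (q * (n + 1) + 2 * q) := by
  induction cs generalizing st with
  | nil => simp
  | cons c cs ih =>
    rw [List.foldl_cons, List.length_cons, add_mul, one_mul]
    refine (ih _).trans ?_
    rcases hp : pivotRow rows st c with _ | i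
    · have := (pivotOn_of_none hp).2.2.2
      omega
    · have := (pivotOn_of_some hp).2.2.2
      omega

/-- The invariants of an elimination with pivot rows in `rows`, where the columns of `done` have
been processed. -/
structure Reduced (rows : List (Fin q)) (done : List (Fin n)) (st : Elim q n) : Prop where
  unit : ∀ i c, st.piv i = some c → ∀ j, st.A j c = if j = i then 1 else 0
  zero : ∀ c ∈ done, ∀ i ∈ rows, st.piv i = none → st.A i c = 0

theorem mem_of_pivotRow {rows : List (Fin q)} {st : Elim q n} {c : Fin n} {i : Fin q}
    (h : pivotRow rows st c = some i) : i ∈ rows ∧ st.piv i = none ∧ st.A i c = 1 :=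
  ⟨List.mem_of_find?_eq_some h, by simpa using List.find?_some h⟩

theorem Reduced.pivotOn {rows : List (Fin q)} {done : List (Fin n)} {st : Elim q n}
    (h : Reduced rows done st) (c : Fin n) : Reduced rows (c :: done) (st.pivotOn rows c) := by
  rcases hp : pivotRow rows st c with _ | i
  · obtain ⟨ha, -, hpv, -⟩ := pivotOn_of_none hp
    refine ⟨by rw [ha, hpv]; exact h.unit, ?_⟩
    rw [ha, hpv]
    intro c' hc' i hi hi'
    rcases List.mem_cons.1 hc' with rfl | hc'
    · have := List.find?_eq_none.1 hp i hi
      rcases ZMod.two_cases (st.A i c') with h0 | h0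
      · exact h0
      · exact absurd (by simpa using ⟨hi', h0⟩) this
    · exact h.zero c' hc' i hi hi'
  · obtain ⟨ha, -, hpv, -⟩ := pivotOn_of_some hp
    obtain ⟨hi, hi0, hi1⟩ := mem_of_pivotRow hp
    constructor
    · intro i' c' hc' j
      rw [hpv] at hc'
      by_cases hii : i' = i
      · subst hii
        rw [Function.update_self] at hc'
        obtain rfl := Option.some_injective _ hc'
        rw [ha]
        by_cases hj : j = i'
        · simp [hj, hi1]
        · simp [hj, hi1, ZMod.two_add_self]
      · rw [Function.update_of_ne hii] at hc'
        have hu := h.unit i' c' hc'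
        rw [ha, hu j, hu i, if_neg (Ne.symm hii), mul_zero, ite_self, add_zero]
    · intro c' hc' j hj hjn
      have hji : j ≠ i := by
        rintro rfl
        rw [hpv, Function.update_self] at hjn
        cases hjn
      rw [hpv, Function.update_of_ne hji] at hjn
      rw [ha, if_neg hji]
      rcases List.mem_cons.1 hc' with rfl | hc'
      · rw [hi1, mul_one, ZMod.two_add_self]
      · rw [h.zero c' hc' j hj hjn, h.zero c' hc' i hi hi0]
        simp

theorem Reduced.foldl {rows : List (Fin q)} {done : List (Fin n)} {st : Elim q n}
    (h : Reduced rows done st) (cs : List (Fin n)) :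
    Reduced rows (cs.reverse ++ done) (cs.foldl (Elim.pivotOn rows) st) := by
  induction cs generalizing done st with
  | nil => exact h
  | cons c cs ih =>
    rw [List.foldl_cons, List.reverse_cons, List.append_assoc]
    exact ih (h.pivotOn c)

/-- The pivots that an elimination adds. -/
theorem piv_foldl (rows : List (Fin q)) (cs : List (Fin n)) (st : Elim q n) (i : Fin q) :
    (cs.foldl (Elim.pivotOn rows) st).piv i = st.piv i ∨
      st.piv i = none ∧ i ∈ rows ∧ ∃ c ∈ cs, (cs.foldl (Elim.pivotOn rows) st).piv i = some c := by
  induction cs generalizing st with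
  | nil => exact Or.inl rfl
  | cons c cs ih =>
    rw [List.foldl_cons]
    rcases hp : pivotRow rows st c with _ | i'
    · obtain ⟨-, -, hpv, -⟩ := pivotOn_of_none hp
      rcases ih (st.pivotOn rows c) with h | ⟨h1, h2, c', h3, h4⟩
      · exact Or.inl (h.trans (by rw [hpv]))
      · exact Or.inr ⟨by rwa [hpv] at h1, h2, c', List.mem_cons_of_mem _ h3, h4⟩
    · obtain ⟨-, -, hpv, -⟩ := pivotOn_of_some hp
      obtain ⟨hi, hi0, -⟩ := mem_of_pivotRow hp
      by_cases hii : i = i'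
      · subst hii
        right
        refine ⟨hi0, hi, ?_⟩
        rcases ih (st.pivotOn rows c) with h | ⟨h1, -⟩
        · exact ⟨c, List.mem_cons_self, h.trans (by rw [hpv, Function.update_self])⟩
        · rw [hpv, Function.update_self] at h1
          cases h1
      · rcases ih (st.pivotOn rows c) with h | ⟨h1, h2, c', h3, h4⟩
        · exact Or.inl (h.trans (by rw [hpv, Function.update_of_ne hii]))
        · exact Or.inr ⟨by rwa [hpv, Function.update_of_ne hii] at h1, h2, c',
            List.mem_cons_of_mem _ h3, h4⟩

/-- Whether a linear condition holds on the rows in `rows` is not changed by an elimination with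
pivot rows in `rows`. -/
theorem residual_foldl (rows : List (Fin q)) (cs : List (Fin n)) (st : Elim q n)
    (x : Fin n → ZMod 2) :
    (∀ i ∈ rows, (cs.foldl (Elim.pivotOn rows) st).A.mulVec x i =
      (cs.foldl (Elim.pivotOn rows) st).s i) ↔ ∀ i ∈ rows, st.A.mulVec x i = st.s i := by
  induction cs generalizing st with
  | nil => exact Iff.rfl
  | cons c cs ih =>
    rw [List.foldl_cons, ih]
    rcases hp : pivotRow rows st c with _ | i
    · obtain ⟨ha, hs, -⟩ := pivotOn_of_none hp
      rw [ha, hs]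
    · have hact := acts_pivotOn_of_some hp
      have hi := (mem_of_pivotRow hp).1
      simp only [hact.mulVec, hact.rhs, clearEquiv_apply, clearFun]
      constructor
      · intro h j hj
        have h1 := h i hi
        have h2 := h j hj
        simp only [if_true, add_zero] at h1
        rw [h1] at h2
        exact add_right_cancel h2
      · intro h j hj
        rw [h j hj, h i hi]

/-- Only pivot rows are added, and they belong to `rows`. Hence the kept rows still vanish on the
window after the second elimination. -/
theorem zero_foldl {rows : List (Fin q)} (cs : List (Fin n)) {st : Elim q n} {c : Fin n}
    (h : ∀ i ∈ rows, st.A i c = 0) : ∀ i ∈ rows, (cs.foldl (Elim.pivotOn rows) st).A i c = 0 := by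
  induction cs generalizing st with
  | nil => exact h
  | cons c' cs ih =>
    rw [List.foldl_cons]
    refine ih ?_
    rcases hp : pivotRow rows st c' with _ | i
    · rw [(pivotOn_of_none hp).1]
      exact h
    · intro j hj
      rw [(pivotOn_of_some hp).1, h j hj, h i (mem_of_pivotRow hp).1]
      simp

end Elim

/-! ### Systematic form of the parity-check matrix. -/

section Puncture

variable {q n : ℕ}

theorem mem_windowCols {r : ℕ} {σ : Equiv.Perm (Fin n)} {c : Fin n} :
    c ∈ windowCols r q σ ↔ r ≤ (σ.symm c).val ∧ (σ.symm c).val < q := by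
  simp only [windowCols, List.mem_map, List.mem_filter, List.mem_finRange, true_and,
    decide_eq_true_eq]
  constructor
  · rintro ⟨t, ht, rfl⟩
    simpa using ht
  · intro h
    exact ⟨σ.symm c, h, by simp⟩

theorem mem_otherCols {r : ℕ} {σ : Equiv.Perm (Fin n)} {c : Fin n} :
    c ∈ otherCols r q σ ↔ c ∉ windowCols r q σ := by
  rw [mem_windowCols]
  simp only [otherCols, List.mem_map, List.mem_filter, List.mem_finRange, true_and,
    decide_eq_true_eq]
  constructor
  · rintro ⟨t, ht, rfl⟩
    simpa using ht
  · intro h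
    exact ⟨σ.symm c, h, by simp⟩

theorem nodup_windowCols (r : ℕ) (σ : Equiv.Perm (Fin n)) : (windowCols r q σ).Nodup :=
  ((List.nodup_finRange n).filter _).map σ.injective

theorem nodup_otherCols (r : ℕ) (σ : Equiv.Perm (Fin n)) : (otherCols r q σ).Nodup :=
  ((List.nodup_finRange n).filter _).map σ.injective

theorem length_windowCols {r : ℕ} (hqn : q ≤ n) (σ : Equiv.Perm (Fin n)) :
    (windowCols r q σ).length = q - r := by
  rw [windowCols, List.length_map, ← List.toFinset_card_of_nodup ((List.nodup_finRange n).filter _),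
    ← Finset.card_map Fin.valEmbedding, ← Nat.card_Ico]
  congr 1
  ext i
  simp only [Finset.mem_map, List.mem_toFinset, List.mem_filter, List.mem_finRange, true_and,
    decide_eq_true_eq, Fin.valEmbedding_apply, Finset.mem_Ico]
  constructor
  · rintro ⟨a, ha, rfl⟩
    exact ha
  · intro h
    exact ⟨⟨i, by omega⟩, h, rfl⟩

theorem length_windowCols_add (r : ℕ) (σ : Equiv.Perm (Fin n)) :
    (windowCols r q σ).length + (otherCols r q σ).length = n := by
  have h1 := List.length_eq_length_filter_add (l := List.finRange n)
    (fun t => decide (r ≤ t.val ∧ t.val < q))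
  rw [List.length_finRange] at h1
  rw [windowCols, otherCols, List.length_map, List.length_map]
  conv_rhs => rw [h1]
  simp only [decide_not]

variable (r : ℕ) (σ : Equiv.Perm (Fin n)) (H : Matrix (Fin q) (Fin n) (ZMod 2)) (s : Fin q → ZMod 2)

/-- The state after the elimination of the window columns. -/
def windowStage : Elim q n :=
  (windowCols r q σ).foldl (Elim.pivotOn (List.finRange q)) ⟨H, s, fun _ => none, 0⟩

/-- The rows that are kept. -/
def keptRows : List (Fin q) :=
  ((List.finRange q).filter fun i => decide ((windowStage r σ H s).piv i = none)).take r

theorem puncture_el : (puncture r H s σ).el =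
    (otherCols r q σ).foldl (Elim.pivotOn (keptRows r σ H s)) (windowStage r σ H s) := rfl

theorem puncture_free : (puncture r H s σ).free =
    (otherCols r q σ).filter fun c => decide (∀ i, (puncture r H s σ).el.piv i ≠ some c) := rfl

/-- The row operations depend only on the window columns. -/
theorem exists_windowStage_acts : ∃ G, ∀ H₂ s₂, (∀ c ∈ windowCols r q σ, ∀ i, H₂ i c = H i c) →
    Elim.Acts G ⟨H₂, s₂, fun _ => none, 0⟩ (windowStage r σ H₂ s₂) ∧
      (windowStage r σ H₂ s₂).piv = (windowStage r σ H s).piv := by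
  obtain ⟨G, hG⟩ := Elim.exists_acts_foldl (List.finRange q) (windowCols r q σ)
    ⟨H, s, fun _ => none, 0⟩
  exact ⟨G, fun H₂ s₂ h => hG ⟨H₂, s₂, fun _ => none, 0⟩ rfl h⟩

theorem windowStage_reduced :
    Elim.Reduced (List.finRange q) (windowCols r q σ).reverse (windowStage r σ H s) := by
  have h : Elim.Reduced (List.finRange q) [] (⟨H, s, fun _ => none, 0⟩ : Elim q n) :=
    ⟨fun i c hc => by simp at hc, by simp⟩
  have := h.foldl (windowCols r q σ)
  rwa [List.append_nil] at this

theorem windowStage_piv {i : Fin q} {c : Fin n} (h : (windowStage r σ H s).piv i = some c) :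
    c ∈ windowCols r q σ := by
  rcases Elim.piv_foldl (List.finRange q) (windowCols r q σ) ⟨H, s, fun _ => none, 0⟩ i with
    h' | ⟨-, -, c', hc', h'⟩
  · rw [windowStage, h'] at h
    simp at h
  · rw [windowStage, h'] at h
    obtain rfl := Option.some_injective _ h
    exact hc'

theorem Elim.Reduced.piv_injective {rows : List (Fin q)} {done : List (Fin n)} {st : Elim q n}
    (h : st.Reduced rows done) {i i' : Fin q} {c : Fin n} (hi : st.piv i = some c)
    (hi' : st.piv i' = some c) : i = i' := by
  by_contra hne
  have h1 := h.unit i c hi i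
  rw [h.unit i' c hi' i, if_pos rfl, if_neg hne] at h1
  exact absurd h1 (by decide)

theorem nodup_keptRows : (keptRows r σ H s).Nodup :=
  ((List.nodup_finRange q).filter _).sublist (List.take_sublist _ _)

theorem mem_keptRows {i : Fin q} (h : i ∈ keptRows r σ H s) :
    (windowStage r σ H s).piv i = none := by
  simpa using (List.mem_filter.1 (List.mem_of_mem_take h)).2

/-- Distinct rows have distinct pivots among the `q - r` window columns, so at least `r` rows remain
without one, also when the window is dependent. -/
theorem length_keptRows (hqn : q ≤ n) (hr : r ≤ q) : (keptRows r σ H s).length = r := by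
  have h1 : ((Finset.univ.filter fun i => ¬ (windowStage r σ H s).piv i = none)).card ≤ q - r := by
    rw [← length_windowCols hqn σ, ← List.toFinset_card_of_nodup (nodup_windowCols r σ)]
    -- The default value is never attained, since only rows with a pivot are mapped.
    refine Finset.card_le_card_of_injOn
      (fun i => ((windowStage r σ H s).piv i).getD ⟨0, ?_⟩) ?_ ?_
    · have := i.2
      omega
    · intro i hi
      obtain ⟨c, hc⟩ := Option.ne_none_iff_exists'.1 (Finset.mem_filter.1 hi).2
      simp only [hc, Option.getD_some]
      exact List.mem_toFinset.2 (windowStage_piv r σ H s hc)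
    · intro i hi i' hi' h
      obtain ⟨c, hc⟩ := Option.ne_none_iff_exists'.1 (Finset.mem_filter.1 hi).2
      obtain ⟨c', hc'⟩ := Option.ne_none_iff_exists'.1 (Finset.mem_filter.1 hi').2
      simp only [hc, hc', Option.getD_some] at h
      subst h
      exact (windowStage_reduced r σ H s).piv_injective hc hc'
  have h2 := Finset.card_filter_add_card_filter_not (s := (Finset.univ : Finset (Fin q)))
    (fun i => (windowStage r σ H s).piv i = none)
  have h3 : ((List.finRange q).filter fun i => decide ((windowStage r σ H s).piv i = none)).length =
      (Finset.univ.filter fun i => (windowStage r σ H s).piv i = none).card := by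
    rw [← List.toFinset_card_of_nodup ((List.nodup_finRange q).filter _)]
    congr 1
    ext i
    simp
  rw [Finset.card_univ, Fintype.card_fin] at h2
  rw [keptRows, List.length_take, h3]
  omega

theorem windowStage_zero {i : Fin q} (hi : i ∈ keptRows r σ H s) {c : Fin n}
    (hc : c ∈ windowCols r q σ) : (windowStage r σ H s).A i c = 0 :=
  (windowStage_reduced r σ H s).zero c (List.mem_reverse.2 hc) i (List.mem_finRange i)
    (mem_keptRows r σ H s hi)

theorem puncture_reduced :
    Elim.Reduced (keptRows r σ H s) (otherCols r q σ).reverse (puncture r H s σ).el := by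
  have h : Elim.Reduced (keptRows r σ H s) [] (windowStage r σ H s) :=
    ⟨(windowStage_reduced r σ H s).unit, by simp⟩
  have := h.foldl (otherCols r q σ)
  rwa [List.append_nil] at this

theorem puncture_zero {i : Fin q} (hi : i ∈ keptRows r σ H s) {c : Fin n}
    (hc : c ∈ windowCols r q σ) : (puncture r H s σ).el.A i c = 0 :=
  Elim.zero_foldl _ (fun _ hi => windowStage_zero r σ H s hi hc) i hi

theorem puncture_acts : ∃ G, Elim.Acts G ⟨H, s, fun _ => none, 0⟩ (puncture r H s σ).el := by
  obtain ⟨G, hG⟩ := exists_windowStage_acts r σ H s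
  obtain ⟨G', hG'⟩ := Elim.exists_acts_foldl (keptRows r σ H s) (otherCols r q σ)
    (windowStage r σ H s)
  exact ⟨_, ((hG H s fun _ _ _ => rfl).1).trans (hG' _ rfl fun _ _ _ => rfl).1⟩

theorem puncture_piv_of_notMem {i : Fin q} (hi : i ∉ keptRows r σ H s) :
    (puncture r H s σ).el.piv i = (windowStage r σ H s).piv i := by
  rcases Elim.piv_foldl (keptRows r σ H s) (otherCols r q σ) (windowStage r σ H s) i with
    h | ⟨-, h, -⟩
  · exact h
  · exact absurd h hi

/-- A kept row without a pivot would be zero on the window and on all other columns, which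
contradicts surjectivity. -/
theorem puncture_piv_of_mem (hH : Function.Surjective H.mulVec) {i : Fin q}
    (hi : i ∈ keptRows r σ H s) :
    ∃ c, c ∉ windowCols r q σ ∧ (puncture r H s σ).el.piv i = some c := by
  rcases Elim.piv_foldl (keptRows r σ H s) (otherCols r q σ) (windowStage r σ H s) i with
    h | ⟨-, -, c, hc, h⟩
  · exfalso
    rw [mem_keptRows r σ H s hi] at h
    obtain ⟨G, hG⟩ := puncture_acts r σ H s
    have hrow : ∀ c, (puncture r H s σ).el.A i c = 0 := by
      intro c
      by_cases hc : c ∈ windowCols r q σ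
      · exact puncture_zero r σ H s hi hc
      · exact (puncture_reduced r σ H s).zero c (List.mem_reverse.2 (mem_otherCols.2 hc)) i hi h
    obtain ⟨x, hx⟩ := hH (G.symm (Pi.single i 1))
    have h1 := congrFun (hG.mulVec x) i
    rw [hx, LinearEquiv.apply_symm_apply, Pi.single_eq_same] at h1
    simp only [Matrix.mulVec, dotProduct, hrow, zero_mul, Finset.sum_const_zero] at h1
    exact absurd h1 (by decide)
  · exact ⟨c, mem_otherCols.1 hc, h⟩

/-- A pivot in the window belongs to a row that is not kept. -/
theorem puncture_piv_window (hH : Function.Surjective H.mulVec) {i : Fin q} {c : Fin n} :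
    (c ∈ windowCols r q σ ∧ (puncture r H s σ).el.piv i = some c) ↔
      (windowStage r σ H s).piv i = some c := by
  constructor
  · rintro ⟨hc, h⟩
    rw [← puncture_piv_of_notMem]
    · exact h
    · intro hi
      obtain ⟨c', hc', h'⟩ := puncture_piv_of_mem r σ H s hH hi
      rw [h] at h'
      obtain rfl := Option.some_injective _ h'
      exact hc' hc
  · intro h
    refine ⟨windowStage_piv r σ H s h, ?_⟩
    rw [puncture_piv_of_notMem]
    · exact h
    · intro hi
      rw [mem_keptRows r σ H s hi] at h
      cases h

/-- The unknowns of the punctured instance are the columns outside the window. -/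
theorem exists_labelling {k : ℕ} (hk : q + k = n) (hr : r ≤ q) (hH : Function.Surjective H.mulVec) :
    ∃ lab : Fin r ⊕ Fin k → Fin n, Function.Injective lab ∧
      (∀ c, c ∉ windowCols r q σ ↔ ∃ x, lab x = c) ∧
      (∀ t : Fin r, ∃ i, (puncture r H s σ).rows[t.val]? = some i ∧ i ∈ keptRows r σ H s ∧
        (puncture r H s σ).el.piv i = some (lab (Sum.inl t))) ∧
      (∀ i ∈ keptRows r σ H s, ∃ t : Fin r, (puncture r H s σ).rows[t.val]? = some i) ∧
      ∀ j : Fin k, (puncture r H s σ).free[j.val]? = some (lab (Sum.inr j)) := by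
  have hlen := length_keptRows r σ H s (by omega) hr
  have hrow : ∀ t : Fin r, ∃ c, c ∉ windowCols r q σ ∧
      (puncture r H s σ).el.piv ((keptRows r σ H s)[t.val]'(by rw [hlen]; exact t.2)) = some c :=
    fun t => puncture_piv_of_mem r σ H s hH (List.getElem_mem _)
  choose pc hpc1 hpc2 using hrow
  have hpcinj : Function.Injective pc := by
    intro t t' h
    have h1 := hpc2 t
    rw [h] at h1
    have h2 := (puncture_reduced r σ H s).piv_injective h1 (hpc2 t')
    exact Fin.ext (((nodup_keptRows r σ H s).getElem_inj_iff).1 h2)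
  set free := (puncture r H s σ).free with hfree
  have hfnd : free.Nodup := (nodup_otherCols r σ).filter _
  have hmemfree : ∀ c, c ∈ free ↔ c ∉ windowCols r q σ ∧ ∀ t, pc t ≠ c := by
    intro c
    rw [hfree, puncture_free, List.mem_filter, mem_otherCols, decide_eq_true_eq]
    refine and_congr_right fun hc => ?_
    constructor
    · intro h t ht
      exact h _ (by rw [hpc2 t, ht])
    · intro h i hi
      by_cases hik : i ∈ keptRows r σ H s
      · obtain ⟨t, ht, rfl⟩ := List.getElem_of_mem hik
        rw [hlen] at ht
        have := hpc2 ⟨t, ht⟩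
        rw [hi] at this
        exact h ⟨t, ht⟩ (Option.some_injective _ this).symm
      · rw [puncture_piv_of_notMem r σ H s hik] at hi
        exact hc (windowStage_piv r σ H s hi)
  have hflen : free.length = k := by
    have h1 : free.toFinset = (otherCols r q σ).toFinset \ Finset.univ.image pc := by
      ext c
      simp [hmemfree, mem_otherCols]
    rw [← List.toFinset_card_of_nodup hfnd, h1, Finset.card_sdiff_of_subset,
      Finset.card_image_of_injective _ hpcinj, List.toFinset_card_of_nodup (nodup_otherCols r σ)]
    · have h2 := length_windowCols_add (q := q) r σ
      rw [length_windowCols (by omega) σ] at h2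
      simp only [Finset.card_univ, Fintype.card_fin]
      omega
    · intro c hc
      obtain ⟨t, -, rfl⟩ := Finset.mem_image.1 hc
      exact List.mem_toFinset.2 (mem_otherCols.2 (hpc1 t))
  refine ⟨Sum.elim pc fun j => free[j.val]'(by rw [hflen]; exact j.2), ?_, ?_, ?_, ?_, ?_⟩
  · rintro (t | j) (t' | j') h
    · exact congrArg Sum.inl (hpcinj h)
    · exact absurd h (((hmemfree _).1 (List.getElem_mem _)).2 t)
    · exact absurd h.symm (((hmemfree _).1 (List.getElem_mem _)).2 t')
    · exact congrArg Sum.inr (Fin.ext ((hfnd.getElem_inj_iff).1 h))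
  · intro c
    constructor
    · intro hc
      by_cases h : ∃ t, pc t = c
      · obtain ⟨t, ht⟩ := h
        exact ⟨Sum.inl t, ht⟩
      · have : c ∈ free := (hmemfree c).2 ⟨hc, fun t ht => h ⟨t, ht⟩⟩
        obtain ⟨j, hj, rfl⟩ := List.getElem_of_mem this
        exact ⟨Sum.inr ⟨j, by rwa [hflen] at hj⟩, rfl⟩
    · rintro ⟨t | j, rfl⟩
      · exact hpc1 t
      · exact ((hmemfree _).1 (List.getElem_mem _)).1
  · intro t
    exact ⟨_, List.getElem?_eq_getElem _, List.getElem_mem _, hpc2 t⟩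
  · intro i hi
    obtain ⟨t, ht, rfl⟩ := List.getElem_of_mem hi
    exact ⟨⟨t, by rwa [hlen] at ht⟩, List.getElem?_eq_getElem _⟩
  · intro j
    exact List.getElem?_eq_getElem _

end Puncture

/-! ### Solutions of the punctured instance and their lifts. -/

section Puncture

variable {q n : ℕ}

theorem ZMod.two_add_eq_zero_iff (a b : ZMod 2) : a + b = 0 ↔ a = b := by
  revert a b; decide

variable (r : ℕ) (σ : Equiv.Perm (Fin n)) (H : Matrix (Fin q) (Fin n) (ZMod 2)) (s : Fin q → ZMod 2)

/-- The homogeneous equations of the punctured instance. -/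
def KeptZero (v : Fin n → ZMod 2) : Prop :=
  ∀ i ∈ keptRows r σ H 0, (windowStage r σ H 0).A.mulVec v i = 0

instance (v : Fin n → ZMod 2) : Decidable (KeptZero r σ H v) :=
  inferInstanceAs (Decidable (∀ i ∈ keptRows r σ H 0, _))

/-- The window columns that are not pivot columns. -/
def looseCols : Finset (Fin n) :=
  (windowCols r q σ).toFinset.filter fun c => ∀ i, (windowStage r σ H 0).piv i ≠ some c

theorem windowStage_piv_eq : (windowStage r σ H s).piv = (windowStage r σ H 0).piv := by
  obtain ⟨G, hG⟩ := exists_windowStage_acts r σ H 0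
  exact (hG H s fun _ _ _ => rfl).2

theorem keptRows_eq : keptRows r σ H s = keptRows r σ H 0 := by
  rw [keptRows, keptRows, windowStage_piv_eq]

/-- Adding the solution `e` makes the equations homogeneous. The syndrome disappears, which allows
averaging over `H` for fixed `e`. -/
theorem puncture_sol_iff {e : Fin n → ZMod 2} (he : H.mulVec e = s) (x : Fin n → ZMod 2) :
    (∀ i ∈ keptRows r σ H s, (puncture r H s σ).el.A.mulVec x i = (puncture r H s σ).el.s i) ↔
      KeptZero r σ H (x + e) := by
  rw [puncture_el, Elim.residual_foldl, KeptZero, keptRows_eq]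
  obtain ⟨G, hG⟩ := exists_windowStage_acts r σ H 0
  have h1 := (hG H s fun _ _ _ => rfl).1
  have h0 := (hG H 0 fun _ _ _ => rfl).1
  refine forall₂_congr fun i _ => ?_
  rw [h1.mulVec, h1.rhs, h0.mulVec]
  simp only
  rw [Matrix.mulVec_add, map_add, Pi.add_apply, he, ZMod.two_add_eq_zero_iff]

variable {k : ℕ} {lab : Fin r ⊕ Fin k → Fin n}

/-- Kept rows vanish on the window and their pivot columns are unit vectors, so each reads its pivot
coordinate plus the free ones. -/
theorem sysSol_puncture_iff (hinj : Function.Injective lab)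
    (hlab : ∀ c, c ∉ windowCols r q σ ↔ ∃ x, lab x = c)
    (hrow : ∀ t : Fin r, ∃ i, (puncture r H s σ).rows[t.val]? = some i ∧ i ∈ keptRows r σ H s ∧
      (puncture r H s σ).el.piv i = some (lab (Sum.inl t)))
    (hrows : ∀ i ∈ keptRows r σ H s, ∃ t : Fin r, (puncture r H s σ).rows[t.val]? = some i)
    (hfree : ∀ j : Fin k, (puncture r H s σ).free[j.val]? = some (lab (Sum.inr j)))
    {e : Fin n → ZMod 2} (he : H.mulVec e = s) (x : Fin n → ZMod 2) :
    SysSol ((puncture r H s σ).matrix r k) ((puncture r H s σ).syndrome r) (x ∘ lab) ↔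
      KeptZero r σ H (x + e) := by
  rw [← puncture_sol_iff r σ H s he]
  have hkey : ∀ t i, (puncture r H s σ).rows[Fin.val t]? = some i → i ∈ keptRows r σ H s →
      (puncture r H s σ).el.piv i = some (lab (Sum.inl t)) →
      ((x ∘ lab) (Sum.inl t) + ∑ j, (puncture r H s σ).matrix r k t j * (x ∘ lab) (Sum.inr j) =
        (puncture r H s σ).syndrome r t ↔
        (puncture r H s σ).el.A.mulVec x i = (puncture r H s σ).el.s i) := by
    intro t i h1 h2 h3
    have hs : (puncture r H s σ).syndrome r t = (puncture r H s σ).el.s i := by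
      simp only [Punctured.syndrome, h1]
    have hm : ∀ j, (puncture r H s σ).matrix r k t j =
        (puncture r H s σ).el.A i (lab (Sum.inr j)) := by
      intro j
      simp only [Punctured.matrix, h1, hfree]
    have hsum : (puncture r H s σ).el.A.mulVec x i =
        ∑ y : Fin r ⊕ Fin k, (puncture r H s σ).el.A i (lab y) * x (lab y) := by
      symm
      refine Fintype.sum_of_injective lab hinj _ _ (fun c hc => ?_) fun _ => rfl
      have hc' : c ∈ windowCols r q σ := by
        by_contra h
        exact hc ((hlab c).1 h)
      beta_reduce
      rw [puncture_zero r σ H s h2 hc', zero_mul]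
    rw [hs, hsum, Fintype.sum_sum_type, Finset.sum_eq_single t]
    · rw [(puncture_reduced r σ H s).unit i _ h3 i, if_pos rfl, one_mul]
      simp only [Function.comp_apply, hm]
    · intro t' _ ht'
      obtain ⟨i', h1', h2', h3'⟩ := hrow t'
      rw [(puncture_reduced r σ H s).unit i' _ h3' i, if_neg, zero_mul]
      rintro rfl
      rw [h3] at h3'
      exact ht' (Sum.inl_injective (hinj (Option.some_injective _ h3'))).symm
    · simp
  constructor
  · intro h i hi
    obtain ⟨t, ht⟩ := hrows i hi
    obtain ⟨i', h1, h2, h3⟩ := hrow t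
    obtain rfl : i' = i := Option.some_injective _ (h1.symm.trans ht)
    exact (hkey t i' h1 h2 h3).1 (h t)
  · intro h t
    obtain ⟨i, h1, h2, h3⟩ := hrow t
    exact (hkey t i h1 h2 h3).2 (h i h2)

/-- A window pivot column is a unit vector, so its row determines the coordinate from the others;
the coins have to be right only on the window columns without a pivot. -/
theorem lift_puncture (hH : Function.Surjective H.mulVec) (hinj : Function.Injective lab)
    (hlab : ∀ c, c ∉ windowCols r q σ ↔ ∃ x, lab x = c)
    (hrow : ∀ t : Fin r, ∃ i, (puncture r H s σ).rows[t.val]? = some i ∧ i ∈ keptRows r σ H s ∧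
      (puncture r H s σ).el.piv i = some (lab (Sum.inl t)))
    (hfree : ∀ j : Fin k, (puncture r H s σ).free[j.val]? = some (lab (Sum.inr j)))
    {e : Fin n → ZMod 2} (he : H.mulVec e = s) {z : Fin n → ZMod 2}
    (hz : ∀ c ∈ looseCols r σ H, z c = e c) :
    (puncture r H s σ).lift (windowCols r q σ) (e ∘ lab) z = e := by
  set P := puncture r H s σ with hP
  have hpw : ∀ i c, (c ∈ windowCols r q σ ∧ P.el.piv i = some c) ↔
      (windowStage r σ H 0).piv i = some c := by
    intro i c
    rw [← windowStage_piv_eq r σ H s]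
    exact puncture_piv_window r σ H s hH
  set x₀ : Fin n → ZMod 2 := fun c =>
    if c ∈ windowCols r q σ then
      if ∃ i, P.el.piv i = some c then 0 else z c
    else
      (∑ t : Fin r, if (P.rows[t.val]?).bind P.el.piv = some c then (e ∘ lab) (Sum.inl t) else 0) +
      ∑ j : Fin k, if P.free[j.val]? = some c then (e ∘ lab) (Sum.inr j) else 0 with hx₀
  have hlift : ∀ c, P.lift (windowCols r q σ) (e ∘ lab) z c = x₀ c + ∑ i : Fin q,
      if c ∈ windowCols r q σ ∧ P.el.piv i = some c then
        P.el.s i + ∑ c', P.el.A i c' * x₀ c' else 0 := fun _ => rfl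
  have hx : ∀ c, x₀ c = if c ∈ windowCols r q σ ∧ ∃ i, P.el.piv i = some c then 0 else e c := by
    intro c
    simp only [hx₀]
    by_cases hc : c ∈ windowCols r q σ
    · rw [if_pos hc]
      by_cases hp : ∃ i, P.el.piv i = some c
      · rw [if_pos hp, if_pos ⟨hc, hp⟩]
      · rw [if_neg hp, if_neg fun h => hp h.2]
        refine hz c (Finset.mem_filter.2 ⟨List.mem_toFinset.2 hc, fun i hi => hp ?_⟩)
        exact ⟨i, ((hpw i c).2 hi).2⟩
    · rw [if_neg hc, if_neg fun h => hc h.1]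
      obtain ⟨y, rfl⟩ := (hlab c).1 hc
      have h1 : ∀ t : Fin r, ((P.rows[t.val]?).bind P.el.piv = some (lab y)) ↔ Sum.inl t = y := by
        intro t
        obtain ⟨i, h1, -, h3⟩ := hrow t
        rw [h1, Option.bind_some, h3, Option.some_inj, hinj.eq_iff]
      have h2 : ∀ j : Fin k, (P.free[j.val]? = some (lab y)) ↔ Sum.inr j = y := by
        intro j
        rw [hfree j, Option.some_inj, hinj.eq_iff]
      simp only [h1, h2]
      rcases y with t | j
      · simp
      · simp
  obtain ⟨G, hG⟩ := puncture_acts r σ H s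
  have hsol : P.el.A.mulVec e = P.el.s := by
    rw [hG.mulVec, hG.rhs]
    simp only [he]
  have hred := puncture_reduced r σ H s
  have hval : ∀ i c, c ∈ windowCols r q σ → P.el.piv i = some c →
      P.el.s i + ∑ c', P.el.A i c' * x₀ c' = e c := by
    intro i c hc hi
    rw [← hsol, Matrix.mulVec, dotProduct, ← Finset.sum_add_distrib, Finset.sum_eq_single c]
    · rw [hx, if_pos ⟨hc, i, hi⟩, hred.unit i c hi i, if_pos rfl]
      simp
    · intro c' _ hc'
      rw [hx]
      split_ifs with h
      · obtain ⟨-, i', hi'⟩ := h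
        rw [hred.unit i' c' hi' i, if_neg]
        · simp
        · rintro rfl
          rw [hi] at hi'
          exact hc' (Option.some_injective _ hi').symm
      · exact ZMod.two_add_self _
    · simp
  funext c
  rw [hlift, hx]
  by_cases h : c ∈ windowCols r q σ ∧ ∃ i, P.el.piv i = some c
  · obtain ⟨hc, i, hi⟩ := h
    rw [if_pos ⟨hc, i, hi⟩, zero_add, Finset.sum_eq_single i]
    · rw [if_pos ⟨hc, hi⟩, hval i c hc hi]
    · intro i' _ hne
      rw [if_neg]
      rintro ⟨-, hi'⟩
      exact hne (hred.piv_injective hi' hi)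
    · simp
  · rw [if_neg h, Finset.sum_eq_zero, add_zero]
    intro i _
    rw [if_neg fun h' => h ⟨h'.1, i, h'.2⟩]

/-- The kernel vectors that are supported on the window. -/
def windowKernel : Finset (Fin n → ZMod 2) :=
  Finset.univ.filter fun z => (∀ c, c ∉ windowCols r q σ → z c = 0) ∧ H.mulVec z = 0

/-- Every choice of values on the loose columns is completed by the window pivots to a kernel vector
and can be read off from it. The inverse probability of guessing the coins is thus bounded by a
quantity that is easy to average. -/
theorem two_pow_looseCols_le : 2 ^ (looseCols r σ H).card ≤ (windowKernel r σ H).card := by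
  obtain ⟨G, hG⟩ := exists_windowStage_acts r σ H 0
  have hact := (hG H 0 fun _ _ _ => rfl).1
  have hred := windowStage_reduced r σ H 0
  set st := windowStage r σ H 0 with hst
  rw [← Finset.card_powerset]
  set ind : Finset (Fin n) → Fin n → ZMod 2 := fun F c => if c ∈ F then 1 else 0 with hind
  set ext : Finset (Fin n) → Fin n → ZMod 2 := fun F c => ind F c + ∑ i,
    if st.piv i = some c then st.A.mulVec (ind F) i else 0 with hext
  have hpiv : ∀ F ∈ (looseCols r σ H).powerset, ∀ c ∈ F, ∀ i, st.piv i ≠ some c := by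
    intro F hF c hc
    exact (Finset.mem_filter.1 (Finset.mem_powerset.1 hF hc)).2
  refine Finset.card_le_card_of_injOn ext ?_ ?_
  · intro F hF
    refine Finset.mem_coe.2 (Finset.mem_filter.2 ⟨Finset.mem_univ _, fun c hc => ?_, ?_⟩)
    · have h1 : c ∉ F := fun h => hc (List.mem_toFinset.1
        (Finset.mem_filter.1 (Finset.mem_powerset.1 hF h)).1)
      simp only [hext, hind, if_neg h1, zero_add]
      refine Finset.sum_eq_zero fun i _ => ?_
      rw [if_neg fun h => hc (windowStage_piv r σ H 0 h)]
    · apply G.injective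
      rw [map_zero]
      refine (hact.mulVec (ext F)).symm.trans ?_
      have hadd : ext F = ind F + fun c => ∑ i, if st.piv i = some c then
        st.A.mulVec (ind F) i else 0 := rfl
      rw [hadd, Matrix.mulVec_add]
      funext j
      rw [Pi.add_apply, Pi.zero_apply]
      -- The correction consists of unit columns, so it adds the residual of `ind F` in exactly the
      -- rows with a pivot. In the other rows `ind F` has no residual.
      have h2 : st.A.mulVec (fun c => ∑ i, if st.piv i = some c then
          st.A.mulVec (ind F) i else 0) j = ∑ i, if ∃ c, st.piv i = some c then
            (if j = i then st.A.mulVec (ind F) i else 0) else 0 := by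
        rw [Matrix.mulVec, dotProduct]
        simp only [Finset.mul_sum]
        rw [Finset.sum_comm]
        refine Finset.sum_congr rfl fun i _ => ?_
        rcases hp : st.piv i with _ | c
        · simp
        · rw [Finset.sum_eq_single c]
          · rw [hred.unit i c hp j]
            simp
          · intro c' _ hc'
            rw [if_neg (by simpa using Ne.symm hc'), mul_zero]
          · simp
      rw [h2]
      rcases hp : st.piv j with _ | c
      · rw [Finset.sum_eq_zero, add_zero]
        · rw [Matrix.mulVec, dotProduct]
          refine Finset.sum_eq_zero fun c _ => ?_
          by_cases hc : c ∈ F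
          · have hcw := (Finset.mem_filter.1 (Finset.mem_powerset.1 hF hc)).1
            rw [hred.zero c (List.mem_reverse.2 (List.mem_toFinset.1 hcw)) j
              (List.mem_finRange j) hp, zero_mul]
          · simp only [hind, if_neg hc, mul_zero]
        · intro i _
          by_cases hij : j = i
          · subst hij
            simp [hp]
          · simp [hij]
      · rw [Finset.sum_eq_single j]
        · rw [if_pos ⟨c, hp⟩, if_pos rfl, ZMod.two_add_self]
        · intro i _ hij
          rw [if_neg (Ne.symm hij), ite_self]
        · simp
  · intro F hF F' hF' h
    have hone : ∀ F ∈ (looseCols r σ H).powerset, ∀ c ∈ looseCols r σ H,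
        ext F c = if c ∈ F then 1 else 0 := by
      intro F hF c hc
      simp only [hext]
      rw [Finset.sum_eq_zero, add_zero]
      intro i _
      rw [if_neg ((Finset.mem_filter.1 hc).2 i)]
    have hsub : ∀ F ∈ (looseCols r σ H).powerset, ∀ F' ∈ (looseCols r σ H).powerset,
        ext F = ext F' → F ⊆ F' := by
      intro F hF F' hF' h c hc
      have hcl := Finset.mem_powerset.1 hF hc
      have := congrFun h c
      rw [hone F hF c hcl, hone F' hF' c hcl, if_pos hc] at this
      by_contra hc'
      rw [if_neg hc'] at this
      exact absurd this (by decide)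
    exact (hsub F hF F' hF' h).antisymm (hsub F' hF' F hF h.symm)

end Puncture

/-! ### Random rows orthogonal to one or two vectors. -/

section Halving

variable {n : ℕ}

/-- The vectors that are orthogonal to `a` and `b`. -/
def orthogonalPair (a b : Fin n → ZMod 2) : Finset (Fin n → ZMod 2) :=
  Finset.univ.filter fun v => v ⬝ᵥ a = 0 ∧ v ⬝ᵥ b = 0

/-- Translation by `v₀` exchanges the vectors orthogonal to `a` with the remaining ones. -/
theorem two_mul_card_filter (T : Finset (Fin n → ZMod 2)) {v₀ a : Fin n → ZMod 2}
    (hT : ∀ v ∈ T, v + v₀ ∈ T) (h : v₀ ⬝ᵥ a = 1) :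
    2 * (T.filter fun v => v ⬝ᵥ a = 0).card = T.card := by
  rw [← Finset.card_filter_add_card_filter_not (s := T) fun v => v ⬝ᵥ a = 0, two_mul]
  congr 1
  have hinv : ∀ v : Fin n → ZMod 2, v + v₀ + v₀ = v := by
    intro v
    funext i
    simp only [Pi.add_apply]
    rw [add_assoc, ZMod.two_add_self, add_zero]
  have hd : ∀ x : ZMod 2, x + 1 = 0 ↔ ¬ x = 0 := by decide
  refine Finset.card_nbij' (fun v => v + v₀) (fun v => v + v₀) ?_ ?_ (fun v _ => hinv v)
    fun v _ => hinv v
  · intro v hv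
    obtain ⟨h1, h2⟩ := Finset.mem_filter.1 hv
    refine Finset.mem_coe.2 (Finset.mem_filter.2 ⟨hT v h1, ?_⟩)
    rw [add_dotProduct, h, h2]
    decide
  · intro v hv
    obtain ⟨h1, h2⟩ := Finset.mem_filter.1 hv
    refine Finset.mem_coe.2 (Finset.mem_filter.2 ⟨hT v h1, ?_⟩)
    rw [add_dotProduct, h, hd]
    exact h2

theorem two_mul_card_orthogonal {a : Fin n → ZMod 2} (ha : a ≠ 0) :
    2 * (Finset.univ.filter fun v : Fin n → ZMod 2 => v ⬝ᵥ a = 0).card = 2 ^ n := by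
  obtain ⟨i, hi⟩ := Function.ne_iff.1 ha
  rw [two_mul_card_filter (v₀ := Pi.single i 1) Finset.univ (fun _ _ => Finset.mem_univ _)]
  · simp
  · rw [single_dotProduct, one_mul]
    exact (ZMod.two_cases (a i)).resolve_left hi

/-- Over `ZMod 2` the span of `b` is `{0, b}`, so `a` lies outside it; a sum of at most two unit
vectors separates them. -/
theorem exists_dotProduct_eq {a b : Fin n → ZMod 2} (ha : a ≠ 0) (hab : a ≠ b) :
    ∃ v, v ⬝ᵥ a = 1 ∧ v ⬝ᵥ b = 0 := by
  obtain ⟨i, hi⟩ := Function.ne_iff.1 ha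
  obtain ⟨j, hj⟩ := Function.ne_iff.1 hab
  have hi1 : a i = 1 := (ZMod.two_cases (a i)).resolve_left hi
  rcases ZMod.two_cases (b i) with hbi | hbi
  · exact ⟨Pi.single i 1, by simp [hi1], by simp [hbi]⟩
  · rcases ZMod.two_cases (a j) with haj | haj <;> rcases ZMod.two_cases (b j) with hbj | hbj
    · exact absurd (haj.trans hbj.symm) hj
    · refine ⟨Pi.single i 1 + Pi.single j 1, ?_, ?_⟩
      · simp [add_dotProduct, hi1, haj]
      · simp [add_dotProduct, hbi, hbj, ZMod.two_add_self]
    · exact ⟨Pi.single j 1, by simp [haj], by simp [hbj]⟩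
    · exact absurd (haj.trans hbj.symm) hj

/-- The fraction of the vectors that are orthogonal to `a` and `b`. -/
noncomputable def orthogonalRatio (a b : Fin n → ZMod 2) : ℝ :=
  (orthogonalPair a b).card / 2 ^ n

theorem orthogonalRatio_nonneg (a b : Fin n → ZMod 2) : 0 ≤ orthogonalRatio a b := by
  unfold orthogonalRatio
  positivity

theorem orthogonalRatio_le_one (a b : Fin n → ZMod 2) : orthogonalRatio a b ≤ 1 := by
  refine div_le_one_of_le₀ ?_ (by positivity)
  have := Finset.card_le_univ (orthogonalPair a b)
  rw [Fintype.card_fun, ZMod.card, Fintype.card_fin] at this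
  exact_mod_cast this

theorem orthogonalRatio_le_half {a b : Fin n → ZMod 2} (h : a ≠ 0 ∨ b ≠ 0) :
    orthogonalRatio a b ≤ 1 / 2 := by
  unfold orthogonalRatio
  rw [div_le_iff₀ (by positivity)]
  have key : 2 * (orthogonalPair a b).card ≤ 2 ^ n := by
    rcases h with h | h
    · rw [← two_mul_card_orthogonal h]
      exact Nat.mul_le_mul_left _ (Finset.card_le_card
        (Finset.monotone_filter_right _ fun v _ hv => hv.1))
    · rw [← two_mul_card_orthogonal h]
      exact Nat.mul_le_mul_left _ (Finset.card_le_card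
        (Finset.monotone_filter_right _ fun v _ hv => hv.2))
  have : (2 : ℝ) * (orthogonalPair a b).card ≤ 2 ^ n := by exact_mod_cast key
  linarith

theorem orthogonalRatio_le_quarter {a b : Fin n → ZMod 2} (ha : a ≠ 0) (hb : b ≠ 0) (hab : a ≠ b) :
    orthogonalRatio a b ≤ 1 / 4 := by
  unfold orthogonalRatio
  rw [div_le_iff₀ (by positivity)]
  obtain ⟨v, hv1, hv2⟩ := exists_dotProduct_eq ha hab
  have h1 := two_mul_card_filter (a := a) (v₀ := v)
    (Finset.univ.filter fun v : Fin n → ZMod 2 => v ⬝ᵥ b = 0) (by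
      intro u hu
      rw [Finset.mem_filter] at hu ⊢
      exact ⟨Finset.mem_univ _, by rw [add_dotProduct, hu.2, hv2, add_zero]⟩) hv1
  have h2 := two_mul_card_orthogonal hb
  have h3 : (Finset.univ.filter fun v : Fin n → ZMod 2 => v ⬝ᵥ b = 0).filter
      (fun v => v ⬝ᵥ a = 0) = orthogonalPair a b := by
    ext u
    simp [orthogonalPair, and_comm]
  rw [h3] at h1
  have h4 : 4 * (orthogonalPair a b).card = 2 ^ n := by omega
  have : (4 : ℝ) * (orthogonalPair a b).card = 2 ^ n := by exact_mod_cast h4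
  linarith

/-- The probability that `r` random rows are orthogonal to `a` and `b`. -/
theorem orthogonalRatio_pow_le (r : ℕ) (a b : Fin n → ZMod 2) :
    orthogonalRatio a b ^ r ≤ (1 / 2) ^ r * (1 / 2) ^ r + ((if a = 0 then (1 / 2) ^ r else 0) +
      (if b = 0 then (1 / 2) ^ r else 0) + (if a = b then (1 / 2) ^ r else 0)) +
      if a = 0 ∧ b = 0 then 1 else 0 := by
  have h0 := orthogonalRatio_nonneg a b
  have hp : (0 : ℝ) ≤ (1 / 2) ^ r := by positivity
  have hpp : (0 : ℝ) ≤ (1 / 2) ^ r * (1 / 2) ^ r := by positivity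
  have hite : ∀ P : Prop, ∀ [Decidable P], (0 : ℝ) ≤ if P then (1 / 2) ^ r else 0 := by
    intro P _
    split_ifs <;> positivity
  have hite1 : (0 : ℝ) ≤ if a = 0 ∧ b = 0 then 1 else 0 := by split_ifs <;> positivity
  have ha := hite (a = 0)
  have hb := hite (b = 0)
  have hab := hite (a = b)
  by_cases h1 : a = 0 ∧ b = 0
  · rw [if_pos h1] at hite1 ⊢
    have := pow_le_one₀ h0 (orthogonalRatio_le_one a b) (n := r)
    linarith
  · have hhalf : orthogonalRatio a b ^ r ≤ (1 / 2) ^ r :=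
      pow_le_pow_left₀ h0 (orthogonalRatio_le_half (by tauto)) r
    by_cases h2 : a = 0
    · rw [if_pos h2] at ha ⊢
      linarith
    · by_cases h3 : b = 0
      · rw [if_pos h3] at hb ⊢
        linarith
      · by_cases h4 : a = b
        · rw [if_pos h4] at hab ⊢
          linarith
        · have := pow_le_pow_left₀ h0 (orthogonalRatio_le_quarter h2 h3 h4) r
          rw [show (1 / 4 : ℝ) = 1 / 2 * (1 / 2) by norm_num, mul_pow] at this
          linarith

variable {q : ℕ}

theorem card_orthogonal_rows (I : Finset (Fin q)) (a b : Fin n → ZMod 2) :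
    ((Finset.univ.filter fun A : Matrix (Fin q) (Fin n) (ZMod 2) =>
      ∀ i ∈ I, A.mulVec a i = 0 ∧ A.mulVec b i = 0).card : ℝ) =
      orthogonalRatio a b ^ I.card * Fintype.card (Matrix (Fin q) (Fin n) (ZMod 2)) := by
  have h1 : (Finset.univ.filter fun A : Matrix (Fin q) (Fin n) (ZMod 2) =>
      ∀ i ∈ I, A.mulVec a i = 0 ∧ A.mulVec b i = 0).card =
      (Fintype.piFinset fun i : Fin q => if i ∈ I then orthogonalPair a b else Finset.univ).card := by
    refine Finset.card_equiv Matrix.of.symm fun A => ?_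
    rw [Fintype.mem_piFinset, Finset.mem_filter]
    simp only [Finset.mem_univ, true_and]
    refine forall_congr' fun i => ?_
    by_cases hi : i ∈ I
    · simp only [hi, true_imp_iff, if_true, orthogonalPair, Finset.mem_filter, Finset.mem_univ,
        true_and]
      rfl
    · simp [hi]
  have h2 : (Fintype.card (Matrix (Fin q) (Fin n) (ZMod 2)) : ℝ) = ∏ _i : Fin q, (2 : ℝ) ^ n := by
    rw [Fintype.card_congr (Matrix.of (m := Fin q) (n := Fin n) (α := ZMod 2)).symm,
      Fintype.card_fun, Fintype.card_fun, ZMod.card, Fintype.card_fin, Fintype.card_fin]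
    simp
  have h3 : orthogonalRatio a b ^ I.card = ∏ i : Fin q, if i ∈ I then orthogonalRatio a b else 1 := by
    rw [Finset.prod_ite_mem]
    simp
  rw [h1, Fintype.card_piFinset, h2, h3, ← Finset.prod_mul_distrib, Nat.cast_prod]
  refine Finset.prod_congr rfl fun i _ => ?_
  by_cases hi : i ∈ I
  · rw [if_pos hi, if_pos hi, orthogonalRatio]
    field_simp
  · rw [if_neg hi, if_neg hi]
    simp

end Halving

/-! ### Averages over all matrices. -/

section Average

variable {q n : ℕ}

/-- The matrix with the window columns of `H₁` and the other columns of `H₂`. -/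
def mixCols (W : List (Fin n)) (H₁ H₂ : Matrix (Fin q) (Fin n) (ZMod 2)) :
    Matrix (Fin q) (Fin n) (ZMod 2) := fun i c => if c ∈ W then H₁ i c else H₂ i c

/-- Exchanging the columns outside the window is an involution on pairs of matrices. So the two
parts of a uniform matrix may be drawn independently. -/
theorem sum_mixCols (W : List (Fin n)) (F : Matrix (Fin q) (Fin n) (ZMod 2) → ℝ) :
    ∑ H₁, ∑ H₂, F (mixCols W H₁ H₂) =
      Fintype.card (Matrix (Fin q) (Fin n) (ZMod 2)) * ∑ H, F H := by
  have hinv : Function.Involutive fun p : Matrix (Fin q) (Fin n) (ZMod 2) ×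
      Matrix (Fin q) (Fin n) (ZMod 2) => (mixCols W p.1 p.2, mixCols W p.2 p.1) := by
    rintro ⟨A, B⟩
    refine Prod.ext ?_ ?_ <;>
    · funext i c
      by_cases hc : c ∈ W <;> simp [mixCols, hc]
  have h1 : ∑ p : Matrix (Fin q) (Fin n) (ZMod 2) × Matrix (Fin q) (Fin n) (ZMod 2),
      F (mixCols W p.1 p.2) = ∑ p : Matrix (Fin q) (Fin n) (ZMod 2) ×
        Matrix (Fin q) (Fin n) (ZMod 2), F p.1 :=
    Equiv.sum_comp hinv.toPerm fun p : Matrix (Fin q) (Fin n) (ZMod 2) ×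
      Matrix (Fin q) (Fin n) (ZMod 2) => F p.1
  rw [← Fintype.sum_prod_type', h1, Fintype.sum_prod_type]
  simp only [Finset.sum_const, Finset.card_univ, nsmul_eq_mul]
  rw [← Finset.mul_sum]

/-- Apply a linear map to all columns of a matrix. -/
def colMap (G : (Fin q → ZMod 2) ≃ₗ[ZMod 2] (Fin q → ZMod 2)) :
    Matrix (Fin q) (Fin n) (ZMod 2) ≃ Matrix (Fin q) (Fin n) (ZMod 2) where
  toFun A := fun i c => G (fun i => A i c) i
  invFun A := fun i c => G.symm (fun i => A i c) i
  left_inv A := by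
    funext i c
    change G.symm (fun i => G (fun i => A i c) i) i = _
    exact congrFun (G.symm_apply_apply fun i => A i c) i
  right_inv A := by
    funext i c
    change G (fun i => G.symm (fun i => A i c) i) i = _
    exact congrFun (G.apply_symm_apply fun i => A i c) i

theorem colMap_mulVec (G : (Fin q → ZMod 2) ≃ₗ[ZMod 2] (Fin q → ZMod 2))
    (A : Matrix (Fin q) (Fin n) (ZMod 2)) (x : Fin n → ZMod 2) :
    (colMap G A).mulVec x = G (A.mulVec x) :=
  Elim.Acts.mulVec (st := ⟨A, 0, fun _ => none, 0⟩) (st' := ⟨colMap G A, G 0, fun _ => none, 0⟩)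
    ⟨fun _ => rfl, rfl⟩ x

/-- A vector is supported outside the window. -/
def OffWindow (W : List (Fin n)) (v : Fin n → ZMod 2) : Prop := ∀ c ∈ W, v c = 0

theorem mixCols_mulVec_off {W : List (Fin n)} {v : Fin n → ZMod 2} (hv : OffWindow W v)
    (H₁ H₂ : Matrix (Fin q) (Fin n) (ZMod 2)) : (mixCols W H₁ H₂).mulVec v = H₂.mulVec v := by
  funext i
  simp only [Matrix.mulVec, dotProduct]
  refine Finset.sum_congr rfl fun c _ => ?_
  by_cases hc : c ∈ W
  · rw [hv c hc, mul_zero, mul_zero]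
  · simp [mixCols, hc]

theorem windowKernel_mixCols (r : ℕ) (σ : Equiv.Perm (Fin n))
    (H₁ H₂ : Matrix (Fin q) (Fin n) (ZMod 2)) :
    windowKernel r σ (mixCols (windowCols r q σ) H₁ H₂) = windowKernel r σ H₁ := by
  ext z
  simp only [windowKernel, Finset.mem_filter, Finset.mem_univ, true_and]
  refine and_congr_right fun hz => ?_
  have : (mixCols (windowCols r q σ) H₁ H₂).mulVec z = H₁.mulVec z := by
    funext i
    simp only [Matrix.mulVec, dotProduct]
    refine Finset.sum_congr rfl fun c _ => ?_
    by_cases hc : c ∈ windowCols r q σ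
    · simp [mixCols, hc]
    · rw [hz c hc, mul_zero, mul_zero]
  rw [this]

/-- The kernel vectors on the window and the equations of the kept rows are independent. -/
theorem sum_windowKernel_keptZero {r : ℕ} (hqn : q ≤ n) (hr : r ≤ q) (σ : Equiv.Perm (Fin n))
    {a b : Fin n → ZMod 2} (ha : OffWindow (windowCols r q σ) a)
    (hb : OffWindow (windowCols r q σ) b) :
    ∑ H : Matrix (Fin q) (Fin n) (ZMod 2), ((windowKernel r σ H).card : ℝ) *
      (if KeptZero r σ H a ∧ KeptZero r σ H b then 1 else 0) =
      orthogonalRatio a b ^ r * ∑ H : Matrix (Fin q) (Fin n) (ZMod 2),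
        ((windowKernel r σ H).card : ℝ) := by
  have hcard : (Fintype.card (Matrix (Fin q) (Fin n) (ZMod 2)) : ℝ) ≠ 0 := by
    exact_mod_cast Fintype.card_ne_zero
  apply mul_left_cancel₀ hcard
  rw [← sum_mixCols (windowCols r q σ), Finset.mul_sum, Finset.mul_sum]
  refine Finset.sum_congr rfl fun H₁ _ => ?_
  simp only [windowKernel_mixCols]
  rw [← Finset.mul_sum]
  -- With the window columns fixed, the row operations and the kept rows are fixed too; `colMap G`
  -- permutes the choices of the other columns, so the kept rows are uniform there.
  obtain ⟨G, hG⟩ := exists_windowStage_acts r σ H₁ 0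
  have hkept : ∀ H₂, ∀ v, OffWindow (windowCols r q σ) v →
      (KeptZero r σ (mixCols (windowCols r q σ) H₁ H₂) v ↔
        ∀ i ∈ keptRows r σ H₁ 0, (colMap G H₂).mulVec v i = 0) := by
    intro H₂ v hv
    obtain ⟨h1, h2⟩ := hG (mixCols (windowCols r q σ) H₁ H₂) 0 fun c hc i => by simp [mixCols, hc]
    have h3 : keptRows r σ (mixCols (windowCols r q σ) H₁ H₂) 0 = keptRows r σ H₁ 0 := by
      rw [keptRows, keptRows, h2]
    rw [KeptZero, h3]
    refine forall₂_congr fun i _ => ?_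
    rw [h1.mulVec, colMap_mulVec, mixCols_mulVec_off hv]
  have hcount := card_orthogonal_rows (keptRows r σ H₁ 0).toFinset a b
  rw [List.toFinset_card_of_nodup (nodup_keptRows r σ H₁ 0), length_keptRows r σ H₁ 0 hqn hr]
    at hcount
  have hsum : ∑ H₂, (if KeptZero r σ (mixCols (windowCols r q σ) H₁ H₂) a ∧
      KeptZero r σ (mixCols (windowCols r q σ) H₁ H₂) b then (1 : ℝ) else 0) =
      orthogonalRatio a b ^ r * Fintype.card (Matrix (Fin q) (Fin n) (ZMod 2)) := by
    rw [← hcount, Finset.card_filter, Nat.cast_sum]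
    refine Eq.trans ?_ ((colMap G).sum_comp _)
    refine Finset.sum_congr rfl fun H₂ _ => ?_
    rw [Nat.cast_ite, Nat.cast_one, Nat.cast_zero]
    refine if_congr ?_ rfl rfl
    rw [hkept H₂ a ha, hkept H₂ b hb]
    simp only [List.mem_toFinset]
    exact ⟨fun h i hi => ⟨h.1 i hi, h.2 i hi⟩, fun h => ⟨fun i hi => (h i hi).1,
      fun i hi => (h i hi).2⟩⟩
  rw [hsum]
  ring

theorem card_supported (T : Finset (Fin n)) :
    (Finset.univ.filter fun x : Fin n → ZMod 2 => vsupp x ⊆ T).card = 2 ^ T.card := by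
  rw [← Finset.card_powerset]
  refine Finset.card_nbij' vsupp (fun K c => if c ∈ K then 1 else 0) ?_ ?_ ?_ ?_
  · intro x hx
    exact Finset.mem_coe.2 (Finset.mem_powerset.2 (Finset.mem_filter.1 hx).2)
  · intro K hK
    refine Finset.mem_coe.2 (Finset.mem_filter.2 ⟨Finset.mem_univ _, fun c hc => ?_⟩)
    have := mem_vsupp.1 hc
    by_contra h
    exact this (if_neg fun h' => h (Finset.mem_powerset.1 hK h'))
  · intro x _
    funext c
    rcases ZMod.two_cases (x c) with h | h <;> simp [mem_vsupp, h]
  · intro K _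
    ext c
    simp [mem_vsupp]

/-- On average, there are few kernel vectors on the window. -/
theorem sum_windowKernel_le {r : ℕ} (hqn : q ≤ n) (σ : Equiv.Perm (Fin n)) :
    ∑ H : Matrix (Fin q) (Fin n) (ZMod 2), ((windowKernel r σ H).card : ℝ) ≤
      2 * Fintype.card (Matrix (Fin q) (Fin n) (ZMod 2)) := by
  set Z := Finset.univ.filter fun z : Fin n → ZMod 2 => vsupp z ⊆ (windowCols r q σ).toFinset with hZ
  -- At most `2 ^ q` vectors live on the window, and a nonzero one is in the kernel with probability
  -- at most `2 ^ (-q)`. Together with the zero vector this gives the constant 2.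
  have hZcard : Z.card ≤ 2 ^ q := by
    rw [hZ, card_supported, List.toFinset_card_of_nodup (nodup_windowCols r σ),
      length_windowCols hqn]
    exact Nat.pow_le_pow_right (by norm_num) (Nat.sub_le _ _)
  have h1 : ∀ H : Matrix (Fin q) (Fin n) (ZMod 2), ((windowKernel r σ H).card : ℝ) =
      ∑ z ∈ Z, if H.mulVec z = 0 then 1 else 0 := by
    intro H
    rw [← Finset.sum_filter, Finset.sum_const, nsmul_eq_mul, mul_one]
    congr 2
    ext z
    simp only [windowKernel, hZ, Finset.mem_filter, Finset.mem_univ, true_and]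
    refine and_congr_left fun _ => ?_
    rw [Finset.subset_iff]
    refine forall_congr' fun c => ?_
    rw [mem_vsupp, List.mem_toFinset, not_imp_comm]
  simp only [h1]
  rw [Finset.sum_comm]
  have h2 : ∀ z ∈ Z, ∑ H : Matrix (Fin q) (Fin n) (ZMod 2), (if H.mulVec z = 0 then (1 : ℝ) else 0) ≤
      ((1 / 2) ^ q + if z = 0 then 1 else 0) *
        Fintype.card (Matrix (Fin q) (Fin n) (ZMod 2)) := by
    intro z _
    have h := card_orthogonal_rows (q := q) Finset.univ z z
    rw [Finset.card_univ, Fintype.card_fin] at h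
    have e : ∑ H : Matrix (Fin q) (Fin n) (ZMod 2), (if H.mulVec z = 0 then (1 : ℝ) else 0) =
        orthogonalRatio z z ^ q * Fintype.card (Matrix (Fin q) (Fin n) (ZMod 2)) := by
      rw [← h, ← Finset.sum_filter, Finset.sum_const, nsmul_eq_mul, mul_one]
      congr 2
      ext H
      simp [funext_iff]
    rw [e]
    gcongr
    by_cases hz : z = 0
    · rw [if_pos hz]
      have := pow_le_one₀ (orthogonalRatio_nonneg z z) (orthogonalRatio_le_one z z) (n := q)
      have h0 : (0 : ℝ) ≤ (1 / 2) ^ q := by positivity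
      linarith
    · rw [if_neg hz, add_zero]
      exact pow_le_pow_left₀ (orthogonalRatio_nonneg z z) (orthogonalRatio_le_half (Or.inl hz)) q
  refine (Finset.sum_le_sum h2).trans ?_
  rw [← Finset.sum_mul]
  gcongr
  rw [Finset.sum_add_distrib, Finset.sum_const, nsmul_eq_mul]
  have h3 : (Z.card : ℝ) * (1 / 2) ^ q ≤ 1 := by
    calc (Z.card : ℝ) * (1 / 2) ^ q ≤ 2 ^ q * (1 / 2) ^ q := by
          gcongr
          exact_mod_cast hZcard
      _ = 1 := by rw [← mul_pow]; norm_num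
  have h4 : ∑ z ∈ Z, (if z = 0 then (1 : ℝ) else 0) ≤ 1 := by
    rw [Finset.sum_ite_eq']
    split_ifs <;> norm_num
  linarith

end Average

/-! ### Second-moment bound for the cost of a call. -/

section Cost

variable {q n : ℕ}

/-- The part of a vector outside the window. -/
def offPart (W : List (Fin n)) (e : Fin n → ZMod 2) : Fin n → ZMod 2 :=
  fun c => if c ∈ W then 0 else e c

/-- The kept rows vanish on the window, so `e` may be replaced by its part outside it. -/
theorem keptZero_congr {r : ℕ} {σ : Equiv.Perm (Fin n)} {H : Matrix (Fin q) (Fin n) (ZMod 2)}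
    {v v' : Fin n → ZMod 2} (h : ∀ c, c ∉ windowCols r q σ → v c = v' c) :
    KeptZero r σ H v ↔ KeptZero r σ H v' := by
  refine forall₂_congr fun i hi => ?_
  have : (windowStage r σ H 0).A.mulVec v i = (windowStage r σ H 0).A.mulVec v' i := by
    simp only [Matrix.mulVec, dotProduct]
    refine Finset.sum_congr rfl fun c _ => ?_
    by_cases hc : c ∈ windowCols r q σ
    · rw [windowStage_zero r σ H 0 hi hc, zero_mul, zero_mul]
    · rw [h c hc]
  rw [this]

/-- The sets of size `r` outside the window that contain the support of `e` there. -/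
def offSets (r : ℕ) (W : List (Fin n)) (e : Fin n → ZMod 2) : Finset (Finset (Fin n)) :=
  Finset.univ.filter fun K => K.card = r ∧ vsupp (offPart W e) ⊆ K ∧ ∀ c ∈ K, c ∉ W

/-- The number of solutions of the punctured instance with support in `K`. -/
def offSolCount (r : ℕ) (σ : Equiv.Perm (Fin n)) (H : Matrix (Fin q) (Fin n) (ZMod 2))
    (e : Fin n → ZMod 2) (K : Finset (Fin n)) : ℕ :=
  (Finset.univ.filter fun x => vsupp x ⊆ K ∧ KeptZero r σ H (x + e)).card

instance (W : List (Fin n)) (v : Fin n → ZMod 2) : Decidable (OffWindow W v) :=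
  inferInstanceAs (Decidable (∀ _ ∈ W, _))

/-- The vectors of weight `w` outside the window. -/
def offVectors (W : List (Fin n)) (w : ℕ) : Finset (Fin n → ZMod 2) :=
  Finset.univ.filter fun u => OffWindow W u ∧ (vsupp u).card = w

/-- The number of solutions of the punctured instance with weight `w`. -/
def offWeightCount (r : ℕ) (σ : Equiv.Perm (Fin n)) (H : Matrix (Fin q) (Fin n) (ZMod 2))
    (e : Fin n → ZMod 2) (w : ℕ) : ℕ :=
  ((offVectors (windowCols r q σ) w).filter fun u => KeptZero r σ H (u + e)).card

theorem card_offVectors {W : List (Fin n)} (hW : W.Nodup) (w : ℕ) :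
    (offVectors W w).card = (n - W.length).choose w := by
  have h : n - W.length = W.toFinsetᶜ.card := by
    rw [Finset.card_compl, Fintype.card_fin, List.toFinset_card_of_nodup hW]
  rw [h, ← Finset.card_powersetCard]
  refine Finset.card_nbij' vsupp (fun K c => if c ∈ K then 1 else 0) ?_ ?_ ?_ ?_
  · intro x hx
    obtain ⟨h1, h2⟩ := (Finset.mem_filter.1 hx).2
    refine Finset.mem_coe.2 (Finset.mem_powersetCard.2 ⟨fun c hc => ?_, h2⟩)
    rw [Finset.mem_compl, List.mem_toFinset]
    exact fun hcW => mem_vsupp.1 hc (h1 c hcW)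
  · intro K hK
    obtain ⟨h1, h2⟩ := Finset.mem_powersetCard.1 hK
    refine Finset.mem_coe.2 (Finset.mem_filter.2 ⟨Finset.mem_univ _, fun c hc => ?_, ?_⟩)
    · refine if_neg fun h' => ?_
      have := h1 h'
      rw [Finset.mem_compl, List.mem_toFinset] at this
      exact this hc
    · rw [← h2]
      congr 1
      ext c
      simp [mem_vsupp]
  · intro x _
    funext c
    rcases ZMod.two_cases (x c) with h | h <;> simp [mem_vsupp, h]
  · intro K _
    ext c
    simp [mem_vsupp]

theorem sum_ite_eq_le {α : Type} [DecidableEq α] (s : Finset α) (a : α) {c : ℝ} (hc : 0 ≤ c) :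
    ∑ x ∈ s, (if x = a then c else 0) ≤ c := by
  rw [Finset.sum_ite_eq']
  split_ifs
  · exact le_rfl
  · exact hc

theorem add_vec_eq_zero_iff (x e : Fin n → ZMod 2) : x + e = 0 ↔ x = e := by
  simp [funext_iff, ZMod.two_add_eq_zero_iff]

/-- In the application `X` consists of the vectors supported on an `r`-set and `U` of the vectors of
the target weight. A generic pair counts `4 ^ (-r)`, the coincidences `x = e`, `u = e`, `u = x`
count `2 ^ (-r)`, and `x = u = e` counts 1. Each of these five sums is at most `mx`, and the first
moment adds `2 mx`. -/
theorem sum_orthogonalRatio_le (r : ℕ) {X U : Finset (Fin n → ZMod 2)} (hX : X.card = 2 ^ r)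
    (e : Fin n → ZMod 2) {mx : ℝ} (h1 : 1 ≤ mx) (hU : (U.card : ℝ) * (1 / 2) ^ r ≤ mx) :
    ∑ x ∈ X, (mx * orthogonalRatio (x + e) (x + e) ^ r +
      ∑ u ∈ U, orthogonalRatio (x + e) (u + e) ^ r) ≤ 7 * mx := by
  set h : ℝ := (1 / 2) ^ r with hh
  have h0 : 0 ≤ h := by positivity
  have hXh : (X.card : ℝ) * h = 1 := by
    rw [hX, hh]
    push_cast
    rw [← mul_pow]
    norm_num
  have ha : ∑ x ∈ X, mx * orthogonalRatio (x + e) (x + e) ^ r ≤ 2 * mx := by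
    have hone : ∀ x ∈ X, mx * orthogonalRatio (x + e) (x + e) ^ r ≤
        mx * (h + if x = e then 1 else 0) := by
      intro x _
      gcongr
      have hn := orthogonalRatio_nonneg (x + e) (x + e)
      by_cases hx : x = e
      · rw [if_pos hx]
        have := pow_le_one₀ hn (orthogonalRatio_le_one (x + e) (x + e)) (n := r)
        linarith
      · rw [if_neg hx, add_zero]
        exact pow_le_pow_left₀ hn
          (orthogonalRatio_le_half (Or.inl fun h => hx ((add_vec_eq_zero_iff x e).1 h))) r
    refine (Finset.sum_le_sum hone).trans ?_
    rw [← Finset.mul_sum, Finset.sum_add_distrib, Finset.sum_const, nsmul_eq_mul, hXh]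
    have := sum_ite_eq_le X e zero_le_one
    nlinarith
  have hb : ∑ x ∈ X, ∑ u ∈ U, orthogonalRatio (x + e) (u + e) ^ r ≤ 5 * mx := by
    have hone : ∀ x ∈ X, ∀ u ∈ U, orthogonalRatio (x + e) (u + e) ^ r ≤
        h * h + ((if x = e then h else 0) + (if u = e then h else 0) + (if u = x then h else 0)) +
          (if u = e then (if x = e then 1 else 0) else 0) := by
      intro x _ u _
      refine (orthogonalRatio_pow_le r (x + e) (u + e)).trans (le_of_eq ?_)
      have h1 : x + e = u + e ↔ u = x := by rw [add_left_inj, eq_comm]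
      simp only [add_vec_eq_zero_iff, h1]
      congr 1
      by_cases hx : x = e <;> by_cases hu : u = e <;> simp [hx, hu]
    refine (Finset.sum_le_sum fun x hx => Finset.sum_le_sum (hone x hx)).trans ?_
    simp only [Finset.sum_add_distrib, Finset.sum_const, nsmul_eq_mul]
    have s1 : (X.card : ℝ) * (U.card * (h * h)) ≤ mx := by
      calc (X.card : ℝ) * (U.card * (h * h)) = (X.card * h) * (U.card * h) := by ring
        _ ≤ mx := by rw [hXh, one_mul]; exact hU
    have s2 : ∑ x ∈ X, (U.card : ℝ) * (if x = e then h else 0) ≤ mx := by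
      rw [← Finset.mul_sum]
      refine le_trans ?_ hU
      gcongr
      exact sum_ite_eq_le X e h0
    have s3 : (X.card : ℝ) * ∑ u ∈ U, (if u = e then h else 0) ≤ mx := by
      refine le_trans ?_ h1
      rw [← hXh]
      gcongr
      exact sum_ite_eq_le U e h0
    have s4 : ∑ x ∈ X, ∑ u ∈ U, (if u = x then h else 0) ≤ mx := by
      refine (Finset.sum_le_sum fun x _ => sum_ite_eq_le U x h0).trans ?_
      rw [Finset.sum_const, nsmul_eq_mul, hXh]
      exact h1
    have s5 : ∑ x ∈ X, ∑ u ∈ U, (if u = e then (if x = e then (1 : ℝ) else 0) else 0) ≤ mx := by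
      refine (Finset.sum_le_sum fun x _ => sum_ite_eq_le U e (by split_ifs <;> norm_num)).trans ?_
      exact (sum_ite_eq_le X e zero_le_one).trans h1
    linarith
  rw [Finset.sum_add_distrib]
  linarith

/-- The average of the inverse success probability of a call, up to a factor. -/
theorem sum_callCost_le {r w : ℕ} (hqn : q ≤ n) (hr : r ≤ q) (σ : Equiv.Perm (Fin n))
    (e : Fin n → ZMod 2) {mx : ℝ} (h1 : 1 ≤ mx)
    (hmx : ((n - (q - r)).choose w : ℝ) * (1 / 2) ^ r ≤ mx) :
    ∑ H : Matrix (Fin q) (Fin n) (ZMod 2), ((windowKernel r σ H).card : ℝ) *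
      ((∑ K ∈ offSets r (windowCols r q σ) e, (offSolCount r σ H e K : ℝ)) *
        (mx + offWeightCount r σ H e w)) ≤
      14 * (offSets r (windowCols r q σ) e).card * mx *
        Fintype.card (Matrix (Fin q) (Fin n) (ZMod 2)) := by
  set W := windowCols r q σ with hW
  set e₀ := offPart W e with he₀
  set U := offVectors W w with hU
  set X : Finset (Fin n) → Finset (Fin n → ZMod 2) :=
    fun K => Finset.univ.filter fun x => vsupp x ⊆ K with hX
  have hoff : OffWindow W e₀ := fun c hc => if_pos hc
  have hkz : ∀ (H : Matrix (Fin q) (Fin n) (ZMod 2)) x, KeptZero r σ H (x + e) ↔ KeptZero r σ H (x + e₀) := fun H x =>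
    keptZero_congr fun c hc => by simp [he₀, offPart, hW, hc]
  have hadd : ∀ x, OffWindow W x → OffWindow W (x + e₀) := fun x hx c hc => by
    rw [Pi.add_apply, hx c hc, hoff c hc, add_zero]
  have hXoff : ∀ K ∈ offSets r W e, ∀ x ∈ X K, OffWindow W x := by
    intro K hK x hx c hc
    by_contra h
    exact (Finset.mem_filter.1 hK).2.2.2 c ((Finset.mem_filter.1 hx).2 (mem_vsupp.2 h)) hc
  have hUoff : ∀ u ∈ U, OffWindow W u := fun u hu => (Finset.mem_filter.1 hu).2.1
  have hsol : ∀ (H : Matrix (Fin q) (Fin n) (ZMod 2)) K, (offSolCount r σ H e K : ℝ) =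
      ∑ x ∈ X K, if KeptZero r σ H (x + e₀) then 1 else 0 := by
    intro H K
    rw [← Finset.sum_filter, Finset.sum_const, nsmul_eq_mul, mul_one, offSolCount, hX,
      Finset.filter_filter]
    simp only [hkz]
  have hwt : ∀ H : Matrix (Fin q) (Fin n) (ZMod 2), (offWeightCount r σ H e w : ℝ) =
      ∑ u ∈ U, if KeptZero r σ H (u + e₀) then 1 else 0 := by
    intro H
    rw [← Finset.sum_filter, Finset.sum_const, nsmul_eq_mul, mul_one, offWeightCount]
    simp only [hkz]
    rfl
  -- Expanding both counts leaves sums over pairs of events, whose mean weighted by `windowKernel`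
  -- is known exactly.
  have hexp : ∀ H : Matrix (Fin q) (Fin n) (ZMod 2), ((windowKernel r σ H).card : ℝ) *
      ((∑ K ∈ offSets r W e, (offSolCount r σ H e K : ℝ)) * (mx + offWeightCount r σ H e w)) =
      ∑ K ∈ offSets r W e, ∑ x ∈ X K, (mx * (((windowKernel r σ H).card : ℝ) *
        (if KeptZero r σ H (x + e₀) ∧ KeptZero r σ H (x + e₀) then 1 else 0)) +
        ∑ u ∈ U, ((windowKernel r σ H).card : ℝ) *
          (if KeptZero r σ H (x + e₀) ∧ KeptZero r σ H (u + e₀) then 1 else 0)) := by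
    intro H
    rw [Finset.sum_mul, Finset.mul_sum]
    refine Finset.sum_congr rfl fun K _ => ?_
    rw [hsol, Finset.sum_mul, Finset.mul_sum]
    refine Finset.sum_congr rfl fun x _ => ?_
    rw [hwt, mul_add, Finset.mul_sum, mul_add, Finset.mul_sum]
    congr 1
    · by_cases h1 : KeptZero r σ H (x + e₀) <;> simp [h1, mul_comm]
    · refine Finset.sum_congr rfl fun u _ => ?_
      by_cases h1 : KeptZero r σ H (x + e₀) <;> by_cases h2 : KeptZero r σ H (u + e₀) <;>
        simp [h1, h2]
  have hF := sum_windowKernel_le (r := r) hqn σ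
  set F := ∑ H : Matrix (Fin q) (Fin n) (ZMod 2), ((windowKernel r σ H).card : ℝ) with hFdef
  have hF0 : 0 ≤ F := Finset.sum_nonneg fun _ _ => by positivity
  simp only [hexp]
  rw [Finset.sum_comm]
  have hK : ∀ K ∈ offSets r W e, ∑ H : Matrix (Fin q) (Fin n) (ZMod 2), ∑ x ∈ X K,
      (mx * (((windowKernel r σ H).card : ℝ) *
        (if KeptZero r σ H (x + e₀) ∧ KeptZero r σ H (x + e₀) then 1 else 0)) +
        ∑ u ∈ U, ((windowKernel r σ H).card : ℝ) *
          (if KeptZero r σ H (x + e₀) ∧ KeptZero r σ H (u + e₀) then 1 else 0)) ≤ 7 * mx * F := by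
    intro K hK
    have hXcard : (X K).card = 2 ^ r := by
      rw [hX]
      simp only
      rw [card_supported, (Finset.mem_filter.1 hK).2.1]
    have hUcard : (U.card : ℝ) * (1 / 2) ^ r ≤ mx := by
      rw [hU, card_offVectors (nodup_windowCols r σ), length_windowCols hqn]
      exact hmx
    refine le_trans (le_of_eq ?_) (mul_le_mul_of_nonneg_right
      (sum_orthogonalRatio_le r hXcard e₀ h1 hUcard) hF0)
    rw [Finset.sum_comm, Finset.sum_mul]
    refine Finset.sum_congr rfl fun x hx => ?_
    rw [Finset.sum_add_distrib, ← Finset.mul_sum, Finset.sum_comm,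
      sum_windowKernel_keptZero hqn hr σ (hadd x (hXoff K hK x hx)) (hadd x (hXoff K hK x hx)),
      add_mul, Finset.sum_mul, mul_assoc]
    congr 1
    refine Finset.sum_congr rfl fun u hu => ?_
    rw [sum_windowKernel_keptZero hqn hr σ (hadd x (hXoff K hK x hx)) (hadd u (hUoff u hu))]
  refine (Finset.sum_le_sum hK).trans ?_
  rw [Finset.sum_const, nsmul_eq_mul]
  calc ((offSets r W e).card : ℝ) * (7 * mx * F) ≤ (offSets r W e).card * (7 * mx *
        (2 * Fintype.card (Matrix (Fin q) (Fin n) (ZMod 2)))) := by gcongr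
    _ = _ := by ring

end Cost

/-! ### Success of a call in terms of the original code. -/

section Call

variable {q n : ℕ}

/-- A lower bound for the success probability of a call on the punctured instance. -/
noncomputable def callBound (r k w : ℕ) (σ : Equiv.Perm (Fin n))
    (H : Matrix (Fin q) (Fin n) (ZMod 2)) (e : Fin n → ZMod 2) : ℝ :=
  (offSets r (windowCols r q σ) e).card / (8 * ((r + k : ℕ) + 1) *
    (∑ K ∈ offSets r (windowCols r q σ) e, (offSolCount r σ H e K : ℝ)) *
    (max 1 (expectedSolutions (r + k) r w) + offWeightCount r σ H e w))

theorem div_bound_le {c m a a' x u u' : ℝ} (hc : 0 ≤ c) (hm : 0 < m) (ha : 0 < a) (haa : a ≤ a')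
    (hx : 0 < x) (hu : 0 ≤ u) (huu : u ≤ u') :
    c / (m * a' * (x + u')) ≤ c / (m * a * (x + u)) := by
  have ha' : 0 < a' := ha.trans_le haa
  gcongr

/-- Transports `decoder_call_ge` along the labelling of the unknowns. The labelling depends on `H`,
whereas `offSets` does not and the other two counts depend on `H` only through `KeptZero`; this is
the form that can be averaged. -/
theorem exists_call_ge {r k w : ℕ} (hk : q + k = n) (hr : r ≤ q) (hw : w ≤ r)
    (σ : Equiv.Perm (Fin n)) {H : Matrix (Fin q) (Fin n) (ZMod 2)}
    (hH : Function.Surjective H.mulVec) {e : Fin n → ZMod 2}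
    (hew : (vsupp (offPart (windowCols r q σ) e)).card = w) :
    ∃ y : Fin r ⊕ Fin k → ZMod 2,
      (∀ z : Fin n → ZMod 2, (∀ c ∈ looseCols r σ H, z c = e c) →
        (puncture r H (H.mulVec e) σ).lift (windowCols r q σ) y z = e) ∧
      ENNReal.ofReal (callBound r k w σ H e) ≤
        ((decoder r k w).call ((puncture r H (H.mulVec e) σ).matrix r k)
          ((puncture r H (H.mulVec e) σ).syndrome r)).result y ∧
      0 < callBound r k w σ H e := by
  obtain ⟨lab, hinj, hlab, hrow, hrows, hfree⟩ :=
    exists_labelling r σ H (H.mulVec e) hk hr hH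
  have hsys := sysSol_puncture_iff r σ H (H.mulVec e) hinj hlab hrow hrows hfree rfl
  refine ⟨e ∘ lab, fun z hz => lift_puncture r σ H _ hH hinj hlab hrow hfree rfl hz, ?_⟩
  set W := windowCols r q σ with hW
  set em : Fin r ⊕ Fin k ↪ Fin n := ⟨lab, hinj⟩ with hem
  set A := (puncture r H (H.mulVec e) σ).matrix r k
  set s := (puncture r H (H.mulVec e) σ).syndrome r
  have hoffsupp : vsupp (offPart W e) = (vsupp (e ∘ lab)).map em := by
    ext c
    simp only [mem_vsupp, offPart, Finset.mem_map, Function.comp_apply]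
    constructor
    · intro h
      by_cases hc : c ∈ W
      · exact absurd (if_pos hc) h
      · obtain ⟨x, rfl⟩ := (hlab c).1 hc
        rw [if_neg hc] at h
        exact ⟨x, h, rfl⟩
    · rintro ⟨x, hx, rfl⟩
      have : lab x ∉ W := (hlab _).2 ⟨x, rfl⟩
      change (if lab x ∈ W then 0 else e (lab x)) ≠ 0
      rwa [if_neg this]
  have hcardw : (vsupp (e ∘ lab)).card = w := by
    rw [← hew, hoffsupp, Finset.card_map]
  have hes : SysSol A s (e ∘ lab) := by
    rw [hsys e]
    have : e + e = 0 := funext fun c => ZMod.two_add_self _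
    rw [this]
    intro i _
    rw [Matrix.mulVec_zero]
    rfl
  have hsets : (supersets r (vsupp (e ∘ lab))).image (fun K => K.map em) = offSets r W e := by
    ext K'
    simp only [Finset.mem_image, mem_supersets, offSets, Finset.mem_filter, Finset.mem_univ,
      true_and, hoffsupp]
    constructor
    · rintro ⟨K, ⟨h1, h2⟩, rfl⟩
      refine ⟨by rw [Finset.card_map, h1], Finset.map_subset_map.2 h2, fun c hc => ?_⟩
      obtain ⟨x, -, rfl⟩ := Finset.mem_map.1 hc
      exact (hlab _).2 ⟨x, rfl⟩
    · rintro ⟨h1, h2, h3⟩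
      have hK : (Finset.univ.filter fun x => lab x ∈ K').map em = K' := by
        ext c
        simp only [Finset.mem_map, Finset.mem_filter, Finset.mem_univ, true_and]
        constructor
        · rintro ⟨x, hx, rfl⟩
          exact hx
        · intro hc
          obtain ⟨x, rfl⟩ := (hlab c).1 (h3 c hc)
          exact ⟨x, hc, rfl⟩
      refine ⟨_, ⟨?_, ?_⟩, hK⟩
      · rw [← Finset.card_map em, hK, h1]
      · rw [← Finset.map_subset_map (f := em), hK]
        exact h2
  have hminj : Function.Injective fun K : Finset (Fin r ⊕ Fin k) => K.map em :=
    Finset.map_injective em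
  have hcard : (offSets r W e).card = (supersets r (vsupp (e ∘ lab))).card := by
    rw [← hsets, Finset.card_image_of_injective _ hminj]
  -- Vectors on the unknowns are extended by zero to the window; this embeds the solution sets.
  set ex : (Fin r ⊕ Fin k → ZMod 2) → Fin n → ZMod 2 := fun x => Function.extend lab x 0 with hex
  have hexlab : ∀ x, ex x ∘ lab = x := fun x => funext fun y => hinj.extend_apply x 0 y
  have hexinj : Function.Injective ex := fun x x' h => by rw [← hexlab x, h, hexlab]
  have hexsupp : ∀ x, vsupp (ex x) = (vsupp x).map em := by
    intro x
    ext c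
    simp only [mem_vsupp, Finset.mem_map]
    constructor
    · intro h
      by_cases hc : ∃ y, lab y = c
      · obtain ⟨y, rfl⟩ := hc
        change Function.extend lab x 0 (lab y) ≠ 0 at h
        rw [hinj.extend_apply] at h
        exact ⟨y, h, rfl⟩
      · exact absurd (Function.extend_apply' x (0 : Fin n → ZMod 2) c hc) h
    · rintro ⟨y, hy, rfl⟩
      change Function.extend lab x 0 (lab y) ≠ 0
      rwa [hinj.extend_apply]
  have hexsol : ∀ x, SysSol A s x ↔ KeptZero r σ H (ex x + e) := by
    intro x
    rw [← hsys, hexlab]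
  have hsol : ∀ K, solCount A s K ≤ offSolCount r σ H e (K.map em) := by
    intro K
    refine Finset.card_le_card_of_injOn ex ?_ hexinj.injOn
    intro x hx
    obtain ⟨h1, h2⟩ := (Finset.mem_filter.1 hx).2
    refine Finset.mem_coe.2 (Finset.mem_filter.2 ⟨Finset.mem_univ _, ?_, (hexsol x).1 h2⟩)
    rw [hexsupp]
    exact Finset.map_subset_map.2 h1
  have hwt : (weightSols A s w).card ≤ offWeightCount r σ H e w := by
    refine Finset.card_le_card_of_injOn ex ?_ hexinj.injOn
    intro x hx
    obtain ⟨h1, h2⟩ := (Finset.mem_filter.1 hx).2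
    refine Finset.mem_coe.2 (Finset.mem_filter.2 ⟨Finset.mem_filter.2
      ⟨Finset.mem_univ _, fun c hc => ?_, ?_⟩, (hexsol x).1 h2⟩)
    · refine Function.extend_apply' x (0 : Fin n → ZMod 2) c fun h => ?_
      exact (hlab c).2 h hc
    · rw [hexsupp, Finset.card_map, h1]
  have hmx : 1 ≤ max 1 (expectedSolutions (r + k) r w) := le_max_left _ _
  have hsum : ∑ K ∈ supersets r (vsupp (e ∘ lab)), (solCount A s K : ℝ) ≤
      ∑ K ∈ offSets r W e, (offSolCount r σ H e K : ℝ) := by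
    rw [← hsets, Finset.sum_image hminj.injOn]
    exact Finset.sum_le_sum fun K _ => by exact_mod_cast hsol K
  have hne : (supersets r (vsupp (e ∘ lab))).Nonempty := by
    rw [← Finset.card_pos, card_supersets_vsupp hcardw hw]
    exact Nat.choose_pos (by omega)
  have hpos : (0 : ℝ) < ∑ K ∈ supersets r (vsupp (e ∘ lab)), (solCount A s K : ℝ) := by
    refine Finset.sum_pos (fun K hK => ?_) hne
    exact_mod_cast Finset.card_pos.2 ⟨e ∘ lab, by simp [(mem_supersets.1 hK).2, hes]⟩
  have hc0 : (0 : ℝ) < (supersets r (vsupp (e ∘ lab))).card := by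
    exact_mod_cast Finset.card_pos.2 hne
  have hpos' := lt_of_lt_of_le hpos hsum
  constructor
  · refine le_trans (ENNReal.ofReal_le_ofReal ?_) (decoder_call_ge A s hw hes hcardw)
    unfold callBound
    rw [hcard]
    have hwt' : ((weightSols A s w).card : ℝ) ≤ offWeightCount r σ H e w := by exact_mod_cast hwt
    exact div_bound_le (Nat.cast_nonneg _) (by positivity) hpos hsum (one_pos.trans_le hmx)
      (Nat.cast_nonneg _) hwt'
  · unfold callBound
    rw [hcard]
    exact div_pos hc0 (mul_pos (mul_pos (by positivity) hpos')
      (add_pos_of_pos_of_nonneg (one_pos.trans_le hmx) (Nat.cast_nonneg _)))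

end Call

/-! ### The inner loop. -/

section Inner

variable {q n r k : ℕ}

open Timed

/-- One pass of the inner loop. -/
noncomputable def innerTry (D : QDecoder r k) (p ω : ℕ) (H : Matrix (Fin q) (Fin n) (ZMod 2))
    (s : Fin q → ZMod 2) (σ : Equiv.Perm (Fin n)) (P : Punctured q n) :
    Timed (Option (Fin n → ZMod 2)) := do
  let y ← D.call (P.matrix r k) (P.syndrome r)
  let z ← Timed.sample (PMF.uniformOfFintype (Fin n → ZMod 2))
  if ((windowCols r q σ).filter fun c =>
      decide (P.lift (windowCols r q σ) y z c ≠ 0)).length = p ∧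
      IsSDSolution H s ω (P.lift (windowCols r q σ) y z) then
    pure (some (P.lift (windowCols r q σ) y z))
  else pure none

variable (D : QDecoder r k) (p ω : ℕ) (H : Matrix (Fin q) (Fin n) (ZMod 2))
    (s : Fin q → ZMod 2) (σ : Equiv.Perm (Fin n)) (P : Punctured q n)

theorem result_innerLoop (L : ℕ) : (innerLoop D p ω H s σ P L).result =
    ((innerTry D p ω H s σ P).repeatUpTo L).result := by
  induction L with
  | zero => rfl
  | succ L ih =>
    rw [repeatUpTo_succ, result_bind, innerLoop]
    generalize (innerTry D p ω H s σ P).repeatUpTo L = X at ih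
    rw [innerTry]
    simp only [result_bind, result_sample, result_tick, PMF.bind_bind, PMF.pure_bind]
    congr 1
    funext y
    congr 1
    funext z
    split_ifs
    · simp
    · simp [ih]

theorem timeLE_innerLoop {t : ℕ} (hD : ∀ A s, TimeLE (D.call A s) t) (L : ℕ) :
    TimeLE (innerLoop D p ω H s σ P L) (L * (t + (2 * (q * (n + 1)) + 4 * n))) := by
  induction L with
  | zero => exact (timeLE_pure _).mono (Nat.zero_le _)
  | succ L ih =>
    rw [innerLoop]
    have e : (L + 1) * (t + (2 * (q * (n + 1)) + 4 * n)) =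
        t + (0 + (2 * (q * (n + 1)) + 4 * n + L * (t + (2 * (q * (n + 1)) + 4 * n)))) := by ring
    rw [e]
    refine (hD _ _).bind fun y => (timeLE_sample _).bind fun z => (timeLE_tick _).bind fun _ => ?_
    dsimp only
    split_ifs
    · exact (timeLE_pure _).mono (Nat.zero_le _)
    · exact ih

theorem isSDSolution_of_innerTry {x : Fin n → ZMod 2}
    (h : some x ∈ (innerTry D p ω H s σ P).result.support) : IsSDSolution H s ω x := by
  rw [innerTry] at h
  simp only [result_bind, result_sample, PMF.mem_support_bind_iff] at h
  obtain ⟨y, -, z, -, h⟩ := h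
  split_ifs at h with hc
  · rw [result_pure, PMF.mem_support_pure_iff] at h
    rw [Option.some_injective _ h]
    exact hc.2
  · rw [result_pure, PMF.mem_support_pure_iff] at h
    cases h

/-- The window coins are independent of the measurement, so the probability `2 ^ (-|F|)` of guessing
right on `F` multiplies the success probability of the call. -/
theorem innerTry_result_ge {e : Fin n → ZMod 2} {y : Fin r ⊕ Fin k → ZMod 2} {F : Finset (Fin n)}
    (hlift : ∀ z : Fin n → ZMod 2, (∀ c ∈ F, z c = e c) → P.lift (windowCols r q σ) y z = e)
    (he : IsSDSolution H s ω e)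
    (hp : ((windowCols r q σ).filter fun c => decide (e c ≠ 0)).length = p) {θ : ℝ} (hθ : 0 ≤ θ)
    (hy : ENNReal.ofReal θ ≤ (D.call (P.matrix r k) (P.syndrome r)).result y) :
    ENNReal.ofReal (θ / 2 ^ F.card) ≤ (innerTry D p ω H s σ P).result (some e) := by
  rw [innerTry]
  simp only [result_bind, result_sample]
  rw [PMF.bind_apply]
  refine le_trans ?_ (ENNReal.le_tsum y)
  rw [div_eq_mul_one_div, ENNReal.ofReal_mul hθ]
  refine mul_le_mul' hy ?_
  rw [PMF.bind_apply, tsum_fintype]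
  set T := Finset.univ.filter fun z : Fin n → ZMod 2 => ∀ c ∈ F, z c = e c with hT
  refine le_trans ?_ (Finset.sum_le_sum_of_subset (Finset.subset_univ T))
  have hterm : ∀ z ∈ T, (PMF.uniformOfFintype (Fin n → ZMod 2)) z *
      (Timed.result (if ((windowCols r q σ).filter fun c =>
        decide (P.lift (windowCols r q σ) y z c ≠ 0)).length = p ∧
        IsSDSolution H s ω (P.lift (windowCols r q σ) y z) then
        pure (some (P.lift (windowCols r q σ) y z)) else pure none)) (some e) =
      ENNReal.ofReal (1 / 2 ^ n) := by
    intro z hz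
    rw [hlift z (Finset.mem_filter.1 hz).2, if_pos ⟨hp, he⟩, result_pure, PMF.pure_apply_self,
      mul_one, PMF.uniformOfFintype_apply, Fintype.card_fun, ZMod.card, Fintype.card_fin, one_div,
      ENNReal.ofReal_inv_of_pos (by positivity)]
    congr 1
    rw [← ENNReal.ofReal_natCast]
    push_cast
    rfl
  rw [Finset.sum_congr rfl hterm, Finset.sum_const, nsmul_eq_mul, ← ENNReal.ofReal_natCast,
    ← ENNReal.ofReal_mul (by positivity)]
  refine ENNReal.ofReal_le_ofReal (le_of_eq ?_)
  have hcard := card_agree F e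
  have hc : (T.card : ℝ) * 2 ^ F.card = 2 ^ n := by exact_mod_cast hcard
  rw [mul_one_div, div_eq_div_iff (by positivity) (by positivity), one_mul, hc]

/-- A repeated experiment with success probability `θ` fails with probability at most
`1 / (1 + L θ)`. -/
theorem pow_le_of_add_le {θ : ℝ} (hθ : 0 ≤ θ) {f : ℝ≥0∞} (hf : ENNReal.ofReal θ + f ≤ 1) (L : ℕ) :
    ENNReal.ofReal (L * θ / (1 + L * θ)) + f ^ L ≤ 1 := by
  have hf1 : f ≤ 1 := le_trans (le_add_left le_rfl) hf
  have hftop : f ≠ ⊤ := ne_top_of_le_ne_top ENNReal.one_ne_top hf1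
  lift f to NNReal using hftop
  have hf' : θ + f ≤ 1 := by
    rw [← ENNReal.ofReal_coe_nnreal, ← ENNReal.ofReal_add hθ (NNReal.coe_nonneg f), ← ENNReal.ofReal_one] at hf
    exact (ENNReal.ofReal_le_ofReal_iff zero_le_one).1 hf
  rw [← ENNReal.coe_pow, ← ENNReal.ofReal_coe_nnreal, ← ENNReal.ofReal_add (by positivity) (by positivity),
    ← ENNReal.ofReal_one]
  refine ENNReal.ofReal_le_ofReal ?_
  -- By Bernoulli `1 + Lθ ≤ (1 + θ) ^ L`, and `f (1 + θ) ≤ (1 - θ)(1 + θ) ≤ 1`.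
  have h1 : (f : ℝ) ^ L * (1 + L * θ) ≤ 1 := by
    have hb := one_add_mul_le_pow (show (-2 : ℝ) ≤ θ by linarith) L
    have hf0 : (0 : ℝ) ≤ f := f.2
    calc (f : ℝ) ^ L * (1 + L * θ) ≤ (f : ℝ) ^ L * (1 + θ) ^ L := by gcongr
      _ = (f * (1 + θ)) ^ L := by rw [mul_pow]
      _ ≤ 1 := pow_le_one₀ (by positivity) (by nlinarith)
  have hpos : 0 < 1 + L * θ := by positivity
  rw [NNReal.coe_pow]
  rw [div_add' _ _ _ hpos.ne', div_le_one hpos]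
  linarith

theorem innerLoop_none_le {e : Fin n → ZMod 2} {y : Fin r ⊕ Fin k → ZMod 2} {F : Finset (Fin n)}
    (hlift : ∀ z : Fin n → ZMod 2, (∀ c ∈ F, z c = e c) → P.lift (windowCols r q σ) y z = e)
    (he : IsSDSolution H s ω e)
    (hp : ((windowCols r q σ).filter fun c => decide (e c ≠ 0)).length = p) {θ : ℝ} (hθ : 0 ≤ θ)
    (hy : ENNReal.ofReal θ ≤ (D.call (P.matrix r k) (P.syndrome r)).result y) (L : ℕ) :
    ENNReal.ofReal (L * (θ / 2 ^ F.card) / (1 + L * (θ / 2 ^ F.card))) +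
      (innerLoop D p ω H s σ P L).result none ≤ 1 := by
  rw [result_innerLoop, result_repeatUpTo_none]
  refine pow_le_of_add_le (by positivity) ?_ L
  refine (add_le_add_left (innerTry_result_ge D p ω H s σ P hlift he hp hθ hy) _).trans ?_
  rw [← (innerTry D p ω H s σ P).result.tsum_coe]
  have := (ENNReal.sum_le_tsum (f := (innerTry D p ω H s σ P).result) {some e, none})
  rwa [Finset.sum_pair (by simp)] at this

end Inner

/-! ### Most matrices have full rank. -/

section Rank

/-- A union bound: the subtracted terms sum to less than `2 ^ m * x`, up to equality at `x = 0`. -/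
theorem one_sub_le_prod {x : ℝ} (hx : 0 ≤ x) (m : ℕ) (h : 2 ^ m * x ≤ 1) :
    1 - 2 ^ m * x ≤ ∏ i ∈ Finset.range m, (1 - 2 ^ i * x) := by
  induction m with
  | zero => simp [hx]
  | succ m ih =>
    rw [pow_succ] at h
    have h2 : 0 ≤ 2 ^ m * x := by positivity
    have := ih (by linarith)
    rw [Finset.prod_range_succ, pow_succ]
    nlinarith

/-- The last factor is at least 1/2, and so is the product of all the others. -/
theorem quarter_le_prod {q n : ℕ} (hqn : q ≤ n) :
    (1 : ℝ) / 4 ≤ ∏ i ∈ Finset.range q, (1 - 2 ^ i * (1 / 2 ^ n)) := by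
  rcases q with - | m
  · norm_num
  have h : (2 : ℝ) ^ m * (1 / 2 ^ n) ≤ 1 / 2 := by
    rw [mul_one_div, div_le_div_iff₀ (by positivity) two_pos, one_mul, ← pow_succ]
    exact pow_le_pow_right₀ one_le_two hqn
  have := one_sub_le_prod (x := 1 / 2 ^ n) (by positivity) m (h.trans (by norm_num))
  rw [Finset.prod_range_succ]
  nlinarith

/-- At least a quarter of all matrices with at most as many rows as columns have full rank. -/
theorem card_le_four_mul_card_rank {q n : ℕ} (hqn : q ≤ n) :
    (Fintype.card (Matrix (Fin q) (Fin n) (ZMod 2)) : ℝ) ≤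
      4 * ((Finset.univ.filter fun H : Matrix (Fin q) (Fin n) (ZMod 2) => H.rank = q).card : ℝ) := by
  have h1 := card_linearIndependent (K := ZMod 2) (V := Fin n → ZMod 2) (k := q) (by simpa using hqn)
  have h2 : Nat.card {s : Fin q → Fin n → ZMod 2 // LinearIndependent (ZMod 2) s} ≤
      (Finset.univ.filter fun H : Matrix (Fin q) (Fin n) (ZMod 2) => H.rank = q).card := by
    have hrank : ∀ s : Fin q → Fin n → ZMod 2, LinearIndependent (ZMod 2) s →
        (Matrix.of s).rank = q := fun s hs =>
      (LinearIndependent.rank_matrix (M := Matrix.of s) hs).trans (Fintype.card_fin q)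
    rw [← Fintype.card_subtype, ← Nat.card_eq_fintype_card]
    exact Nat.card_le_card_of_injective
      (fun s : {s : Fin q → Fin n → ZMod 2 // LinearIndependent (ZMod 2) s} =>
        (⟨Matrix.of s.1, hrank s.1 s.2⟩ : {H : Matrix (Fin q) (Fin n) (ZMod 2) // H.rank = q}))
      fun s s' h => Subtype.ext (congrArg (fun X => X.1) h)
  have h3 : (Nat.card {s : Fin q → Fin n → ZMod 2 // LinearIndependent (ZMod 2) s} : ℝ) =
      Fintype.card (Matrix (Fin q) (Fin n) (ZMod 2)) *
        ∏ i ∈ Finset.range q, (1 - 2 ^ i * (1 / 2 ^ n)) := by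
    rw [h1, Module.finrank_fin_fun, ZMod.card, Fin.prod_univ_eq_prod_range (fun i => 2 ^ n - 2 ^ i)]
    have hc : (Fintype.card (Matrix (Fin q) (Fin n) (ZMod 2)) : ℝ) =
        ∏ _i ∈ Finset.range q, (2 : ℝ) ^ n := by
      have : Fintype.card (Matrix (Fin q) (Fin n) (ZMod 2)) = (2 ^ n) ^ q := by
        change Fintype.card (Fin q → Fin n → ZMod 2) = _
        rw [Fintype.card_fun, Fintype.card_fun, ZMod.card, Fintype.card_fin, Fintype.card_fin]
      rw [this, Finset.prod_const, Finset.card_range]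
      push_cast
      rfl
    rw [hc, ← Finset.prod_mul_distrib, Nat.cast_prod]
    refine Finset.prod_congr rfl fun i hi => ?_
    rw [Nat.cast_sub (Nat.pow_le_pow_right two_pos ((Finset.mem_range.1 hi).le.trans hqn))]
    push_cast
    field_simp
  have h4 := quarter_le_prod hqn
  have h5 : (Nat.card {s : Fin q → Fin n → ZMod 2 // LinearIndependent (ZMod 2) s} : ℝ) ≤
    (Finset.univ.filter fun H : Matrix (Fin q) (Fin n) (ZMod 2) => H.rank = q).card := by
    exact_mod_cast h2
  have h6 : (0 : ℝ) ≤ Fintype.card (Matrix (Fin q) (Fin n) (ZMod 2)) := Nat.cast_nonneg _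
  rw [h3] at h5
  nlinarith

theorem surjective_mulVec_of_rank {q n : ℕ} {H : Matrix (Fin q) (Fin n) (ZMod 2)}
    (h : H.rank = q) : Function.Surjective H.mulVec := by
  have : LinearMap.range H.mulVecLin = ⊤ := by
    refine Submodule.eq_top_of_finrank_eq ?_
    rw [Module.finrank_fin_fun]
    exact h
  exact LinearMap.range_eq_top.1 this

end Rank

/-! ### Distribution of the errors under a random permutation. -/

section Permutations

variable {n : ℕ}

theorem exists_perm_map_eq {S S' : Finset (Fin n)} (h : S.card = S'.card) :
    ∃ τ : Equiv.Perm (Fin n), ∀ c, τ c ∈ S' ↔ c ∈ S := by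
  let f : {c // c ∈ S} ≃ {c // c ∈ S'} := Finset.equivOfCardEq h
  refine ⟨f.extendSubtype, fun c => ⟨fun hc => ?_, fun hc => f.extendSubtype_mem c hc⟩⟩
  by_contra hn
  exact f.extendSubtype_not_mem c hn hc

theorem choose_mul_choose_le (U : Finset (Fin n)) {ω p : ℕ} (hp : p ≤ ω) :
    U.card.choose p * (n - U.card).choose (ω - p) ≤
      ((Finset.univ.powersetCard ω).filter fun S : Finset (Fin n) => (U ∩ S).card = p).card := by
  have hc : (U.powersetCard p ×ˢ Uᶜ.powersetCard (ω - p)).card =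
      U.card.choose p * (n - U.card).choose (ω - p) := by
    rw [Finset.card_product, Finset.card_powersetCard, Finset.card_powersetCard,
      Finset.card_compl, Fintype.card_fin]
  rw [← hc]
  have hU : ∀ A B : Finset (Fin n), A ⊆ U → B ⊆ Uᶜ → U ∩ (A ∪ B) = A := by
    intro A B hA hB
    ext c
    have := @hA c
    have := @hB c
    simp only [Finset.mem_inter, Finset.mem_union, Finset.mem_compl] at *
    tauto
  have hU' : ∀ A B : Finset (Fin n), A ⊆ U → B ⊆ Uᶜ → Uᶜ ∩ (A ∪ B) = B := by
    intro A B hA hB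
    ext c
    have := @hA c
    have := @hB c
    simp only [Finset.mem_inter, Finset.mem_union, Finset.mem_compl] at *
    tauto
  refine Finset.card_le_card_of_injOn (fun x => x.1 ∪ x.2) ?_ ?_
  · rintro ⟨A, B⟩ h
    obtain ⟨hA, hB⟩ := Finset.mem_product.1 (Finset.mem_coe.1 h)
    obtain ⟨hA, hA'⟩ := Finset.mem_powersetCard.1 hA
    obtain ⟨hB, hB'⟩ := Finset.mem_powersetCard.1 hB
    refine Finset.mem_coe.2 (Finset.mem_filter.2 ⟨Finset.mem_powersetCard.2
      ⟨Finset.subset_univ _, ?_⟩, ?_⟩)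
    · have hd : Disjoint A B :=
        Finset.disjoint_of_subset_left hA (Finset.disjoint_of_subset_right hB disjoint_compl_right)
      simp only at hA' hB' ⊢
      rw [Finset.card_union_of_disjoint hd]
      omega
    · rw [hU A B hA hB, hA']
  · rintro ⟨A, B⟩ h ⟨A', B'⟩ h' heq
    obtain ⟨hA, hB⟩ := Finset.mem_product.1 (Finset.mem_coe.1 h)
    obtain ⟨hA', hB'⟩ := Finset.mem_product.1 (Finset.mem_coe.1 h')
    have h1 := (Finset.mem_powersetCard.1 hA).1
    have h2 := (Finset.mem_powersetCard.1 hB).1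
    have h3 := (Finset.mem_powersetCard.1 hA').1
    have h4 := (Finset.mem_powersetCard.1 hB').1
    simp only at heq h1 h2 h3 h4
    rw [Prod.mk.injEq]
    exact ⟨by rw [← hU A B h1 h2, heq, hU A' B' h3 h4],
      by rw [← hU' A B h1 h2, heq, hU' A' B' h3 h4]⟩

/-- A random permutation of the columns puts `p` of the elements of `S` into the window with
probability at least `C(b, p) C(n - b, ω - p) / C(n, ω)`. -/
theorem card_perm_window_ge (T S : Finset (Fin n)) {p : ℕ} (hp : p ≤ S.card) :
    n.factorial * (T.card.choose p * (n - T.card).choose (S.card - p)) ≤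
      (Finset.univ.filter fun σ : Equiv.Perm (Fin n) => (T.map σ.toEmbedding ∩ S).card = p).card *
        n.choose S.card := by
  -- By symmetry the number of good permutations is the same for all supports of this size, so it
  -- can be found by double counting pairs of a support and a permutation.
  have hg : ∀ S' ∈ Finset.univ.powersetCard S.card,
      (Finset.univ.filter fun σ : Equiv.Perm (Fin n) => (T.map σ.toEmbedding ∩ S').card = p).card =
      (Finset.univ.filter fun σ : Equiv.Perm (Fin n) =>
        (T.map σ.toEmbedding ∩ S).card = p).card := by
    intro S' hS'
    obtain ⟨τ, hτ⟩ := exists_perm_map_eq (Finset.mem_powersetCard.1 hS').2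
    refine Finset.card_equiv (Equiv.mulLeft τ) fun σ => ?_
    have : T.map (τ * σ).toEmbedding ∩ S = (T.map σ.toEmbedding ∩ S').map τ.toEmbedding := by
      ext c
      simp only [Finset.mem_inter, Finset.mem_map, Equiv.coe_toEmbedding, Equiv.Perm.mul_apply]
      constructor
      · rintro ⟨⟨t, ht, rfl⟩, hc⟩
        exact ⟨σ t, ⟨⟨t, ht, rfl⟩, (hτ _).1 hc⟩, rfl⟩
      · rintro ⟨_, ⟨⟨t, ht, rfl⟩, hc⟩, rfl⟩
        exact ⟨⟨t, ht, rfl⟩, (hτ _).2 hc⟩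
    simp only [Finset.mem_filter, Finset.mem_univ, true_and, Equiv.coe_mulLeft]
    rw [this, Finset.card_map]
  have hsum := Finset.sum_card_bipartiteAbove_eq_sum_card_bipartiteBelow
    (s := Finset.univ.powersetCard S.card) (t := (Finset.univ : Finset (Equiv.Perm (Fin n))))
    (fun S' σ => (T.map σ.toEmbedding ∩ S').card = p)
  simp only [Finset.bipartiteAbove, Finset.bipartiteBelow] at hsum
  rw [Finset.sum_congr rfl hg, Finset.sum_const, Finset.card_powersetCard, Finset.card_univ,
    Fintype.card_fin, smul_eq_mul] at hsum
  rw [mul_comm _ (n.choose S.card), hsum]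
  have hc : n.factorial = (Finset.univ : Finset (Equiv.Perm (Fin n))).card := by
    rw [Finset.card_univ, Fintype.card_perm, Fintype.card_fin]
  rw [hc, ← smul_eq_mul]
  refine Finset.card_nsmul_le_sum _ _ _ fun σ _ => ?_
  have := choose_mul_choose_le (T.map σ.toEmbedding) hp
  rwa [Finset.card_map] at this

variable {q r : ℕ}

/-- The permutations that put `p` errors into the window. -/
def goodPerms (q r p : ℕ) (e : Fin n → ZMod 2) : Finset (Equiv.Perm (Fin n)) :=
  Finset.univ.filter fun σ =>
    ((windowCols r q σ).filter fun c => decide (e c ≠ 0)).length = p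

theorem goodPerms_ge (hqn : q ≤ n) (e : Fin n → ZMod 2) {p : ℕ} (hp : p ≤ hwt e) :
    n.factorial * ((q - r).choose p * (n - (q - r)).choose (hwt e - p)) ≤
      (goodPerms q r p e).card * n.choose (hwt e) := by
  have hT : (Finset.univ.filter fun t : Fin n => r ≤ t.val ∧ t.val < q).card = q - r := by
    have h := length_windowCols (r := r) hqn (1 : Equiv.Perm (Fin n))
    rw [← h, ← List.toFinset_card_of_nodup (nodup_windowCols r 1)]
    congr 1
    ext c
    simp only [Finset.mem_filter, Finset.mem_univ, true_and, List.mem_toFinset, mem_windowCols]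
    rfl
  have hcard := card_perm_window_ge (Finset.univ.filter fun t : Fin n => r ≤ t.val ∧ t.val < q)
    (Finset.univ.filter fun c => e c ≠ 0) hp
  rw [hT] at hcard
  refine hcard.trans (le_of_eq ?_)
  congr 2
  ext σ
  simp only [goodPerms, Finset.mem_filter, Finset.mem_univ, true_and]
  rw [← List.toFinset_card_of_nodup ((nodup_windowCols r σ).filter _)]
  have : (Finset.univ.filter fun t : Fin n => r ≤ t.val ∧ t.val < q).map σ.toEmbedding ∩
      (Finset.univ.filter fun c => e c ≠ 0) =
      ((windowCols r q σ).filter fun c => decide (e c ≠ 0)).toFinset := by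
    ext c
    simp only [Finset.mem_inter, Finset.mem_map, Finset.mem_filter, Finset.mem_univ, true_and,
      List.mem_toFinset, List.mem_filter, mem_windowCols, decide_eq_true_eq, Equiv.coe_toEmbedding]
    constructor
    · rintro ⟨⟨t, ht, rfl⟩, hc⟩
      simpa [ht] using hc
    · rintro ⟨h, hc⟩
      exact ⟨⟨σ.symm c, h, by simp⟩, hc⟩
  rw [this]

theorem card_vsupp_offPart (σ : Equiv.Perm (Fin n)) (e : Fin n → ZMod 2) {p : ℕ}
    (hσ : σ ∈ goodPerms q r p e) :
    (vsupp (offPart (windowCols r q σ) e)).card = hwt e - p := by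
  have h := (Finset.mem_filter.1 hσ).2
  rw [← List.toFinset_card_of_nodup ((nodup_windowCols r σ).filter _)] at h
  have hsub : ((windowCols r q σ).filter fun c => decide (e c ≠ 0)).toFinset ⊆
      Finset.univ.filter fun c => e c ≠ 0 := by
    intro c hc
    simp only [List.mem_toFinset, List.mem_filter, decide_eq_true_eq] at hc
    simpa using hc.2
  rw [← h, hwt, ← Finset.card_sdiff_of_subset hsub]
  congr 1
  ext c
  simp only [mem_vsupp, offPart, Finset.mem_sdiff, Finset.mem_filter, Finset.mem_univ, true_and,
    List.mem_toFinset, List.mem_filter, decide_eq_true_eq]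
  by_cases hc : c ∈ windowCols r q σ <;> simp [hc]

end Permutations

/-! ### Success probability and average time of a round. -/

section Round

variable {q n r k : ℕ}

open Timed

/-- A lower bound for the success probability of one pass of the inner loop. -/
noncomputable def tryBound (r k w : ℕ) (σ : Equiv.Perm (Fin n))
    (H : Matrix (Fin q) (Fin n) (ZMod 2)) (e : Fin n → ZMod 2) : ℝ :=
  callBound r k w σ H e / 2 ^ (looseCols r σ H).card

/-- A lower bound for the success probability of a round. -/
noncomputable def roundBound (r k w p L : ℕ) (H : Matrix (Fin q) (Fin n) (ZMod 2))
    (e : Fin n → ZMod 2) : ℝ :=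
  (∑ σ ∈ goodPerms q r p e, L * tryBound r k w σ H e / (1 + L * tryBound r k w σ H e)) /
    n.factorial

theorem tryBound_pos {w p : ℕ} (hk : q + k = n) (hr : r ≤ q)
    {H : Matrix (Fin q) (Fin n) (ZMod 2)} (hH : Function.Surjective H.mulVec)
    {e : Fin n → ZMod 2} (hpw : hwt e - p = w) (hw : w ≤ r) {σ : Equiv.Perm (Fin n)}
    (hσ : σ ∈ goodPerms q r p e) : 0 < tryBound r k w σ H e := by
  obtain ⟨y, -, -, h⟩ := exists_call_ge hk hr hw σ hH ((card_vsupp_offPart σ e hσ).trans hpw)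
  exact div_pos h (by positivity)

/-- The average over permutations of `innerLoop_none_le`, where bad permutations are counted as
failures. -/
theorem roundBound_add_none_le {w p : ℕ} (hk : q + k = n) (hr : r ≤ q)
    {H : Matrix (Fin q) (Fin n) (ZMod 2)} (hH : Function.Surjective H.mulVec)
    {e : Fin n → ZMod 2} (hpw : hwt e - p = w) (hw : w ≤ r) (L : ℕ) :
    ENNReal.ofReal (roundBound r k w p L H e) +
      (puncturedHybridRound (decoder r k w) p (hwt e) L H (H.mulVec e)).result none ≤ 1 := by
  have hres : (puncturedHybridRound (decoder r k w) p (hwt e) L H (H.mulVec e)).result none =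
      ∑ σ : Equiv.Perm (Fin n), (n.factorial : ℝ≥0∞)⁻¹ *
        (innerLoop (decoder r k w) p (hwt e) H (H.mulVec e) σ
          (puncture r H (H.mulVec e) σ) L).result none := by
    rw [puncturedHybridRound]
    simp only [result_bind, result_sample, result_tick, PMF.pure_bind]
    rw [PMF.bind_apply, tsum_fintype]
    simp only [PMF.uniformOfFintype_apply, Fintype.card_perm, Fintype.card_fin]
  have hbound : ENNReal.ofReal (roundBound r k w p L H e) =
      ∑ σ : Equiv.Perm (Fin n), (n.factorial : ℝ≥0∞)⁻¹ *
        (if σ ∈ goodPerms q r p e then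
          ENNReal.ofReal (L * tryBound r k w σ H e / (1 + L * tryBound r k w σ H e)) else 0) := by
    rw [← Finset.mul_sum, Finset.sum_ite_mem, Finset.univ_inter, roundBound,
      ENNReal.ofReal_div_of_pos (by positivity), ENNReal.ofReal_natCast, mul_comm, ← div_eq_mul_inv,
      ENNReal.ofReal_sum_of_nonneg]
    intro σ hσ
    have := tryBound_pos hk hr hH hpw hw hσ
    positivity
  rw [hbound, hres, ← Finset.sum_add_distrib]
  have hfac : (n.factorial : ℝ≥0∞) ≠ 0 := by exact_mod_cast n.factorial_ne_zero
  calc _ ≤ ∑ _σ : Equiv.Perm (Fin n), (n.factorial : ℝ≥0∞)⁻¹ := by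
        refine Finset.sum_le_sum fun σ _ => ?_
        rw [← mul_add]
        refine mul_le_of_le_one_right' ?_
        split_ifs with hσ
        · obtain ⟨y, hlift, hy, hpos⟩ :=
            exists_call_ge hk hr hw σ hH ((card_vsupp_offPart σ e hσ).trans hpw)
          exact innerLoop_none_le (decoder r k w) p (hwt e) H (H.mulVec e) σ
            (puncture r H (H.mulVec e) σ) hlift ⟨rfl, rfl⟩ (Finset.mem_filter.1 hσ).2 hpos.le hy L
        · rw [zero_add]
          exact PMF.coe_le_one _ _
    _ = 1 := by
        rw [Finset.sum_const, Finset.card_univ, Fintype.card_perm, Fintype.card_fin, nsmul_eq_mul,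
          ENNReal.mul_inv_cancel hfac (ENNReal.natCast_ne_top _)]

theorem roundBound_pos {w p L : ℕ} (hk : q + k = n) (hr : r ≤ q)
    {H : Matrix (Fin q) (Fin n) (ZMod 2)} (hH : Function.Surjective H.mulVec)
    {e : Fin n → ZMod 2} (hpw : hwt e - p = w) (hw : w ≤ r) (hL : 0 < L)
    (hg : (goodPerms q r p e).Nonempty) : 0 < roundBound r k w p L H e := by
  refine div_pos (Finset.sum_pos (fun σ hσ => ?_) hg) (by positivity)
  have := tryBound_pos hk hr hH hpw hw hσ
  positivity

theorem timeLE_round {t : ℕ} (D : QDecoder r k) (hD : ∀ A s, TimeLE (D.call A s) t) (p ω L : ℕ)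
    (H : Matrix (Fin q) (Fin n) (ZMod 2)) (s : Fin q → ZMod 2) :
    TimeLE (puncturedHybridRound D p ω L H s)
      (n * n + (n * (q * (n + 1) + 2 * q) + L * (t + (2 * (q * (n + 1)) + 4 * n)))) := by
  rw [puncturedHybridRound, ← zero_add (n * n + _)]
  refine (timeLE_sample _).bind fun σ => (timeLE_tick _).bind fun _ => ?_
  refine TimeLE.bind ((timeLE_tick _).mono ?_) fun _ => timeLE_innerLoop D p ω H s σ _ hD L
  have h1 := Elim.time_foldl_pivotOn (List.finRange q) (windowCols r q σ)
    (⟨H, s, fun _ => none, 0⟩ : Elim q n)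
  have h2 := Elim.time_foldl_pivotOn (keptRows r σ H s) (otherCols r q σ) (windowStage r σ H s)
  have h3 := length_windowCols_add (q := q) r σ
  have h4 : (windowStage r σ H s).time ≤ (windowCols r q σ).length * (q * (n + 1) + 2 * q) := by
    rw [zero_add] at h1
    exact h1
  rw [puncture_el]
  refine h2.trans ((Nat.add_le_add_right h4 _).trans (le_of_eq ?_))
  rw [← add_mul, h3]

theorem isSDSolution_of_round (D : QDecoder r k) (p ω L : ℕ)
    (H : Matrix (Fin q) (Fin n) (ZMod 2)) (s : Fin q → ZMod 2) {x : Fin n → ZMod 2}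
    (h : some x ∈ (puncturedHybridRound D p ω L H s).result.support) : IsSDSolution H s ω x := by
  rw [puncturedHybridRound] at h
  simp only [result_bind, result_sample, result_tick, PMF.pure_bind, PMF.mem_support_bind_iff] at h
  obtain ⟨σ, -, h⟩ := h
  rw [result_innerLoop] at h
  exact isSDSolution_of_innerTry D p ω H s σ _ (mem_support_repeatUpTo _ _ _ h)

theorem mul_div_le_of_le {X K m a y c : ℝ} (hX : X ≤ K) (hm : 0 ≤ m) (ha : 0 ≤ a) (hy : 0 ≤ y)
    (hc : 0 ≤ c) : X * (m * a * y) / c ≤ m / c * (K * (a * y)) := by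
  rw [div_mul_eq_mul_div]
  refine div_le_div_of_nonneg_right ?_ hc
  calc X * (m * a * y) ≤ K * (m * a * y) := by gcongr
    _ = m * (K * (a * y)) := by ring

/-- The average of the inverse of `tryBound` over all codes. -/
theorem sum_inv_tryBound_le {w : ℕ} (hk : q + k = n) (hr : r ≤ q) (σ : Equiv.Perm (Fin n))
    (e : Fin n → ZMod 2) :
    ∑ H ∈ Finset.univ.filter (fun H : Matrix (Fin q) (Fin n) (ZMod 2) => H.rank = q),
        (tryBound r k w σ H e)⁻¹ ≤
      448 * ((r + k : ℕ) + 1) * max 1 (expectedSolutions (r + k) r w) *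
        ((Finset.univ.filter fun H : Matrix (Fin q) (Fin n) (ZMod 2) => H.rank = q).card : ℝ) := by
  have hqn : q ≤ n := by omega
  have h4 := card_le_four_mul_card_rank hqn
  have hN : n - (q - r) = r + k := by omega
  generalize hmx : max 1 (expectedSolutions (r + k) r w) = mx
  have h1 : 1 ≤ mx := hmx ▸ le_max_left _ _
  have hsum := sum_callCost_le (w := w) hqn hr σ e h1 (by
    rw [hN, ← hmx]
    refine le_trans (le_of_eq ?_) (le_max_right _ _)
    rw [expectedSolutions, zpow_neg, zpow_natCast, one_div, inv_pow])
  generalize hoff : ((offSets r (windowCols r q σ) e).card : ℝ) = c at hsum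
  have hc : 0 ≤ c := hoff ▸ Nat.cast_nonneg _
  have hterm : ∀ H : Matrix (Fin q) (Fin n) (ZMod 2), (tryBound r k w σ H e)⁻¹ ≤
      8 * ((r + k : ℕ) + 1) / c * (((windowKernel r σ H).card : ℝ) *
      ((∑ K ∈ offSets r (windowCols r q σ) e, (offSolCount r σ H e K : ℝ)) *
        (mx + offWeightCount r σ H e w))) := by
    intro H
    rw [tryBound, callBound, hoff, hmx, inv_div, div_div_eq_mul_div]
    have h2 : ((2 : ℝ) ^ (looseCols r σ H).card) ≤ (windowKernel r σ H).card := by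
      exact_mod_cast two_pow_looseCols_le r σ H
    have h3 : (0 : ℝ) ≤ ∑ K ∈ offSets r (windowCols r q σ) e, (offSolCount r σ H e K : ℝ) :=
      Finset.sum_nonneg fun _ _ => Nat.cast_nonneg _
    exact mul_div_le_of_le h2 (by positivity) h3 (add_nonneg (zero_le_one.trans h1)
      (Nat.cast_nonneg _)) hc
  have hnn : ∀ H : Matrix (Fin q) (Fin n) (ZMod 2), 0 ≤ ((windowKernel r σ H).card : ℝ) *
      ((∑ K ∈ offSets r (windowCols r q σ) e, (offSolCount r σ H e K : ℝ)) *
        (mx + offWeightCount r σ H e w)) := by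
    intro H
    have h3 : (0 : ℝ) ≤ ∑ K ∈ offSets r (windowCols r q σ) e, (offSolCount r σ H e K : ℝ) :=
      Finset.sum_nonneg fun _ _ => Nat.cast_nonneg _
    exact mul_nonneg (Nat.cast_nonneg _) (mul_nonneg h3 (add_nonneg (zero_le_one.trans h1)
      (Nat.cast_nonneg _)))
  generalize hFR : ((Finset.univ.filter fun H : Matrix (Fin q) (Fin n) (ZMod 2) =>
    H.rank = q).card : ℝ) = F at h4
  have hF : 0 ≤ F := hFR ▸ Nat.cast_nonneg _
  refine (Finset.sum_le_sum fun H _ => hterm H).trans ?_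
  rw [← Finset.mul_sum]
  have hsub := Finset.sum_le_sum_of_subset_of_nonneg (Finset.subset_univ
    (Finset.univ.filter fun H : Matrix (Fin q) (Fin n) (ZMod 2) => H.rank = q))
    fun H _ _ => hnn H
  have hm : (0 : ℝ) ≤ 8 * ((r + k : ℕ) + 1) / c := by positivity
  refine (mul_le_mul_of_nonneg_left (hsub.trans hsum) hm).trans ?_
  -- If `offSets` is empty, division by zero makes the left side zero.
  rcases hc.eq_or_lt with h0 | h0
  · rw [← h0, div_zero, zero_mul]
    positivity
  -- `112 = 8 · 14` combines the call bound with the second moment; the factor 4 restricts the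
  -- average to full rank, whence 448.
  · calc _ = 112 * ((r + k : ℕ) + 1) * mx *
        Fintype.card (Matrix (Fin q) (Fin n) (ZMod 2)) := by field_simp; ring
      _ ≤ 112 * ((r + k : ℕ) + 1) * mx * (4 * F) := by gcongr
      _ = _ := by ring

/-- The average of the inverse of `roundBound` over all codes. -/
theorem sum_inv_roundBound_le {w p L : ℕ} (hk : q + k = n) (hr : r ≤ q) {e : Fin n → ZMod 2}
    (hpw : hwt e - p = w) (hw : w ≤ r) (hL : max 1 (expectedSolutions (r + k) r w) ≤ L)
    (hg : (goodPerms q r p e).Nonempty) :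
    ∑ H ∈ Finset.univ.filter (fun H : Matrix (Fin q) (Fin n) (ZMod 2) => H.rank = q),
        (roundBound r k w p L H e)⁻¹ ≤
      n.factorial / (goodPerms q r p e).card * (1 + 448 * ((r + k : ℕ) + 1)) *
        ((Finset.univ.filter fun H : Matrix (Fin q) (Fin n) (ZMod 2) => H.rank = q).card : ℝ) := by
  have hg0 : (0 : ℝ) < (goodPerms q r p e).card := by exact_mod_cast Finset.card_pos.2 hg
  have hL1 : (1 : ℝ) ≤ L := (le_max_left _ _).trans hL
  have hL0 : (0 : ℝ) < L := one_pos.trans_le hL1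
  have hterm : ∀ H ∈ Finset.univ.filter (fun H : Matrix (Fin q) (Fin n) (ZMod 2) => H.rank = q),
      (roundBound r k w p L H e)⁻¹ ≤ n.factorial / (goodPerms q r p e).card ^ 2 *
        ∑ σ ∈ goodPerms q r p e, (1 + (tryBound r k w σ H e)⁻¹ / L) := by
    intro H hH
    have hH' := surjective_mulVec_of_rank (Finset.mem_filter.1 hH).2
    have hpos : ∀ σ ∈ goodPerms q r p e,
        0 < L * tryBound r k w σ H e / (1 + L * tryBound r k w σ H e) := by
      intro σ hσ
      have := tryBound_pos hk hr hH' hpw hw hσ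
      positivity
    -- Cauchy-Schwarz over the good permutations bounds the inverse of a sum by a sum of inverses,
    -- each of the form `1 + 1/(Lθ)`.
    have h := sq_card_le_sum_mul_sum_inv (goodPerms q r p e) _ hpos
    have hsp := Finset.sum_pos hpos hg
    have hinv : ∑ σ ∈ goodPerms q r p e,
        1 / (L * tryBound r k w σ H e / (1 + L * tryBound r k w σ H e)) =
        ∑ σ ∈ goodPerms q r p e, (1 + (tryBound r k w σ H e)⁻¹ / L) := by
      refine Finset.sum_congr rfl fun σ hσ => ?_
      have := tryBound_pos hk hr hH' hpw hw hσ
      field_simp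
      ring
    rw [hinv] at h
    rw [roundBound, inv_div, div_mul_eq_mul_div, div_le_div_iff₀ hsp (by positivity), mul_assoc]
    refine mul_le_mul_of_nonneg_left ?_ (Nat.cast_nonneg _)
    rwa [mul_comm (∑ σ ∈ goodPerms q r p e, (1 + (tryBound r k w σ H e)⁻¹ / L))]
  refine (Finset.sum_le_sum hterm).trans ?_
  rw [← Finset.mul_sum, Finset.sum_comm]
  generalize hFR : ((Finset.univ.filter fun H : Matrix (Fin q) (Fin n) (ZMod 2) =>
    H.rank = q).card : ℝ) = F
  have hF : 0 ≤ F := hFR ▸ Nat.cast_nonneg _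
  have hσ : ∀ σ ∈ goodPerms q r p e,
      ∑ H ∈ Finset.univ.filter (fun H : Matrix (Fin q) (Fin n) (ZMod 2) => H.rank = q),
        (1 + (tryBound r k w σ H e)⁻¹ / L) ≤ (1 + 448 * ((r + k : ℕ) + 1)) * F := by
    intro σ _
    have h := sum_inv_tryBound_le (w := w) hk hr σ e
    rw [hFR] at h
    rw [Finset.sum_add_distrib, Finset.sum_const, nsmul_eq_mul, hFR, mul_one, ← Finset.sum_div,
      add_mul, one_mul]
    refine add_le_add_right ((div_le_iff₀ hL0).2 (h.trans ?_)) F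
    calc _ ≤ 448 * ((r + k : ℕ) + 1) * (L : ℝ) * F := by gcongr
      _ = _ := by ring
  refine (mul_le_mul_of_nonneg_left (Finset.sum_le_sum hσ) (by positivity)).trans (le_of_eq ?_)
  rw [Finset.sum_const, nsmul_eq_mul]
  field_simp

/-- The average expected running time over all codes. -/
theorem average_repeatExpectedTime_le {w p L t : ℕ} (hk : q + k = n) (hr : r ≤ q)
    {e : Fin n → ZMod 2} (hpw : hwt e - p = w) (hw : w ≤ r)
    (hL : max 1 (expectedSolutions (r + k) r w) ≤ L) (hg : (goodPerms q r p e).Nonempty)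
    (ht : ∀ H : Matrix (Fin q) (Fin n) (ZMod 2),
      TimeLE (puncturedHybridRound (decoder r k w) p (hwt e) L H (H.mulVec e)) t) :
    (∑ H ∈ Finset.univ.filter (fun H : Matrix (Fin q) (Fin n) (ZMod 2) => H.rank = q),
      (puncturedHybridRound (decoder r k w) p (hwt e) L H (H.mulVec e)).repeatExpectedTime) /
      ((Finset.univ.filter fun H : Matrix (Fin q) (Fin n) (ZMod 2) => H.rank = q).card : ℝ≥0∞) ≤
    ENNReal.ofReal (t * (n.factorial / (goodPerms q r p e).card *
      (1 + 448 * ((r + k : ℕ) + 1)))) := by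
  have hL0 : 0 < L := by
    have : (1 : ℝ) ≤ L := (le_max_left _ _).trans hL
    exact_mod_cast one_pos.trans_le this
  have hterm : ∀ H ∈ Finset.univ.filter (fun H : Matrix (Fin q) (Fin n) (ZMod 2) => H.rank = q),
      (puncturedHybridRound (decoder r k w) p (hwt e) L H (H.mulVec e)).repeatExpectedTime ≤
        ENNReal.ofReal (t * (roundBound r k w p L H e)⁻¹) := by
    intro H hH
    have hH' := surjective_mulVec_of_rank (Finset.mem_filter.1 hH).2
    have hpos := roundBound_pos hk hr hH' hpw hw hL0 hg
    refine (repeatExpectedTime_le _ (ht H) (roundBound_add_none_le hk hr hH' hpw hw L)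
      (ENNReal.ofReal_pos.2 hpos).ne').trans (le_of_eq ?_)
    rw [ENNReal.ofReal_mul (Nat.cast_nonneg _), ENNReal.ofReal_natCast,
      ENNReal.ofReal_inv_of_pos hpos, div_eq_mul_inv]
  have hnn : ∀ H ∈ Finset.univ.filter (fun H : Matrix (Fin q) (Fin n) (ZMod 2) => H.rank = q),
      0 ≤ (t : ℝ) * (roundBound r k w p L H e)⁻¹ := by
    intro H hH
    have hH' := surjective_mulVec_of_rank (Finset.mem_filter.1 hH).2
    have hpos := roundBound_pos hk hr hH' hpw hw hL0 hg
    positivity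
  refine ENNReal.div_le_of_le_mul ((Finset.sum_le_sum hterm).trans ?_)
  rw [← ENNReal.ofReal_sum_of_nonneg hnn, ← ENNReal.ofReal_natCast, ← ENNReal.ofReal_mul
    (by positivity), ← Finset.mul_sum, mul_assoc]
  exact ENNReal.ofReal_le_ofReal (mul_le_mul_of_nonneg_left
    (sum_inv_roundBound_le hk hr hpw hw hL hg) (Nat.cast_nonneg _))

end Round

/-! ### Closed form of the running time. -/

section Numeric

/-- Because `C(r,w)` is at most `C(r+k,w)` and at most `2 ^ r`. Hence the radicand in `searchRounds`
is at least 1, and rounding up costs at most a factor 2. -/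
theorem choose_mul_max_le {r k w : ℕ} :
    (r.choose w : ℝ) * max 1 (expectedSolutions (r + k) r w) ≤ (r + k).choose w := by
  have h1 : (r.choose w : ℝ) ≤ (r + k).choose w := by
    exact_mod_cast Nat.choose_le_choose w (Nat.le_add_right r k)
  have h2 : (r.choose w : ℝ) ≤ 2 ^ r := by exact_mod_cast Nat.choose_le_two_pow r w
  rw [mul_max_of_nonneg _ _ (Nat.cast_nonneg _), mul_one]
  refine max_le h1 ?_
  rw [expectedSolutions, zpow_neg, zpow_natCast]
  calc (r.choose w : ℝ) * ((r + k).choose w * (2 ^ r)⁻¹)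
      ≤ 2 ^ r * ((r + k).choose w * (2 ^ r)⁻¹) := by gcongr
    _ = (r + k).choose w := by field_simp

theorem searchRounds_le {r k w : ℕ} (hw : w ≤ r) : (searchRounds r k w : ℝ) ≤
    2 * √(((r + k).choose w : ℝ) / ((r.choose w : ℝ) * max 1 (expectedSolutions (r + k) r w))) := by
  have hB : (0 : ℝ) < r.choose w := by exact_mod_cast Nat.choose_pos hw
  have hmx : 0 < max 1 (expectedSolutions (r + k) r w) := one_pos.trans_le (le_max_left _ _)
  have h1 : 1 ≤ √(((r + k).choose w : ℝ) /
      ((r.choose w : ℝ) * max 1 (expectedSolutions (r + k) r w))) := by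
    rw [Real.one_le_sqrt, one_le_div (mul_pos hB hmx)]
    exact choose_mul_max_le
  rw [searchRounds, Nat.cast_max, Nat.cast_one]
  refine max_le (by linarith) ?_
  have := Nat.ceil_lt_add_one (zero_le_one.trans h1)
  linarith

theorem ceil_max_one_le (x : ℝ) : (⌈max 1 x⌉₊ : ℝ) ≤ 2 * max 1 x := by
  have h1 : 1 ≤ max 1 x := le_max_left _ _
  have := Nat.ceil_lt_add_one (zero_le_one.trans h1)
  linarith

/-- The number of calls times the number of rounds, divided by the factor `N` of the permutation
probability, has the shape of `T`. -/
theorem mul_sqrt_div_eq {N B x : ℝ} (hN : 0 < N) (hB : 0 < B) :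
    max 1 x * √(N / (B * max 1 x)) / N = max 1 √x / √(N * B) := by
  have hmx : 0 < max 1 x := one_pos.trans_le (le_max_left _ _)
  have h : max 1 √x = √(max 1 x) := by
    rw [Monotone.map_max (f := Real.sqrt) fun _ _ h => Real.sqrt_le_sqrt h, Real.sqrt_one]
  rw [h, Real.sqrt_div hN.le, Real.sqrt_mul hB.le, Real.sqrt_mul hN.le]
  have h1 := Real.sqrt_pos.2 hN
  have h2 := Real.sqrt_pos.2 hB
  have h3 := Real.sqrt_pos.2 hmx
  have e1 := Real.mul_self_sqrt hN.le
  have e2 := Real.mul_self_sqrt hmx.le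
  generalize √N = u at *
  generalize √(max 1 x) = v at *
  rw [← e1, ← e2]
  field_simp

/-- The calls dominate with `700 · 2⁶ = 44800`; lifting, elimination and the permutation add 8, 4
and 1. -/
theorem round_steps_le {n q m L J : ℕ} (hn : 1 ≤ n) (hq : q ≤ n) (hm : m ≤ n) (hL : 1 ≤ L)
    (hJ : 1 ≤ J) :
    n * n + (n * (q * (n + 1) + 2 * q) + L * (700 * (m + 1) ^ 6 * J + (2 * (q * (n + 1)) + 4 * n))) ≤
      44813 * n ^ 6 * L * J := by
  have hm1 : m + 1 ≤ 2 * n := by omega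
  have hq1 : q * (n + 1) ≤ n * (2 * n) := Nat.mul_le_mul hq (by omega)
  have h6 : (m + 1) ^ 6 ≤ (2 * n) ^ 6 := Nat.pow_le_pow_left hm1 6
  have e2 : n ^ 2 ≤ n ^ 6 := Nat.pow_le_pow_right hn (by norm_num)
  have e1 : n ^ 1 ≤ n ^ 2 := Nat.pow_le_pow_right hn (by norm_num)
  have e3 : n ^ 3 ≤ n ^ 6 := Nat.pow_le_pow_right hn (by norm_num)
  have hLJ : 1 ≤ L * J := Nat.mul_pos hL hJ
  have hLL : L ≤ L * J := Nat.le_mul_of_pos_right L hJ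
  have ha : n * n ≤ n ^ 6 * (L * J) := by
    calc n * n = n ^ 2 := by ring
      _ ≤ n ^ 6 := e2
      _ ≤ n ^ 6 * (L * J) := Nat.le_mul_of_pos_right _ hLJ
  have hb : n * (q * (n + 1) + 2 * q) ≤ 4 * n ^ 6 * (L * J) := by
    calc n * (q * (n + 1) + 2 * q) ≤ n * (n * (2 * n) + 2 * (n * n)) := by
          refine Nat.mul_le_mul_left n (Nat.add_le_add hq1 (Nat.mul_le_mul_left 2 ?_))
          exact hq.trans (Nat.le_mul_of_pos_right n hn)
      _ = 4 * n ^ 3 := by ring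
      _ ≤ 4 * n ^ 6 := by omega
      _ ≤ 4 * n ^ 6 * (L * J) := Nat.le_mul_of_pos_right _ hLJ
  have hc : 2 * (q * (n + 1)) + 4 * n ≤ 8 * n ^ 6 := by
    have : n * (2 * n) = 2 * n ^ 2 := by ring
    have : n ^ 1 = n := pow_one n
    omega
  have hd : L * (700 * (m + 1) ^ 6 * J + (2 * (q * (n + 1)) + 4 * n)) ≤ 44808 * n ^ 6 * (L * J) := by
    calc L * (700 * (m + 1) ^ 6 * J + (2 * (q * (n + 1)) + 4 * n))
        ≤ L * (700 * (2 * n) ^ 6 * J + 8 * n ^ 6) := by gcongr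
      _ = 44800 * n ^ 6 * (L * J) + 8 * n ^ 6 * L := by ring
      _ ≤ 44800 * n ^ 6 * (L * J) + 8 * n ^ 6 * (L * J) := by gcongr
      _ = 44808 * n ^ 6 * (L * J) := by ring
  calc _ ≤ n ^ 6 * (L * J) + (4 * n ^ 6 * (L * J) + 44808 * n ^ 6 * (L * J)) := by gcongr
    _ = _ := by ring

/-- The time bound of a round, divided by its success probability, in closed form. -/
theorem round_time_le {n k ω b p r L t G : ℕ} (hn : 1 ≤ n) (hrk : r + k = n - b)
    (hr : r = n - k - b) (hpω : p ≤ ω) (hpb : p ≤ b) (hbn : b ≤ n) (hw : ω - p ≤ r)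
    (hL : (L : ℝ) ≤ 2 * max 1 (expectedSolutions (r + k) r (ω - p)))
    (ht : t ≤ 44813 * n ^ 6 * L * searchRounds r k (ω - p))
    (hG : n.factorial * (b.choose p * (n - b).choose (ω - p)) ≤ G * n.choose ω) :
    (t : ℝ) * (n.factorial / G * (1 + 448 * ((r + k : ℕ) + 1))) ≤
      200000000 * n ^ 7 * puncturedHybridTime n k ω b p := by
  have hB : (0 : ℝ) < r.choose (ω - p) := by exact_mod_cast Nat.choose_pos hw
  have hN : (0 : ℝ) < (r + k).choose (ω - p) := by exact_mod_cast Nat.choose_pos (by omega)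
  have hb : (0 : ℝ) < b.choose p := by exact_mod_cast Nat.choose_pos hpb
  have hG0 : (0 : ℝ) < G := by
    have h1 : 0 < (n - b).choose (ω - p) := Nat.choose_pos (by omega)
    have h2 : 0 < b.choose p := Nat.choose_pos hpb
    have : 0 < G * n.choose ω := lt_of_lt_of_le (by positivity) hG
    exact_mod_cast pos_of_mul_pos_left this (Nat.zero_le _)
  have hn1 : (1 : ℝ) ≤ n := by exact_mod_cast hn
  have hrkn : ((r + k : ℕ) : ℝ) ≤ n := by exact_mod_cast (by omega : r + k ≤ n)
  have hJ := searchRounds_le (k := k) hw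
  set mx := max 1 (expectedSolutions (r + k) r (ω - p)) with hmx
  have hmx0 : 0 < mx := one_pos.trans_le (le_max_left _ _)
  set J : ℝ := √(((r + k).choose (ω - p) : ℝ) / ((r.choose (ω - p) : ℝ) * mx)) with hJdef
  have hJ0 : 0 ≤ J := Real.sqrt_nonneg _
  have ht' : (t : ℝ) ≤ 44813 * n ^ 6 * (2 * mx) * (2 * J) := by
    calc (t : ℝ) ≤ 44813 * n ^ 6 * L * searchRounds r k (ω - p) := by exact_mod_cast ht
      _ ≤ _ := by gcongr
  have hfrac : (n.factorial : ℝ) / G ≤ n.choose ω / (b.choose p * (r + k).choose (ω - p)) := by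
    rw [div_le_div_iff₀ hG0 (by positivity), hrk]
    calc _ ≤ ((G * n.choose ω : ℕ) : ℝ) := by exact_mod_cast hG
      _ = _ := by push_cast; ring
  have hlin : 1 + 448 * (((r + k : ℕ) : ℝ) + 1) ≤ 897 * n := by linarith
  have hT : puncturedHybridTime n k ω b p = n.choose ω / b.choose p *
      (mx * J / (r + k).choose (ω - p)) := by
    rw [hJdef, hmx, mul_sqrt_div_eq hN hB, puncturedHybridTime, ← hrk, ← hr, expectedSolutions]
    field_simp
  have hTnn : 0 ≤ puncturedHybridTime n k ω b p := by
    rw [hT]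
    positivity
  calc (t : ℝ) * (n.factorial / G * (1 + 448 * ((r + k : ℕ) + 1)))
      ≤ (44813 * n ^ 6 * (2 * mx) * (2 * J)) *
        (n.choose ω / (b.choose p * (r + k).choose (ω - p)) * (897 * n)) := by gcongr
    -- The constant is `44813 · 4 · 897`, where 4 comes from rounding up the numbers of calls and of
    -- rounds.
    _ = 160789044 * n ^ 7 * puncturedHybridTime n k ω b p := by
        rw [hT]
        field_simp
        ring
    _ ≤ 200000000 * n ^ 7 * puncturedHybridTime n k ω b p := by
        gcongr
        norm_num

end Numeric

/-! ### Assembly. -/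

theorem mainTheorem2 :
    ∃ (C d a : ℕ) (D : (r k : ℕ) → ℕ → QDecoder r k),
      ∀ (n k ω b p : ℕ) (R δ : ℝ),
        ω ∈ Finset.Icc 1 n →
        R ∈ Set.Icc (0 : ℝ) 1 → (k : ℝ) = R * n →
        δ ∈ Set.Icc (0 : ℝ) 1 → (b : ℝ) = (1 - δ) * (1 - R) * n →
        p ≤ min ω b → ω - p ≤ n - k - b →
        -- for every error vector `e` of weight `ω`:
        (∀ e : Fin n → ZMod 2, hwt e = ω →
          -- correctness for every code: only solutions are returned, and almost surely
          -- one is returned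
          (∀ H ∈ parityCheckMatrices n k,
            (∀ (N : ℕ) (x : Fin n → ZMod 2),
              some x ∈ ((puncturedHybrid a D n k ω b p H (H.mulVec e)).repeatUpTo N).result.support →
                IsSDSolution H (H.mulVec e) ω x) ∧
            Filter.Tendsto
              (fun N : ℕ =>
                ((puncturedHybrid a D n k ω b p H (H.mulVec e)).repeatUpTo N).result none)
              Filter.atTop (nhds 0)) ∧
          -- expected time, over a uniformly random code and the coins and measurements
          (∑ H ∈ parityCheckMatrices n k,
              (puncturedHybrid a D n k ω b p H (H.mulVec e)).repeatExpectedTime) /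
              ((parityCheckMatrices n k).card : ℝ≥0∞) ≤
            ENNReal.ofReal (C * (n : ℝ) ^ d * puncturedHybridTime n k ω b p)) ∧
        -- number of qubits: the matrix register, and all registers together
        (Fintype.card (Fin (n - k - b) × Fin k) : ℝ) = δ * (1 - R) * R * (n : ℝ) ^ 2 ∧
        (Fintype.card (QReg (n - k - b) k (D (n - k - b) k (ω - p)).ancillas) : ℝ) ≤
          δ * (1 - R) * R * (n : ℝ) ^ 2 + C * n := by
  -- The exponent `a = 0` suffices: the expected number of solutions, rounded up, is enough calls.
  -- Of the seven powers of `n`, six bound the cost of a call and one is the loss from the binomial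
  -- mode.
  refine ⟨200000000, 7, 0, decoder, ?_⟩
  intro n k ω b p R δ hω hR hkR hδ hbR hp hw
  obtain ⟨hω1, hωn⟩ := Finset.mem_Icc.1 hω
  obtain ⟨hpω, hpb⟩ := le_min_iff.1 hp
  have hn : 1 ≤ n := hω1.trans hωn
  have hn0 : (0 : ℝ) ≤ n := Nat.cast_nonneg n
  have hkn : k ≤ n := by
    have : (k : ℝ) ≤ n := by rw [hkR]; exact mul_le_of_le_one_left hn0 hR.2
    exact_mod_cast this
  have hbkn : b + k ≤ n := by
    have h1 : 0 ≤ δ * ((1 - R) * n) := mul_nonneg hδ.1 (mul_nonneg (sub_nonneg.2 hR.2) hn0)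
    have : (b : ℝ) + k ≤ n := by rw [hkR, hbR]; nlinarith
    exact_mod_cast this
  have hrcast : ((n - k - b : ℕ) : ℝ) = n - k - b := by
    rw [Nat.cast_sub (by omega), Nat.cast_sub hkn]
  obtain ⟨r, hr⟩ : ∃ r, r = n - k - b := ⟨_, rfl⟩
  -- The number of kept rows is `δ (1 - R) n`, and `k = R n`.
  have hmat : ((n - k - b : ℕ) : ℝ) * k = δ * (1 - R) * R * (n : ℝ) ^ 2 := by
    rw [hrcast, hbR, hkR]
    ring
  rw [← hr] at hw hmat ⊢
  have hk' : n - k + k = n := by omega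
  have hrq : r ≤ n - k := by omega
  have hrk : n - b = r + k := by omega
  refine ⟨fun e he => ?_, by simpa using hmat, ?_⟩
  · subst he
    have hround : ∀ (H : Matrix (Fin (n - k)) (Fin n) (ZMod 2)) s,
        puncturedHybrid 0 decoder n k (hwt e) b p H s =
          puncturedHybridRound (decoder r k (hwt e - p)) p (hwt e)
            ⌈max 1 (expectedSolutions (r + k) r (hwt e - p))⌉₊ H s := by
      intro H s
      rw [puncturedHybrid, callCount, pow_zero, one_mul, hrk, hr]
    simp only [hround]
    set L := ⌈max 1 (expectedSolutions (r + k) r (hwt e - p))⌉₊ with hL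
    have hLle : max 1 (expectedSolutions (r + k) r (hwt e - p)) ≤ L := Nat.le_ceil _
    have hL1 : 1 ≤ L := by
      have : (1 : ℝ) ≤ L := (le_max_left _ _).trans hLle
      exact_mod_cast this
    have hgood := goodPerms_ge (q := n - k) (r := r) (Nat.sub_le n k) e hpω
    rw [show n - k - r = b by omega] at hgood
    have hne : (goodPerms (n - k) r p e).Nonempty := by
      have h1 : 0 < b.choose p := Nat.choose_pos hpb
      have h2 : 0 < (n - b).choose (hwt e - p) := Nat.choose_pos (by omega)
      have h3 : 0 < (goodPerms (n - k) r p e).card * n.choose (hwt e) :=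
        lt_of_lt_of_le (by positivity) hgood
      exact Finset.card_pos.1 (pos_of_mul_pos_left h3 (Nat.zero_le _))
    refine ⟨fun H hH => ⟨fun N x hx => ?_, ?_⟩, ?_⟩
    · exact isSDSolution_of_round _ p (hwt e) L H _ (Timed.mem_support_repeatUpTo _ _ _ hx)
    · have hsurj := surjective_mulVec_of_rank (Finset.mem_filter.1 hH).2
      simp only [Timed.result_repeatUpTo_none]
      refine ENNReal.tendsto_pow_atTop_nhds_zero_of_lt_one ?_
      have h1 := roundBound_add_none_le hk' hrq hsurj (p := p) rfl hw L
      have h2 := roundBound_pos hk' hrq hsurj rfl hw hL1 hne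
      refine lt_of_lt_of_le (ENNReal.lt_add_right ?_ (ENNReal.ofReal_pos.2 h2).ne')
        ((add_comm _ _).trans_le h1)
      exact ne_top_of_le_ne_top ENNReal.one_ne_top (PMF.coe_le_one _ _)
    · refine (average_repeatExpectedTime_le hk' hrq rfl hw hLle hne fun H =>
        (timeLE_round _ (timeLE_decoder_call _) p (hwt e) L H _).mono
          (round_steps_le hn (Nat.sub_le n k) (by omega) hL1 (one_le_searchRounds _))).trans
        (ENNReal.ofReal_le_ofReal ?_)
      refine (round_time_le hn hrk.symm hr hpω hpb (by omega) hw (ceil_max_one_le _) le_rfl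
        hgood).trans (le_of_eq ?_)
      norm_num
  · have hanc := decoder_ancillas_le (r := r) (k := k) (ω - p)
    have hcard : Fintype.card (QReg r k (decoder r k (ω - p)).ancillas) =
        r * k + (r + (decoder r k (ω - p)).ancillas) := by
      simp [QReg]
    have hle : r + (decoder r k (ω - p)).ancillas ≤ 200000000 * n := by omega
    rw [hcard, ← hmat]
    push_cast
    have : (r : ℝ) + ((decoder r k (ω - p)).ancillas : ℝ) ≤ 200000000 * n := by exact_mod_cast hle
    linarith
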